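/- Let $K$ be an algebraically closed field. Let $\Delta\subset\mathbb R^2$ be a (two-dimensional, convex) lattice polygon that is $h$-transverse: all normal vectors of its sides have integral or infinite slope. Let $\mathtt w(\Delta)$ be its width, i.e. the maximal length of the slices $\Delta\cap\{y=k\}$, $k\in\mathbb Z$. Let $(S_\Delta,\mathscr L_\Delta)$ be the associated polarized toric surface over $K$, and let $D_1,\dots,D_s$ be the toric divisors corresponding to the sides $\partial\Delta_1,\dots,\partial\Delta_s$ of $\Delta$. Let $\underline d=(\{d_{i,j}\}_{1\le j\le a_i})_{1\le i\le s}$ be a tangency profile, i.e. a collection of multisets of positive integers such that $\sum_j d_{i,j}$ is the integral length of $\partial\Delta_i$ for each $i$, and assume that $d_{i,j}=1$ for all $j$ whenever $\partial\Delta_i$ is not horizontal. Let $V^{\mathrm{irr}}_{0,\underline d,\Delta}\subset|\mathscr L_\Delta|$ be the locus of the integral curves $C$ of geometric genus $0$ in the linear system $|\mathscr L_\Delta|$ that contain no zero-dimensional orbit of the torus action and for which the composition $f\colon\mathbb P^1\simeq C^\nu\to C\hookrightarrow S_\Delta$ of a parametrization of the normalization $C^\nu$ of $C$ with the natural maps has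 tangency profile $\underline d$, that is, for each $i$ one has $f^*(D_i)=\sum_{j}d_{i,j}p_{i,j}$ with distinct points $p_{i,1},\dots,p_{i,a_i}\in\mathbb P^1$. Then: 1. In every characteristic, $V^{\mathrm{irr}}_{0,\underline d,\Delta}$ is non-empty and irreducible (in the Zariski topology), and if $[C]\in V^{\mathrm{irr}}_{0,\underline d,\Delta}$ is general, then $f$ is injective on the preimage of the toric boundary $\bigcup_i D_i$ of $S_\Delta$. 2. If $\mathrm{char}(K)=0$ or $\mathrm{char}(K)>\mathtt w(\Delta)$, and $[C]\in V^{\mathrm{irr}}_{0,\underline d,\Delta}$ is general, then $f$ is locally an immersion (its differential is injective at every point of $\mathbb P^1$), and the singular locus of $C$ is contained in the dense torus of $S_\Delta$. Here a property holds for a general $[C]$ if it holds for all $[C]$ in a dense Zariski-open subset of $V^{\mathrm{irr}}_{0,\underline d,\Delta}$. -/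

import Mathlib

open scoped LinearAlgebra.Projectivization

noncomputable section

/-! ### Lattice polygons -/

/-- The inclusion of the lattice `M = ℤ²` in `M_ℝ = ℝ²`. -/
def latticeToReal (m : ℤ × ℤ) : ℝ × ℝ := ((m.1 : ℝ), (m.2 : ℝ))

/-- A lattice polygon: the convex hull in `ℝ²` of finitely many lattice points, of dimension two. -/
structure LatticePolygon where
  carrier : Set (ℝ × ℝ)
  isLattice : ∃ P : Finset (ℤ × ℤ), carrier = convexHull ℝ (latticeToReal '' (P : Set (ℤ × ℤ)))
  nonempty_interior : (interior carrier).Nonempty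

/-- The dot product pairing of `N = ℤ²` with `M = ℤ²`. -/
def latticePairing (n m : ℤ × ℤ) : ℤ := n.1 * m.1 + n.2 * m.2

namespace LatticePolygon

/-- The lattice points `Δ ∩ M`. -/
def Pts (Δ : LatticePolygon) : Type := {m : ℤ × ℤ // latticeToReal m ∈ Δ.carrier}

instance (Δ : LatticePolygon) : DecidableEq Δ.Pts := Classical.decEq _

theorem finite_pts (Δ : LatticePolygon) : Finite Δ.Pts := by
  obtain ⟨P, hP⟩ := Δ.isLattice
  have hb : Bornology.IsBounded Δ.carrier := by
    rw [hP]
    exact (isBounded_convexHull).2 ((P.finite_toSet.image _).isBounded)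
  obtain ⟨r, hr⟩ := hb.subset_closedBall 0
  have hfin : {m : ℤ × ℤ | latticeToReal m ∈ Δ.carrier}.Finite := by
    refine ((Set.finite_Icc (-⌈r⌉) ⌈r⌉).prod (Set.finite_Icc (-⌈r⌉) ⌈r⌉)).subset ?_
    intro m hm
    have h := hr hm
    rw [mem_closedBall_zero_iff, Prod.norm_def] at h
    have h1 : |(m.1 : ℝ)| ≤ r := (le_max_left _ _).trans h
    have h2 : |(m.2 : ℝ)| ≤ r := (le_max_right _ _).trans h
    have key : ∀ k : ℤ, |(k : ℝ)| ≤ r → k ∈ Set.Icc (-⌈r⌉) ⌈r⌉ := by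
      intro k hk
      have h3 : ((|k| : ℤ) : ℝ) ≤ (⌈r⌉ : ℝ) := by
        push_cast
        exact hk.trans (Int.le_ceil r)
      exact abs_le.1 (by exact_mod_cast h3)
    exact ⟨key _ h1, key _ h2⟩
  exact hfin.to_subtype

instance (Δ : LatticePolygon) : Finite Δ.Pts := Δ.finite_pts

instance (Δ : LatticePolygon) : Fintype Δ.Pts := Fintype.ofFinite _

/-- The lattice points of the face of `Δ` on which the linear functional `n` is minimal. -/
def face (Δ : LatticePolygon) (n : ℤ × ℤ) : Set Δ.Pts :=
  {a | ∀ b : Δ.Pts, latticePairing n a.1 ≤ latticePairing n b.1}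

/-- The sides of `Δ`, indexed by their primitive inner normal vectors. -/
def Side (Δ : LatticePolygon) : Type :=
  {n : ℤ × ℤ // Int.gcd n.1 n.2 = 1 ∧ (Δ.face n).Nontrivial}

/-- The integral length of a side. -/
def Side.length {Δ : LatticePolygon} (i : Δ.Side) : ℕ := (Δ.face i.1).ncard - 1

/-- A side is horizontal if its normal is vertical. -/
def Side.IsHorizontal {Δ : LatticePolygon} (i : Δ.Side) : Prop := i.1.1 = 0

/-- `Δ` is `h`-transverse: the slopes `n.2 / n.1` of all its normals are integral or infinite. -/
def IsHTransverse (Δ : LatticePolygon) : Prop :=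
  ∀ i : Δ.Side, i.1.1 = 0 ∨ i.1.1 ∣ i.1.2

/-- The width of `Δ`: the maximal length of its slices by horizontal lines of integral height. -/
def width (Δ : LatticePolygon) : ℝ :=
  sSup {l : ℝ | ∃ (k : ℤ) (x x' : ℝ),
    (x, (k : ℝ)) ∈ Δ.carrier ∧ (x', (k : ℝ)) ∈ Δ.carrier ∧ l = x' - x}

/-- A tangency profile of `(S_Δ, L_Δ)`: for each side a multiset of positive integers that sum to
the degree of `L_Δ` on the corresponding toric divisor, which is the integral length of the side. -/
structure TangencyProfile (Δ : LatticePolygon) where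
  mult : Δ.Side → Multiset ℕ
  pos : ∀ i, ∀ k ∈ mult i, 0 < k
  sum_eq : ∀ i, (mult i).sum = i.length

/-- The profile `d` is trivial on the toric divisor of the side `i`. -/
def TangencyProfile.IsTrivialOn {Δ : LatticePolygon} (d : Δ.TangencyProfile) (i : Δ.Side) : Prop :=
  ∀ k ∈ d.mult i, k = 1

/-! ### The toric surface

`S_Δ` is the projective toric variety of the set of lattice points `Δ ∩ M`: the closed subvariety
of the projective space with homogeneous coordinates `z_a`, `a ∈ Δ ∩ M`, that is cut out by the
toric ideal. The hyperplane bundle restricts to `L_Δ`, whose sections are the linear forms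
`∑ F_a z_a`. Varieties over the algebraically closed field `K` are described by their `K`-points
and homogeneous ideals. -/

variable (K : Type*) [Field K] (Δ : LatticePolygon)

/-- The binomials `z^u - z^v`, where `u` and `v` have the same degree and the same weight in `M`.
They generate the toric ideal of `Δ ∩ M`. -/
def toricBinomials : Set (MvPolynomial Δ.Pts K) :=
  {G | ∃ u v : Δ.Pts →₀ ℕ, (∑ a, u a = ∑ a, v a) ∧ (∑ a, u a • a.1 = ∑ a, v a • a.1) ∧
    G = MvPolynomial.monomial u 1 - MvPolynomial.monomial v 1}

/-- The points of the ambient projective space of `S_Δ`. -/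
abbrev AmbientSpace : Type _ := ℙ K (Δ.Pts → K)

/-- The toric surface `S_Δ`. -/
def toricSurface : Set (AmbientSpace K Δ) :=
  {z | ∀ G ∈ Δ.toricBinomials K, MvPolynomial.eval z.rep G = 0}

/-- The dense torus of `S_Δ`. -/
def torus : Set (AmbientSpace K Δ) :=
  {z | z ∈ Δ.toricSurface K ∧ ∀ a, z.rep a ≠ 0}

/-- The toric divisor of the side `i`, the closure of a codimension one orbit. -/
def toricDivisor (i : Δ.Side) : Set (AmbientSpace K Δ) :=
  {z | z ∈ Δ.toricSurface K ∧ ∀ a, a ∉ Δ.face i.1 → z.rep a = 0}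

/-- The toric boundary of `S_Δ`. -/
def toricBoundary : Set (AmbientSpace K Δ) := ⋃ i : Δ.Side, Δ.toricDivisor K i

/-- The union of the zero-dimensional orbits, that is, the points of `S_Δ` with exactly one
nonvanishing homogeneous coordinate. -/
def zeroDimensionalOrbits : Set (AmbientSpace K Δ) :=
  {z | z ∈ Δ.toricSurface K ∧ ∃ a, ∀ b, b ≠ a → z.rep b = 0}

/-! ### Curves in the linear system of `L_Δ` -/

/-- The linear system `|L_Δ|`: a point is the class of a nonzero section `F`, that is, of the curve
`∑ F_a z_a = 0` in `S_Δ`. -/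
def LinearSystem : Type _ := ℙ K (Δ.Pts → K)

/-- The Zariski topology of the projective space `|L_Δ|`. -/
instance : TopologicalSpace (LinearSystem K Δ) :=
  TopologicalSpace.generateFrom
    {U | ∃ (k : ℕ) (P : MvPolynomial Δ.Pts K), P.IsHomogeneous k ∧
      U = {C : ℙ K (Δ.Pts → K) | MvPolynomial.eval C.rep P ≠ 0}}

variable {K Δ}

namespace LinearSystem

/-- The coefficients of an equation of the curve. -/
def coeff (C : LinearSystem K Δ) : Δ.Pts → K := Projectivization.rep C

/-- The linear form `∑ F_a z_a` that cuts out the curve in `S_Δ`. -/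
def linearForm (C : LinearSystem K Δ) : MvPolynomial Δ.Pts K :=
  ∑ a, MvPolynomial.C (C.coeff a) * MvPolynomial.X a

/-- The points of the curve. -/
def points (C : LinearSystem K Δ) : Set (AmbientSpace K Δ) :=
  {z | z ∈ Δ.toricSurface K ∧ MvPolynomial.eval z.rep C.linearForm = 0}

/-- The equations of the curve: those of `S_Δ` and its linear form. -/
def equations (C : LinearSystem K Δ) : Set (MvPolynomial Δ.Pts K) :=
  Δ.toricBinomials K ∪ {C.linearForm}

/-- The saturated homogeneous ideal of the curve `C ⊆ S_Δ`, as a closed subscheme. -/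
def ideal (C : LinearSystem K Δ) : Ideal (MvPolynomial Δ.Pts K) where
  carrier := {G | ∀ a, ∃ N : ℕ, MvPolynomial.X a ^ N * G ∈ Ideal.span C.equations}
  zero_mem' := fun a => ⟨0, by simp⟩
  add_mem' := by
    intro G H hG hH a
    obtain ⟨N, hN⟩ := hG a
    obtain ⟨N', hN'⟩ := hH a
    refine ⟨N + N', ?_⟩
    have h : (MvPolynomial.X a : MvPolynomial Δ.Pts K) ^ (N + N') * (G + H) =
        MvPolynomial.X a ^ N' * (MvPolynomial.X a ^ N * G) +
          MvPolynomial.X a ^ N * (MvPolynomial.X a ^ N' * H) := by ring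
    rw [h]
    exact Ideal.add_mem _ (Ideal.mul_mem_left _ _ hN) (Ideal.mul_mem_left _ _ hN')
  smul_mem' := by
    intro H G hG a
    obtain ⟨N, hN⟩ := hG a
    refine ⟨N, ?_⟩
    have h : (MvPolynomial.X a : MvPolynomial Δ.Pts K) ^ N * (H • G) =
        H * (MvPolynomial.X a ^ N * G) := by
      rw [smul_eq_mul]
      ring
    rw [h]
    exact Ideal.mul_mem_left _ _ hN

/-- The curve is integral, that is, reduced and irreducible: the closed subscheme of projective
space defined by a homogeneous ideal is integral iff the saturation of the ideal is prime. -/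
def IsIntegralCurve (C : LinearSystem K Δ) : Prop := C.ideal.IsPrime

/-- The curve is torically transverse: it contains no zero-dimensional orbits. -/
def IsToricallyTransverse (C : LinearSystem K Δ) : Prop :=
  ∀ z ∈ C.points, z ∉ Δ.zeroDimensionalOrbits K

/-- The affine cone over the embedded Zariski tangent space of the curve at `z`: the kernel of the
differentials at `z` of all the equations. It contains `z`, and the Zariski tangent space has
dimension one less. -/
def affineTangentSpace (C : LinearSystem K Δ) (z : AmbientSpace K Δ) : Submodule K (Δ.Pts → K) where
  carrier := {w | ∀ G ∈ C.equations,
    ∑ a, MvPolynomial.eval z.rep (MvPolynomial.pderiv a G) * w a = 0}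
  zero_mem' := by
    intro G _
    simp
  add_mem' := by
    intro w w' hw hw' G hG
    simp only [Pi.add_apply, mul_add, Finset.sum_add_distrib, hw G hG, hw' G hG, add_zero]
  smul_mem' := by
    intro c w hw G hG
    have h := hw G hG
    simp only [Pi.smul_apply, smul_eq_mul]
    simp_rw [mul_left_comm _ c]
    rw [← Finset.mul_sum, h, mul_zero]

/-- The singular locus of the curve: the points at which the Zariski tangent space is not of
dimension one. -/
def singularLocus (C : LinearSystem K Δ) : Set (AmbientSpace K Δ) :=
  {z | z ∈ C.points ∧ Module.finrank K (C.affineTangentSpace z) ≠ 2}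

end LinearSystem

/-! ### Morphisms from the projective line -/

variable (K Δ)

/-- A morphism `ℙ¹ → S_Δ`, given by binary forms of the same degree without a common zero that
satisfy the equations of `S_Δ`. -/
structure LineMap where
  degree : ℕ
  form : Δ.Pts → MvPolynomial (Fin 2) K
  isHomogeneous : ∀ a, (form a).IsHomogeneous degree
  no_common_zero : ∀ p : Fin 2 → K, p ≠ 0 → ∃ a, MvPolynomial.eval p (form a) ≠ 0
  mem_toricSurface : ∀ G ∈ Δ.toricBinomials K, MvPolynomial.bind₁ form G = 0

variable {K Δ}

namespace LineMap

/-- The map on homogeneous coordinates. -/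
def lift (f : LineMap K Δ) (p : Fin 2 → K) : Δ.Pts → K :=
  fun a => MvPolynomial.eval p (f.form a)

theorem lift_ne_zero (f : LineMap K Δ) {p : Fin 2 → K} (hp : p ≠ 0) : f.lift p ≠ 0 := by
  obtain ⟨a, ha⟩ := f.no_common_zero p hp
  exact fun h => ha (congrFun h a)

/-- The map on points. -/
def toFun (f : LineMap K Δ) (p : ℙ K (Fin 2 → K)) : AmbientSpace K Δ :=
  Projectivization.mk K (f.lift p.rep) (f.lift_ne_zero p.rep_nonzero)

/-- The linear form on `ℙ¹` that vanishes at `p`. -/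
def pointForm (p : ℙ K (Fin 2 → K)) : MvPolynomial (Fin 2) K :=
  MvPolynomial.C (p.rep 1) * MvPolynomial.X 0 - MvPolynomial.C (p.rep 0) * MvPolynomial.X 1

/-- The multiplicity at `p` of the pullback under `f` of the toric divisor of the side `i`. The
ideal of this divisor is generated by the coordinates `z_a` with `a` not on the side, so this is
the minimal order of vanishing at `p` of the corresponding forms. -/
def pullbackMult (f : LineMap K Δ) (i : Δ.Side) (p : ℙ K (Fin 2 → K)) : ℕ∞ :=
  ⨅ a : {a : Δ.Pts // a ∉ Δ.face i.1}, emultiplicity (pointForm p) (f.form a.1)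

/-- `f` has tangency profile `d`: for each side `i`, the pullback of the toric divisor of `i` is the
sum of distinct points with multiplicities the elements of `d_i`. -/
def HasTangencyProfile (f : LineMap K Δ) (d : Δ.TangencyProfile) : Prop :=
  ∀ i : Δ.Side, ∃ Z : Finset (ℙ K (Fin 2 → K)),
    (∀ p, p ∉ Z → f.pullbackMult i p = 0) ∧
      Z.val.map (f.pullbackMult i) = (d.mult i).map (fun k : ℕ => (k : ℕ∞))

/-- The pullback under `f` of the rational functions `z_a / z_b` generate the function field
`K(t)` of `ℙ¹`: the map `f` is birational onto its image. -/
def IsBirationalOntoImage (f : LineMap K Δ) : Prop :=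
  IntermediateField.adjoin K {r : RatFunc K | ∃ a b : Δ.Pts,
    r = MvPolynomial.aeval ![RatFunc.X, 1] (f.form a) /
      MvPolynomial.aeval ![RatFunc.X, 1] (f.form b)} = ⊤

/-- For an integral curve `C`: the map `f` factors through a birational morphism `ℙ¹ → C`. As
`ℙ¹` is smooth and projective, this says that `f` is the composition of an isomorphism of `ℙ¹` with
the normalization of `C`, the normalization, and the inclusion of `C`. -/
def IsNormalizationOf (f : LineMap K Δ) (C : LinearSystem K Δ) : Prop :=
  MvPolynomial.bind₁ f.form C.linearForm = 0 ∧ f.IsBirationalOntoImage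

/-- `f` is locally an immersion: its differential is injective at each point. At the point of `ℙ¹`
with homogeneous coordinates `p`, the differential is the map `K² / K p → K^(Δ ∩ M) / K (lift p)`
(up to a twist) that sends `q` to the derivative of the lift of `f` at `p` in the direction `q`. -/
def IsImmersion (f : LineMap K Δ) : Prop :=
  ∀ p q : Fin 2 → K, LinearIndependent K ![p, q] →
    LinearIndependent K ![f.lift p,
      fun a => ∑ j, q j * MvPolynomial.eval p (MvPolynomial.pderiv j (f.form a))]

end LineMap

/-! ### The Severi variety -/

variable (K)

/-- The Severi variety `V^irr_{0,d,Δ}`: the integral, torically transverse curves in `|L_Δ|` of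
geometric genus zero (the normalization is `ℙ¹`) such that the parametrization by the
normalization has tangency profile `d`. -/
def severi (d : Δ.TangencyProfile) : Set (LinearSystem K Δ) :=
  {C | C.IsIntegralCurve ∧ C.IsToricallyTransverse ∧
    ∃ f : LineMap K Δ, f.IsNormalizationOf C ∧ f.HasTangencyProfile d}

variable {K}

/-- The property `Q` holds for a general element of `V`: for all elements of a dense open subset. -/
def ForGeneral (V : Set (LinearSystem K Δ)) (Q : LinearSystem K Δ → Prop) : Prop :=
  ∃ U : Set (LinearSystem K Δ), IsOpen U ∧ V ⊆ closure (V ∩ U) ∧ ∀ C ∈ V ∩ U, Q C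

end LatticePolygon

end

/-! A torically transverse rational curve is determined by the way its normalization meets the toric
boundary. Choose the affine coordinate `t` on the line so that no boundary point is at infinity. At
a point over the side `i` with tangency `m`, the coordinate `z_a` vanishes to order `m` times the
lattice distance of `a` from `i`, and it has no other zeros. So the torus coordinates pull back to
scalars times products of powers of `t - p_j`, and the curve depends only on two scalars and the
points `p_j` (`LineMap.exists_parameters`). Its equation spans the kernel of a matrix with entries
polynomial in these parameters (`relMatrix`); the kernel is a line because the two pulled back
coordinates `x`, `y` generate `K(t)`. Such a family of kernels over an affine space is irreducible
(`isIrreducible_of_kernels`), and by Chevalley's theorem a property of general parameters is a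
property of general curves (`forGeneral_of_kernels`).

The heart of the matter is the converse, valid in every characteristic: general parameters give a
birational map onto a curve with Newton polygon `Δ` (`IsGeneric.exists_equation`). Let `F₀` be the
irreducible relation between `x` and `y`. Its degree in `Y` is `[K(x,y):K(x)]`, at most the degree
of `x`, which is the height `h` of `Δ`. For general parameters the points over one side have
distinct images, and these are roots of the restriction of `F₀` to the face of its support in that
direction. Over a non-horizontal side the profile is trivial, so this face is at least as long as
the side (`IsGeneric.edge_length`). By `h`-transversality the height of a non-horizontal side equals
its integral length, so the left sides alone already fill the height `h`, and so do the right ones.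
No room is left: `F₀` has degree `h`, hence the map is birational, and the left and right boundaries
of its Newton polygon are those of `Δ` (`ConvexSeq.boundary_of_faces`). An equation that is
irreducible and does not vanish at the vertices defines an integral, torically transverse curve
(`Shape.isIntegralCurve`, `isToricallyTransverse`).

Any two parametrizations of such a curve differ by a fractional linear transformation
(`exists_linSubst`), so assertions about the normalization need to be checked only on the explicit
one. There, boundary points over one side are separated by their coordinates `sval`, which gives
injectivity.

If the characteristic is zero or larger than the width, the multiplicities on horizontal sides and
the widths of rows are invertible in `K`. Then the two logarithmic derivatives `∑ exp / (t - p_j)`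
have independent coefficient vectors, none of them zero, and for general `p_j` no common zero
(`log_derivatives`): the map is immersive over the torus. Over non-horizontal sides the crossing is
transversal, and over horizontal ones the coordinate along the divisor has nonzero derivative in
general. Smoothness along the boundary follows by expanding the equation at a boundary point: the
restriction of the equation to a side has roots of exactly the prescribed multiplicities, so it has
either a simple root or, at a tangency, a nonzero normal derivative (`finrank_affineTangentSpace`).
-/

noncomputable section

/-! ### Images of polynomial maps -/

section PolynomialMaps

open MvPolynomial

variable {K : Type*} [Field K]

/-- **Chevalley's theorem for points**: the image of a nonempty principal open subset of an affine
space under a polynomial map contains a nonempty principal open subset of its closure. -/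
theorem exists_image_contains_principal_open [IsAlgClosed K] {σ ι : Type*} [Finite σ] [Finite ι]
    (Φ : σ → MvPolynomial ι K) (q : MvPolynomial ι K) (hq : q ≠ 0) :
    ∃ a : MvPolynomial σ K, aeval Φ a ≠ 0 ∧ ∀ F : σ → K,
      (∀ P : MvPolynomial σ K, aeval Φ P = 0 → eval F P = 0) → eval F a ≠ 0 →
      ∃ θ : ι → K, eval θ q ≠ 0 ∧ ∀ s, eval θ (Φ s) = F s := by
  let φ : MvPolynomial σ K →+* MvPolynomial ι K := (aeval Φ : _ →ₐ[K] _).toRingHom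
  have hφ : φ.FinitePresentation := by
    apply RingHom.FinitePresentation.of_finiteType.1
    exact RingHom.FiniteType.of_comp_finiteType (f := (C : K →+* MvPolynomial σ K))
      (by
        have : φ.comp C = (C : K →+* MvPolynomial ι K) := by
          ext x; simp [φ]
        rw [this]
        have : Algebra.FiniteType K (MvPolynomial ι K) := inferInstance
        rwa [← RingHom.finiteType_algebraMap] at this)
  -- Chevalley: the image of the principal open set of `q` is a finite union of locally closed
  -- pieces. The piece that contains the image of the generic point supplies the polynomial `a`.
  have hcons := PrimeSpectrum.isConstructible_comap_image hφ
    (PrimeSpectrum.isConstructible_basicOpen (f := q))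
  obtain ⟨S, hS⟩ := PrimeSpectrum.exists_constructibleSetData_iff.2 hcons
  let η : PrimeSpectrum (MvPolynomial ι K) := ⟨⊥, Ideal.isPrime_bot⟩
  have hη : PrimeSpectrum.comap φ η ∈ S.toSet := by
    rw [hS]
    exact ⟨η, by simpa [η] using hq, rfl⟩
  simp only [PrimeSpectrum.ConstructibleSetData.toSet, Set.mem_iUnion] at hη
  obtain ⟨D, hD, hη⟩ := hη
  obtain ⟨hη1, hη2⟩ := hη
  refine ⟨D.f, ?_, ?_⟩
  · intro h
    apply hη2
    simp only [PrimeSpectrum.mem_zeroLocus, Set.singleton_subset_iff]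
    change φ D.f ∈ (⊥ : Ideal _)
    simpa [φ] using h
  · intro F hF ha
    -- The closed point `F` satisfies the equations of that piece because they vanish at the image
    -- of the generic point, that is, on the whole image.
    let P : PrimeSpectrum (MvPolynomial σ K) := ⟨RingHom.ker (eval F), RingHom.ker_isPrime _⟩
    have hP : P ∈ S.toSet := by
      simp only [PrimeSpectrum.ConstructibleSetData.toSet, Set.mem_iUnion]
      refine ⟨D, hD, ?_, ?_⟩
      · rw [PrimeSpectrum.mem_zeroLocus] at hη1 ⊢
        intro g hg
        have h1 : φ g ∈ (⊥ : Ideal _) := hη1 hg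
        exact hF g (by simpa [φ] using h1)
      · simp only [PrimeSpectrum.mem_zeroLocus, Set.singleton_subset_iff]
        exact ha
    rw [hS] at hP
    obtain ⟨Q, hQ, hQP⟩ := hP
    -- The point `Q` over `F` need not be closed. The Jacobson property replaces it by a maximal
    -- ideal that still avoids `q`, and the Nullstellensatz turns this into a point of affine space.
    have hjac : Q.asIdeal.jacobson = Q.asIdeal :=
      IsJacobsonRing.out inferInstance Q.2.isRadical
    have hq' : q ∉ Q.asIdeal.jacobson := by
      rw [hjac]; exact hQ
    rw [Ideal.jacobson, Ideal.mem_sInf] at hq'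
    push Not at hq'
    obtain ⟨M, ⟨hQM, hM⟩, hqM⟩ := hq'
    obtain ⟨θ, rfl⟩ := MvPolynomial.isMaximal_iff_eq_vanishingIdeal_singleton.1 hM
    refine ⟨θ, ?_, fun s => ?_⟩
    · intro h
      exact hqM (by simpa [MvPolynomial.mem_vanishingIdeal_iff, aeval_eq_eval] using h)
    · have h1 : (X s - C (F s) : MvPolynomial σ K) ∈ (PrimeSpectrum.comap φ Q).asIdeal := by
        rw [hQP]
        simp [P, RingHom.mem_ker]
      have h2 : φ (X s - C (F s)) ∈ Q.asIdeal := h1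
      have h3 := hQM h2
      rw [MvPolynomial.mem_vanishingIdeal_iff] at h3
      have h4 := h3 θ (Set.mem_singleton _)
      simpa [φ, sub_eq_zero, aeval_eq_eval] using h4

/-- A nonzero polynomial over an infinite domain has a point at which it does not vanish. -/
theorem exists_eval_ne_zero {R ι : Type*} [CommRing R] [IsDomain R] [Infinite R]
    {q : MvPolynomial ι R} (hq : q ≠ 0) : ∃ θ : ι → R, eval θ q ≠ 0 := by
  by_contra! h
  exact hq (MvPolynomial.funext (by simpa using h))

theorem ne_zero_of_eval_ne_zero {ι : Type*} {q : MvPolynomial ι K} {θ : ι → K}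
    (h : eval θ q ≠ 0) : q ≠ 0 := by
  rintro rfl
  simp at h

theorem eval_aeval {σ ι : Type*} (θ : ι → K) (Φ : σ → MvPolynomial ι K) (P : MvPolynomial σ K) :
    eval θ (aeval Φ P) = eval (fun s => eval θ (Φ s)) P := by
  induction P using MvPolynomial.induction_on with
  | C a => simp
  | add p q hp hq => rw [map_add, map_add, hp, hq, map_add]
  | mul_X p i hp => rw [map_mul, map_mul, hp, map_mul, aeval_X, eval_X]

/-- The kernel of a matrix of polynomials with one-dimensional kernel at a point is given by
polynomials near this point. -/
theorem exists_polynomial_kernel {σ ι ρ : Type*} [Fintype σ] [DecidableEq σ] [Fintype ρ]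
    (A : Matrix ρ σ (MvPolynomial ι K)) (θ₁ : ι → K) (F₁ : σ → K) (hF₁ : F₁ ≠ 0)
    (huniq : ∀ G : σ → K, (A.map (eval θ₁)).mulVec G = 0 → ∃ c : K, G = c • F₁) :
    ∃ (δ : MvPolynomial ι K) (Φ : σ → MvPolynomial ι K), eval θ₁ δ ≠ 0 ∧
      ((A.map (eval θ₁)).mulVec F₁ = 0 → ∃ c : K, c ≠ 0 ∧ (fun s => eval θ₁ (Φ s)) = c • F₁) ∧
      ∀ θ : ι → K, eval θ δ ≠ 0 → ∀ F : σ → K, F ≠ 0 → (A.map (eval θ)).mulVec F = 0 →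
        ∃ c : K, c ≠ 0 ∧ F = c • fun s => eval θ (Φ s) := by
  obtain ⟨s₀, hs₀⟩ : ∃ s, F₁ s ≠ 0 := by
    by_contra! h
    exact hF₁ (funext h)
  -- Adding the coordinate `s₀` to the equations makes the system injective at `θ₁`. A constant left
  -- inverse `B` turns it into a square matrix `N` that is the identity at `θ₁`; a kernel vector `F`
  -- solves `N F = F s₀ • b`, and Cramer's rule with denominator `δ = det N` gives the polynomials.
  let T : (σ → K) →ₗ[K] (ρ → K) × K :=
    LinearMap.prod (Matrix.mulVecLin (A.map (eval θ₁))) (LinearMap.proj s₀)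
  have hT : LinearMap.ker T = ⊥ := by
    rw [LinearMap.ker_eq_bot']
    intro G hG
    have h1 : (A.map (eval θ₁)).mulVec G = 0 := congrArg Prod.fst hG
    have h2 : G s₀ = 0 := congrArg Prod.snd hG
    obtain ⟨c, rfl⟩ := huniq G h1
    have h3 : c * F₁ s₀ = 0 := h2
    have h4 : c = 0 := (mul_eq_zero.1 h3).resolve_right hs₀
    simp [h4]
  obtain ⟨B, hB⟩ := LinearMap.exists_leftInverse_of_injective T hT
  classical
  let b : σ → K := B (0, 1)
  let B₁ : Matrix σ ρ K := LinearMap.toMatrix' (B.comp (LinearMap.inl K _ _))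
  let E : Matrix σ σ K := Matrix.of fun s t => b s * if t = s₀ then 1 else 0
  let B₂ : Matrix σ ρ (MvPolynomial ι K) := B₁.map (C : K →+* MvPolynomial ι K)
  let B₃ : Matrix σ σ (MvPolynomial ι K) := B₂ * A
  let N : Matrix σ σ (MvPolynomial ι K) := B₃ + E.map (C : K →+* MvPolynomial ι K)
  have key : ∀ θ : ι → K, ∀ F : σ → K, (N.map (eval θ)).mulVec F =
      B ((A.map (eval θ)).mulVec F, F s₀) := by
    intro θ F
    have h1 : N.map (eval θ) = B₁ * A.map (eval θ) + E := by
      ext i j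
      simp only [N, B₃, B₂, Matrix.map_apply, Matrix.add_apply, Matrix.mul_apply, map_add, map_sum,
        map_mul, eval_C]
    rw [h1, Matrix.add_mulVec, ← Matrix.mulVec_mulVec]
    have h2 : B₁.mulVec ((A.map (eval θ)).mulVec F) = B ((A.map (eval θ)).mulVec F, 0) := by
      rw [← Matrix.toLin'_apply]
      simp [B₁]
    have h3 : E.mulVec F = F s₀ • b := by
      ext i
      simp [E, Matrix.mulVec, dotProduct, mul_comm]
    rw [h2, h3]
    have h4 : ((A.map (eval θ)).mulVec F, F s₀) =
      ((A.map (eval θ)).mulVec F, (0 : K)) + F s₀ • ((0 : ρ → K), (1 : K)) := by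
      ext <;> simp
    rw [h4, map_add, map_smul]
  have hN₁ : N.map (eval θ₁) = 1 := by
    apply Matrix.ext_of_mulVec_single
    intro j
    rw [key]
    have : B (T (Pi.single j 1)) = Pi.single j 1 := congrFun (congrArg DFunLike.coe hB) _
    rw [Matrix.one_mulVec]
    exact this
  have hdet : ∀ θ, eval θ N.det = (N.map (eval θ)).det := fun θ => by
    rw [RingHom.map_det]; rfl
  refine ⟨N.det, N.adjugate.mulVec (fun s => C (b s)), ?_, ?_, ?_⟩
  · rw [hdet, hN₁, Matrix.det_one]
    exact one_ne_zero
  · intro h0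
    have h1 : F₁ = F₁ s₀ • b := by
      have h2 := key θ₁ F₁
      rw [hN₁, Matrix.one_mulVec, h0] at h2
      have h5 : ((0 : ρ → K), F₁ s₀) = F₁ s₀ • ((0 : ρ → K), (1 : K)) := by ext <;> simp
      exact h2.trans (by rw [h5, map_smul])
    refine ⟨(F₁ s₀)⁻¹, inv_ne_zero hs₀, ?_⟩
    have h3 : (fun s => eval θ₁ (N.adjugate.mulVec (fun s => C (b s)) s)) =
        ((N.map (eval θ₁)).adjugate).mulVec b := by
      ext s
      have : (N.map (eval θ₁)).adjugate = N.adjugate.map (eval θ₁) :=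
        ((eval θ₁).map_adjugate N).symm
      rw [this]
      simp [Matrix.mulVec, dotProduct]
    rw [h3, hN₁, Matrix.adjugate_one, Matrix.one_mulVec]
    have h4 := congrArg (fun v => (F₁ s₀)⁻¹ • v) h1
    simp only [smul_smul, inv_mul_cancel₀ hs₀, one_smul] at h4
    exact h4.symm
  · intro θ hθ F hF hAF
    have h3 : (fun s => eval θ (N.adjugate.mulVec (fun s => C (b s)) s)) =
        ((N.map (eval θ)).adjugate).mulVec b := by
      ext s
      have : (N.map (eval θ)).adjugate = N.adjugate.map (eval θ) :=
        ((eval θ).map_adjugate N).symm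
      rw [this]
      simp [Matrix.mulVec, dotProduct]
    rw [hdet] at hθ
    have h4 : (N.map (eval θ)).mulVec F = F s₀ • b := by
      rw [key, hAF]
      have : ((0 : ρ → K), F s₀) = F s₀ • ((0 : ρ → K), (1 : K)) := by ext <;> simp
      rw [this, map_smul]
    have h5 : (N.map (eval θ)).det • F = F s₀ • ((N.map (eval θ)).adjugate).mulVec b := by
      rw [← Matrix.mulVec_smul, ← h4, Matrix.mulVec_mulVec, Matrix.adjugate_mul,
        Matrix.smul_mulVec, Matrix.one_mulVec]
    have h6 : F = ((N.map (eval θ)).det⁻¹ * F s₀) • ((N.map (eval θ)).adjugate).mulVec b := by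
      rw [mul_smul, ← h5, smul_smul, inv_mul_cancel₀ hθ, one_smul]
    refine ⟨(N.map (eval θ)).det⁻¹ * F s₀, ?_, ?_⟩
    · intro h0
      rw [h0, zero_smul] at h6
      exact hF h6
    · rw [h3]; exact h6

theorem MvPolynomial.IsHomogeneous.aeval_mul_left {σ R A : Type*} [CommSemiring R] [CommSemiring A]
    [Algebra R A] {P : MvPolynomial σ R} {n : ℕ} (hP : P.IsHomogeneous n) (c : A) (v : σ → A) :
    MvPolynomial.aeval (fun i => c * v i) P = c ^ n * MvPolynomial.aeval v P := by
  rw [aeval_def, aeval_def, eval₂_eq, eval₂_eq, Finset.mul_sum]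
  refine Finset.sum_congr rfl fun d hd => ?_
  rw [hP.degree_eq_sum_deg_support hd, ← Finset.prod_pow_eq_pow_sum]
  simp only [mul_pow, Finset.prod_mul_distrib]
  ring

theorem MvPolynomial.IsHomogeneous.eval_smul {σ : Type*} {P : MvPolynomial σ K} {n : ℕ}
    (hP : P.IsHomogeneous n) (c : K) (v : σ → K) : eval (c • v) P = c ^ n * eval v P := by
  have := hP.aeval_mul_left c v
  rwa [aeval_eq_eval, aeval_eq_eval] at this

/-- The restriction of a polynomial to a line through the origin. -/
theorem eval_smul_eq_sum {σ : Type*} (P : MvPolynomial σ K) (v : σ → K) (c : K) :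
    eval (c • v) P =
      ∑ k ∈ Finset.range (P.totalDegree + 1), c ^ k * eval v (homogeneousComponent k P) := by
  conv_lhs => rw [← sum_homogeneousComponent P]
  rw [map_sum]
  exact Finset.sum_congr rfl fun k _ => (homogeneousComponent_isHomogeneous k P).eval_smul c v

/-- A curve determines its coefficients only up to a scalar, while Chevalley's theorem yields an
inhomogeneous polynomial. On a line through the origin this is a polynomial in the scalar whose
coefficients are the values of the homogeneous components. -/
theorem exists_eval_smul_ne_zero [Infinite K] {σ : Type*} (P : MvPolynomial σ K) (v : σ → K)
    (k : ℕ) (hk : eval v (homogeneousComponent k P) ≠ 0) :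
    ∃ c : K, c ≠ 0 ∧ eval (c • v) P ≠ 0 := by
  let p : Polynomial K := ∑ k ∈ Finset.range (P.totalDegree + 1),
    Polynomial.C (eval v (homogeneousComponent k P)) * Polynomial.X ^ k
  have hp : p ≠ 0 := by
    intro h0
    have h1 : p.coeff k = 0 := by rw [h0, Polynomial.coeff_zero]
    simp only [p, Polynomial.finsetSum_coeff, Polynomial.coeff_C_mul_X_pow] at h1
    rw [Finset.sum_ite_eq] at h1
    split_ifs at h1 with h2
    · exact hk h1
    · rw [homogeneousComponent_eq_zero] at hk
      · simp at hk
      · simpa using h2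
  -- The factor `X` ensures that the scalar is nonzero.
  obtain ⟨c, hc⟩ : ∃ c, Polynomial.eval c (p * Polynomial.X) ≠ 0 := by
    by_contra! h
    exact mul_ne_zero hp Polynomial.X_ne_zero (Polynomial.funext (by simpa using h))
  simp only [Polynomial.eval_mul, Polynomial.eval_X, ne_eq, mul_eq_zero, not_or] at hc
  refine ⟨c, hc.2, ?_⟩
  rw [eval_smul_eq_sum]
  have : Polynomial.eval c p = ∑ k ∈ Finset.range (P.totalDegree + 1),
      c ^ k * eval v (homogeneousComponent k P) := by
    simp only [p, Polynomial.eval_finsetSum, Polynomial.eval_mul, Polynomial.eval_C,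
      Polynomial.eval_pow, Polynomial.eval_X]
    exact Finset.sum_congr rfl fun _ _ => mul_comm _ _
  rw [← this]
  exact hc.1

end PolynomialMaps

/-! ### Families of curves given by kernels of polynomial matrices -/

namespace LatticePolygon

section LinearSystems

open MvPolynomial

variable {K : Type*} [Field K] {Δ : LatticePolygon}

theorem LinearSystem.coeff_ne_zero (C : LinearSystem K Δ) : C.coeff ≠ 0 :=
  Projectivization.rep_nonzero C

/-- The curve with the equation `F`. -/
def LinearSystem.of (F : Δ.Pts → K) (hF : F ≠ 0) : LinearSystem K Δ := Projectivization.mk K F hF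

theorem LinearSystem.exists_coeff_of (F : Δ.Pts → K) (hF : F ≠ 0) :
    ∃ c : K, c ≠ 0 ∧ (LinearSystem.of F hF).coeff = c • F := by
  obtain ⟨a, ha⟩ := Projectivization.exists_smul_eq_mk_rep K F hF
  exact ⟨a, a.ne_zero, ha.symm⟩

theorem LinearSystem.eq_of_coeff_eq_smul {C C' : LinearSystem K Δ} (c : K)
    (h : C.coeff = c • C'.coeff) : C = C' := by
  have h1 := Projectivization.mk_rep (K := K) (V := Δ.Pts → K) C
  have h2 := Projectivization.mk_rep (K := K) (V := Δ.Pts → K) C'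
  rw [← h1, ← h2]
  exact (Projectivization.mk_eq_mk_iff' K _ _ _ _).2 ⟨c, h.symm⟩

theorem LinearSystem.isOpen_basic {k : ℕ} (P : MvPolynomial Δ.Pts K) (hP : P.IsHomogeneous k) :
    IsOpen {C : LinearSystem K Δ | eval C.coeff P ≠ 0} :=
  TopologicalSpace.isOpen_generateFrom_of_mem ⟨k, P, hP, rfl⟩

variable [IsAlgClosed K] {ι ρ : Type*} [Finite ι] [Fintype ρ]
  {A : Matrix ρ Δ.Pts (MvPolynomial ι K)} {V : Set (LinearSystem K Δ)}

/-- If the equation of a curve spans the kernel of a matrix with polynomial entries at a parameter,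
then the curves of the kernel at general parameters are in any given neighbourhood of it. -/
theorem exists_polynomial_mem_open {C₁ : LinearSystem K Δ} {θ₁ : ι → K}
    (hC₁ : (A.map (eval θ₁)).mulVec C₁.coeff = 0)
    (huniq : ∀ G, (A.map (eval θ₁)).mulVec G = 0 → ∃ c : K, G = c • C₁.coeff)
    {U : Set (LinearSystem K Δ)} (hU : IsOpen U) (hCU : C₁ ∈ U) :
    ∃ q : MvPolynomial ι K, q ≠ 0 ∧ ∀ θ, eval θ q ≠ 0 → ∀ C : LinearSystem K Δ,
      (A.map (eval θ)).mulVec C.coeff = 0 → C ∈ U := by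
  obtain ⟨δ, Φ, hδ, hΦ₁, hΦ⟩ := exists_polynomial_kernel A θ₁ C₁.coeff C₁.coeff_ne_zero huniq
  obtain ⟨c₁, hc₁, hΦ₁⟩ := hΦ₁ hC₁
  have hU' : TopologicalSpace.GenerateOpen
    {U : Set (LinearSystem K Δ) | ∃ (k : ℕ) (P : MvPolynomial Δ.Pts K), P.IsHomogeneous k ∧
      U = {C : ℙ K (Δ.Pts → K) | MvPolynomial.eval C.rep P ≠ 0}} U := hU
  clear hU
  induction hU' with
  | basic U hU =>
    obtain ⟨k, P, hP, rfl⟩ := hU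
    -- Near `θ₁` the equation of the curve is `Φ` up to a scalar, so a homogeneous condition on it
    -- becomes a polynomial condition on the parameter.
    refine ⟨δ * aeval Φ P, ne_zero_of_eval_ne_zero (θ := θ₁) ?_, ?_⟩
    · rw [map_mul]
      refine mul_ne_zero hδ ?_
      rw [eval_aeval, hΦ₁, hP.eval_smul]
      exact mul_ne_zero (pow_ne_zero _ hc₁) hCU
    · intro θ hθ C hC
      rw [map_mul] at hθ
      obtain ⟨c, hc, hCc⟩ := hΦ θ (left_ne_zero_of_mul hθ) C.coeff C.coeff_ne_zero hC
      change eval C.coeff P ≠ 0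
      rw [hCc, hP.eval_smul, ← eval_aeval]
      exact mul_ne_zero (pow_ne_zero _ hc) (right_ne_zero_of_mul hθ)
  | univ => exact ⟨1, one_ne_zero, fun _ _ _ _ => trivial⟩
  | inter s t hs ht ihs iht =>
    obtain ⟨q₁, hq₁, h₁⟩ := ihs hCU.1
    obtain ⟨q₂, hq₂, h₂⟩ := iht hCU.2
    refine ⟨q₁ * q₂, mul_ne_zero hq₁ hq₂, fun θ hθ C hC => ?_⟩
    rw [map_mul] at hθ
    exact ⟨h₁ θ (left_ne_zero_of_mul hθ) C hC, h₂ θ (right_ne_zero_of_mul hθ) C hC⟩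
  | sUnion S hS ih =>
    obtain ⟨s, hs, hCs⟩ := hCU
    obtain ⟨q, hq, h⟩ := ih s hs hCs
    exact ⟨q, hq, fun θ hθ C hC => ⟨s, hs, h θ hθ C hC⟩⟩

/-- A family of curves whose equations span the kernels of a matrix with polynomial entries at some
parameters, including all general ones, is irreducible. -/
theorem isIrreducible_of_kernels
    (hV : ∀ C ∈ V, ∃ θ : ι → K, (A.map (eval θ)).mulVec C.coeff = 0 ∧
      ∀ G, (A.map (eval θ)).mulVec G = 0 → ∃ c : K, G = c • C.coeff)
    {q₀ : MvPolynomial ι K} (hq₀ : q₀ ≠ 0)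
    (hgen : ∀ θ, eval θ q₀ ≠ 0 → ∃ C ∈ V, (A.map (eval θ)).mulVec C.coeff = 0) :
    IsIrreducible V := by
  have : Infinite K := IsAlgClosed.instInfinite
  constructor
  · obtain ⟨θ, hθ⟩ := exists_eval_ne_zero hq₀
    obtain ⟨C, hC, -⟩ := hgen θ hθ
    exact ⟨C, hC⟩
  · rintro U₁ U₂ hU₁ hU₂ ⟨C₁, hC₁V, hC₁⟩ ⟨C₂, hC₂V, hC₂⟩
    obtain ⟨θ₁, h₁, h₁'⟩ := hV C₁ hC₁V
    obtain ⟨θ₂, h₂, h₂'⟩ := hV C₂ hC₂V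
    obtain ⟨q₁, hq₁, H₁⟩ := exists_polynomial_mem_open h₁ h₁' hU₁ hC₁
    obtain ⟨q₂, hq₂, H₂⟩ := exists_polynomial_mem_open h₂ h₂' hU₂ hC₂
    obtain ⟨θ, hθ⟩ := exists_eval_ne_zero (mul_ne_zero (mul_ne_zero hq₁ hq₂) hq₀)
    simp only [map_mul, ne_eq, mul_eq_zero, not_or] at hθ
    obtain ⟨C, hC, hCθ⟩ := hgen θ hθ.2
    exact ⟨C, hC, H₁ θ hθ.1.1 C hCθ, H₂ θ hθ.1.2 C hCθ⟩

/-- A property that holds for the curves of all general parameters holds for a general curve. -/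
theorem forGeneral_of_kernels
    (hV : ∀ C ∈ V, ∃ θ : ι → K, (A.map (eval θ)).mulVec C.coeff = 0 ∧
      ∀ G, (A.map (eval θ)).mulVec G = 0 → ∃ c : K, G = c • C.coeff)
    {q₀ : MvPolynomial ι K} (hq₀ : q₀ ≠ 0)
    (hgen : ∀ θ, eval θ q₀ ≠ 0 → ∃ C ∈ V, (A.map (eval θ)).mulVec C.coeff = 0)
    {Q : LinearSystem K Δ → Prop} {q : MvPolynomial ι K} (hq : q ≠ 0)
    (hQ : ∀ θ, eval θ q ≠ 0 → ∀ C ∈ V, (A.map (eval θ)).mulVec C.coeff = 0 → Q C) :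
    ForGeneral V Q := by
  have : Infinite K := IsAlgClosed.instInfinite
  have hirr := isIrreducible_of_kernels hV hq₀ hgen
  obtain ⟨C₁, hC₁⟩ := hirr.1
  obtain ⟨θ₁, hθ₁, huniq⟩ := hV C₁ hC₁
  obtain ⟨δ, Φ, hδ, -, hΦ⟩ := exists_polynomial_kernel A θ₁ C₁.coeff C₁.coeff_ne_zero huniq
  have hδ0 : δ ≠ 0 := ne_zero_of_eval_ne_zero hδ
  -- The new variable `none` is a scalar factor, so the image of `Φ'` is the affine cone over the
  -- family; Chevalley's theorem is applied to this cone.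
  let Φ' : Δ.Pts → MvPolynomial (Option ι) K := fun s => X none * rename some (Φ s)
  let q' : MvPolynomial (Option ι) K := rename some (q * q₀ * δ)
  have hq' : q' ≠ 0 := by
    intro h0
    exact mul_ne_zero (mul_ne_zero hq hq₀) hδ0
      (rename_injective _ (Option.some_injective ι) (by rw [map_zero]; exact h0))
  obtain ⟨a, ha, hlift⟩ := exists_image_contains_principal_open Φ' q' hq'
  have hev : ∀ (P : MvPolynomial Δ.Pts K) (ϑ : Option ι → K), eval ϑ (aeval Φ' P) =
      eval (ϑ none • fun s => eval (ϑ ∘ some) (Φ s)) P := by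
    intro P ϑ
    rw [eval_aeval]
    congr 2
    ext s
    simp [Φ', eval_rename]
  -- a curve of the family satisfies all equations of the image
  have hclos : ∀ C ∈ V, ∀ c₀ : K, ∀ P : MvPolynomial Δ.Pts K, aeval Φ' P = 0 →
      eval (c₀ • C.coeff) P = 0 := by
    intro C hC c₀ P hP
    by_contra hne
    have hk : ∃ k, eval C.coeff (homogeneousComponent k P) ≠ 0 := by
      by_contra! h
      apply hne
      rw [eval_smul_eq_sum]
      simp [h]
    obtain ⟨k, hk⟩ := hk
    obtain ⟨θ₂, h₂, h₂'⟩ := hV C hC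
    obtain ⟨q₂, hq₂, H₂⟩ := exists_polynomial_mem_open h₂ h₂'
      (LinearSystem.isOpen_basic _ (homogeneousComponent_isHomogeneous k P)) hk
    obtain ⟨θ, hθ⟩ := exists_eval_ne_zero (mul_ne_zero (mul_ne_zero hq₂ hq₀) hδ0)
    simp only [map_mul, ne_eq, mul_eq_zero, not_or] at hθ
    obtain ⟨C', -, hC'⟩ := hgen θ hθ.1.2
    have h3 : eval C'.coeff (homogeneousComponent k P) ≠ 0 := H₂ θ hθ.1.1 C' hC'
    obtain ⟨c, hc, hCc⟩ := hΦ θ hθ.2 C'.coeff C'.coeff_ne_zero hC'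
    obtain ⟨c', -, hc'⟩ := exists_eval_smul_ne_zero P C'.coeff k h3
    apply hc'
    have h4 := hev P (fun o => o.elim (c' * c) θ)
    rw [hP, map_zero] at h4
    rw [hCc, smul_smul]
    exact h4.symm
  have hak : ∃ ϑ : Option ι → K, eval ϑ (aeval Φ' a * q') ≠ 0 :=
    exists_eval_ne_zero (mul_ne_zero ha hq')
  refine ⟨⋃ k, {C : LinearSystem K Δ | eval C.coeff (homogeneousComponent k a) ≠ 0},
    isOpen_iUnion fun k => LinearSystem.isOpen_basic _ (homogeneousComponent_isHomogeneous k a),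
    ?_, ?_⟩
  -- In an irreducible set a nonempty relatively open subset is dense, so a single curve suffices;
  -- it comes from a parameter at which `a` does not vanish on the cone.
  · refine subset_closure_inter_of_isPreirreducible_of_isOpen hirr.2 (isOpen_iUnion fun k =>
      LinearSystem.isOpen_basic _ (homogeneousComponent_isHomogeneous k a)) ?_
    obtain ⟨ϑ, hϑ⟩ := hak
    rw [map_mul, hev] at hϑ
    have hϑ1 := left_ne_zero_of_mul hϑ
    have hϑ2 := right_ne_zero_of_mul hϑ
    simp only [q', eval_rename, map_mul, ne_eq, mul_eq_zero, not_or] at hϑ2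
    obtain ⟨C, hC, hCθ⟩ := hgen (ϑ ∘ some) hϑ2.1.2
    obtain ⟨c, hc, hCc⟩ := hΦ _ hϑ2.2 C.coeff C.coeff_ne_zero hCθ
    refine ⟨C, hC, ?_⟩
    by_contra hno
    simp only [Set.mem_iUnion, not_exists, Set.mem_ofPred_eq, not_not] at hno
    apply hϑ1
    have h5 : (ϑ none • fun s => eval (ϑ ∘ some) (Φ s)) = (ϑ none * c⁻¹) • C.coeff := by
      rw [hCc, smul_smul, mul_assoc, inv_mul_cancel₀ hc, mul_one]
    rw [h5, eval_smul_eq_sum]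
    simp [hno]
  · rintro C ⟨hC, hCU⟩
    simp only [Set.mem_iUnion, Set.mem_ofPred_eq] at hCU
    obtain ⟨k, hk⟩ := hCU
    obtain ⟨c, hc, hca⟩ := exists_eval_smul_ne_zero a C.coeff k hk
    obtain ⟨ϑ, hϑ, hϑC⟩ := hlift (c • C.coeff) (hclos C hC c) hca
    simp only [q', eval_rename, map_mul, ne_eq, mul_eq_zero, not_or] at hϑ
    obtain ⟨C', hC'V, hC'⟩ := hgen (ϑ ∘ some) hϑ.1.2
    obtain ⟨c', hc', hCc'⟩ := hΦ _ hϑ.2 C'.coeff C'.coeff_ne_zero hC'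
    -- The given curve was only known to have some parameter. Chevalley's theorem produces a general
    -- one, and the kernel vector there identifies the two curves.
    have h6 : C = C' := by
      apply LinearSystem.eq_of_coeff_eq_smul (c⁻¹ * ϑ none * c'⁻¹)
      have h7 : c • C.coeff = ϑ none • fun s => eval (ϑ ∘ some) (Φ s) := by
        ext s
        have := hϑC s
        simp only [Φ', map_mul, eval_X, eval_rename] at this
        simp [← this]
      rw [hCc', smul_smul, mul_assoc, inv_mul_cancel₀ hc', mul_one, mul_smul, ← h7, smul_smul,
        inv_mul_cancel₀ hc, one_smul]
    rw [h6]
    exact hQ _ hϑ.1.1 C' hC'V hC'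

end LinearSystems

end LatticePolygon

/-! ### Pairs of rational functions -/

section RationalPairs

open Polynomial IntermediateField
open scoped Polynomial.Bivariate

variable {K : Type*} [Field K]

/-- The degree of a rational function as a map of the projective line. -/
def RatFunc.mapDegree (x : RatFunc K) : ℕ := max x.num.natDegree x.denom.natDegree

theorem RatFunc.mapDegree_pos {x : RatFunc K} (hx : ¬ ∃ c, x = RatFunc.C c) : 0 < x.mapDegree := by
  rw [Nat.pos_iff_ne_zero]
  intro h
  rw [RatFunc.mapDegree, Nat.max_eq_zero_iff, ← x.eq_C_iff] at h
  exact hx h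

theorem RatFunc.mapDegree_div {P Q : K[X]} (h : IsCoprime P Q) (hQ : Q ≠ 0) :
    (algebraMap K[X] (RatFunc K) P / algebraMap K[X] (RatFunc K) Q).mapDegree =
      max P.natDegree Q.natDegree := by
  set x := algebraMap K[X] (RatFunc K) P / algebraMap K[X] (RatFunc K) Q with hx
  have h1 : x.num * Q = P * x.denom := by
    apply IsFractionRing.injective K[X] (RatFunc K)
    rw [map_mul, map_mul]
    have h2 := RatFunc.num_div_denom x
    have h3 : algebraMap K[X] (RatFunc K) x.denom ≠ 0 := by simpa using x.denom_ne_zero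
    have h4 : algebraMap K[X] (RatFunc K) Q ≠ 0 := by simpa using hQ
    rw [div_eq_iff h3, hx, div_mul_eq_mul_div, eq_div_iff h4] at h2
    exact h2
  have h5 : Associated P x.num := associated_of_dvd_dvd
    (h.dvd_of_dvd_mul_right (Dvd.intro _ h1.symm))
    ((RatFunc.isCoprime_num_denom x).dvd_of_dvd_mul_right (Dvd.intro _ h1))
  have h6 : Associated Q x.denom := associated_of_dvd_dvd
    (h.symm.dvd_of_dvd_mul_left (Dvd.intro_left _ h1))
    ((RatFunc.isCoprime_num_denom x).symm.dvd_of_dvd_mul_left (Dvd.intro_left _ h1.symm))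
  rw [RatFunc.mapDegree, Polynomial.natDegree_eq_of_degree_eq (degree_eq_degree_of_associated h5),
    Polynomial.natDegree_eq_of_degree_eq (degree_eq_degree_of_associated h6)]

theorem aevalAeval_eq_aeval_map {E : IntermediateField K (RatFunc K)} (x : E) (y : RatFunc K)
    (G : K[X][Y]) :
    aevalAeval (x : RatFunc K) y G = aeval y (G.map (aeval x : K[X] →ₐ[K] E).toRingHom) := by
  induction G using Polynomial.induction_on' with
  | add p q hp hq => simp only [map_add, hp, hq, Polynomial.map_add]
  | monomial n p =>
    rw [← C_mul_X_pow_eq_monomial, map_mul, map_pow, aevalAeval_C]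
    simp only [Polynomial.map_mul, Polynomial.map_C, Polynomial.map_pow, Polynomial.map_X, map_mul,
      map_pow, aeval_X, aeval_C]
    congr 1
    · exact Polynomial.aeval_algHom_apply (E.val) x p
    · simp

section Fraction

variable {x : RatFunc K} (hx : ¬ ∃ c, x = RatFunc.C c)

include hx

/-- A nonconstant `x` is transcendental, so `K(x)` is the fraction field of `K[X]` embedded by `X ↦
x`. This is the setting in which Gauss's lemma is applied to bivariate polynomials. -/
theorem isFractionRing_adjoin_simple :
    letI := (aeval (AdjoinSimple.gen K x) : K[X] →ₐ[K] K⟮x⟯).toRingHom.toAlgebra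
    IsFractionRing K[X] K⟮x⟯ := by
  letI := (aeval (AdjoinSimple.gen K x) : K[X] →ₐ[K] K⟮x⟯).toRingHom.toAlgebra
  have hcoe : ∀ p : K[X], ((algebraMap K[X] K⟮x⟯ p : K⟮x⟯) : RatFunc K) = aeval x p := fun p =>
    (Polynomial.aeval_algHom_apply (K⟮x⟯).val (AdjoinSimple.gen K x) p).symm
  have hinj : Function.Injective (algebraMap K[X] K⟮x⟯) := by
    rw [injective_iff_map_eq_zero]
    intro p hp
    by_contra h0
    have h1 := hcoe p
    rw [hp] at h1
    exact (RatFunc.transcendental_of_ne_C x hx) ⟨p, h0, h1.symm⟩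
  have : FaithfulSMul K[X] K⟮x⟯ := (faithfulSMul_iff_algebraMap_injective _ _).2 hinj
  refine .of_field _ _ fun ⟨z, hz⟩ => ?_
  obtain ⟨r, s, rfl⟩ := (mem_adjoin_simple_iff K z).1 hz
  refine ⟨r, s, Subtype.ext ?_⟩
  rw [IntermediateField.coe_div, hcoe, hcoe]

theorem irreducible_map_adjoin {F : K[X][Y]} (hF : Irreducible F) (hd : F.natDegree ≠ 0) :
    Irreducible (F.map (aeval (AdjoinSimple.gen K x) : K[X] →ₐ[K] K⟮x⟯).toRingHom) := by
  letI := (aeval (AdjoinSimple.gen K x) : K[X] →ₐ[K] K⟮x⟯).toRingHom.toAlgebra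
  haveI := isFractionRing_adjoin_simple hx
  exact ((hF.isPrimitive hd).irreducible_iff_irreducible_map_fraction_map (K := K⟮x⟯)).1 hF

/-- By Gauss's lemma `F` stays irreducible over `K(x)`, so up to a unit it is the minimal polynomial
of `y`. -/
theorem natDegree_eq_finrank {y : RatFunc K} {F : K[X][Y]} (hF : Irreducible F)
    (hd : F.natDegree ≠ 0) (hxy : aevalAeval x y F = 0) :
    F.natDegree = Module.finrank K⟮x⟯ K⟮x⟯⟮y⟯ := by
  have h1 := irreducible_map_adjoin hx hF hd
  have h2 : aeval y (F.map (aeval (AdjoinSimple.gen K x) : K[X] →ₐ[K] K⟮x⟯).toRingHom) = 0 := by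
    rw [← aevalAeval_eq_aeval_map]; exact hxy
  have h3 : IsIntegral K⟮x⟯ y := (isAlgebraic_iff_isIntegral).1 ⟨_, h1.ne_zero, h2⟩
  rw [adjoin.finrank h3, ← minpoly.eq_of_irreducible h1 h2, mul_comm, natDegree_C_mul
    (inv_ne_zero (leadingCoeff_ne_zero.2 h1.ne_zero))]
  letI := (aeval (AdjoinSimple.gen K x) : K[X] →ₐ[K] K⟮x⟯).toRingHom.toAlgebra
  haveI := isFractionRing_adjoin_simple hx
  exact (natDegree_map_eq_of_injective (IsFractionRing.injective K[X] K⟮x⟯) F).symm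

theorem natDegree_ne_zero_of_aevalAeval {y : RatFunc K} {F : K[X][Y]} (hF : F ≠ 0)
    (hxy : aevalAeval x y F = 0) : F.natDegree ≠ 0 := by
  intro h
  rw [natDegree_eq_zero] at h
  obtain ⟨p, rfl⟩ := h
  rw [aevalAeval_C] at hxy
  have hp : p ≠ 0 := fun h => hF (by rw [h, map_zero])
  exact (RatFunc.transcendental_of_ne_C x hx) ⟨p, hp, hxy⟩

/-- An irreducible relation between two rational functions divides all of them. -/
theorem dvd_of_aevalAeval_eq_zero {y : RatFunc K} {F G : K[X][Y]} (hF : Irreducible F)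
    (hxy : aevalAeval x y F = 0) (hG : aevalAeval x y G = 0) : F ∣ G := by
  have hd := natDegree_ne_zero_of_aevalAeval hx hF.ne_zero hxy
  have h1 := irreducible_map_adjoin hx hF hd
  have h2 : aeval y (F.map (aeval (AdjoinSimple.gen K x) : K[X] →ₐ[K] K⟮x⟯).toRingHom) = 0 := by
    rw [← aevalAeval_eq_aeval_map]; exact hxy
  have h3 : aeval y (G.map (aeval (AdjoinSimple.gen K x) : K[X] →ₐ[K] K⟮x⟯).toRingHom) = 0 := by
    rw [← aevalAeval_eq_aeval_map]; exact hG
  have h4 := minpoly.dvd _ _ h3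
  rw [← minpoly.eq_of_irreducible h1 h2] at h4
  have h5 := (dvd_mul_right _ _).trans h4
  letI := (aeval (AdjoinSimple.gen K x) : K[X] →ₐ[K] K⟮x⟯).toRingHom.toAlgebra
  haveI := isFractionRing_adjoin_simple hx
  obtain ⟨H, hH⟩ := h5
  -- Divisibility holds over `K(x)`. After clearing the denominator `b`, the prime `F` divides `b
  -- G`, and it cannot divide `b`, which has degree zero in `Y`.
  obtain ⟨b, hb, hb'⟩ := IsLocalization.integerNormalization_spec (nonZeroDivisors K[X]) H
  have h6 : F * IsLocalization.integerNormalization (nonZeroDivisors K[X]) H = Polynomial.C b * G := by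
    apply Polynomial.map_injective (algebraMap K[X] K⟮x⟯) (IsFractionRing.injective K[X] K⟮x⟯)
    have hb2 : map (algebraMap K[X] K⟮x⟯)
      (IsLocalization.integerNormalization (nonZeroDivisors K[X]) H) = b • H := hb'
    rw [Polynomial.map_mul, Polynomial.map_mul, hb2, Polynomial.map_C, mul_smul_comm]
    change b • (_ : K⟮x⟯[X]) = _ * map (aeval (AdjoinSimple.gen K x) : K[X] →ₐ[K] K⟮x⟯).toRingHom G
    rw [hH, Algebra.smul_def]
    rfl
  have h7 : F ∣ Polynomial.C b * G := Dvd.intro _ h6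
  rcases hF.prime.dvd_or_dvd h7 with h8 | h8
  · exfalso
    apply hd
    have h9 := natDegree_le_of_dvd h8 (C_ne_zero.2 (nonZeroDivisors.ne_zero hb))
    rw [natDegree_C] at h9
    omega
  · exact h8

/-- The extension `K(t)/K(x)` is finite, so `y` is algebraic over `K(x)`. The relations form a
nonzero prime ideal of a factorial ring, and such an ideal contains a prime element. -/
theorem exists_irreducible_relation (y : RatFunc K) :
    ∃ F : K[X][Y], Irreducible F ∧ aevalAeval x y F = 0 := by
  have hfin : Module.Finite K⟮x⟯ (RatFunc K) := by
    apply Module.finite_of_finrank_pos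
    rw [RatFunc.finrank_eq_max_natDegree]
    exact RatFunc.mapDegree_pos hx
  obtain ⟨p, hp, hpy⟩ := Algebra.IsAlgebraic.isAlgebraic (R := K⟮x⟯) y
  letI := (aeval (AdjoinSimple.gen K x) : K[X] →ₐ[K] K⟮x⟯).toRingHom.toAlgebra
  haveI := isFractionRing_adjoin_simple hx
  obtain ⟨b, hb, hb'⟩ := IsLocalization.integerNormalization_spec (nonZeroDivisors K[X]) p
  set G := IsLocalization.integerNormalization (nonZeroDivisors K[X]) p
  have hb2 : map (algebraMap K[X] K⟮x⟯) G = b • p := hb'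
  have hG : aevalAeval x y G = 0 := by
    have h1 := aevalAeval_eq_aeval_map (AdjoinSimple.gen K x) y G
    change aevalAeval x y G = aeval y (map (algebraMap K[X] K⟮x⟯) G) at h1
    rw [h1, hb2, Algebra.smul_def, map_mul, hpy, mul_zero]
  have hG0 : G ≠ 0 := by
    intro h
    rw [h, Polynomial.map_zero] at hb2
    have h2 : (algebraMap K[X] K⟮x⟯ b) • p = 0 := by
      rw [algebraMap_smul]; exact hb2.symm
    rcases smul_eq_zero.1 h2 with h3 | h3
    · exact nonZeroDivisors.ne_zero hb (IsFractionRing.injective K[X] K⟮x⟯ (by rw [h3, map_zero]))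
    · exact hp h3
  have hprime : (RingHom.ker (aevalAeval x y : K[X][Y] →ₐ[K] RatFunc K)).IsPrime :=
    RingHom.ker_isPrime _
  obtain ⟨F, hF, hF'⟩ := hprime.exists_mem_prime_of_ne_bot (by
    intro h
    have : G ∈ RingHom.ker (aevalAeval x y : K[X][Y] →ₐ[K] RatFunc K) := hG
    rw [h] at this
    exact hG0 this)
  exact ⟨F, hF'.irreducible, hF⟩

/-- The left side is `[K(x,y):K(x)]` and the right side is `[K(t):K(x)]`. -/
theorem natDegree_relation_le {y : RatFunc K} {F : K[X][Y]} (hF : Irreducible F)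
    (hxy : aevalAeval x y F = 0) : F.natDegree ≤ x.mapDegree := by
  rw [natDegree_eq_finrank hx hF (natDegree_ne_zero_of_aevalAeval hx hF.ne_zero hxy) hxy]
  have hfin : Module.Finite K⟮x⟯ (RatFunc K) := by
    apply Module.finite_of_finrank_pos
    rw [RatFunc.finrank_eq_max_natDegree]
    exact RatFunc.mapDegree_pos hx
  rw [RatFunc.mapDegree, ← RatFunc.finrank_eq_max_natDegree]
  exact Submodule.finrank_le (K⟮x⟯⟮y⟯).toSubmodule

/-- The bound by `[K(t):K(x)]` is attained exactly when `K(x,y)` is all of `K(t)`: birationality can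
be read off a Newton polygon. -/
theorem natDegree_relation_eq_iff {y : RatFunc K} {F : K[X][Y]} (hF : Irreducible F)
    (hxy : aevalAeval x y F = 0) : F.natDegree = x.mapDegree ↔ K⟮x, y⟯ = ⊤ := by
  rw [natDegree_eq_finrank hx hF (natDegree_ne_zero_of_aevalAeval hx hF.ne_zero hxy) hxy]
  have hfin : Module.Finite K⟮x⟯ (RatFunc K) := by
    apply Module.finite_of_finrank_pos
    rw [RatFunc.finrank_eq_max_natDegree]
    exact RatFunc.mapDegree_pos hx
  rw [RatFunc.mapDegree, ← RatFunc.finrank_eq_max_natDegree, ← adjoin_simple_adjoin_simple]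
  constructor
  · intro h
    have : K⟮x⟯⟮y⟯ = ⊤ := by
      apply IntermediateField.eq_of_le_of_finrank_eq le_top
      rw [h, IntermediateField.finrank_top']
    rw [this, restrictScalars_top]
  · intro h
    have : K⟮x⟯⟮y⟯ = ⊤ := by
      apply IntermediateField.restrictScalars_injective K
      rw [h, restrictScalars_top]
    rw [this, IntermediateField.finrank_top']

end Fraction

theorem ratFunc_X_not_const : ¬ ∃ c : K, (RatFunc.X : RatFunc K) = RatFunc.C c := by
  rw [RatFunc.eq_C_iff]
  simp

theorem bot_ne_top_ratFunc : (⊥ : IntermediateField K (RatFunc K)) ≠ ⊤ := by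
  intro h
  have : (RatFunc.X : RatFunc K) ∈ (⊥ : IntermediateField K (RatFunc K)) := h ▸ mem_top
  obtain ⟨c, hc⟩ := mem_bot.1 this
  exact ratFunc_X_not_const ⟨c, hc.symm⟩

/-- If `x` were a constant `c`, then `y` would be nonconstant and `F(c, Y)` would vanish at it,
hence identically; so `X - c` would divide the irreducible `F`, which has positive degree in `Y`. -/
theorem not_const_of_relation {x y : RatFunc K} {F : K[X][Y]} (hF : Irreducible F)
    (hd : F.natDegree ≠ 0) (h : aevalAeval x y F = 0) (htop : K⟮x, y⟯ = ⊤) :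
    ¬ ∃ c, x = RatFunc.C c := by
  rintro ⟨c, rfl⟩
  have hy : ¬ ∃ c, y = RatFunc.C c := by
    rintro ⟨c', rfl⟩
    apply bot_ne_top_ratFunc (K := K)
    rw [← htop, eq_comm, adjoin_eq_bot_iff]
    rintro z (rfl | rfl)
    · exact ⟨c, rfl⟩
    · exact ⟨c', rfl⟩
  have h1 : F.map (evalRingHom c) = 0 := by
    by_contra h0
    apply RatFunc.transcendental_of_ne_C y hy
    refine ⟨_, h0, ?_⟩
    rw [← h]
    have h2 : ∀ G : K[X][Y], aeval y (G.map (evalRingHom c)) = aevalAeval (RatFunc.C c) y G := by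
      intro G
      induction G using Polynomial.induction_on' with
      | add p q hp hq => simp only [Polynomial.map_add, map_add, hp, hq]
      | monomial n p =>
        rw [← C_mul_X_pow_eq_monomial, map_mul, map_pow, aevalAeval_C]
        have : aeval (RatFunc.C c : RatFunc K) p = algebraMap K _ (p.eval c) := by
          rw [← Polynomial.aeval_algebraMap_apply_eq_algebraMap_eval]
          rfl
        rw [this]
        simp
    exact h2 F
  have h2 : Polynomial.C (X - Polynomial.C c) ∣ F := by
    rw [C_dvd_iff_dvd_coeff]
    intro i
    rw [dvd_iff_isRoot, IsRoot.def]
    have := congrArg (fun p => coeff p i) h1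
    simpa using this
  obtain ⟨H, hH⟩ := h2
  rcases hF.isUnit_or_isUnit hH with h3 | h3
  · rw [isUnit_C] at h3
    exact not_isUnit_X_sub_C c h3
  · obtain ⟨u, -, hu⟩ := Polynomial.isUnit_iff.1 h3
    apply hd
    rw [hH, ← hu, ← C_mul, natDegree_C]

/-- Both maps embed `R` modulo the common kernel, and `L` is its fraction field, so the second
embedding extends to `L`. -/
theorem exists_algHom_of_ker_eq {R L L' : Type*} [CommRing R] [Algebra K R] [Field L] [Algebra K L]
    [Field L'] [Algebra K L'] (f : R →ₐ[K] L) (g : R →ₐ[K] L') (hker : ∀ r, f r = 0 ↔ g r = 0)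
    (hf : ∀ z, ∃ r s, z = f r / f s) : ∃ σ : L →ₐ[K] L', ∀ r, σ (f r) = g r := by
  letI : Algebra (R ⧸ RingHom.ker f) L := (Ideal.kerLiftAlg f).toRingHom.toAlgebra
  have hinj : Function.Injective (algebraMap (R ⧸ RingHom.ker f) L) := Ideal.kerLiftAlg_injective f
  haveI : FaithfulSMul (R ⧸ RingHom.ker f) L := (faithfulSMul_iff_algebraMap_injective _ _).2 hinj
  haveI : IsScalarTower K (R ⧸ RingHom.ker f) L := IsScalarTower.of_algebraMap_eq fun r =>
    ((Ideal.kerLiftAlg f).commutes r).symm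
  haveI : IsFractionRing (R ⧸ RingHom.ker f) L := .of_field _ _ fun z => by
    obtain ⟨r, s, rfl⟩ := hf z
    exact ⟨Ideal.Quotient.mk _ r, Ideal.Quotient.mk _ s, rfl⟩
  let g' : (R ⧸ RingHom.ker f) →ₐ[K] L' := Ideal.Quotient.liftₐ _ g fun P hP => (hker P).1 hP
  have hg' : Function.Injective g' := by
    rw [injective_iff_map_eq_zero]
    intro a ha
    obtain ⟨P, rfl⟩ := Ideal.Quotient.mk_surjective a
    rw [Ideal.Quotient.eq_zero_iff_mem]
    exact (hker P).2 ha
  exact ⟨IsFractionRing.liftAlgHom (g := g') hg', fun r =>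
    IsFractionRing.lift_algebraMap hg' (Ideal.Quotient.mk _ r)⟩

theorem exists_aevalAeval_div {x y : RatFunc K} (htop : K⟮x, y⟯ = ⊤) (z : RatFunc K) :
    ∃ P Q : K[X][Y], z = aevalAeval x y P / aevalAeval x y Q := by
  have hrange : Algebra.adjoin K {x, y} ≤ (aevalAeval x y : K[X][Y] →ₐ[K] RatFunc K).range := by
    rw [Algebra.adjoin_le_iff]
    rintro z (rfl | rfl)
    · exact ⟨Polynomial.C X, by simp⟩
    · exact ⟨X, by simp⟩
  have hz : z ∈ K⟮x, y⟯ := htop ▸ mem_top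
  obtain ⟨r, hr, s, hs, rfl⟩ := mem_adjoin_iff_div.1 hz
  obtain ⟨P, rfl⟩ := hrange hr
  obtain ⟨Q, rfl⟩ := hrange hs
  exact ⟨P, Q, rfl⟩

/-- If two generating pairs of `K(t)` satisfy the same irreducible relation, then they differ by an
automorphism. -/
theorem exists_algEquiv_of_relation {x y x' y' : RatFunc K} {F : K[X][Y]} (hF : Irreducible F)
    (hd : F.natDegree ≠ 0) (h : aevalAeval x y F = 0)
    (h' : aevalAeval x' y' F = 0) (htop : K⟮x, y⟯ = ⊤) (htop' : K⟮x', y'⟯ = ⊤) :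
    ∃ σ : RatFunc K ≃ₐ[K] RatFunc K, σ x = x' ∧ σ y = y' := by
  have hx := not_const_of_relation hF hd h htop
  have hx' := not_const_of_relation hF hd h' htop'
  obtain ⟨σ, hσ⟩ := exists_algHom_of_ker_eq (aevalAeval x y : K[X][Y] →ₐ[K] RatFunc K)
    (aevalAeval x' y' : K[X][Y] →ₐ[K] RatFunc K) (fun G => by
      constructor
      · intro hG
        obtain ⟨H, rfl⟩ := dvd_of_aevalAeval_eq_zero hx hF h hG
        rw [map_mul, h', zero_mul]
      · intro hG
        obtain ⟨H, rfl⟩ := dvd_of_aevalAeval_eq_zero hx' hF h' hG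
        rw [map_mul, h, zero_mul]) (exists_aevalAeval_div htop)
  have hσx : σ x = x' := by simpa using hσ (Polynomial.C X)
  have hσy : σ y = y' := by simpa using hσ X
  have hsurj : Function.Surjective σ := by
    intro z
    have hz : z ∈ K⟮x', y'⟯ := htop' ▸ mem_top
    have hle : K⟮x', y'⟯ ≤ σ.fieldRange := by
      rw [adjoin_le_iff]
      rintro w (rfl | rfl)
      · exact ⟨x, hσx⟩
      · exact ⟨y, hσy⟩
    exact hle hz
  exact ⟨AlgEquiv.ofBijective σ ⟨σ.toRingHom.injective, hsurj⟩, hσx, hσy⟩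

theorem adjoin_image_algEquiv (σ : RatFunc K ≃ₐ[K] RatFunc K) {S : Set (RatFunc K)}
    (hS : adjoin K S = ⊤) : adjoin K (σ '' S) = ⊤ := by
  have h1 : (adjoin K S).map σ.toAlgHom = adjoin K (σ '' S) := adjoin_map K S σ.toAlgHom
  rw [← h1, hS, eq_top_iff]
  intro z _
  exact ⟨σ.symm z, mem_top, σ.apply_symm_apply z⟩

/-- The automorphisms of `K(t)` are the fractional linear transformations. -/
theorem exists_mobius (σ : RatFunc K ≃ₐ[K] RatFunc K) :
    ∃ a b c d : K, a * d - b * c ≠ 0 ∧ σ RatFunc.X =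
      (RatFunc.C a * RatFunc.X + RatFunc.C b) / (RatFunc.C c * RatFunc.X + RatFunc.C d) := by
  set g := σ RatFunc.X with hg
  have htop : K⟮g⟯ = ⊤ := by
    have h1 := adjoin_image_algEquiv σ (RatFunc.adjoin_X (K := K))
    rwa [Set.image_singleton] at h1
  -- The image of the generator generates again, and `[K(t):K(g)]` is the maximum of the degrees of
  -- numerator and denominator.
  have h1 : max g.num.natDegree g.denom.natDegree = 1 := by
    rw [← RatFunc.finrank_eq_max_natDegree, htop]
    exact IntermediateField.finrank_top
  have hgC : ¬ ∃ c, g = RatFunc.C c := by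
    rintro ⟨c, hc⟩
    apply ratFunc_X_not_const (K := K)
    refine ⟨c, σ.injective ?_⟩
    rw [← hg, hc]
    exact (σ.commutes c).symm
  have hn : g.num = Polynomial.C (g.num.coeff 1) * X + Polynomial.C (g.num.coeff 0) :=
    eq_X_add_C_of_natDegree_le_one (h1 ▸ le_max_left _ _)
  have hde : g.denom = Polynomial.C (g.denom.coeff 1) * X + Polynomial.C (g.denom.coeff 0) :=
    eq_X_add_C_of_natDegree_le_one (h1 ▸ le_max_right _ _)
  refine ⟨g.num.coeff 1, g.num.coeff 0, g.denom.coeff 1, g.denom.coeff 0, ?_, ?_⟩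
  · intro h0
    -- A vanishing determinant makes numerator and denominator proportional, so `g` would be
    -- constant.
    have h2 : Polynomial.C (g.denom.coeff 1) * g.num = Polynomial.C (g.num.coeff 1) * g.denom := by
      conv_lhs => rw [hn]
      conv_rhs => rw [hde]
      have h3 : Polynomial.C (g.num.coeff 1) * Polynomial.C (g.denom.coeff 0) =
          Polynomial.C (g.num.coeff 0) * Polynomial.C (g.denom.coeff 1) := by
        rw [← Polynomial.C_mul, ← Polynomial.C_mul, sub_eq_zero.1 h0]
      linear_combination -h3
    by_cases hc : g.denom.coeff 1 = 0
    · rw [hc, map_zero, zero_mul, eq_comm, mul_eq_zero, or_iff_left g.denom_ne_zero] at h2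
      have h3 : g.num.coeff 1 = 0 := by simpa using h2
      rw [hc, map_zero, zero_mul, zero_add] at hde
      rw [h3, map_zero, zero_mul, zero_add] at hn
      rw [hn, hde] at h1
      simp at h1
    · apply hgC
      refine ⟨g.num.coeff 1 / g.denom.coeff 1, ?_⟩
      conv_lhs => rw [← RatFunc.num_div_denom g]
      have h3 : algebraMap K[X] (RatFunc K) g.denom ≠ 0 := by simpa using g.denom_ne_zero
      rw [div_eq_iff h3, map_div₀]
      have h4 := congrArg (algebraMap K[X] (RatFunc K)) h2
      rw [map_mul, map_mul, RatFunc.algebraMap_C, RatFunc.algebraMap_C] at h4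
      have h5 : RatFunc.C (g.denom.coeff 1) ≠ 0 := by simpa using hc
      field_simp
      linear_combination h4
  · conv_lhs => rw [← RatFunc.num_div_denom g, hn, hde]
    simp [RatFunc.algebraMap_C, RatFunc.algebraMap_X]

end RationalPairs

/-! ### The shape of an `h`-transverse polygon -/

/-- One step along the left boundary of a finite lattice-convex set whose left edges have integral
slopes. -/
theorem exists_left_step {S : Set (ℤ × ℤ)} (hfin : S.Finite)
    (hconv : ∀ a ∈ S, ∀ b ∈ S, ∀ m : ℤ × ℤ, ∀ s t : ℕ, 0 < s + t →
      (s + t : ℤ) * m.1 = s * a.1 + t * b.1 → (s + t : ℤ) * m.2 = s * a.2 + t * b.2 → m ∈ S)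
    (hslope : ∀ p q : ℤ, 0 < q → Int.gcd q p = 1 → ∀ a ∈ S, ∀ b ∈ S, a ≠ b →
      (∀ c ∈ S, p * (c.2 - a.2) ≤ q * (c.1 - a.1)) → q * (b.1 - a.1) = p * (b.2 - a.2) → q = 1)
    {a : ℤ × ℤ} (ha : a ∈ S) {l : ℤ} (hl : ∀ c ∈ S, a.1 + l * (c.2 - a.2) ≤ c.1)
    (hup : ∃ c ∈ S, a.2 < c.2) :
    ∃ l' : ℤ, (a.1 + l', a.2 + 1) ∈ S ∧ ∀ c ∈ S, a.1 + l' * (c.2 - a.2) ≤ c.1 := by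
  obtain ⟨c₀, hc₀, hc₀a⟩ := hup
  -- The next edge of the left boundary goes from `a` to a point above `a` of minimal inverse slope;
  -- it is then written in lowest terms as `p / q`.
  obtain ⟨b, ⟨hb, hba⟩, hbmin⟩ := (hfin.subset (Set.sep_subset S fun c => a.2 < c.2)).exists_minimalFor
    (fun c : ℤ × ℤ => ((c.1 - a.1 : ℤ) : ℚ) / ((c.2 - a.2 : ℤ) : ℚ)) _ ⟨c₀, hc₀, hc₀a⟩
  have hmin : ∀ c ∈ S, a.2 < c.2 → (b.1 - a.1) * (c.2 - a.2) ≤ (c.1 - a.1) * (b.2 - a.2) := by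
    intro c hc hca
    by_contra hcon
    push Not at hcon
    have h1 : (0 : ℚ) < ((c.2 - a.2 : ℤ) : ℚ) := by exact_mod_cast sub_pos.2 hca
    have h2 : (0 : ℚ) < ((b.2 - a.2 : ℤ) : ℚ) := by exact_mod_cast sub_pos.2 hba
    have h3 : ((c.1 - a.1 : ℤ) : ℚ) / ((c.2 - a.2 : ℤ) : ℚ) <
        ((b.1 - a.1 : ℤ) : ℚ) / ((b.2 - a.2 : ℤ) : ℚ) := by
      rw [div_lt_div_iff₀ h1 h2]
      exact_mod_cast hcon
    exact absurd (hbmin (show c ∈ {c ∈ S | a.2 < c.2} from ⟨hc, hca⟩) h3.le) (not_le.2 h3)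
  obtain ⟨g, p, q, hg, hpq, hp, hq⟩ :
      ∃ g p q : ℤ, 0 < g ∧ Int.gcd q p = 1 ∧ b.1 - a.1 = p * g ∧ b.2 - a.2 = q * g := by
    have hne : 0 < Int.gcd (b.2 - a.2) (b.1 - a.1) := Int.gcd_pos_of_ne_zero_left _ (by omega)
    obtain ⟨g, q, p, h1, h2, h3, h4⟩ := Int.exists_gcd_one' hne
    exact ⟨g, p, q, by exact_mod_cast h1, h2, h4, h3⟩
  have hq0 : 0 < q := by
    have : 0 < q * g := by omega
    exact pos_of_mul_pos_left this hg.le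
  -- The new line is at least as inclined as the old supporting line, so the points in rows not
  -- above `a`, controlled by `hl`, stay on its right as well.
  have hlp : l * q ≤ p := by
    have h1 := hl b hb
    rw [hq] at h1
    have : l * q * g ≤ p * g := by rw [← hp, mul_assoc]; linarith
    exact le_of_mul_le_mul_right this hg
  have hall : ∀ c ∈ S, p * (c.2 - a.2) ≤ q * (c.1 - a.1) := by
    intro c hc
    rcases lt_or_ge a.2 c.2 with h | h
    · have h1 := hmin c hc h
      rw [hp, hq] at h1
      have : p * (c.2 - a.2) * g ≤ q * (c.1 - a.1) * g := by nlinarith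
      exact le_of_mul_le_mul_right this hg
    · have h1 := hl c hc
      nlinarith
  have hq1 : q = 1 := hslope p q hq0 hpq a ha b hb (by rintro rfl; exact lt_irrefl _ hba) hall
    (by rw [hp, hq]; ring)
  subst hq1
  refine ⟨p, ?_, fun c hc => by have := hall c hc; linarith⟩
  lift g to ℕ using hg.le
  have hg1 : 1 ≤ g := by exact_mod_cast hg
  -- As `q = 1`, the edge `b - a` is `g` times `(p, 1)`, and its first lattice point has weights `g
  -- - 1` and `1`.
  refine hconv a ha b hb _ (g - 1) 1 (by omega) ?_ ?_
  · push_cast [hg1]; linear_combination -hp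
  · push_cast [hg1]; linear_combination -hq

/-- The left boundary of a finite lattice-convex set whose left edges have integral slopes. -/
theorem exists_left_boundary {S : Set (ℤ × ℤ)} (hfin : S.Finite)
    (hconv : ∀ a ∈ S, ∀ b ∈ S, ∀ m : ℤ × ℤ, ∀ s t : ℕ, 0 < s + t →
      (s + t : ℤ) * m.1 = s * a.1 + t * b.1 → (s + t : ℤ) * m.2 = s * a.2 + t * b.2 → m ∈ S)
    (hslope : ∀ p q : ℤ, 0 < q → Int.gcd q p = 1 → ∀ a ∈ S, ∀ b ∈ S, a ≠ b →
      (∀ c ∈ S, p * (c.2 - a.2) ≤ q * (c.1 - a.1)) → q * (b.1 - a.1) = p * (b.2 - a.2) → q = 1)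
    {y₀ : ℤ} {h : ℕ} (hbot : ∃ c ∈ S, c.2 = y₀) (htop : ∃ c ∈ S, c.2 = y₀ + h)
    (hbd : ∀ c ∈ S, y₀ ≤ c.2) :
    ∃ L : ℕ → ℤ, (∀ k ≤ h, (L k, y₀ + k) ∈ S) ∧ (∀ k ≤ h, ∀ c ∈ S, c.2 = y₀ + k → L k ≤ c.1) ∧
      ∀ k < h, ∀ l ≤ h, L k + (L (k + 1) - L k) * ((l : ℤ) - k) ≤ L l := by
  obtain ⟨ct, hct, hct2⟩ := htop
  -- The induction carries some supporting line through the leftmost point of the current row.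
  have key : ∀ k ≤ h, ∃ a ∈ S, a.2 = y₀ + k ∧ ∃ l : ℤ, ∀ c ∈ S, a.1 + l * (c.2 - a.2) ≤ c.1 := by
    intro k
    induction k with
    | zero =>
      intro _
      obtain ⟨c₀, hc₀, hc₀y⟩ := hbot
      obtain ⟨a, ⟨ha, hay⟩, hamin⟩ :=
        (hfin.subset (Set.sep_subset S fun c => c.2 = y₀)).exists_minimalFor
        (fun c : ℤ × ℤ => c.1) _ ⟨c₀, hc₀, hc₀y⟩
      obtain ⟨b, hb, hbmin⟩ := hfin.exists_minimalFor (fun c : ℤ × ℤ => c.1) _ ⟨a, ha⟩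
      have hrow : ∀ c ∈ S, c.2 = y₀ → a.1 ≤ c.1 := by
        intro c hc hcy
        by_contra hcon
        exact hcon (hamin (show c ∈ {c ∈ S | c.2 = y₀} from ⟨hc, hcy⟩) (not_le.1 hcon).le)
      have hb' : ∀ c ∈ S, b.1 ≤ c.1 := by
        intro c hc
        by_contra hcon
        exact hcon (hbmin hc (not_le.1 hcon).le)
      -- The slope `b.1 - a.1 ≤ 0` reaches the overall leftmost column already one row above the
      -- bottom, so this line supports the set.
      refine ⟨a, ha, by simpa using hay, b.1 - a.1, fun c hc => ?_⟩
      rcases (hbd c hc).eq_or_lt with h | h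
      · rw [hay, ← h]; simpa using hrow c hc h.symm
      · have h1 := hb' c hc
        have h2 := hb' a ha
        nlinarith
    | succ k ih =>
      intro hk
      obtain ⟨a, ha, hay, l, hl⟩ := ih (by omega)
      obtain ⟨l', h1, h2⟩ := exists_left_step hfin hconv hslope ha hl ⟨ct, hct, by omega⟩
      refine ⟨_, h1, by push_cast; omega, l', fun c hc => ?_⟩
      have := h2 c hc
      dsimp only
      linarith
  choose! a haS hay l hl using key
  have hrow : ∀ k ≤ h, ∀ c ∈ S, c.2 = y₀ + k → (a k).1 ≤ c.1 := by
    intro k hk c hc hcy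
    have := hl k hk c hc
    rw [hcy, hay k hk] at this
    simpa using this
  have hmem : ∀ k ≤ h, ((a k).1, y₀ + (k : ℤ)) ∈ S := by
    intro k hk
    rw [← hay k hk]
    exact haS k hk
  refine ⟨fun k => (a k).1, hmem, hrow, fun k hk m hm => ?_⟩
  obtain ⟨l', h1, h2⟩ := exists_left_step hfin hconv hslope (haS k hk.le) (hl k hk.le)
    ⟨ct, hct, by rw [hct2, hay k hk.le]; omega⟩
  have e1 : (a (k + 1)).1 ≤ (a k).1 + l' :=
    hrow (k + 1) hk _ h1 (by dsimp only; rw [hay k hk.le]; push_cast; ring)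
  have e2 := h2 _ (hmem (k + 1) hk)
  have e3 := h2 _ (hmem m hm)
  rw [hay k hk.le] at e2 e3
  push_cast at e2 e3
  have e4 : (a (k + 1)).1 - (a k).1 = l' := by linarith
  dsimp only
  rw [e4]
  linarith

/-- The combinatorial shape of an `h`-transverse polygon: its lattice points are the points
`(x₁ + i, y₀ + k)` with `0 ≤ k ≤ h` and `L k ≤ i ≤ R k`, with `L` convex and `R` concave. -/
structure LatticePolygon.Shape (Δ : LatticePolygon) where
  (x₁ y₀ : ℤ)
  (h e : ℕ)
  (L R : ℕ → ℤ)
  h_pos : 0 < h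
  mem_iff : ∀ m : ℤ × ℤ, latticeToReal m ∈ Δ.carrier ↔
    ∃ k ≤ h, m.2 = y₀ + k ∧ L k ≤ m.1 - x₁ ∧ m.1 - x₁ ≤ R k
  L_le_R : ∀ k ≤ h, L k ≤ R k
  L_convex : ∀ k < h, ∀ l ≤ h, L k + (L (k + 1) - L k) * ((l : ℤ) - k) ≤ L l
  R_concave : ∀ k < h, ∀ l ≤ h, R l ≤ R k + (R (k + 1) - R k) * ((l : ℤ) - k)
  nondeg : ∀ k < h, L k < R k ∨ L (k + 1) < R (k + 1)
  L_nonneg : ∀ k ≤ h, 0 ≤ L k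
  exists_L_eq : ∃ k ≤ h, L k = 0
  R_le : ∀ k ≤ h, R k ≤ e
  exists_R_eq : ∃ k ≤ h, R k = e
  transverse : Δ.IsHTransverse
  le_width : ∀ k ≤ h, ((R k - L k : ℤ) : ℝ) ≤ Δ.width

namespace LatticePolygon

variable (Δ : LatticePolygon)

theorem convex_carrier : Convex ℝ Δ.carrier := by
  obtain ⟨P, hP⟩ := Δ.isLattice
  rw [hP]
  exact convex_convexHull _ _

theorem isBounded_carrier : Bornology.IsBounded Δ.carrier := by
  obtain ⟨P, hP⟩ := Δ.isLattice
  rw [hP]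
  exact (isBounded_convexHull).2 ((P.finite_toSet.image _).isBounded)

/-- The set of lattice points. -/
def lattice : Set (ℤ × ℤ) := {m | latticeToReal m ∈ Δ.carrier}

theorem finite_lattice : Δ.lattice.Finite := Set.finite_coe_iff.1 Δ.finite_pts

theorem lattice_convex {a b : ℤ × ℤ} (ha : a ∈ Δ.lattice) (hb : b ∈ Δ.lattice) (m : ℤ × ℤ)
    (s t : ℕ) (hst : 0 < s + t) (h1 : (s + t : ℤ) * m.1 = s * a.1 + t * b.1)
    (h2 : (s + t : ℤ) * m.2 = s * a.2 + t * b.2) : m ∈ Δ.lattice := by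
  have hpos : (0 : ℝ) < s + t := by exact_mod_cast hst
  have h := Δ.convex_carrier ha hb (a := (s : ℝ) / (s + t)) (b := (t : ℝ) / (s + t))
    (by positivity) (by positivity) (by rw [← add_div, div_self hpos.ne'])
  have e1 : ((s : ℝ) + t) * m.1 = s * a.1 + t * b.1 := by exact_mod_cast h1
  have e2 : ((s : ℝ) + t) * m.2 = s * a.2 + t * b.2 := by exact_mod_cast h2
  have : ((s : ℝ) / (s + t)) • latticeToReal a + ((t : ℝ) / (s + t)) • latticeToReal b =
      latticeToReal m := by
    ext
    · simp only [latticeToReal, Prod.fst_add, Prod.smul_fst, smul_eq_mul]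
      field_simp
      linarith
    · simp only [latticeToReal, Prod.snd_add, Prod.smul_snd, smul_eq_mul]
      field_simp
      linarith
  rw [this] at h
  exact h

/-- A linear equation valid at the lattice points holds on their convex hull. Small moves from an
interior point in the two coordinate directions then force both coefficients to vanish. -/
theorem lattice_not_collinear {p q c : ℤ} (h : ∀ m ∈ Δ.lattice, p * m.1 + q * m.2 = c) :
    p = 0 ∧ q = 0 := by
  have hsub : Δ.carrier ⊆ {z : ℝ × ℝ | (p : ℝ) * z.1 + q * z.2 = c} := by
    obtain ⟨P, hP⟩ := Δ.isLattice
    rw [hP]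
    refine convexHull_min ?_ ?_
    · rintro _ ⟨m, hm, rfl⟩
      have hmem : m ∈ Δ.lattice := by
        change latticeToReal m ∈ Δ.carrier
        rw [hP]
        exact subset_convexHull _ _ ⟨m, hm, rfl⟩
      have := h m hmem
      simp only [Set.mem_ofPred_eq, latticeToReal]
      exact_mod_cast this
    · intro z hz w hw s t _ _ hst
      simp only [Set.mem_ofPred_eq] at hz hw ⊢
      simp only [Prod.fst_add, Prod.snd_add, Prod.smul_fst, Prod.smul_snd, smul_eq_mul]
      linear_combination s * hz + t * hw + (c : ℝ) * hst
  obtain ⟨z, hz⟩ := Δ.nonempty_interior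
  have hz0 := hsub (interior_subset hz)
  have hdir : ∀ v : ℝ × ℝ, ∃ t : ℝ, t ≠ 0 ∧ z + t • v ∈ Δ.carrier := by
    intro v
    have hcont : Filter.Tendsto (fun t : ℝ => z + t • v) (nhdsWithin 0 {0}ᶜ) (nhds z) := by
      have : ContinuousAt (fun t : ℝ => z + t • v) 0 := by fun_prop
      have h2 := this.tendsto
      simp only [zero_smul, add_zero] at h2
      exact h2.mono_left nhdsWithin_le_nhds
    have h1 := hcont.eventually (mem_interior_iff_mem_nhds.1 hz)
    obtain ⟨t, ht1, ht2⟩ := (h1.and self_mem_nhdsWithin).exists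
    exact ⟨t, ht2, ht1⟩
  constructor
  · obtain ⟨t, ht, hm⟩ := hdir (1, 0)
    have := hsub hm
    simp only [Set.mem_ofPred_eq, Prod.fst_add, Prod.snd_add, Prod.smul_fst, Prod.smul_snd,
      smul_eq_mul, mul_one, mul_zero, add_zero] at this hz0
    have h3 : (p : ℝ) * t = 0 := by linarith
    exact_mod_cast (mul_eq_zero.1 h3).resolve_right ht
  · obtain ⟨t, ht, hm⟩ := hdir (0, 1)
    have := hsub hm
    simp only [Set.mem_ofPred_eq, Prod.fst_add, Prod.snd_add, Prod.smul_fst, Prod.smul_snd,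
      smul_eq_mul, mul_one, mul_zero, add_zero] at this hz0
    have h3 : (q : ℝ) * t = 0 := by linarith
    exact_mod_cast (mul_eq_zero.1 h3).resolve_right ht

theorem lattice_nonempty : Δ.lattice.Nonempty := by
  by_contra hcon
  rw [Set.not_nonempty_iff_eq_empty] at hcon
  have := Δ.lattice_not_collinear (p := 1) (q := 0) (c := 0) (by simp [hcon])
  omega

theorem sub_le_width {k : ℤ} {x x' : ℤ} (h : (x, k) ∈ Δ.lattice) (h' : (x', k) ∈ Δ.lattice) :
    ((x' - x : ℤ) : ℝ) ≤ Δ.width := by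
  refine le_csSup ?_ ⟨k, x, x', h, h', by push_cast; ring⟩
  obtain ⟨r, hr⟩ := Δ.isBounded_carrier.subset_closedBall 0
  refine ⟨r + r, ?_⟩
  rintro l ⟨k, x, x', hx, hx', rfl⟩
  have h1 := hr hx
  have h2 := hr hx'
  rw [mem_closedBall_zero_iff, Prod.norm_def] at h1 h2
  have h3 := abs_le.1 ((le_max_left _ _).trans h1)
  have h4 := abs_le.1 ((le_max_left _ _).trans h2)
  simp only at h3 h4
  linarith [h3.1, h4.2]

variable {Δ}

/-- The first entry of the normal divides the second one, and the two are coprime. -/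
theorem IsHTransverse.slope (hΔ : Δ.IsHTransverse) {n a b : ℤ × ℤ} (h0 : n.1 ≠ 0)
    (hn : Int.gcd n.1 n.2 = 1) (ha : a ∈ Δ.lattice) (hb : b ∈ Δ.lattice) (hab : a ≠ b)
    (hmin : ∀ c ∈ Δ.lattice, latticePairing n a ≤ latticePairing n c)
    (heq : latticePairing n a = latticePairing n b) : n.1.natAbs = 1 := by
  have := hΔ ⟨n, hn, ⟨a, ha⟩, fun c => hmin c.1 c.2, ⟨b, hb⟩,
    fun c => heq ▸ hmin c.1 c.2, fun h => hab (congrArg Subtype.val h)⟩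
  have h1 : n.1 ∣ n.2 := this.resolve_left h0
  rwa [← Nat.gcd_eq_left (Int.natAbs_dvd_natAbs.2 h1)]

theorem exists_shape (hΔ : Δ.IsHTransverse) : Nonempty Δ.Shape := by
  obtain ⟨b, hb, hbmin⟩ := Δ.finite_lattice.exists_minimalFor Prod.snd _ Δ.lattice_nonempty
  obtain ⟨t, ht, htmax⟩ := Δ.finite_lattice.exists_maximalFor Prod.snd _ Δ.lattice_nonempty
  obtain ⟨l, hl, hlmin⟩ := Δ.finite_lattice.exists_minimalFor Prod.fst _ Δ.lattice_nonempty
  obtain ⟨r, hr, hrmax⟩ := Δ.finite_lattice.exists_maximalFor Prod.fst _ Δ.lattice_nonempty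
  have hb' : ∀ c ∈ Δ.lattice, b.2 ≤ c.2 := fun c hc => (le_total _ _).elim id (hbmin hc)
  have ht' : ∀ c ∈ Δ.lattice, c.2 ≤ t.2 := fun c hc => (le_total _ _).elim id (htmax hc)
  have hl' : ∀ c ∈ Δ.lattice, l.1 ≤ c.1 := fun c hc => (le_total _ _).elim id (hlmin hc)
  have hr' : ∀ c ∈ Δ.lattice, c.1 ≤ r.1 := fun c hc => (le_total _ _).elim id (hrmax hc)
  obtain ⟨h, hh⟩ := Int.eq_ofNat_of_zero_le (sub_nonneg.2 (hb' t ht))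
  obtain ⟨e, he⟩ := Int.eq_ofNat_of_zero_le (sub_nonneg.2 (hl' r hr))
  obtain ⟨L, hL1, hL2, hL3⟩ := exists_left_boundary (h := h) (y₀ := b.2) Δ.finite_lattice
    (fun a ha b hb => Δ.lattice_convex ha hb)
    (fun p q hq hpq a ha b hb hab hmin heq => by
      have := hΔ.slope (n := (q, -p)) hq.ne' (by simpa using hpq) ha hb hab
        (fun c hc => by have := hmin c hc; simp only [latticePairing]; linarith)
        (by simp only [latticePairing]; linarith)
      dsimp only at this
      omega)
    ⟨b, hb, rfl⟩ ⟨t, ht, by omega⟩ hb'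
  -- The right boundary is the left boundary of the reflected polygon, so here `R` is the negative
  -- of the right end.
  obtain ⟨R, hR1, hR2, hR3⟩ := exists_left_boundary (h := h) (y₀ := b.2)
    (S := {c | (-c.1, c.2) ∈ Δ.lattice})
    (Δ.finite_lattice.preimage (f := fun c : ℤ × ℤ => (-c.1, c.2))
      (fun a _ b _ hab => by simpa [Prod.ext_iff] using hab))
    (fun a ha b hb m s t hst e1 e2 => Δ.lattice_convex ha hb _ s t hst (by dsimp only; linarith) e2)
    (fun p q hq hpq a ha b hb hab hmin heq => by
      have := hΔ.slope (n := (-q, -p)) (by simpa using hq.ne') (by simpa using hpq) ha hb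
        (fun hcon => hab (by simpa [Prod.ext_iff] using hcon))
        (fun c hc => by
          have := hmin (-c.1, c.2) (by simpa using hc)
          simp only [latticePairing] at this ⊢; linarith)
        (by simp only [latticePairing]; linarith)
      dsimp only at this
      omega)
    ⟨(-b.1, b.2), by simpa using hb, rfl⟩ ⟨(-t.1, t.2), by simpa using ht, by dsimp only; omega⟩
    (fun c hc => hb' (-c.1, c.2) hc)
  have hR1' : ∀ k ≤ h, (-R k, b.2 + (k : ℤ)) ∈ Δ.lattice := hR1
  have hR2' : ∀ k ≤ h, ∀ c ∈ Δ.lattice, c.2 = b.2 + k → c.1 ≤ - R k := by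
    intro k hk c hc hck
    have := hR2 k hk (-c.1, c.2) (by simpa using hc) hck
    dsimp only at this
    linarith
  have hLR : ∀ k ≤ h, L k ≤ - R k := fun k hk => hR2' k hk _ (hL1 k hk) rfl
  have hmem : ∀ m : ℤ × ℤ, m ∈ Δ.lattice ↔
      ∃ k ≤ h, m.2 = b.2 + k ∧ L k ≤ m.1 ∧ m.1 ≤ - R k := by
    intro m
    constructor
    · intro hm
      obtain ⟨k, hk⟩ := Int.eq_ofNat_of_zero_le (sub_nonneg.2 (hb' m hm))
      have h1 := ht' m hm
      have hkh : k ≤ h := by omega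
      exact ⟨k, hkh, by omega, hL2 k hkh m hm (by omega), hR2' k hkh m hm (by omega)⟩
    · rintro ⟨k, hk, hm, h1, h2⟩
      rcases h1.eq_or_lt with h3 | h3
      · have := hL1 k hk
        rwa [h3, ← hm] at this
      · obtain ⟨s, hs⟩ := Int.eq_ofNat_of_zero_le (sub_nonneg.2 h1)
        obtain ⟨t, ht⟩ := Int.eq_ofNat_of_zero_le (sub_nonneg.2 h2)
        refine Δ.lattice_convex (hL1 k hk) (hR1' k hk) m t s (by omega) ?_ ?_
        · dsimp only; rw [← hs, ← ht]; ring
        · dsimp only; rw [hm]; ring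
  have hpos : 0 < h := by
    rcases Nat.eq_zero_or_pos h with h0 | h0
    · have := Δ.lattice_not_collinear (p := 0) (q := 1) (c := b.2) (fun m hm => by
        have h1 := ht' m hm
        have h2 := hb' m hm
        omega)
      omega
    · exact h0
  refine ⟨⟨l.1, b.2, h, e, fun k => L k - l.1, fun k => - R k - l.1, hpos, ?_, ?_, ?_, ?_, ?_, ?_, ?_,
    ?_, ?_, hΔ, ?_⟩⟩
  · intro m
    refine (hmem m).trans (exists_congr fun k => and_congr_right fun _ => and_congr_right fun _ => ?_)
    constructor <;> rintro ⟨h1, h2⟩ <;> constructor <;> linarith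
  · intro k hk
    have := hLR k hk
    linarith
  · intro k hk m hm
    have := hL3 k hk m hm
    simp only [sub_sub_sub_cancel_right]
    linarith
  · intro k hk m hm
    have := hR3 k hk m hm
    simp only [sub_sub_sub_cancel_right]
    linarith
  · intro k hk
    by_contra hcon
    push Not at hcon
    have e1 : L k = - R k := by have := hLR k hk.le; linarith
    have e2 : L (k + 1) = - R (k + 1) := by have := hLR (k + 1) hk; linarith
    -- If two consecutive rows are single points, convexity of the left end and concavity of the
    -- right end squeeze every row onto the line through them, contradicting two-dimensionality.
    have hline : ∀ j ≤ h, L j = L k + (L (k + 1) - L k) * ((j : ℤ) - k) ∧ L j = - R j := by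
      intro j hj
      have h1 := hL3 k hk j hj
      have h2 := hR3 k hk j hj
      have h3 := hLR j hj
      have h4 : R (k + 1) - R k = - (L (k + 1) - L k) := by linarith
      rw [h4] at h2
      constructor <;> linarith
    have := Δ.lattice_not_collinear (p := 1) (q := - (L (k + 1) - L k))
      (c := L k - (L (k + 1) - L k) * (b.2 + k)) (fun m hm => by
        obtain ⟨j, hj, h1, h2, h3⟩ := (hmem m).1 hm
        obtain ⟨h4, h5⟩ := hline j hj
        have h6 : m.1 = L k + (L (k + 1) - L k) * ((j : ℤ) - k) := by linarith
        rw [h6, h1]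
        ring)
    omega
  · intro k hk
    have := hl' _ (hL1 k hk)
    dsimp only at this
    linarith
  · obtain ⟨k, hk, h1, h2, h3⟩ := (hmem l).1 hl
    have := hl' _ (hL1 k hk)
    exact ⟨k, hk, by dsimp only at this; linarith⟩
  · intro k hk
    have := hr' _ (hR1' k hk)
    dsimp only at this
    linarith
  · obtain ⟨k, hk, h1, h2, h3⟩ := (hmem r).1 hr
    have := hr' _ (hR1' k hk)
    exact ⟨k, hk, by dsimp only at this; linarith⟩
  · intro k hk
    have := Δ.sub_le_width (hL1 k hk) (hR1' k hk)
    simpa only [sub_sub_sub_cancel_right] using this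

end LatticePolygon

/-! ### Convex sequences of integers -/

/-- The sequence `L 0, …, L h` is convex. -/
def ConvexSeq (h : ℕ) (L : ℕ → ℤ) : Prop :=
  ∀ k < h, ∀ l ≤ h, L k + (L (k + 1) - L k) * ((l : ℤ) - k) ≤ L l

/-- The number of steps of slope less than `c`. -/
def stepsBelow (h : ℕ) (L : ℕ → ℤ) (c : ℤ) : ℕ :=
  ((Finset.range h).filter fun k => L (k + 1) - L k < c).card

/-- The number of steps of slope `c`. -/
def stepsEq (h : ℕ) (L : ℕ → ℤ) (c : ℤ) : ℕ :=
  ((Finset.range h).filter fun k => L (k + 1) - L k = c).card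

theorem stepsBelow_add_one (h : ℕ) (L : ℕ → ℤ) (c : ℤ) :
    stepsBelow h L (c + 1) = stepsBelow h L c + stepsEq h L c := by
  rw [stepsBelow, stepsBelow, stepsEq, ← Finset.card_union_of_disjoint]
  · congr 1
    ext k
    simp only [Finset.mem_filter, Finset.mem_union, Finset.mem_range]
    constructor
    · rintro ⟨h1, h2⟩
      rcases (Int.lt_add_one_iff.1 h2).lt_or_eq with h3 | h3
      · exact Or.inl ⟨h1, h3⟩
      · exact Or.inr ⟨h1, h3⟩
    · rintro (⟨h1, h2⟩ | ⟨h1, h2⟩) <;> exact ⟨h1, by omega⟩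
  · rw [Finset.disjoint_filter]
    intro k _ h1 h2
    omega

theorem stepsBelow_le (h : ℕ) (L : ℕ → ℤ) (c : ℤ) : stepsBelow h L c ≤ h :=
  (Finset.card_filter_le _ _).trans (Finset.card_range h).le

theorem exists_stepsBelow_eq_zero (h : ℕ) (L : ℕ → ℤ) : ∃ c, ∀ c' ≤ c, stepsBelow h L c' = 0 := by
  obtain ⟨c, hc⟩ := ((Finset.range h).image fun k => L (k + 1) - L k).bddBelow
  refine ⟨c, fun c' hc' => Finset.card_eq_zero.2 (Finset.filter_eq_empty_iff.2 fun k hk => ?_)⟩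
  have := hc (Finset.mem_coe.2 (Finset.mem_image_of_mem (fun k => L (k + 1) - L k) hk))
  omega

theorem exists_stepsBelow_eq (h : ℕ) (L : ℕ → ℤ) : ∃ c, ∀ c' ≥ c, stepsBelow h L c' = h := by
  obtain ⟨c, hc⟩ := ((Finset.range h).image fun k => L (k + 1) - L k).bddAbove
  refine ⟨c + 1, fun c' hc' => ?_⟩
  rw [stepsBelow, Finset.filter_true_of_mem, Finset.card_range]
  intro k hk
  have := hc (Finset.mem_coe.2 (Finset.mem_image_of_mem (fun k => L (k + 1) - L k) hk))
  omega

namespace ConvexSeq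

variable {h : ℕ} {L : ℕ → ℤ} (hL : ConvexSeq h L)
include hL

theorem slope_mono {k l : ℕ} (hkl : k ≤ l) (hl : l < h) : L (k + 1) - L k ≤ L (l + 1) - L l := by
  have h1 := hL l hl k (by omega)
  have h2 := hL l hl (k + 1) (by omega)
  rcases hkl.eq_or_lt with rfl | hkl
  · rfl
  have h3 := hL k (by omega) l (by omega)
  have h4 := hL k (by omega) (l + 1) (by omega)
  push_cast at *
  have h5 : (0 : ℤ) < (l : ℤ) - k := by omega
  have h6 : (L (k + 1) - L k) * ((l : ℤ) - k) ≤ (L (l + 1) - L l) * ((l : ℤ) - k) := by linarith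
  exact le_of_mul_le_mul_right h6 h5

/-- Slopes are nondecreasing, so the steps of slope less than `c` form an initial segment:
`stepsBelow h L c` is the height of the lower end of the face of slope `c`. -/
theorem lt_stepsBelow_iff {k : ℕ} (hk : k < h) (c : ℤ) :
    k < stepsBelow h L c ↔ L (k + 1) - L k < c := by
  constructor
  · intro hlt
    by_contra hcon
    push Not at hcon
    have : ((Finset.range h).filter fun k => L (k + 1) - L k < c) ⊆ Finset.range k := by
      intro l hl
      simp only [Finset.mem_filter, Finset.mem_range] at hl ⊢
      by_contra hlk
      have := hL.slope_mono (not_lt.1 hlk) hl.1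
      omega
    have := Finset.card_le_card this
    rw [Finset.card_range] at this
    exact absurd hlt (not_lt.2 this)
  · intro hlt
    have : Finset.range (k + 1) ⊆ ((Finset.range h).filter fun k => L (k + 1) - L k < c) := by
      intro l hl
      simp only [Finset.mem_filter, Finset.mem_range] at hl ⊢
      have := hL.slope_mono (show l ≤ k by omega) hk
      exact ⟨by omega, by omega⟩
    have := Finset.card_le_card this
    rw [Finset.card_range] at this
    exact this

/-- Below the face of slope `c`, the function `L l - c l` drops by at least one in each step. -/
theorem add_le_of_le_stepsBelow (c : ℤ) {l : ℕ} (hl : l ≤ stepsBelow h L c) :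
    L (stepsBelow h L c) - c * stepsBelow h L c + (stepsBelow h L c - l) ≤ L l - c * l := by
  obtain ⟨n, hn⟩ := Nat.exists_eq_add_of_le hl
  rw [hn]
  have hle := stepsBelow_le h L c
  have : ∀ n, l + n ≤ stepsBelow h L c →
      L (l + n) - c * (l + n : ℕ) + ((l + n : ℕ) - l : ℤ) ≤ L l - c * l := by
    intro n
    induction n with
    | zero => intro _; simp
    | succ n ih =>
      intro hn
      have h1 := ih (by omega)
      have h2 := (hL.lt_stepsBelow_iff (k := l + n) (by omega) c).1 (by omega)
      rw [← add_assoc]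
      push_cast at h1 ⊢
      linarith
  exact this n hn.ge

theorem eq_of_between (c : ℤ) {l : ℕ} (h1 : stepsBelow h L c ≤ l) (h2 : l ≤ stepsBelow h L (c + 1)) :
    L l - c * l = L (stepsBelow h L c) - c * stepsBelow h L c := by
  obtain ⟨n, rfl⟩ := Nat.exists_eq_add_of_le h1
  have hle := stepsBelow_le h L (c + 1)
  induction n with
  | zero => rfl
  | succ n ih =>
    rw [← ih (by omega) (by omega)]
    have h3 := (hL.lt_stepsBelow_iff (k := stepsBelow h L c + n) (by omega) (c + 1)).1 (by omega)
    have h4 := (hL.lt_stepsBelow_iff (k := stepsBelow h L c + n) (by omega) c).not.1 (by omega)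
    rw [← add_assoc]
    have h5 : L (stepsBelow h L c + n + 1) - L (stepsBelow h L c + n) = c := by omega
    push_cast
    linarith

theorem add_le_of_ge (c : ℤ) {l : ℕ} (h1 : stepsBelow h L (c + 1) ≤ l) (h2 : l ≤ h) :
    L (stepsBelow h L c) - c * stepsBelow h L c + (l - stepsBelow h L (c + 1)) ≤ L l - c * l := by
  have hle := stepsBelow_add_one h L c
  rw [← hL.eq_of_between c (l := stepsBelow h L (c + 1)) (by omega) le_rfl]
  obtain ⟨n, rfl⟩ := Nat.exists_eq_add_of_le h1
  induction n with
  | zero => simp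
  | succ n ih =>
    have h3 := ih (by omega) (by omega)
    have h4 := (hL.lt_stepsBelow_iff (k := stepsBelow h L (c + 1) + n) (by omega) (c + 1)).not.1
      (by omega)
    rw [← add_assoc]
    push_cast at h3 ⊢
    linarith

theorem support_le (c : ℤ) {l : ℕ} (hl : l ≤ h) :
    L (stepsBelow h L c) - c * stepsBelow h L c ≤ L l - c * l := by
  rcases le_total l (stepsBelow h L c) with h1 | h1
  · have := hL.add_le_of_le_stepsBelow c h1; omega
  rcases le_total l (stepsBelow h L (c + 1)) with h2 | h2
  · exact (hL.eq_of_between c h1 h2).ge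
  · have := hL.add_le_of_ge c h2 hl; omega

theorem support_eq_iff (c : ℤ) {l : ℕ} (hl : l ≤ h) :
    L l - c * l = L (stepsBelow h L c) - c * stepsBelow h L c ↔
      stepsBelow h L c ≤ l ∧ l ≤ stepsBelow h L (c + 1) := by
  refine ⟨fun heq => ⟨?_, ?_⟩, fun hh => hL.eq_of_between c hh.1 hh.2⟩
  · by_contra hcon
    have := hL.add_le_of_le_stepsBelow c (not_le.1 hcon).le; omega
  · by_contra hcon
    have := hL.add_le_of_ge c (not_le.1 hcon).le hl; omega

theorem support_slope {k : ℕ} (hk : k < h) :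
    L k - (L (k + 1) - L k) * k = L (stepsBelow h L (L (k + 1) - L k)) -
      (L (k + 1) - L k) * stepsBelow h L (L (k + 1) - L k) :=
  (hL.support_eq_iff _ hk.le).2
    ⟨not_lt.1 ((hL.lt_stepsBelow_iff hk _).not.2 (lt_irrefl _)),
      ((hL.lt_stepsBelow_iff hk _).2 (by omega)).le⟩

/-- If a finite set of lattice points in a strip of height `h` has, for each slope `c`, a left face
at least as long as that of the convex sequence `L`, then its left boundary is given by `L`. -/
theorem boundary_of_faces {S : Set (ℤ × ℤ)} (hS : ∀ a ∈ S, 0 ≤ a.2 ∧ a.2 ≤ h)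
    (hface : ∀ c : ℤ, ∃ a ∈ S, ∃ b ∈ S, (∀ m ∈ S, a.1 - c * a.2 ≤ m.1 - c * m.2) ∧
      (∀ m ∈ S, b.1 - c * b.2 ≤ m.1 - c * m.2) ∧ a.2 + stepsEq h L c ≤ b.2)
    (hmin : ∃ a ∈ S, (∀ m ∈ S, a.1 ≤ m.1) ∧ a.1 = L (stepsBelow h L 0)) (c : ℤ) :
    (L (stepsBelow h L c), (stepsBelow h L c : ℤ)) ∈ S ∧
      ∀ m ∈ S, L (stepsBelow h L c) - c * stepsBelow h L c ≤ m.1 - c * m.2 := by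
  choose a ha b hb hamin hbmin hab using hface
  -- The face of slope `c + 1` lies above that of slope `c`. Summing the lower bounds for their
  -- heights from below and from above bounds the end points on both sides, and the total height `h`
  -- makes these bounds equalities.
  have hmono : ∀ c, (b c).2 ≤ (a (c + 1)).2 := by
    intro c
    have h1 := hbmin c _ (ha (c + 1))
    have h2 := hamin (c + 1) _ (hb c)
    linarith
  have hlow : ∀ c, (stepsBelow h L c : ℤ) ≤ (a c).2 := by
    obtain ⟨c₀, hc₀⟩ := exists_stepsBelow_eq_zero h L
    intro c
    rcases le_total c c₀ with h1 | h1
    · rw [hc₀ c h1]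
      exact_mod_cast (hS _ (ha c)).1
    · induction c, h1 using Int.leInduction with
      | base => rw [hc₀ _ le_rfl]; exact_mod_cast (hS _ (ha _)).1
      | succ c h1 ih =>
        have h2 := hmono c
        have h3 := hab c
        rw [stepsBelow_add_one]
        push_cast
        linarith
  have hhigh : ∀ c, (b c).2 ≤ (stepsBelow h L (c + 1) : ℤ) := by
    obtain ⟨c₀, hc₀⟩ := exists_stepsBelow_eq h L
    intro c
    rcases le_total c₀ c with h1 | h1
    · rw [hc₀ (c + 1) (by omega)]
      exact (hS _ (hb c)).2
    · induction c, h1 using Int.leInductionDown with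
      | base => rw [hc₀ (c₀ + 1) (by omega)]; exact (hS _ (hb _)).2
      | pred c h1 ih =>
        have h2 := hmono (c - 1)
        have h3 := hab c
        have h4 := stepsBelow_add_one h L c
        rw [sub_add_cancel] at h2 ⊢
        rw [h4] at ih
        push_cast at ih
        linarith
  have ha2 : ∀ c, (a c).2 = stepsBelow h L c := by
    intro c
    have h1 := hlow c
    have h2 := hhigh c
    have h3 := hab c
    rw [stepsBelow_add_one] at h2
    push_cast at h2
    linarith
  have hb2 : ∀ c, (b c).2 = stepsBelow h L (c + 1) := by
    intro c
    have h1 := hlow c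
    have h2 := hhigh c
    have h3 := hab c
    rw [stepsBelow_add_one] at h2 ⊢
    push_cast at h2 ⊢
    linarith
  -- The end of one face and the start of the next have equal heights, and minimality on either side
  -- makes the points equal.
  have hstep : ∀ c, (a (c + 1)).1 = (a c).1 + c * stepsEq h L c := by
    intro c
    have h1 := hbmin c _ (ha (c + 1))
    have h2 := hamin (c + 1) _ (hb c)
    have h3 := hbmin c _ (ha c)
    have h4 := hamin c _ (hb c)
    rw [ha2, hb2] at h1 h2
    rw [ha2, hb2, stepsBelow_add_one] at h3 h4
    push_cast at h3 h4
    linarith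
  have hstepL : ∀ c, L (stepsBelow h L (c + 1)) = L (stepsBelow h L c) + c * stepsEq h L c := by
    intro c
    have h1 := hL.eq_of_between c (l := stepsBelow h L (c + 1))
      (by rw [stepsBelow_add_one]; omega) le_rfl
    have h2 := stepsBelow_add_one h L c
    have h3 : (stepsBelow h L (c + 1) : ℤ) = stepsBelow h L c + stepsEq h L c := by exact_mod_cast h2
    rw [h3] at h1
    linarith
  have ha1 : ∀ c, (a c).1 = L (stepsBelow h L c) := by
    intro c
    -- The heights fix the boundary only up to a horizontal translation; the leftmost column, at `c
    -- = 0`, removes it.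
    induction c with
    | zero =>
      obtain ⟨a₀, ha₀, hmin₀, heq⟩ := hmin
      have h1 := hamin 0 _ ha₀
      have h2 := hmin₀ _ (ha 0)
      linarith
    | succ i ih => rw [hstep, ih, hstepL]
    | pred i ih =>
      have h1 := hstep (-(i : ℤ) - 1)
      have h2 := hstepL (-(i : ℤ) - 1)
      rw [sub_add_cancel] at h1 h2
      linarith
  have hac : a c = (L (stepsBelow h L c), (stepsBelow h L c : ℤ)) := Prod.ext (ha1 c) (ha2 c)
  refine ⟨hac ▸ ha c, fun m hm => ?_⟩
  have := hamin c m hm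
  rwa [ha1, ha2] at this

end ConvexSeq

/-! ### Sides, heights and edges -/

namespace LatticePolygon

variable {Δ : LatticePolygon}

theorem Pts.mem_lattice (a : Δ.Pts) : a.1 ∈ Δ.lattice := a.2

@[ext] theorem Pts.ext {a b : Δ.Pts} (h : a.1 = b.1) : a = b := Subtype.ext h

theorem latticePairing_add (n m m' : ℤ × ℤ) :
    latticePairing n (m + m') = latticePairing n m + latticePairing n m' := by
  simp only [latticePairing, Prod.fst_add, Prod.snd_add]; ring

theorem latticePairing_sub (n m m' : ℤ × ℤ) :
    latticePairing n (m - m') = latticePairing n m - latticePairing n m' := by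
  simp only [latticePairing, Prod.fst_sub, Prod.snd_sub]; ring

theorem latticePairing_zsmul (n m : ℤ × ℤ) (k : ℤ) :
    latticePairing n (k • m) = k * latticePairing n m := by
  simp only [latticePairing, Prod.smul_fst, Prod.smul_snd, smul_eq_mul]; ring

/-- A vertex: a lattice point that is not the midpoint of two others. -/
def IsVertex (a : Δ.Pts) : Prop := ∀ b c : Δ.Pts, b.1 + c.1 = a.1 + a.1 → b = a

namespace Side

variable (i : Δ.Side)

/-- The minimum of the normal of the side. -/
def level : ℤ := latticePairing i.1 i.2.2.nonempty.some.1

/-- The lattice distance from the side. -/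
def ht (m : ℤ × ℤ) : ℤ := latticePairing i.1 m - i.level

/-- The primitive tangent vector of the side. -/
def tangent : ℤ × ℤ := (-i.1.2, i.1.1)

variable {i}

theorem ht_nonneg (a : Δ.Pts) : 0 ≤ i.ht a.1 :=
  sub_nonneg.2 (i.2.2.nonempty.some_mem a)

theorem mem_face_iff (a : Δ.Pts) : a ∈ Δ.face i.1 ↔ i.ht a.1 = 0 := by
  constructor
  · intro ha
    exact le_antisymm (sub_nonpos.2 (ha _)) (ht_nonneg a)
  · intro ha b
    have := ht_nonneg (i := i) b
    rw [ht] at ha this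
    omega

theorem ht_add_sub (m v w : ℤ × ℤ) : i.ht (m + v - w) = i.ht m + i.ht v - i.ht w := by
  simp only [ht, latticePairing_sub, latticePairing_add]; ring

theorem pairing_tangent : latticePairing i.1 i.tangent = 0 := by
  simp only [latticePairing, tangent]; ring

theorem ht_add_tangent (m : ℤ × ℤ) (k : ℤ) : i.ht (m + k • i.tangent) = i.ht m := by
  rw [ht, latticePairing_add, latticePairing_zsmul, pairing_tangent, ht]; ring

theorem tangent_ne_zero : i.tangent ≠ 0 := by
  intro h
  have h1 : i.1.1 = 0 := congrArg Prod.snd h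
  have h2 : -i.1.2 = 0 := congrArg Prod.fst h
  have := i.2.1
  rw [h1, neg_eq_zero.1 h2] at this
  simp at this

/-- The normal is primitive, so Bézout's identity gives an integral coordinate along its kernel. -/
theorem exists_coord : ∃ u : ℤ × ℤ, ∀ v : ℤ × ℤ, latticePairing i.1 v = 0 →
    v = (latticePairing u v) • i.tangent := by
  refine ⟨(-Int.gcdB i.1.1 i.1.2, Int.gcdA i.1.1 i.1.2), fun v hv => ?_⟩
  have h1 := Int.gcd_eq_gcd_ab i.1.1 i.1.2
  rw [i.2.1] at h1
  simp only [latticePairing] at hv ⊢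
  push_cast at h1
  ext
  · simp only [tangent, Prod.smul_fst, smul_eq_mul]
    linear_combination v.1 * h1 + (Int.gcdA i.1.1 i.1.2) * hv
  · simp only [tangent, Prod.smul_snd, smul_eq_mul]
    linear_combination v.2 * h1 + (Int.gcdB i.1.1 i.1.2) * hv

theorem smul_tangent_inj {k k' : ℤ} (h : k • i.tangent = k' • i.tangent) : k = k' :=
  smul_left_injective ℤ tangent_ne_zero h

theorem length_pos : 0 < i.length := by
  have := Set.one_lt_ncard_iff_nontrivial (s := Δ.face i.1) |>.2 i.2.2
  rw [length]
  omega

variable (i) in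
theorem exists_edge : ∃ o : Δ.Pts, ∀ m : ℤ × ℤ, (m ∈ Δ.lattice ∧ i.ht m = 0) ↔
    ∃ k : ℕ, k ≤ i.length ∧ m = o.1 + (k : ℤ) • i.tangent := by
  obtain ⟨u, hu⟩ := exists_coord (i := i)
  have hfin : (Δ.face i.1).Finite := Set.toFinite _
  obtain ⟨o, ho, homin⟩ := hfin.exists_minimalFor (fun a => latticePairing u a.1) _ i.2.2.nonempty
  obtain ⟨o', ho', homax⟩ := hfin.exists_maximalFor (fun a => latticePairing u a.1) _ i.2.2.nonempty
  have homin' : ∀ a ∈ Δ.face i.1, latticePairing u o.1 ≤ latticePairing u a.1 :=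
    fun a ha => (le_total _ _).elim id (homin ha)
  have homax' : ∀ a ∈ Δ.face i.1, latticePairing u a.1 ≤ latticePairing u o'.1 :=
    fun a ha => (le_total _ _).elim id (homax ha)
  obtain ⟨N, hN⟩ := Int.eq_ofNat_of_zero_le (sub_nonneg.2 (homin' o' ho'))
  have hsub : ∀ a ∈ Δ.face i.1,
      a.1 = o.1 + (latticePairing u a.1 - latticePairing u o.1) • i.tangent := by
    intro a ha
    rw [← latticePairing_sub]
    refine eq_add_of_sub_eq' (hu _ ?_)
    have h1 := (mem_face_iff a).1 ha
    have h2 := (mem_face_iff o).1 ho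
    rw [latticePairing_sub]
    rw [ht] at h1 h2
    omega
  have hmem : ∀ k : ℕ, k ≤ N → o.1 + (k : ℤ) • i.tangent ∈ Δ.lattice := by
    intro k hk
    have h1 := hsub o' ho'
    rw [hN] at h1
    rcases Nat.eq_zero_or_pos N with h0 | h0
    · obtain rfl : k = 0 := by omega
      simpa using o.mem_lattice
    have hk' : ((N - k : ℕ) : ℤ) = N - k := by omega
    refine Δ.lattice_convex o.mem_lattice o'.mem_lattice _ (N - k) k (by omega) ?_ ?_
    · rw [h1, hk']; simp only [Prod.fst_add, Prod.smul_fst, smul_eq_mul]; simp; ring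
    · rw [h1, hk']; simp only [Prod.snd_add, Prod.smul_snd, smul_eq_mul]; simp; ring
  have ho0 := (mem_face_iff o).1 ho
  have hchar : ∀ m : ℤ × ℤ, (m ∈ Δ.lattice ∧ i.ht m = 0) ↔
      ∃ k : ℕ, k ≤ N ∧ m = o.1 + (k : ℤ) • i.tangent := by
    intro m
    constructor
    · rintro ⟨hm, hm0⟩
      have hf : (⟨m, hm⟩ : Δ.Pts) ∈ Δ.face i.1 := (mem_face_iff _).2 hm0
      obtain ⟨k, hk⟩ := Int.eq_ofNat_of_zero_le (sub_nonneg.2 (homin' _ hf))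
      have h1 := hsub _ hf
      rw [hk] at h1
      refine ⟨k, ?_, h1⟩
      have := homax' _ hf
      omega
    · rintro ⟨k, hk, rfl⟩
      exact ⟨hmem k hk, by rw [ht_add_tangent, ho0]⟩
  have hlen : i.length = N := by
    have hinj : Function.Injective (fun a : Δ.Pts => a.1) := fun a b h => Pts.ext h
    have himg : (fun a : Δ.Pts => a.1) '' (Δ.face i.1) =
        (fun k : ℕ => o.1 + (k : ℤ) • i.tangent) '' (Finset.range (N + 1) : Set ℕ) := by
      ext m
      simp only [Set.mem_image, Finset.coe_range, Set.mem_Iio]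
      constructor
      · rintro ⟨a, ha, rfl⟩
        obtain ⟨k, hk, h⟩ := (hchar a.1).1 ⟨a.2, (mem_face_iff a).1 ha⟩
        exact ⟨k, by omega, h.symm⟩
      · rintro ⟨k, hk, rfl⟩
        obtain ⟨h1, h2⟩ := (hchar _).2 ⟨k, by omega, rfl⟩
        exact ⟨⟨_, h1⟩, (mem_face_iff _).2 h2, rfl⟩
    have h1 := congrArg Set.ncard himg
    rw [Set.ncard_image_of_injective _ hinj,
      Set.ncard_image_of_injective, Set.ncard_coe_finset, Finset.card_range] at h1
    · rw [length, h1]; rfl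
    · intro k k' hkk
      exact_mod_cast smul_tangent_inj (add_left_cancel hkk)
  rw [hlen]
  exact ⟨o, hchar⟩

variable (i)

/-- The initial vertex of the side. -/
def origin : Δ.Pts := i.exists_edge.choose

theorem edge_iff (m : ℤ × ℤ) : (m ∈ Δ.lattice ∧ i.ht m = 0) ↔
    ∃ k : ℕ, k ≤ i.length ∧ m = i.origin.1 + (k : ℤ) • i.tangent := i.exists_edge.choose_spec m

/-- The lattice points of the side. -/
def edgePt (k : ℕ) (hk : k ≤ i.length) : Δ.Pts :=
  ⟨i.origin.1 + (k : ℤ) • i.tangent, ((i.edge_iff _).2 ⟨k, hk, rfl⟩).1⟩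

theorem ht_edgePt (k : ℕ) (hk : k ≤ i.length) : i.ht (i.edgePt k hk).1 = 0 :=
  ((i.edge_iff _).2 ⟨k, hk, rfl⟩).2

theorem edgePt_zero : i.edgePt 0 (Nat.zero_le _) = i.origin := by
  ext1; simp [edgePt]

theorem ht_origin : i.ht i.origin.1 = 0 := by
  rw [← edgePt_zero]; exact i.ht_edgePt 0 _

theorem exists_edgePt {a : Δ.Pts} (ha : i.ht a.1 = 0) : ∃ k, ∃ hk : k ≤ i.length, a = i.edgePt k hk := by
  obtain ⟨k, hk, h⟩ := (i.edge_iff a.1).1 ⟨a.2, ha⟩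
  exact ⟨k, hk, Pts.ext h⟩

theorem edgePt_inj {k k' : ℕ} {hk : k ≤ i.length} {hk' : k' ≤ i.length}
    (h : i.edgePt k hk = i.edgePt k' hk') : k = k' := by
  have := congrArg Subtype.val h
  exact_mod_cast smul_tangent_inj (add_left_cancel this)

theorem ht_eq (m : ℤ × ℤ) : i.ht m = latticePairing i.1 m - latticePairing i.1 i.origin.1 := by
  have := i.ht_origin
  rw [ht] at this ⊢
  omega

/-- Two points with midpoint on a side lie on that side, because heights are nonnegative; at an end
of the edge they must coincide. -/
theorem isVertex_edgePt {k : ℕ} (hk : k ≤ i.length) (h : k = 0 ∨ k = i.length) :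
    IsVertex (i.edgePt k hk) := by
  intro b c hbc
  have h0 := i.ht_edgePt k hk
  have hb := ht_nonneg (i := i) b
  have hc := ht_nonneg (i := i) c
  have hs : i.ht (b.1 + c.1 - (i.edgePt k hk).1) = i.ht (i.edgePt k hk).1 := by
    rw [hbc, add_sub_cancel_right]
  rw [ht_add_sub, h0] at hs
  obtain ⟨k1, hk1, rfl⟩ := i.exists_edgePt (a := b) (by omega)
  obtain ⟨k2, hk2, rfl⟩ := i.exists_edgePt (a := c) (by omega)
  have hkk : ((k1 : ℤ) + k2) • i.tangent = ((k : ℤ) + k) • i.tangent := by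
    simp only [edgePt] at hbc
    rw [add_smul, add_smul]
    have : i.origin.1 + i.origin.1 + ((k1 : ℤ) • i.tangent + (k2 : ℤ) • i.tangent) =
      i.origin.1 + i.origin.1 + ((k : ℤ) • i.tangent + (k : ℤ) • i.tangent) := by
      rw [add_add_add_comm, hbc, add_add_add_comm]
    exact add_left_cancel this
  have := smul_tangent_inj hkk
  have : k1 = k := by omega
  subst this
  rfl

end Side

/-- A side is determined by its first two lattice points. -/
instance : Finite Δ.Side := by
  refine Finite.of_injective
    (fun i : Δ.Side => (i.origin, i.edgePt 1 Side.length_pos)) fun i j hij => ?_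
  simp only [Prod.mk.injEq] at hij
  have h1 := congrArg Subtype.val hij.2
  simp only [Side.edgePt, Nat.cast_one, one_smul] at h1
  rw [hij.1] at h1
  have h2 := add_left_cancel h1
  simp only [Side.tangent, Prod.mk.injEq, neg_inj] at h2
  exact Subtype.ext (Prod.ext h2.2 h2.1)

instance : Fintype Δ.Side := Fintype.ofFinite _

instance : DecidableEq Δ.Side := Classical.decEq _

end LatticePolygon

/-! ### Sides of the polygon in terms of its left and right boundaries -/

namespace LatticePolygon

variable {Δ : LatticePolygon}

/-- A common treatment of the left and the right boundary: `P` lists the boundary points, and the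
functional `n` is smallest in each row at the boundary point only, where it equals the support
function `Λ r - c r` up to a constant. -/
theorem face_eq_of_boundary {h : ℕ} {Λ : ℕ → ℤ} (hΛ : ConvexSeq h Λ) (c : ℤ) {n : ℤ × ℤ} {κ : ℤ}
    {P : ℕ → ℤ × ℤ} (hP : ∀ r ≤ h, P r ∈ Δ.lattice)
    (hn : ∀ r ≤ h, latticePairing n (P r) = κ + (Λ r - c * r))
    (hle : ∀ m ∈ Δ.lattice, ∃ r ≤ h, κ + (Λ r - c * r) ≤ latticePairing n m ∧
      (κ + (Λ r - c * r) = latticePairing n m → m = P r)) (a : Δ.Pts) :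
    a ∈ Δ.face n ↔ ∃ r, stepsBelow h Λ c ≤ r ∧ r ≤ stepsBelow h Λ (c + 1) ∧ a.1 = P r := by
  have hs := stepsBelow_le h Λ c
  have hs' := stepsBelow_le h Λ (c + 1)
  constructor
  · intro ha
    obtain ⟨r, hr, h1, h2⟩ := hle a.1 a.2
    have h3 := ha ⟨_, hP _ hs⟩
    dsimp only at h3
    rw [hn _ hs] at h3
    have h4 := hΛ.support_le c hr
    have h5 := (hΛ.support_eq_iff c hr).1 (by linarith)
    exact ⟨r, h5.1, h5.2, h2 (by linarith)⟩
  · rintro ⟨r, h1, h2, h3⟩ b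
    obtain ⟨r', hr', h4, _⟩ := hle b.1 b.2
    rw [h3, hn r (by omega), hΛ.eq_of_between c h1 h2]
    have h5 := hΛ.support_le c hr'
    linarith

theorem ncard_face_of_boundary {h : ℕ} {Λ : ℕ → ℤ} (hΛ : ConvexSeq h Λ) (c : ℤ) {n : ℤ × ℤ} {κ : ℤ}
    {P : ℕ → ℤ × ℤ} (hP : ∀ r ≤ h, P r ∈ Δ.lattice) (hinj : Function.Injective P)
    (hn : ∀ r ≤ h, latticePairing n (P r) = κ + (Λ r - c * r))
    (hle : ∀ m ∈ Δ.lattice, ∃ r ≤ h, κ + (Λ r - c * r) ≤ latticePairing n m ∧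
      (κ + (Λ r - c * r) = latticePairing n m → m = P r)) :
    (Δ.face n).ncard = stepsEq h Λ c + 1 := by
  have himg : (fun a : Δ.Pts => a.1) '' (Δ.face n) =
      P '' (Finset.Icc (stepsBelow h Λ c) (stepsBelow h Λ (c + 1)) : Finset ℕ) := by
    ext m
    simp only [Set.mem_image, Finset.mem_coe, Finset.mem_Icc]
    constructor
    · rintro ⟨a, ha, rfl⟩
      obtain ⟨r, h1, h2, h3⟩ := (face_eq_of_boundary hΛ c hP hn hle a).1 ha
      exact ⟨r, ⟨h1, h2⟩, h3.symm⟩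
    · rintro ⟨r, ⟨h1, h2⟩, rfl⟩
      exact ⟨⟨P r, hP r (h2.trans (stepsBelow_le _ _ _))⟩,
        (face_eq_of_boundary hΛ c hP hn hle _).2 ⟨r, h1, h2, rfl⟩, rfl⟩
  have h1 := congrArg Set.ncard himg
  have hinj' : Function.Injective (fun a : Δ.Pts => a.1) := fun a b h => Pts.ext h
  rw [Set.ncard_image_of_injective _ hinj', Set.ncard_image_of_injective _ hinj,
    Set.ncard_coe_finset, Nat.card_Icc, stepsBelow_add_one] at h1
  omega

namespace Shape

variable (sh : Δ.Shape)

/-- The column of a lattice point. -/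
def col (a : Δ.Pts) : ℕ := (a.1.1 - sh.x₁).toNat

/-- The row of a lattice point. -/
def row (a : Δ.Pts) : ℕ := (a.1.2 - sh.y₀).toNat

theorem L_conv : ConvexSeq sh.h sh.L := sh.L_convex

theorem R_conv : ConvexSeq sh.h (fun k => - sh.R k) := fun k hk l hl => by
  have := sh.R_concave k hk l hl
  dsimp only
  linarith

theorem row_spec (a : Δ.Pts) : sh.row a ≤ sh.h ∧ a.1.2 = sh.y₀ + sh.row a ∧
    sh.L (sh.row a) ≤ a.1.1 - sh.x₁ ∧ a.1.1 - sh.x₁ ≤ sh.R (sh.row a) := by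
  obtain ⟨k, hk, h1, h2, h3⟩ := (sh.mem_iff a.1).1 a.2
  have : sh.row a = k := by rw [row]; omega
  rw [this]
  exact ⟨hk, h1, h2, h3⟩

theorem row_le (a : Δ.Pts) : sh.row a ≤ sh.h := (sh.row_spec a).1

theorem snd_eq (a : Δ.Pts) : a.1.2 = sh.y₀ + sh.row a := (sh.row_spec a).2.1

theorem fst_eq (a : Δ.Pts) : a.1.1 = sh.x₁ + sh.col a := by
  have := sh.row_spec a
  have h2 := sh.L_nonneg _ this.1
  rw [col]
  omega

theorem L_le_col (a : Δ.Pts) : sh.L (sh.row a) ≤ sh.col a := by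
  have := (sh.row_spec a).2.2.1
  have h2 := sh.fst_eq a
  omega

theorem col_le_R (a : Δ.Pts) : (sh.col a : ℤ) ≤ sh.R (sh.row a) := by
  have := (sh.row_spec a).2.2.2
  have h2 := sh.fst_eq a
  omega

theorem col_le (a : Δ.Pts) : sh.col a ≤ sh.e := by
  have := sh.col_le_R a
  have h2 := sh.R_le _ (sh.row_le a)
  omega

theorem mem_lattice {k : ℕ} (hk : k ≤ sh.h) {x : ℤ} (h1 : sh.L k ≤ x) (h2 : x ≤ sh.R k) :
    (sh.x₁ + x, sh.y₀ + (k : ℤ)) ∈ Δ.lattice :=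
  (sh.mem_iff _).2 ⟨k, hk, rfl, by simpa using h1, by simpa using h2⟩

/-- The lattice point in column `x` and row `k`. -/
def pt {k : ℕ} (hk : k ≤ sh.h) {x : ℤ} (h1 : sh.L k ≤ x) (h2 : x ≤ sh.R k) : Δ.Pts :=
  ⟨_, sh.mem_lattice hk h1 h2⟩

@[simp] theorem row_pt {k : ℕ} (hk : k ≤ sh.h) {x : ℤ} (h1 : sh.L k ≤ x) (h2 : x ≤ sh.R k) :
    sh.row (sh.pt hk h1 h2) = k := by simp [row, pt]

theorem col_pt {k : ℕ} (hk : k ≤ sh.h) {x : ℤ} (h1 : sh.L k ≤ x) (h2 : x ≤ sh.R k) :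
    (sh.col (sh.pt hk h1 h2) : ℤ) = x := by
  have := sh.fst_eq (sh.pt hk h1 h2)
  simp only [pt] at this ⊢
  omega

theorem pts_ext {a b : Δ.Pts} (h1 : sh.col a = sh.col b) (h2 : sh.row a = sh.row b) : a = b :=
  Pts.ext (Prod.ext (by rw [sh.fst_eq, sh.fst_eq, h1]) (by rw [sh.snd_eq, sh.snd_eq, h2]))

/-- The last conjunct depends neither on `r` nor on `a`. It is bundled so that a single point of the
face also gives the length of the side. -/
theorem face_left (c : ℤ) (a : Δ.Pts) : a ∈ Δ.face (1, -c) ↔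
    ∃ r, stepsBelow sh.h sh.L c ≤ r ∧ r ≤ stepsBelow sh.h sh.L (c + 1) ∧
      a.1 = (sh.x₁ + sh.L r, sh.y₀ + (r : ℤ)) ∧ (Δ.face (1, -c)).ncard = stepsEq sh.h sh.L c + 1 := by
  have hP : ∀ r ≤ sh.h, (sh.x₁ + sh.L r, sh.y₀ + (r : ℤ)) ∈ Δ.lattice :=
    fun r hr => sh.mem_lattice hr le_rfl (sh.L_le_R r hr)
  have hn : ∀ r ≤ sh.h, latticePairing (1, -c) (sh.x₁ + sh.L r, sh.y₀ + (r : ℤ)) =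
      (sh.x₁ - c * sh.y₀) + (sh.L r - c * r) := fun r _ => by simp only [latticePairing]; ring
  have hle : ∀ m ∈ Δ.lattice, ∃ r ≤ sh.h,
      (sh.x₁ - c * sh.y₀) + (sh.L r - c * r) ≤ latticePairing (1, -c) m ∧
      ((sh.x₁ - c * sh.y₀) + (sh.L r - c * r) = latticePairing (1, -c) m →
        m = (sh.x₁ + sh.L r, sh.y₀ + (r : ℤ))) := by
    intro m hm
    obtain ⟨r, hr, h1, h2, h3⟩ := (sh.mem_iff m).1 hm
    simp only [latticePairing]
    rw [h1]
    exact ⟨r, hr, by linarith, fun h => Prod.ext (by dsimp only; linarith) h1⟩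
  have h1 := face_eq_of_boundary sh.L_conv c hP hn hle a
  have h2 := ncard_face_of_boundary sh.L_conv c hP
    (fun r r' h => by simpa using (Prod.ext_iff.1 h).2) hn hle
  simpa only [h2, and_true] using h1

theorem face_right (c : ℤ) (a : Δ.Pts) : a ∈ Δ.face (-1, c) ↔
    ∃ r, stepsBelow sh.h (fun k => - sh.R k) (-c) ≤ r ∧
      r ≤ stepsBelow sh.h (fun k => - sh.R k) (-c + 1) ∧
      a.1 = (sh.x₁ + sh.R r, sh.y₀ + (r : ℤ)) ∧
        (Δ.face (-1, c)).ncard = stepsEq sh.h (fun k => - sh.R k) (-c) + 1 := by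
  have hP : ∀ r ≤ sh.h, (sh.x₁ + sh.R r, sh.y₀ + (r : ℤ)) ∈ Δ.lattice :=
    fun r hr => sh.mem_lattice hr (sh.L_le_R r hr) le_rfl
  have hn : ∀ r ≤ sh.h, latticePairing (-1, c) (sh.x₁ + sh.R r, sh.y₀ + (r : ℤ)) =
      (-sh.x₁ + c * sh.y₀) + (-sh.R r - -c * r) := fun r _ => by simp only [latticePairing]; ring
  have hle : ∀ m ∈ Δ.lattice, ∃ r ≤ sh.h,
      (-sh.x₁ + c * sh.y₀) + (- sh.R r - -c * r) ≤ latticePairing (-1, c) m ∧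
      ((-sh.x₁ + c * sh.y₀) + (- sh.R r - -c * r) = latticePairing (-1, c) m →
        m = (sh.x₁ + sh.R r, sh.y₀ + (r : ℤ))) := by
    intro m hm
    obtain ⟨r, hr, h1, h2, h3⟩ := (sh.mem_iff m).1 hm
    simp only [latticePairing]
    rw [h1]
    exact ⟨r, hr, by linarith, fun h => Prod.ext (by dsimp only; linarith) h1⟩
  have h1 := face_eq_of_boundary sh.R_conv (-c) hP hn hle a
  have h2 := ncard_face_of_boundary sh.R_conv (-c) hP
    (fun r r' h => by simpa using (Prod.ext_iff.1 h).2) hn hle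
  simpa only [h2, and_true] using h1

theorem left_length {i : Δ.Side} {c : ℤ} (hi : i.1 = (1, -c)) : i.length = stepsEq sh.h sh.L c := by
  obtain ⟨a, ha⟩ := i.2.2.nonempty
  rw [hi] at ha
  obtain ⟨_, _, _, _, h⟩ := (sh.face_left c a).1 ha
  rw [Side.length, hi, h]
  rfl

theorem right_length {i : Δ.Side} {c : ℤ} (hi : i.1 = (-1, c)) :
    i.length = stepsEq sh.h (fun k => - sh.R k) (-c) := by
  obtain ⟨a, ha⟩ := i.2.2.nonempty
  rw [hi] at ha
  obtain ⟨_, _, _, _, h⟩ := (sh.face_right c a).1 ha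
  rw [Side.length, hi, h]
  rfl

theorem exists_left {k : ℕ} (hk : k < sh.h) :
    ∃ i : Δ.Side, i.1 = (1, -(sh.L (k + 1) - sh.L k)) := by
  set c := sh.L (k + 1) - sh.L k with hc
  have hs := stepsBelow_le sh.h sh.L c
  have hne : (Δ.face (1, -c)).ncard = stepsEq sh.h sh.L c + 1 := by
    by_contra hcon
    have h1 : ∀ a, a ∉ Δ.face (1, -c) := fun a ha => by
      obtain ⟨_, _, _, _, h⟩ := (sh.face_left c a).1 ha
      exact hcon h
    obtain ⟨a, -, ha⟩ := (Set.finite_univ (α := Δ.Pts)).exists_minimalFor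
      (fun a => latticePairing (1, -c) a.1) _
      ⟨⟨_, sh.mem_lattice hs le_rfl (sh.L_le_R _ hs)⟩, trivial⟩
    exact h1 a fun b => (le_total _ _).elim id (ha (Set.mem_univ b))
  have hpos : 0 < stepsEq sh.h sh.L c :=
    Finset.card_pos.2 ⟨k, Finset.mem_filter.2 ⟨Finset.mem_range.2 hk, rfl⟩⟩
  exact ⟨⟨(1, -c), by simp, Set.one_lt_ncard_iff_nontrivial.1 (by omega)⟩, rfl⟩

theorem exists_right {k : ℕ} (hk : k < sh.h) :
    ∃ i : Δ.Side, i.1 = (-1, sh.R (k + 1) - sh.R k) := by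
  set c := sh.R (k + 1) - sh.R k with hc
  have hne : (Δ.face (-1, c)).ncard = stepsEq sh.h (fun k => - sh.R k) (-c) + 1 := by
    by_contra hcon
    have h1 : ∀ a, a ∉ Δ.face (-1, c) := fun a ha => by
      obtain ⟨_, _, _, _, h⟩ := (sh.face_right c a).1 ha
      exact hcon h
    obtain ⟨a, -, ha⟩ := (Set.finite_univ (α := Δ.Pts)).exists_minimalFor
      (fun a => latticePairing (-1, c) a.1) _
      ⟨⟨_, sh.mem_lattice hk.le le_rfl (sh.L_le_R _ hk.le)⟩, trivial⟩
    exact h1 a fun b => (le_total _ _).elim id (ha (Set.mem_univ b))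
  have hpos : 0 < stepsEq sh.h (fun k => - sh.R k) (-c) :=
    Finset.card_pos.2 ⟨k, Finset.mem_filter.2 ⟨Finset.mem_range.2 hk, by dsimp only; omega⟩⟩
  exact ⟨⟨(-1, c), by simp [Int.gcd], Set.one_lt_ncard_iff_nontrivial.1 (by omega)⟩, rfl⟩

theorem mem_face_bottom (a : Δ.Pts) : a ∈ Δ.face (0, 1) ↔ sh.row a = 0 := by
  constructor
  · intro ha
    have := ha ⟨_, sh.mem_lattice (Nat.zero_le _) le_rfl (sh.L_le_R 0 (Nat.zero_le _))⟩
    have h2 := sh.snd_eq a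
    simp only [latticePairing] at this
    push_cast at this
    omega
  · intro ha b
    have h1 := sh.snd_eq a
    have h2 := sh.snd_eq b
    simp only [latticePairing]
    omega

theorem mem_face_top (a : Δ.Pts) : a ∈ Δ.face (0, -1) ↔ sh.row a = sh.h := by
  have h0 := sh.row_le a
  constructor
  · intro ha
    have := ha ⟨_, sh.mem_lattice le_rfl le_rfl (sh.L_le_R sh.h le_rfl)⟩
    have h2 := sh.snd_eq a
    simp only [latticePairing] at this
    omega
  · intro ha b
    have h1 := sh.snd_eq a
    have h2 := sh.snd_eq b
    have h3 := sh.row_le b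
    simp only [latticePairing]
    omega

theorem ncard_row {k : ℕ} (hk : k ≤ sh.h) :
    ({a : Δ.Pts | sh.row a = k}.ncard : ℤ) = sh.R k - sh.L k + 1 := by
  have himg : (fun a : Δ.Pts => a.1.1 - sh.x₁) '' {a : Δ.Pts | sh.row a = k} =
      (Finset.Icc (sh.L k) (sh.R k) : Finset ℤ) := by
    ext x
    simp only [Set.mem_image, Set.mem_ofPred_eq, Finset.mem_coe, Finset.mem_Icc]
    constructor
    · rintro ⟨a, rfl, rfl⟩
      exact (sh.row_spec a).2.2
    · rintro ⟨h1, h2⟩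
      exact ⟨sh.pt hk h1 h2, sh.row_pt hk h1 h2, by simp [pt]⟩
  have h1 := congrArg Set.ncard himg
  rw [Set.InjOn.ncard_image, Set.ncard_coe_finset, Int.card_Icc] at h1
  · have := sh.L_le_R k hk
    omega
  · intro a ha b hb hab
    refine sh.pts_ext ?_ (Eq.trans ha hb.symm)
    simp only [col, hab]

theorem bottom_length {i : Δ.Side} (hi : i.1 = (0, 1)) : (i.length : ℤ) = sh.R 0 - sh.L 0 := by
  have h1 : Δ.face i.1 = {a : Δ.Pts | sh.row a = 0} := by
    ext a; rw [hi]; exact sh.mem_face_bottom a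
  have := sh.ncard_row (k := 0) (Nat.zero_le _)
  rw [Side.length, h1]
  have h0 := sh.L_le_R 0 (Nat.zero_le _)
  omega

theorem top_length {i : Δ.Side} (hi : i.1 = (0, -1)) :
    (i.length : ℤ) = sh.R sh.h - sh.L sh.h := by
  have h1 : Δ.face i.1 = {a : Δ.Pts | sh.row a = sh.h} := by
    ext a; rw [hi]; exact sh.mem_face_top a
  have := sh.ncard_row (k := sh.h) le_rfl
  rw [Side.length, h1]
  have h0 := sh.L_le_R sh.h le_rfl
  omega

theorem exists_bottom (h : sh.L 0 < sh.R 0) : ∃ i : Δ.Side, i.1 = (0, 1) := by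
  refine ⟨⟨(0, 1), by simp, sh.pt (Nat.zero_le _) le_rfl h.le, ?_, sh.pt (Nat.zero_le _) h.le le_rfl,
    ?_, ?_⟩, rfl⟩
  · rw [sh.mem_face_bottom]; simp
  · rw [sh.mem_face_bottom]; simp
  · intro hcon
    have := congrArg (fun a : Δ.Pts => a.1.1) hcon
    simp only [pt] at this
    omega

theorem exists_top (h : sh.L sh.h < sh.R sh.h) : ∃ i : Δ.Side, i.1 = (0, -1) := by
  refine ⟨⟨(0, -1), by simp, sh.pt le_rfl le_rfl h.le, ?_, sh.pt le_rfl h.le le_rfl, ?_, ?_⟩, rfl⟩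
  · rw [sh.mem_face_top]; simp
  · rw [sh.mem_face_top]; simp
  · intro hcon
    have := congrArg (fun a : Δ.Pts => a.1.1) hcon
    simp only [pt] at this
    omega

/-- By transversality a normal with nonzero first entry has first entry `1` or `-1`; since the side
has positive length, its slope occurs among the steps of the boundary. -/
theorem side_cases (i : Δ.Side) : (∃ k < sh.h, i.1 = (1, -(sh.L (k + 1) - sh.L k))) ∨
    (∃ k < sh.h, i.1 = (-1, sh.R (k + 1) - sh.R k)) ∨ i.1 = (0, 1) ∨ i.1 = (0, -1) := by
  have hg := i.2.1
  have hlen := i.length_pos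
  rcases sh.transverse i with h | h
  · rw [h, Int.gcd_zero_left] at hg
    right; right
    rcases Int.natAbs_eq i.1.2 with h2 | h2 <;> rw [hg] at h2
    · exact Or.inl (Prod.ext h h2)
    · exact Or.inr (Prod.ext h h2)
  · have h1 : i.1.1.natAbs = 1 := by rwa [← Nat.gcd_eq_left (Int.natAbs_dvd_natAbs.2 h)]
    rcases Int.natAbs_eq i.1.1 with h2 | h2 <;> rw [h1] at h2
    · have hi : i.1 = (1, -(-i.1.2)) := Prod.ext h2 (by simp)
      rw [sh.left_length hi] at hlen
      obtain ⟨k, hk⟩ := Finset.card_pos.1 hlen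
      simp only [Finset.mem_filter, Finset.mem_range] at hk
      exact Or.inl ⟨k, hk.1, hk.2 ▸ hi⟩
    · have hi : i.1 = (-1, i.1.2) := Prod.ext h2 rfl
      rw [sh.right_length hi] at hlen
      obtain ⟨k, hk⟩ := Finset.card_pos.1 hlen
      simp only [Finset.mem_filter, Finset.mem_range] at hk
      refine Or.inr (Or.inl ⟨k, hk.1, ?_⟩)
      rw [show sh.R (k + 1) - sh.R k = i.1.2 by omega]
      exact hi

theorem sum_steps {h : ℕ} {Λ : ℕ → ℤ} {ν : ℤ → ℤ × ℤ} (hν : Function.Injective ν)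
    (hex : ∀ k < h, ∃ i : Δ.Side, i.1 = ν (Λ (k + 1) - Λ k)) (φ : ℤ × ℤ → ℤ) :
    ∑ k ∈ Finset.range h, φ (ν (Λ (k + 1) - Λ k)) = ∑ i : Δ.Side,
      (((Finset.range h).filter fun k => i.1 = ν (Λ (k + 1) - Λ k)).card : ℤ) * φ i.1 := by
  simp_rw [Finset.card_filter, Nat.cast_sum, Finset.sum_mul]
  rw [Finset.sum_comm]
  refine Finset.sum_congr rfl fun k hk => ?_
  obtain ⟨i₀, hi₀⟩ := hex k (Finset.mem_range.1 hk)
  rw [Finset.sum_eq_single i₀]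
  · simp [hi₀]
  · intro i _ hi
    rw [if_neg]
    · simp
    · intro hcon
      exact hi (Subtype.ext (hcon.trans hi₀.symm))
  · simp

theorem sum_horizontal {n : ℤ × ℤ} {w : ℤ} (hex : w ≠ 0 → ∃ i : Δ.Side, i.1 = n)
    (φ : ℤ × ℤ → ℤ) :
    w * φ n = ∑ i : Δ.Side, (if i.1 = n then w else 0) * φ i.1 := by
  by_cases hw : w = 0
  · simp [hw]
  obtain ⟨i₀, hi₀⟩ := hex hw
  rw [Finset.sum_eq_single i₀]
  · simp [hi₀]
  · intro i _ hi
    rw [if_neg, zero_mul]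
    intro hcon
    exact hi (Subtype.ext (hcon.trans hi₀.symm))
  · simp

/-- A sum over sides weighted by length is a sum over the unit steps of the boundary. It is used for
the balancing condition and for the degrees of the torus coordinates. -/
theorem sum_sides (φ : ℤ × ℤ → ℤ) : ∑ i : Δ.Side, (i.length : ℤ) * φ i.1 =
    ∑ k ∈ Finset.range sh.h, φ (1, -(sh.L (k + 1) - sh.L k)) +
      ∑ k ∈ Finset.range sh.h, φ (-1, sh.R (k + 1) - sh.R k) +
      (sh.R 0 - sh.L 0) * φ (0, 1) + (sh.R sh.h - sh.L sh.h) * φ (0, -1) := by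
  rw [sum_steps (Δ := Δ) (ν := fun c => (1, -c)) (fun c c' h => by simpa using h)
      (fun k hk => sh.exists_left hk) φ,
    sum_steps (Δ := Δ) (ν := fun c => (-1, c)) (fun c c' h => by simpa using h)
      (fun k hk => sh.exists_right hk) φ,
    sum_horizontal (Δ := Δ) (n := (0, 1)) (w := sh.R 0 - sh.L 0) (fun hw => sh.exists_bottom (by
      have := sh.L_le_R 0 (Nat.zero_le _); omega)) φ,
    sum_horizontal (Δ := Δ) (n := (0, -1)) (w := sh.R sh.h - sh.L sh.h) (fun hw => sh.exists_top (by
      have := sh.L_le_R sh.h le_rfl; omega)) φ,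
    ← Finset.sum_add_distrib, ← Finset.sum_add_distrib, ← Finset.sum_add_distrib]
  refine Finset.sum_congr rfl fun i _ => ?_
  rw [← add_mul, ← add_mul, ← add_mul]
  congr 1
  rcases sh.side_cases i with ⟨k, -, hi⟩ | ⟨k, -, hi⟩ | hi | hi
  · rw [sh.left_length hi, hi]
    simp only [stepsEq, Prod.ext_iff]
    norm_num
    congr 1
    ext k'
    simp only [Finset.mem_filter, Finset.mem_range]
    constructor <;> rintro ⟨h1, h2⟩ <;> exact ⟨h1, by omega⟩
  · rw [sh.right_length hi, hi]
    simp only [stepsEq, Prod.ext_iff]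
    norm_num
    congr 1
    ext k'
    simp only [Finset.mem_filter, Finset.mem_range]
    constructor <;> rintro ⟨h1, h2⟩ <;> exact ⟨h1, by omega⟩
  · rw [sh.bottom_length hi, hi]
    simp [Prod.ext_iff]
  · rw [sh.top_length hi, hi]
    simp [Prod.ext_iff]

include sh in
theorem sum_length_mul_fst : ∑ i : Δ.Side, (i.length : ℤ) * i.1.1 = 0 := by
  rw [sh.sum_sides fun n => n.1]
  simp

include sh in
theorem sum_length_mul_snd : ∑ i : Δ.Side, (i.length : ℤ) * i.1.2 = 0 := by
  rw [sh.sum_sides fun n => n.2]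
  simp only [Finset.sum_neg_distrib, Finset.sum_range_sub]
  ring

/-- The left sides contribute one for each of the `h` steps. This number is the degree of the first
torus coordinate on a parametrized curve. -/
theorem sum_length_mul_fst_pos : ∑ i : Δ.Side, (i.length : ℤ) * max i.1.1 0 = sh.h := by
  rw [sh.sum_sides fun n => max n.1 0]
  simp

/-- The steps of negative slope form an initial segment, over which the sum telescopes. -/
theorem _root_.ConvexSeq.sum_neg_part {h : ℕ} {L : ℕ → ℤ} (hL : ConvexSeq h L) :
    ∑ k ∈ Finset.range h, max (-(L (k + 1) - L k)) 0 = L 0 - L (stepsBelow h L 0) := by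
  have hs := stepsBelow_le h L 0
  rw [← Finset.sum_range_add_sum_Ico _ hs, Finset.sum_congr rfl (g := fun k => -(L (k + 1) - L k)),
    Finset.sum_eq_zero (s := Finset.Ico _ _)]
  · rw [Finset.sum_neg_distrib, Finset.sum_range_sub]
    ring
  · intro k hk
    rw [Finset.mem_Ico] at hk
    have := (hL.lt_stepsBelow_iff hk.2 0).not.1 (by omega)
    exact max_eq_right (by omega)
  · intro k hk
    rw [Finset.mem_range] at hk
    have := (hL.lt_stepsBelow_iff (by omega) 0).1 hk
    exact max_eq_left (by omega)

theorem L_min : sh.L (stepsBelow sh.h sh.L 0) = 0 := by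
  obtain ⟨k, hk, h0⟩ := sh.exists_L_eq
  have h1 := sh.L_conv.support_le 0 hk
  have h2 := sh.L_nonneg _ (stepsBelow_le sh.h sh.L 0)
  linarith

theorem R_max : sh.R (stepsBelow sh.h (fun k => - sh.R k) 0) = sh.e := by
  obtain ⟨k, hk, h0⟩ := sh.exists_R_eq
  have h1 := sh.R_conv.support_le 0 hk
  have h2 := sh.R_le _ (stepsBelow_le sh.h (fun k => - sh.R k) 0)
  linarith

theorem sum_length_mul_snd_pos : ∑ i : Δ.Side, (i.length : ℤ) * max i.1.2 0 = sh.e := by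
  rw [sh.sum_sides fun n => max n.2 0]
  have h1 := sh.L_conv.sum_neg_part
  have h2 := sh.R_conv.sum_neg_part
  have h3 : ∀ k, -(-sh.R (k + 1) - -sh.R k) = sh.R (k + 1) - sh.R k := fun k => by ring
  simp only [h3] at h2
  rw [h1, h2, sh.L_min, sh.R_max]
  simp
  ring

include sh in
-- On a left or right side, of two consecutive rows one has positive width, and its second point
-- from the side is at lattice distance one. Consequently the pullback multiplicity of a divisor is
-- attained on such a coordinate.
theorem exists_ht_one (i : Δ.Side) : ∃ a : Δ.Pts, i.ht a.1 = 1 := by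
  have key : ∀ a b : Δ.Pts, a ∈ Δ.face i.1 → latticePairing i.1 (b.1 - a.1) = 1 → i.ht b.1 = 1 := by
    intro a b ha hb
    have := (Side.mem_face_iff a).1 ha
    rw [latticePairing_sub] at hb
    rw [Side.ht] at this ⊢
    omega
  rcases sh.side_cases i with ⟨k, hk, hi⟩ | ⟨k, hk, hi⟩ | hi | hi
  · set c := sh.L (k + 1) - sh.L k with hc
    have hsb := stepsBelow_add_one sh.h sh.L c
    have h1 : ¬ k < stepsBelow sh.h sh.L c := (sh.L_conv.lt_stepsBelow_iff hk _).not.2 (by omega)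
    have h2 : k < stepsBelow sh.h sh.L (c + 1) := (sh.L_conv.lt_stepsBelow_iff hk _).2 (by omega)
    obtain ⟨a₀, ha₀⟩ := i.2.2.nonempty
    rw [hi] at ha₀
    obtain ⟨_, _, _, _, hcard⟩ := (sh.face_left c a₀).1 ha₀
    have hf : ∀ r (hr : r ≤ sh.h), stepsBelow sh.h sh.L c ≤ r → r ≤ stepsBelow sh.h sh.L (c + 1) →
        sh.pt hr le_rfl (sh.L_le_R r hr) ∈ Δ.face i.1 := fun r hr h3 h4 => by
      rw [hi]
      exact (sh.face_left c _).2 ⟨r, h3, h4, rfl, hcard⟩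
    rcases sh.nondeg k hk with h3 | h3
    · refine ⟨sh.pt hk.le (x := sh.L k + 1) (by omega) (by omega),
        key _ _ (hf k hk.le (by omega) (by omega)) ?_⟩
      rw [hi]; simp [pt, latticePairing]
    · refine ⟨sh.pt (k := k + 1) hk (x := sh.L (k + 1) + 1) (by omega) (by omega),
        key _ _ (hf (k + 1) hk (by omega) (by omega)) ?_⟩
      rw [hi]; simp [pt, latticePairing]
  · set c := sh.R (k + 1) - sh.R k with hc
    have h1 : ¬ k < stepsBelow sh.h (fun k => - sh.R k) (-c) :=
      (sh.R_conv.lt_stepsBelow_iff hk _).not.2 (by omega)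
    have h2 : k < stepsBelow sh.h (fun k => - sh.R k) (-c + 1) :=
      (sh.R_conv.lt_stepsBelow_iff hk _).2 (by omega)
    obtain ⟨a₀, ha₀⟩ := i.2.2.nonempty
    rw [hi] at ha₀
    obtain ⟨_, _, _, _, hcard⟩ := (sh.face_right c a₀).1 ha₀
    have hf : ∀ r (hr : r ≤ sh.h), stepsBelow sh.h (fun k => - sh.R k) (-c) ≤ r →
        r ≤ stepsBelow sh.h (fun k => - sh.R k) (-c + 1) →
        sh.pt hr (sh.L_le_R r hr) le_rfl ∈ Δ.face i.1 := fun r hr h3 h4 => by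
      rw [hi]
      exact (sh.face_right c _).2 ⟨r, h3, h4, rfl, hcard⟩
    rcases sh.nondeg k hk with h3 | h3
    · refine ⟨sh.pt hk.le (x := sh.R k - 1) (by omega) (by omega),
        key _ _ (hf k hk.le (by omega) (by omega)) ?_⟩
      rw [hi]; simp [pt, latticePairing]
    · refine ⟨sh.pt (k := k + 1) hk (x := sh.R (k + 1) - 1) (by omega) (by omega),
        key _ _ (hf (k + 1) hk (by omega) (by omega)) ?_⟩
      rw [hi]; simp [pt, latticePairing]
  · refine ⟨sh.pt (k := 1) sh.h_pos le_rfl (sh.L_le_R 1 sh.h_pos),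
      key (sh.pt (k := 0) (Nat.zero_le _) le_rfl (sh.L_le_R 0 (Nat.zero_le _))) _ ?_ ?_⟩
    · rw [hi, sh.mem_face_bottom]; simp
    · rw [hi]; simp [pt, latticePairing]
  · have hp := sh.h_pos
    refine ⟨sh.pt (k := sh.h - 1) (by omega) le_rfl (sh.L_le_R _ (by omega)),
      key (sh.pt (k := sh.h) le_rfl le_rfl (sh.L_le_R _ le_rfl)) _ ?_ ?_⟩
    · rw [hi, sh.mem_face_top]; simp
    · rw [hi]; simp [pt, latticePairing]; omega

theorem ht_left {i : Δ.Side} {k : ℕ} (hk : k < sh.h) (hi : i.1 = (1, -(sh.L (k + 1) - sh.L k)))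
    (m : ℤ × ℤ) : i.ht m = (m.1 - sh.x₁) - sh.L k -
      (sh.L (k + 1) - sh.L k) * ((m.2 - sh.y₀) - k) := by
  set c := sh.L (k + 1) - sh.L k with hc
  have h1 : ¬ k < stepsBelow sh.h sh.L c := (sh.L_conv.lt_stepsBelow_iff hk _).not.2 (by omega)
  have h2 : k < stepsBelow sh.h sh.L (c + 1) := (sh.L_conv.lt_stepsBelow_iff hk _).2 (by omega)
  obtain ⟨a₀, ha₀⟩ := i.2.2.nonempty
  rw [hi] at ha₀
  obtain ⟨_, _, _, _, hcard⟩ := (sh.face_left c a₀).1 ha₀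
  have hf : sh.pt hk.le le_rfl (sh.L_le_R k hk.le) ∈ Δ.face i.1 := by
    rw [hi]
    exact (sh.face_left c _).2 ⟨k, by omega, by omega, rfl, hcard⟩
  have h3 := (Side.mem_face_iff _).1 hf
  rw [Side.ht, hi] at h3 ⊢
  simp only [pt, latticePairing] at h3 ⊢
  linear_combination h3

theorem ht_right {i : Δ.Side} {k : ℕ} (hk : k < sh.h) (hi : i.1 = (-1, sh.R (k + 1) - sh.R k))
    (m : ℤ × ℤ) : i.ht m = sh.R k + (sh.R (k + 1) - sh.R k) * ((m.2 - sh.y₀) - k) -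
      (m.1 - sh.x₁) := by
  set c := sh.R (k + 1) - sh.R k with hc
  have h1 : ¬ k < stepsBelow sh.h (fun k => - sh.R k) (-c) :=
    (sh.R_conv.lt_stepsBelow_iff hk _).not.2 (by omega)
  have h2 : k < stepsBelow sh.h (fun k => - sh.R k) (-c + 1) :=
    (sh.R_conv.lt_stepsBelow_iff hk _).2 (by omega)
  obtain ⟨a₀, ha₀⟩ := i.2.2.nonempty
  rw [hi] at ha₀
  obtain ⟨_, _, _, _, hcard⟩ := (sh.face_right c a₀).1 ha₀
  have hf : sh.pt hk.le (sh.L_le_R k hk.le) le_rfl ∈ Δ.face i.1 := by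
    rw [hi]
    exact (sh.face_right c _).2 ⟨k, by omega, by omega, rfl, hcard⟩
  have h3 := (Side.mem_face_iff _).1 hf
  rw [Side.ht, hi] at h3 ⊢
  simp only [pt, latticePairing] at h3 ⊢
  linear_combination h3

theorem ht_bottom {i : Δ.Side} (hi : i.1 = (0, 1)) (m : ℤ × ℤ) : i.ht m = m.2 - sh.y₀ := by
  have hf : sh.pt (k := 0) (Nat.zero_le _) le_rfl (sh.L_le_R 0 (Nat.zero_le _)) ∈ Δ.face i.1 := by
    rw [hi, sh.mem_face_bottom]; simp
  have h3 := (Side.mem_face_iff _).1 hf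
  rw [Side.ht, hi] at h3 ⊢
  simp only [pt, latticePairing] at h3 ⊢
  push_cast at h3
  linear_combination h3

theorem ht_top {i : Δ.Side} (hi : i.1 = (0, -1)) (m : ℤ × ℤ) : i.ht m = sh.h - (m.2 - sh.y₀) := by
  have hf : sh.pt (k := sh.h) le_rfl le_rfl (sh.L_le_R sh.h le_rfl) ∈ Δ.face i.1 := by
    rw [hi, sh.mem_face_top]; simp
  have h3 := (Side.mem_face_iff _).1 hf
  rw [Side.ht, hi] at h3 ⊢
  simp only [pt, latticePairing] at h3 ⊢
  linear_combination h3

include sh in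
/-- The polygon is the intersection of the half planes defined by its sides. -/
theorem mem_of_ht_nonneg {m : ℤ × ℤ} (hm : ∀ i : Δ.Side, 0 ≤ i.ht m) : m ∈ Δ.lattice := by
  have hp := sh.h_pos
  have hleft : ∀ k < sh.h, sh.L k + (sh.L (k + 1) - sh.L k) * ((m.2 - sh.y₀) - k) ≤ m.1 - sh.x₁ := by
    intro k hk
    obtain ⟨i, hi⟩ := sh.exists_left hk
    have := hm i
    rw [sh.ht_left hk hi] at this
    linarith
  have hright : ∀ k < sh.h, m.1 - sh.x₁ ≤ sh.R k + (sh.R (k + 1) - sh.R k) * ((m.2 - sh.y₀) - k) := by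
    intro k hk
    obtain ⟨i, hi⟩ := sh.exists_right hk
    have := hm i
    rw [sh.ht_right hk hi] at this
    linarith
  have hbot : 0 ≤ m.2 - sh.y₀ := by
    rcases (sh.L_le_R 0 (Nat.zero_le _)).lt_or_eq with h0 | h0
    · obtain ⟨i, hi⟩ := sh.exists_bottom h0
      have := hm i
      rwa [sh.ht_bottom hi] at this
    -- Without a bottom side, the left and the right line through the two lowest rows meet in the
    -- bottom row and diverge above it, which excludes points below. The top is treated in the same
    -- way.
    · have h1 := (sh.nondeg 0 hp).resolve_left (by omega)
      have h2 := hleft 0 hp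
      have h3 := hright 0 hp
      by_contra hcon
      push_cast at h2 h3
      simp only [zero_add] at h1 h2 h3
      nlinarith
  have htop : m.2 - sh.y₀ ≤ sh.h := by
    rcases (sh.L_le_R sh.h le_rfl).lt_or_eq with h0 | h0
    · obtain ⟨i, hi⟩ := sh.exists_top h0
      have := hm i
      rw [sh.ht_top hi] at this
      linarith
    · obtain ⟨k, hk⟩ : ∃ k, sh.h = k + 1 := ⟨sh.h - 1, by omega⟩
      have h1 := (sh.nondeg k (by omega)).resolve_right (by rw [← hk]; omega)
      have h2 := hleft k (by omega)
      have h3 := hright k (by omega)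
      rw [hk] at h0 ⊢
      by_contra hcon
      push_cast at hcon
      have h4 : 1 < m.2 - sh.y₀ - k := by omega
      nlinarith
  obtain ⟨r, hr⟩ := Int.eq_ofNat_of_zero_le hbot
  refine (sh.mem_iff m).2 ⟨r, by omega, by omega, ?_, ?_⟩
  · rcases Nat.lt_or_ge r sh.h with h1 | h1
    · have := hleft r h1
      rw [hr] at this
      simpa using this
    · obtain ⟨k, hk⟩ : ∃ k, r = k + 1 := ⟨r - 1, by omega⟩
      have := hleft k (by omega)
      rw [hr, hk] at this
      rw [hk]
      push_cast at this
      linarith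
  · rcases Nat.lt_or_ge r sh.h with h1 | h1
    · have := hright r h1
      rw [hr] at this
      simpa using this
    · obtain ⟨k, hk⟩ : ∃ k, r = k + 1 := ⟨r - 1, by omega⟩
      have := hright k (by omega)
      rw [hr, hk] at this
      rw [hk]
      push_cast at this
      linarith

include sh in
-- Otherwise one could move from the initial vertex backwards along the side and stay in all half
-- planes. For general position this means that the coordinate along a divisor has a zero at a point
-- over some other side.
theorem exists_pairing_tangent_pos (i : Δ.Side) :
    ∃ j : Δ.Side, 0 < latticePairing j.1 i.tangent := by
  by_contra hcon
  push Not at hcon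
  have h1 : i.origin.1 - i.tangent ∈ Δ.lattice := by
    refine sh.mem_of_ht_nonneg fun j => ?_
    have h2 := Side.ht_nonneg (i := j) i.origin
    have h3 := hcon j
    rw [Side.ht] at h2 ⊢
    rw [latticePairing_sub]
    omega
  have h0 : i.ht (i.origin.1 - i.tangent) = 0 := by
    have := Side.ht_add_tangent (i := i) i.origin.1 (-1)
    rw [neg_one_smul, ← sub_eq_add_neg, i.ht_origin] at this
    exact this
  obtain ⟨k, -, hk⟩ := (i.edge_iff _).1 ⟨h1, h0⟩
  have h4 : (-1 : ℤ) • i.tangent = (k : ℤ) • i.tangent := by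
    rw [neg_one_smul]
    rw [sub_eq_add_neg] at hk
    exact add_left_cancel hk
  have := Side.smul_tangent_inj h4
  omega

theorem boundary_break {h : ℕ} {Λ : ℕ → ℤ} (hΛ : ConvexSeq h Λ) {r : ℕ} (hr : r ≤ h)
    (hbr : ∀ k, k + 1 = r → r < h → Λ (k + 1) - Λ k ≠ Λ (r + 1) - Λ r) :
    ∃ c, r = stepsBelow h Λ c := by
  rcases hr.lt_or_eq with h1 | rfl
  · refine ⟨Λ (r + 1) - Λ r, ?_⟩
    have h2 := (hΛ.lt_stepsBelow_iff h1 (Λ (r + 1) - Λ r)).not.2 (lt_irrefl _)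
    rcases Nat.eq_zero_or_pos r with rfl | h3
    · omega
    · obtain ⟨k, rfl⟩ : ∃ k, r = k + 1 := ⟨r - 1, by omega⟩
      have h4 := hbr k rfl h1
      have h5 := hΛ.slope_mono (Nat.le_succ k) h1
      have h6 := (hΛ.lt_stepsBelow_iff (k := k) (by omega) (Λ (k + 1 + 1) - Λ (k + 1))).2
        (lt_of_le_of_ne h5 h4)
      omega
  · obtain ⟨c, hc⟩ := exists_stepsBelow_eq r Λ
    exact ⟨c, (hc c le_rfl).symm⟩

/-- An interior point of a row is a midpoint in its row, and a boundary point at which the slope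
does not change is a midpoint of its neighbours. So the vertices are among the end points of faces,
where the equation is shown to be nonzero. -/
theorem vertex_cases {a : Δ.Pts} (ha : IsVertex a) :
    ((sh.col a : ℤ) = sh.L (sh.row a) ∧ ∃ c, sh.row a = stepsBelow sh.h sh.L c) ∨
    ((sh.col a : ℤ) = sh.R (sh.row a) ∧ ∃ c, sh.row a = stepsBelow sh.h (fun k => - sh.R k) c) := by
  have h1 := sh.L_le_col a
  have h2 := sh.col_le_R a
  have hr := sh.row_le a
  have hx := sh.fst_eq a
  have hy := sh.snd_eq a
  have hmid : ∀ (b c : Δ.Pts), b.1 ≠ a.1 → b.1 + c.1 = a.1 + a.1 → False :=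
    fun b c hb hbc => hb (congrArg Subtype.val (ha b c hbc))
  rcases h1.eq_or_lt with h3 | h3
  · refine Or.inl ⟨h3.symm, boundary_break sh.L_conv hr fun k hk hlt heq => ?_⟩
    refine hmid (sh.pt (k := k) (by omega) le_rfl (sh.L_le_R _ (by omega)))
      (sh.pt (k := k + 1 + 1) (by omega) le_rfl (sh.L_le_R _ (by omega))) ?_ ?_
    · intro hcon
      have := congrArg Prod.snd hcon
      simp only [pt] at this
      omega
    · rw [← hk] at heq h3 hy
      ext
      · simp only [pt, Prod.fst_add]; omega
      · simp only [pt, Prod.snd_add]; push_cast at hy ⊢; omega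
  rcases h2.eq_or_lt with h4 | h4
  · refine Or.inr ⟨h4, boundary_break sh.R_conv hr fun k hk hlt heq => ?_⟩
    refine hmid (sh.pt (k := k) (by omega) (sh.L_le_R _ (by omega)) le_rfl)
      (sh.pt (k := k + 1 + 1) (by omega) (sh.L_le_R _ (by omega)) le_rfl) ?_ ?_
    · intro hcon
      have := congrArg Prod.snd hcon
      simp only [pt] at this
      omega
    · rw [← hk] at heq h4 hy
      ext
      · simp only [pt, Prod.fst_add]; omega
      · simp only [pt, Prod.snd_add]; push_cast at hy ⊢; omega
  · refine (hmid (sh.pt hr (x := sh.col a - 1) (by omega) (by omega))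
      (sh.pt hr (x := sh.col a + 1) (by omega) (by omega)) ?_ ?_).elim
    · intro hcon
      have := congrArg Prod.fst hcon
      simp only [pt] at this
      omega
    · ext
      · simp only [pt, Prod.fst_add]; omega
      · simp only [pt, Prod.snd_add]; omega

end Shape

end LatticePolygon

/-! ### Laurent monomials in linear polynomials -/

section LaurentMonomials

open Polynomial

variable {K : Type*} [Field K] {ι : Type*} [Fintype ι]

theorem ratFunc_X_sub_C_ne_zero (c : K) : (RatFunc.X - RatFunc.C c : RatFunc K) ≠ 0 := by
  intro h
  exact ratFunc_X_not_const ⟨c, sub_eq_zero.1 h⟩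

theorem algebraMap_X_sub_C (c : K) :
    algebraMap K[X] (RatFunc K) (X - C c) = RatFunc.X - RatFunc.C c := by
  rw [map_sub, RatFunc.algebraMap_X, RatFunc.algebraMap_C]

theorem mapDegree_prod_zpow {p : ι → K} (hp : Function.Injective p) {c : K} (hc : c ≠ 0)
    (n : ι → ℤ) : (RatFunc.C c * ∏ i, (RatFunc.X - RatFunc.C (p i)) ^ n i).mapDegree =
      max (∑ i, (n i).toNat) (∑ i, (-n i).toNat) := by
  classical
  have h1 : RatFunc.C c * ∏ i, (RatFunc.X - RatFunc.C (p i)) ^ n i =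
      algebraMap K[X] (RatFunc K) (C c * ∏ i, (X - C (p i)) ^ (n i).toNat) /
        algebraMap K[X] (RatFunc K) (∏ i, (X - C (p i)) ^ (-n i).toNat) := by
    simp only [map_mul, map_prod, map_pow, algebraMap_X_sub_C, RatFunc.algebraMap_C]
    rw [mul_div_assoc, ← Finset.prod_div_distrib]
    congr 1
    refine Finset.prod_congr rfl fun i _ => ?_
    rw [← zpow_natCast, ← zpow_natCast, ← zpow_sub₀ (ratFunc_X_sub_C_ne_zero _)]
    congr 1
    omega
  have hmon : ∀ m : ι → ℕ, (∏ i, (X - C (p i)) ^ m i).Monic := fun m =>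
    monic_prod_of_monic _ _ fun i _ => (monic_X_sub_C _).pow _
  have hdeg : ∀ m : ι → ℕ, (∏ i, (X - C (p i)) ^ m i).natDegree = ∑ i, m i := fun m => by
    rw [natDegree_prod_of_monic _ _ fun i _ => (monic_X_sub_C _).pow _]
    simp
  rw [h1, RatFunc.mapDegree_div _ (hmon _).ne_zero, natDegree_C_mul hc, hdeg, hdeg]
  refine (isCoprime_mul_unit_left_left (isUnit_C.2 hc.isUnit) _ _).2
    (IsCoprime.prod_left fun i _ => IsCoprime.prod_right fun j _ => ?_)
  by_cases hij : i = j
  · subst hij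
    rcases le_total 0 (n i) with h | h
    · rw [show (-n i).toNat = 0 by omega, pow_zero]; exact isCoprime_one_right
    · rw [show (n i).toNat = 0 by omega, pow_zero]; exact isCoprime_one_left
  · exact (isCoprime_X_sub_C_of_isUnit_sub (sub_ne_zero.2 (hp.ne hij)).isUnit).pow

/-- The terms of lowest order at one of the points in a linear relation between Laurent monomials
in linear polynomials. -/
theorem initial_form_eq_zero [DecidableEq ι] {p : ι → K} (hp : Function.Injective p) {τ : Type*}
    (T : Finset τ) (c : τ → K) (n : τ → ι → ℤ)
    (hrel : ∑ t ∈ T, RatFunc.C (c t) * ∏ i, (RatFunc.X - RatFunc.C (p i)) ^ n t i = 0)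
    (j : ι) (μ : ℤ) (hμ : ∀ t ∈ T, c t ≠ 0 → μ ≤ n t j) :
    ∑ t ∈ T with n t j = μ, c t * ∏ i ∈ Finset.univ.erase j, (p j - p i) ^ n t i = 0 := by
  classical
  obtain ⟨W, hW⟩ : ∃ W : ι → ℤ, ∀ t ∈ T, ∀ i, W i ≤ n t i := by
    refine ⟨fun i => -∑ t ∈ T, |n t i|, fun t ht i => ?_⟩
    have h1 := Finset.single_le_sum (f := fun t => |n t i|) (fun t _ => abs_nonneg _) ht
    have h2 := neg_abs_le (n t i)
    linarith
  -- Multiplying by the powers with exponents `-W'` makes all terms polynomial. Evaluation at `p j`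
  -- then keeps exactly the terms of order `μ` there.
  let W' : ι → ℤ := Function.update W j μ
  have hW' : ∀ t ∈ T, c t ≠ 0 → ∀ i, W' i ≤ n t i := by
    intro t ht hct i
    by_cases hij : i = j
    · subst hij; simpa [W'] using hμ t ht hct
    · simpa [W', hij] using hW t ht i
  have hpoly : ∑ t ∈ T, C (c t) * ∏ i, (X - C (p i)) ^ (n t i - W' i).toNat = 0 := by
    apply IsFractionRing.injective K[X] (RatFunc K)
    rw [map_zero, map_sum]
    have h1 := congrArg (fun r => r * ∏ i, (RatFunc.X - RatFunc.C (p i)) ^ (-W' i)) hrel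
    simp only [zero_mul, Finset.sum_mul] at h1
    rw [← h1]
    refine Finset.sum_congr rfl fun t ht => ?_
    by_cases hct : c t = 0
    · simp [hct]
    rw [mul_assoc, ← Finset.prod_mul_distrib]
    simp only [map_mul, map_prod, map_pow, algebraMap_X_sub_C, RatFunc.algebraMap_C]
    congr 1
    refine Finset.prod_congr rfl fun i _ => ?_
    have := hW' t ht hct i
    rw [← zpow_natCast, ← zpow_add₀ (ratFunc_X_sub_C_ne_zero _)]
    congr 1
    omega
  have heval := congrArg (eval (p j)) hpoly
  simp only [eval_finsetSum, eval_mul, eval_C, eval_prod, eval_pow, eval_sub, eval_X, eval_zero]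
    at heval
  have hne : ∀ i ∈ Finset.univ.erase j, p j - p i ≠ 0 := fun i hi =>
    sub_ne_zero.2 (hp.ne (Finset.ne_of_mem_erase hi).symm)
  have h2 := congrArg (fun r => r * ∏ i ∈ Finset.univ.erase j, (p j - p i) ^ (W' i)) heval
  simp only [zero_mul, Finset.sum_mul] at h2
  rw [← h2, Finset.sum_filter]
  refine Finset.sum_congr rfl fun t ht => ?_
  by_cases hct : c t = 0
  · simp [hct]
  rw [← Finset.mul_prod_erase _ _ (Finset.mem_univ j), sub_self]
  have hW'' := hW' t ht hct
  have hj : W' j = μ := by simp [W']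
  split_ifs with h3
  · rw [h3, hj, sub_self, Int.toNat_zero, pow_zero, one_mul, mul_assoc, ← Finset.prod_mul_distrib]
    congr 1
    refine Finset.prod_congr rfl fun i hi => ?_
    rw [← zpow_natCast, ← zpow_add₀ (hne i hi)]
    congr 1
    have := hW'' i
    omega
  · have := hW'' j
    rw [zero_pow (by omega)]
    ring

end LaurentMonomials

/-! ### Families satisfying the binomial relations of the toric surface -/

namespace LatticePolygon

section Toric

variable {Δ : LatticePolygon} {R : Type*} [CommMonoid R]

/-- The family `Z` satisfies the binomial relations of the toric surface. -/
def IsToric (Z : Δ.Pts → R) : Prop := ∀ u v : Δ.Pts → ℕ, ∑ a, u a = ∑ a, v a →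
  ∑ a, u a • a.1 = ∑ a, v a • a.1 → ∏ a, Z a ^ u a = ∏ a, Z a ^ v a

theorem IsToric.mul {Z W : Δ.Pts → R} (hZ : IsToric Z) (hW : IsToric W) :
    IsToric fun a => Z a * W a := fun u v h1 h2 => by
  simp only [mul_pow, Finset.prod_mul_distrib, hZ u v h1 h2, hW u v h1 h2]

theorem IsToric.prod {ι : Type*} (s : Finset ι) {Z : ι → Δ.Pts → R} (hZ : ∀ i ∈ s, IsToric (Z i)) :
    IsToric fun a => ∏ i ∈ s, Z i a := fun u v h1 h2 => by
  simp only [← Finset.prod_pow]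
  rw [Finset.prod_comm, Finset.prod_comm (s := Finset.univ)]
  exact Finset.prod_congr rfl fun i hi => hZ i hi u v h1 h2

theorem IsToric.map {S F : Type*} [CommMonoid S] [FunLike F R S] [MonoidHomClass F R S] (φ : F)
    {Z : Δ.Pts → R} (hZ : IsToric Z) : IsToric fun a => φ (Z a) := fun u v h1 h2 => by
  simp only [← map_pow, ← map_prod, hZ u v h1 h2]

theorem isToric_const (c : R) : IsToric fun _ : Δ.Pts => c := fun u v h1 _ => by
  rw [Finset.prod_pow_eq_pow_sum, Finset.prod_pow_eq_pow_sum, h1]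

/-- A weight that is affine in the lattice point has the same total on both sides of a binomial
relation. -/
theorem isToric_pow (π : R) {w : Δ.Pts → ℕ} (n : ℤ × ℤ) (c : ℤ)
    (hw : ∀ a, (w a : ℤ) = latticePairing n a.1 + c) : IsToric fun a => π ^ w a := by
  intro u v h1 h2
  simp only [← pow_mul]
  rw [Finset.prod_pow_eq_pow_sum, Finset.prod_pow_eq_pow_sum]
  congr 1
  have key : ∀ u : Δ.Pts → ℕ, ((∑ a, w a * u a : ℕ) : ℤ) =
      latticePairing n (∑ a, u a • a.1) + c * (∑ a, u a : ℕ) := by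
    intro u
    have hlin : latticePairing n (∑ a, u a • a.1) = ∑ a, (u a : ℤ) * latticePairing n a.1 := by
      simp only [latticePairing, Prod.fst_sum, Prod.snd_sum, Prod.smul_fst, Prod.smul_snd,
        Finset.mul_sum, ← Finset.sum_add_distrib]
      exact Finset.sum_congr rfl fun a _ => by simp only [nsmul_eq_mul]; ring
    rw [hlin]
    push_cast
    rw [Finset.mul_sum, ← Finset.sum_add_distrib]
    exact Finset.sum_congr rfl fun a _ => by rw [hw]; ring
  have := (key u).trans ((congrArg₂ (fun m k : _ => latticePairing n m + c * ((k : ℕ) : ℤ)) h2 h1).trans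
    (key v).symm)
  exact_mod_cast this

variable {K : Type*} [Field K]

theorem forall_toricBinomials_iff {A : Type*} [CommRing A] [Algebra K A] (Z : Δ.Pts → A) :
    (∀ G ∈ Δ.toricBinomials K, MvPolynomial.aeval Z G = 0) ↔ IsToric Z := by
  have hmon : ∀ u : Δ.Pts →₀ ℕ, MvPolynomial.aeval Z (MvPolynomial.monomial u (1 : K)) =
      ∏ a, Z a ^ u a := by
    intro u
    rw [MvPolynomial.aeval_monomial, map_one, one_mul, Finsupp.prod_fintype _ _ (by simp)]
  constructor
  · intro h u v h1 h2
    have := h _ ⟨Finsupp.equivFunOnFinite.symm u, Finsupp.equivFunOnFinite.symm v, by simpa using h1,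
      by simpa using h2, rfl⟩
    rw [map_sub, hmon, hmon, sub_eq_zero] at this
    simpa using this
  · rintro h _ ⟨u, v, h1, h2, rfl⟩
    rw [map_sub, hmon, hmon, h u v h1 h2, sub_self]

theorem mem_toricSurface_iff (z : AmbientSpace K Δ) : z ∈ Δ.toricSurface K ↔ IsToric z.rep := by
  rw [← forall_toricBinomials_iff (K := K)]
  exact forall₂_congr fun G _ => by rw [MvPolynomial.aeval_eq_eval]

theorem isToric_smul_iff {z : Δ.Pts → K} {c : K} (hc : c ≠ 0) : IsToric (c • z) ↔ IsToric z := by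
  constructor
  · intro h
    have := (isToric_const (Δ := Δ) c⁻¹).mul h
    simpa [← mul_assoc, inv_mul_cancel₀ hc] using this
  · exact fun h => (isToric_const c).mul h

theorem mk_mem_toricSurface_iff {z : Δ.Pts → K} (hz : z ≠ 0) :
    Projectivization.mk K z hz ∈ Δ.toricSurface K ↔ IsToric z := by
  rw [mem_toricSurface_iff]
  obtain ⟨c, hc⟩ := Projectivization.exists_smul_eq_mk_rep K z hz
  rw [← hc]
  exact isToric_smul_iff c.ne_zero

theorem LineMap.isToric (f : LineMap K Δ) : IsToric f.form :=
  (forall_toricBinomials_iff (K := K) _).1 fun G hG => f.mem_toricSurface G hG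

end Toric

end LatticePolygon

namespace LatticePolygon

open Polynomial
open scoped Polynomial.Bivariate

variable {Δ : LatticePolygon}

/-! ### Parametrizations with given points -/

/-- The points in which a parametrized curve with tangency profile `d` meets the toric boundary. -/
abbrev Idx (d : Δ.TangencyProfile) : Type := Σ i : Δ.Side, (d.mult i).ToType

/-- The parameters of a parametrization: two scalars and the points on the toric boundary. -/
abbrev Par (d : Δ.TangencyProfile) : Type := Fin 2 ⊕ Idx d

variable {d : Δ.TangencyProfile}

namespace Idx

/-- The tangency multiplicity. -/
def mult (j : Idx d) : ℕ := j.2.1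

/-- The order of vanishing of the coordinate `a` at the point `j`. -/
def weight (j : Idx d) (a : Δ.Pts) : ℕ := j.mult * (j.1.ht a.1).toNat

/-- The order at the point `j` of the Laurent monomial with exponent `v`. -/
def exp (j : Idx d) (v : ℤ × ℤ) : ℤ := j.mult * latticePairing j.1.1 v

theorem mult_pos (j : Idx d) : 0 < j.mult := d.pos j.1 _ Multiset.coe_mem

theorem exp_eq (j : Idx d) (v : ℤ × ℤ) : j.exp v = j.exp (1, 0) * v.1 + j.exp (0, 1) * v.2 := by
  simp only [exp, latticePairing]; ring

theorem weight_cast (j : Idx d) (a : Δ.Pts) : (j.weight a : ℤ) = j.mult * j.1.ht a.1 := by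
  rw [weight, Nat.cast_mul, Int.toNat_of_nonneg (Side.ht_nonneg a)]

theorem weight_eq (j : Idx d) (a : Δ.Pts) : (j.weight a : ℤ) = j.exp a.1 - j.mult * j.1.level := by
  rw [weight_cast, Side.ht, exp]; ring

theorem weight_eq_shape (sh : Δ.Shape) (j : Idx d) (a : Δ.Pts) : (j.weight a : ℤ) =
    j.exp (1, 0) * sh.col a + j.exp (0, 1) * sh.row a + j.mult * j.1.ht (sh.x₁, sh.y₀) := by
  rw [weight_eq, exp_eq, sh.fst_eq, sh.snd_eq, Side.ht, exp, exp]
  simp only [latticePairing]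
  ring

theorem isToric_pow_weight {R : Type*} [CommMonoid R] (j : Idx d) (π : R) :
    IsToric fun a : Δ.Pts => π ^ j.weight a :=
  isToric_pow π ((j.mult : ℤ) * j.1.1.1, (j.mult : ℤ) * j.1.1.2) (-(j.mult * j.1.level)) fun a => by
    rw [weight_eq, exp]; simp only [latticePairing]; ring

theorem weight_eq_zero_iff (j : Idx d) (a : Δ.Pts) : j.weight a = 0 ↔ a ∈ Δ.face j.1.1 := by
  rw [Side.mem_face_iff, weight, mul_eq_zero, or_iff_right j.mult_pos.ne']
  have := Side.ht_nonneg (i := j.1) a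
  omega

end Idx

/-- The multiplicities over a side add up to its length. -/
theorem sum_idx (φ : Δ.Side → ℤ) :
    ∑ j : Idx d, (j.mult : ℤ) * φ j.1 = ∑ i : Δ.Side, (i.length : ℤ) * φ i := by
  rw [Fintype.sum_sigma]
  refine Finset.sum_congr rfl fun i _ => ?_
  rw [← d.sum_eq i, Multiset.sum_eq_sum_coe, Nat.cast_sum, Finset.sum_mul]
  rfl

namespace Shape

variable (sh : Δ.Shape)

theorem isToric_pow_col {R : Type*} [CommMonoid R] (π : R) : IsToric fun a : Δ.Pts => π ^ sh.col a :=
  isToric_pow π (1, 0) (-sh.x₁) fun a => by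
    have := sh.fst_eq a
    simp only [latticePairing]; linarith

theorem isToric_pow_row {R : Type*} [CommMonoid R] (π : R) : IsToric fun a : Δ.Pts => π ^ sh.row a :=
  isToric_pow π (0, 1) (-sh.y₀) fun a => by
    have := sh.snd_eq a
    simp only [latticePairing]; linarith

include sh in
-- The balancing condition of the polygon: a Laurent monomial has as many zeros as poles among the
-- chosen points, so infinity is neither a zero nor a pole.
theorem sum_exp (v : ℤ × ℤ) : ∑ j : Idx d, j.exp v = 0 := by
  simp only [Idx.exp]
  rw [sum_idx fun i => latticePairing i.1 v]
  simp only [latticePairing]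
  have h1 := sh.sum_length_mul_fst
  have h2 := sh.sum_length_mul_snd
  calc ∑ i : Δ.Side, (i.length : ℤ) * (i.1.1 * v.1 + i.1.2 * v.2)
      = (∑ i : Δ.Side, (i.length : ℤ) * i.1.1) * v.1 + (∑ i : Δ.Side, (i.length : ℤ) * i.1.2) * v.2 := by
        rw [Finset.sum_mul, Finset.sum_mul, ← Finset.sum_add_distrib]
        exact Finset.sum_congr rfl fun i _ => by ring
    _ = 0 := by rw [h1, h2]; ring

theorem sum_toNat_exp {v : ℤ × ℤ} {w : ℕ}
    (h : ∑ i : Δ.Side, (i.length : ℤ) * max (latticePairing i.1 v) 0 = w) :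
    ∑ j : Idx d, (j.exp v).toNat = w := by
  rw [← sum_idx (d := d) fun i => max (latticePairing i.1 v) 0] at h
  have h2 : ((∑ j : Idx d, (j.exp v).toNat : ℕ) : ℤ) = w := by
    rw [← h, Nat.cast_sum]
    refine Finset.sum_congr rfl fun j _ => ?_
    rw [Int.toNat_eq_max, Idx.exp, mul_max_of_nonneg _ _ (Int.natCast_nonneg _), mul_zero]
  exact_mod_cast h2

theorem sum_toNat_exp_fst : ∑ j : Idx d, (j.exp (1, 0)).toNat = sh.h :=
  sum_toNat_exp (by simpa [latticePairing] using sh.sum_length_mul_fst_pos)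

theorem sum_toNat_exp_snd : ∑ j : Idx d, (j.exp (0, 1)).toNat = sh.e :=
  sum_toNat_exp (by simpa [latticePairing] using sh.sum_length_mul_snd_pos)

include sh in
theorem sum_toNat_neg_exp (v : ℤ × ℤ) :
    ∑ j : Idx d, (-j.exp v).toNat = ∑ j : Idx d, (j.exp v).toNat := by
  have h1 := sh.sum_exp (d := d) v
  have h2 : ((∑ j : Idx d, (-j.exp v).toNat : ℕ) : ℤ) = (∑ j : Idx d, (j.exp v).toNat : ℕ) := by
    rw [← sub_eq_zero, ← neg_eq_zero, ← h1, Nat.cast_sum, Nat.cast_sum, ← Finset.sum_sub_distrib,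
      ← Finset.sum_neg_distrib]
    exact Finset.sum_congr rfl fun j _ => by omega
  exact_mod_cast h2

include sh in
theorem sum_weight_eq (a b : Δ.Pts) : ∑ j : Idx d, j.weight a = ∑ j : Idx d, j.weight b := by
  have h : ((∑ j : Idx d, j.weight a : ℕ) : ℤ) = (∑ j : Idx d, j.weight b : ℕ) := by
    rw [← sub_eq_zero, Nat.cast_sum, Nat.cast_sum, ← Finset.sum_sub_distrib,
      ← sh.sum_exp (d := d) (a.1 - b.1)]
    refine Finset.sum_congr rfl fun j _ => ?_
    rw [Idx.weight_eq, Idx.weight_eq, Idx.exp, Idx.exp, Idx.exp, latticePairing_sub]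
    ring
  exact_mod_cast h

/-- The lower left vertex. -/
def base : Δ.Pts := sh.pt (k := 0) (Nat.zero_le _) le_rfl (sh.L_le_R 0 (Nat.zero_le _))

/-- The degree of the parametrizations. -/
def paramDegree (d : Δ.TangencyProfile) : ℕ := ∑ j : Idx d, j.weight sh.base

section Forms

variable {R S : Type*} [CommRing R] [CommRing S]

/-- The affine coordinates of the parametrization. -/
def dform (θ : Par d → R) (a : Δ.Pts) : R[X] :=
  C (θ (Sum.inl 0) ^ sh.col a * θ (Sum.inl 1) ^ sh.row a) *
    ∏ j : Idx d, (X - C (θ (Sum.inr j))) ^ j.weight a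

theorem dform_map (φ : R →+* S) (θ : Par d → R) (a : Δ.Pts) :
    (sh.dform θ a).map φ = sh.dform (fun j => φ (θ j)) a := by
  simp only [dform, Polynomial.map_mul, Polynomial.map_prod, Polynomial.map_pow, Polynomial.map_sub,
    Polynomial.map_C, Polynomial.map_X, map_mul, map_pow]

theorem natDegree_dform_le (θ : Par d → R) (a : Δ.Pts) :
    (sh.dform θ a).natDegree ≤ sh.paramDegree d := by
  rw [paramDegree, sh.sum_weight_eq _ a]
  refine (natDegree_C_mul_le _ _).trans ((natDegree_prod_le _ _).trans
    (Finset.sum_le_sum fun j _ => ?_))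
  refine natDegree_pow_le.trans ?_
  have := natDegree_X_sub_C_le (θ (Sum.inr j))
  nlinarith

/-- The homogeneous coordinates of the parametrization. -/
def hform (θ : Par d → R) (a : Δ.Pts) : MvPolynomial (Fin 2) R :=
  MvPolynomial.C (θ (Sum.inl 0) ^ sh.col a * θ (Sum.inl 1) ^ sh.row a) *
    ∏ j : Idx d, (MvPolynomial.X 0 - MvPolynomial.C (θ (Sum.inr j)) * MvPolynomial.X 1) ^ j.weight a

theorem isHomogeneous_hform (θ : Par d → R) (a : Δ.Pts) :
    (sh.hform θ a).IsHomogeneous (sh.paramDegree d) := by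
  rw [paramDegree, sh.sum_weight_eq _ a, ← zero_add (∑ j : Idx d, j.weight a)]
  refine (MvPolynomial.isHomogeneous_C _ _).mul (MvPolynomial.IsHomogeneous.prod _ _ _ fun j _ => ?_)
  have := ((MvPolynomial.isHomogeneous_X R (0 : Fin 2)).sub
    (MvPolynomial.isHomogeneous_C_mul_X (θ (Sum.inr j)) (1 : Fin 2))).pow (j.weight a)
  rwa [one_mul] at this

theorem isToric_hform (θ : Par d → R) : IsToric (sh.hform θ) := by
  refine IsToric.mul ?_ (IsToric.prod _ fun j _ => j.isToric_pow_weight _)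
  have : IsToric fun a : Δ.Pts => (θ (Sum.inl 0) ^ sh.col a * θ (Sum.inl 1) ^ sh.row a) :=
    (sh.isToric_pow_col _).mul (sh.isToric_pow_row _)
  exact this.map (MvPolynomial.C : R →+* MvPolynomial (Fin 2) R)

theorem aeval_hform (θ : Par d → R) (a : Δ.Pts) :
    MvPolynomial.aeval ![(X : R[X]), 1] (sh.hform θ a) = sh.dform θ a := by
  simp [hform, dform, map_prod, MvPolynomial.algebraMap_eq, Polynomial.algebraMap_eq]

end Forms

/-- The matrix, with entries polynomial in the parameters, whose kernel at a parameter consists of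
the equations of the parametrized curve. -/
def relMatrix (K : Type*) [Field K] (d : Δ.TangencyProfile) :
    Matrix (Fin (sh.paramDegree d + 1)) Δ.Pts (MvPolynomial (Par d) K) :=
  fun n a => (sh.dform (R := MvPolynomial (Par d) K) MvPolynomial.X a).coeff n

variable {K : Type*} [Field K]

theorem relMatrix_mulVec_eq_zero_iff (θ : Par d → K) (F : Δ.Pts → K) :
    ((sh.relMatrix K d).map (MvPolynomial.eval θ)).mulVec F = 0 ↔
      ∑ a, C (F a) * sh.dform θ a = 0 := by
  have hc : ∀ n a, MvPolynomial.eval θ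
      ((sh.dform (R := MvPolynomial (Par d) K) MvPolynomial.X a).coeff n) =
      (sh.dform θ a).coeff n := by
    intro n a
    have := congrArg (fun q => q.coeff n)
      (sh.dform_map (MvPolynomial.eval θ) (MvPolynomial.X : Par d → MvPolynomial (Par d) K) a)
    simpa only [coeff_map, MvPolynomial.eval_X] using this
  constructor
  · intro h
    ext n
    rw [finsetSum_coeff, coeff_zero]
    simp only [coeff_C_mul]
    by_cases hn : n < sh.paramDegree d + 1
    · have := congrFun h ⟨n, hn⟩
      simp only [Matrix.mulVec, dotProduct, Matrix.map_apply, relMatrix, hc, Pi.zero_apply] at this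
      rw [← this]
      exact Finset.sum_congr rfl fun a _ => mul_comm _ _
    · refine Finset.sum_eq_zero fun a _ => ?_
      rw [coeff_eq_zero_of_natDegree_lt, mul_zero]
      have := sh.natDegree_dform_le θ a
      omega
  · intro h
    ext n
    have := congrArg (fun q => q.coeff n) h
    simp only [finsetSum_coeff, coeff_C_mul, coeff_zero] at this
    simp only [Matrix.mulVec, dotProduct, Matrix.map_apply, relMatrix, hc, Pi.zero_apply]
    rw [← this]
    exact Finset.sum_congr rfl fun a _ => mul_comm _ _

/-! ### The rational functions of a parametrization -/

/-- The value of the Laurent monomial with exponent `v` on the parametrization. -/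
def mon (θ : Par d → K) (v : ℤ × ℤ) : RatFunc K :=
  RatFunc.C (θ (Sum.inl 0) ^ v.1 * θ (Sum.inl 1) ^ v.2) *
    ∏ j : Idx d, (RatFunc.X - RatFunc.C (θ (Sum.inr j))) ^ j.exp v

end Shape

/-- The parameters are regular: the scalars do not vanish and the points are distinct. -/
structure IsRegular {K : Type*} [Field K] (θ : Par d → K) : Prop where
  ne_zero : ∀ l, θ (Sum.inl l) ≠ 0
  inj : Function.Injective fun j => θ (Sum.inr j)

namespace Shape

variable (sh : Δ.Shape) {K : Type*} [Field K] {θ : Par d → K} (hθ : IsRegular θ)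
include hθ

omit hθ in
theorem mon_prod_ne_zero (w : Idx d → ℤ) :
    ∏ j : Idx d, (RatFunc.X - RatFunc.C (θ (Sum.inr j)) : RatFunc K) ^ w j ≠ 0 :=
  Finset.prod_ne_zero_iff.2 fun _ _ => zpow_ne_zero _ (ratFunc_X_sub_C_ne_zero _)

theorem mon_ne_zero (v : ℤ × ℤ) : mon θ v ≠ 0 := by
  refine mul_ne_zero ?_ (mon_prod_ne_zero _)
  rw [Ne, map_eq_zero]
  exact mul_ne_zero (zpow_ne_zero _ (hθ.ne_zero 0)) (zpow_ne_zero _ (hθ.ne_zero 1))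

theorem mon_add (v w : ℤ × ℤ) : mon θ (v + w) = mon θ v * mon θ w := by
  simp only [mon, Prod.fst_add, Prod.snd_add, zpow_add₀ (hθ.ne_zero _)]
  have : ∀ j : Idx d, j.exp (v + w) = j.exp v + j.exp w := fun j => by
    simp only [Idx.exp, latticePairing_add]; ring
  have hz : ∀ j : Idx d, (RatFunc.X - RatFunc.C (θ (Sum.inr j))) ^ j.exp (v + w) =
      (RatFunc.X - RatFunc.C (θ (Sum.inr j))) ^ j.exp v *
        (RatFunc.X - RatFunc.C (θ (Sum.inr j))) ^ j.exp w := fun j => by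
    rw [this, zpow_add₀ (ratFunc_X_sub_C_ne_zero _)]
  simp only [hz, Finset.prod_mul_distrib, map_mul]
  ring

theorem mon_nat (c r : ℕ) : mon θ ((c : ℤ), (r : ℤ)) = mon θ (1, 0) ^ c * mon θ (0, 1) ^ r := by
  have h0 : mon θ (0 : ℤ × ℤ) = 1 := by
    simp [mon, Idx.exp, latticePairing]
  have h1 : ∀ (v : ℤ × ℤ) (n : ℕ), mon θ (n • v) = mon θ v ^ n := by
    intro v n
    induction n with
    | zero => rw [zero_smul, h0, pow_zero]
    | succ n ih => rw [succ_nsmul, mon_add hθ, ih, pow_succ]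
  rw [← h1, ← h1, ← mon_add hθ]
  simp

/-- Up to a factor independent of `a`, the coordinates are monomials in two rational functions, so
linear relations between the coordinates are polynomial relations between these two. -/
theorem algebraMap_dform (a : Δ.Pts) : algebraMap K[X] (RatFunc K) (sh.dform θ a) =
    (∏ j : Idx d, (RatFunc.X - RatFunc.C (θ (Sum.inr j))) ^ (j.mult * j.1.ht (sh.x₁, sh.y₀) : ℤ)) *
      (mon θ (1, 0) ^ sh.col a * mon θ (0, 1) ^ sh.row a) := by
  rw [← mon_nat hθ, mon]
  simp only [dform, map_mul, map_prod, map_pow, algebraMap_X_sub_C, RatFunc.algebraMap_C,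
    zpow_natCast]
  rw [mul_left_comm, ← Finset.prod_mul_distrib]
  congr 1
  refine Finset.prod_congr rfl fun j _ => ?_
  rw [← zpow_natCast, ← zpow_add₀ (ratFunc_X_sub_C_ne_zero _), Idx.weight_eq_shape sh]
  congr 1
  rw [j.exp_eq ((sh.col a : ℤ), _)]
  ring

/-- The number of zeros counted with multiplicity is the total length of the left sides. -/
theorem mapDegree_mon_fst : (mon θ (1, 0)).mapDegree = sh.h := by
  rw [mon, mapDegree_prod_zpow hθ.inj, sh.sum_toNat_neg_exp, sh.sum_toNat_exp_fst, max_self]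
  simpa using hθ.ne_zero 0

theorem mapDegree_mon_snd : (mon θ (0, 1)).mapDegree = sh.e := by
  rw [mon, mapDegree_prod_zpow hθ.inj, sh.sum_toNat_neg_exp, sh.sum_toNat_exp_snd, max_self]
  simpa using hθ.ne_zero 1

end Shape

/-! ### Equations as bivariate polynomials -/

section BivariatePolynomials

variable {K : Type*} [Field K]

theorem coeff_swap (G : K[X][Y]) (m n : ℕ) :
    ((Bivariate.swap G).coeff m).coeff n = (G.coeff n).coeff m := by
  induction G using Polynomial.induction_on' with
  | add p q hp hq => simp only [map_add, coeff_add, hp, hq]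
  | monomial r p =>
    induction p using Polynomial.induction_on' with
    | add p q hp hq => simp only [map_add, coeff_add, hp, hq]
    | monomial s c =>
      rw [Bivariate.swap_monomial_monomial]
      simp only [coeff_monomial]
      split_ifs <;> simp_all [coeff_monomial]

theorem natDegree_coeff_le_swap (G : K[X][Y]) (n : ℕ) :
    (G.coeff n).natDegree ≤ (Bivariate.swap G).natDegree := by
  rw [natDegree_le_iff_coeff_eq_zero]
  intro m hm
  rw [← coeff_swap, coeff_eq_zero_of_natDegree_lt hm, coeff_zero]

theorem aevalAeval_eq_sum {L : Type*} [CommRing L] [Algebra K L] (x y : L) (G : K[X][Y]) {M N : ℕ}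
    (hM : (Bivariate.swap G).natDegree < M) (hN : G.natDegree < N) :
    aevalAeval x y G = ∑ t ∈ Finset.range M ×ˢ Finset.range N,
      algebraMap K L ((G.coeff t.2).coeff t.1) * (x ^ t.1 * y ^ t.2) := by
  conv_lhs => rw [G.as_sum_range' N hN]
  rw [map_sum, Finset.sum_product_right]
  refine Finset.sum_congr rfl fun r _ => ?_
  rw [← C_mul_X_pow_eq_monomial, map_mul, map_pow, aevalAeval_C, aevalAeval_Y,
    aeval_eq_sum_range' (lt_of_le_of_lt (natDegree_coeff_le_swap G r) hM), Finset.sum_mul]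
  exact Finset.sum_congr rfl fun c _ => by rw [Algebra.smul_def]; ring

end BivariatePolynomials

namespace Shape

variable (sh : Δ.Shape) {K : Type*} [Field K]

/-- The bivariate polynomial with the given coefficients. -/
def poly (F : Δ.Pts → K) : K[X][Y] := ∑ a, monomial (sh.row a) (monomial (sh.col a) (F a))

theorem coeff_poly (F : Δ.Pts → K) (a : Δ.Pts) :
    ((sh.poly F).coeff (sh.row a)).coeff (sh.col a) = F a := by
  simp only [poly, finsetSum_coeff, coeff_monomial]
  rw [Finset.sum_eq_single a]
  · simp
  · intro b _ hb
    split_ifs with h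
    · rw [coeff_monomial, if_neg]
      intro h'
      exact hb (sh.pts_ext h' h)
    · simp
  · simp

theorem coeff_poly_eq_zero (F : Δ.Pts → K) {c r : ℕ}
    (h : ∀ a, sh.row a = r → sh.col a ≠ c) : ((sh.poly F).coeff r).coeff c = 0 := by
  simp only [poly, finsetSum_coeff, coeff_monomial]
  refine Finset.sum_eq_zero fun a _ => ?_
  split_ifs with h1
  · rw [coeff_monomial, if_neg (h a h1)]
  · simp

theorem poly_eq_of_coeff (G : K[X][Y]) (hG : ∀ c r, (G.coeff r).coeff c ≠ 0 →
    ∃ a, sh.row a = r ∧ sh.col a = c) :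
    G = sh.poly fun a => (G.coeff (sh.row a)).coeff (sh.col a) := by
  ext r c
  by_cases h : ∃ a, sh.row a = r ∧ sh.col a = c
  · obtain ⟨a, rfl, rfl⟩ := h
    rw [coeff_poly]
  · have h1 : (G.coeff r).coeff c = 0 := by
      by_contra h1
      exact h (hG c r h1)
    rw [h1, coeff_poly_eq_zero]
    intro a h2 h3
    exact h ⟨a, h2, h3⟩

theorem poly_injective : Function.Injective (sh.poly (K := K)) := by
  intro F G h
  ext a
  rw [← sh.coeff_poly F, h, sh.coeff_poly]

theorem aevalAeval_poly {L : Type*} [CommRing L] [Algebra K L] (x y : L) (F : Δ.Pts → K) :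
    aevalAeval x y (sh.poly F) =
      ∑ a, algebraMap K L (F a) * (x ^ sh.col a * y ^ sh.row a) := by
  rw [poly, map_sum]
  refine Finset.sum_congr rfl fun a _ => ?_
  rw [← C_mul_X_pow_eq_monomial, map_mul, map_pow, aevalAeval_C, aevalAeval_Y, aeval_monomial]
  ring

theorem natDegree_poly_le (F : Δ.Pts → K) : (sh.poly F).natDegree ≤ sh.h :=
  natDegree_sum_le_of_forall_le _ _ fun a _ => (natDegree_monomial_le _).trans (sh.row_le a)

theorem natDegree_swap_poly_le (F : Δ.Pts → K) : (Bivariate.swap (sh.poly F)).natDegree ≤ sh.e := by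
  rw [poly, map_sum]
  refine natDegree_sum_le_of_forall_le _ _ fun a _ => ?_
  rw [Bivariate.swap_monomial_monomial]
  exact (natDegree_monomial_le _).trans (sh.col_le a)

theorem poly_smul (c : K) (F : Δ.Pts → K) : sh.poly (c • F) = C (C c) * sh.poly F := by
  rw [poly, poly, Finset.mul_sum]
  refine Finset.sum_congr rfl fun a _ => ?_
  rw [C_mul_monomial, C_mul_monomial, Pi.smul_apply, smul_eq_mul]

variable {θ : Par d → K} (hθ : IsRegular θ)

include hθ in
theorem sum_dform_eq_zero_iff (F : Δ.Pts → K) : ∑ a, C (F a) * sh.dform θ a = 0 ↔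
    aevalAeval (mon θ (1, 0)) (mon θ (0, 1)) (sh.poly F) = 0 := by
  have key : algebraMap K[X] (RatFunc K) (∑ a, C (F a) * sh.dform θ a) =
      (∏ j : Idx d, (RatFunc.X - RatFunc.C (θ (Sum.inr j))) ^ (j.mult * j.1.ht (sh.x₁, sh.y₀) : ℤ)) *
        aevalAeval (mon θ (1, 0)) (mon θ (0, 1)) (sh.poly F) := by
    rw [aevalAeval_poly, map_sum, Finset.mul_sum]
    refine Finset.sum_congr rfl fun a _ => ?_
    rw [map_mul, algebraMap_dform sh hθ, RatFunc.algebraMap_C, RatFunc.algebraMap_eq_C]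
    ring
  rw [← map_eq_zero_iff _ (IsFractionRing.injective K[X] (RatFunc K)), key, mul_eq_zero,
    or_iff_right (mon_prod_ne_zero _)]

include sh hθ in
theorem mon_fst_not_const : ¬ ∃ c, mon θ (1, 0) = RatFunc.C c := by
  rintro ⟨c, hc⟩
  have h1 := mapDegree_mon_fst sh hθ
  have h2 := sh.h_pos
  rw [hc, RatFunc.mapDegree, RatFunc.num_C, RatFunc.denom_C, natDegree_C, natDegree_one, max_self] at h1
  omega

theorem e_pos : 0 < sh.e := by
  rcases sh.nondeg 0 sh.h_pos with h | h
  · have h1 := sh.L_nonneg 0 (Nat.zero_le _)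
    have h2 := sh.R_le 0 (Nat.zero_le _)
    omega
  · have h1 := sh.L_nonneg 1 sh.h_pos
    have h2 := sh.R_le 1 sh.h_pos
    simp only [zero_add] at h
    omega

include sh hθ in
theorem mon_snd_not_const : ¬ ∃ c, mon θ (0, 1) = RatFunc.C c := by
  rintro ⟨c, hc⟩
  have h1 := mapDegree_mon_snd sh hθ
  have h2 := sh.e_pos
  rw [hc, RatFunc.mapDegree, RatFunc.num_C, RatFunc.denom_C, natDegree_C, natDegree_one, max_self] at h1
  omega

open IntermediateField in
include hθ in
/-- The bidegree of the irreducible equation of a parametrized curve. -/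
theorem natDegree_relation {F₀ : K[X][Y]} (hF₀ : Irreducible F₀)
    (hrel : aevalAeval (mon θ (1, 0)) (mon θ (0, 1)) F₀ = 0)
    (htop : K⟮mon θ (1, 0), mon θ (0, 1)⟯ = ⊤) :
    F₀.natDegree = sh.h ∧ (Bivariate.swap F₀).natDegree = sh.e := by
  constructor
  · rw [(natDegree_relation_eq_iff (mon_fst_not_const sh hθ) hF₀ hrel).2 htop, mapDegree_mon_fst sh hθ]
  · rw [(natDegree_relation_eq_iff (mon_snd_not_const sh hθ)
      ((MulEquiv.irreducible_iff Bivariate.swap).2 hF₀) (by rw [Bivariate.aevalAeval_swap]; exact hrel)).2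
      (by rw [Set.pair_comm]; exact htop), mapDegree_mon_snd sh hθ]

open IntermediateField in
include hθ in
/-- The equation of a birationally parametrized curve is unique. -/
theorem eq_C_mul_of_relation {F₀ : K[X][Y]} (hF₀ : Irreducible F₀)
    (hrel : aevalAeval (mon θ (1, 0)) (mon θ (0, 1)) F₀ = 0)
    (htop : K⟮mon θ (1, 0), mon θ (0, 1)⟯ = ⊤) {F : Δ.Pts → K}
    (hF : aevalAeval (mon θ (1, 0)) (mon θ (0, 1)) (sh.poly F) = 0) :
    ∃ c : K, sh.poly F = C (C c) * F₀ := by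
  obtain ⟨h1, h2⟩ := sh.natDegree_relation hθ hF₀ hrel htop
  -- The relation is a multiple of `F₀`. As `F₀` already has the full bidegree `(e, h)`, the
  -- cofactor is constant.
  obtain ⟨H, hH⟩ := dvd_of_aevalAeval_eq_zero (mon_fst_not_const sh hθ) hF₀ hrel hF
  by_cases hH0 : H = 0
  · exact ⟨0, by rw [hH, hH0]; simp⟩
  have h3 := sh.natDegree_poly_le F
  have h4 := sh.natDegree_swap_poly_le F
  rw [hH, natDegree_mul hF₀.ne_zero hH0] at h3
  rw [hH, map_mul, natDegree_mul (by simpa using hF₀.ne_zero) (by simpa using hH0)] at h4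
  obtain ⟨H', rfl⟩ := natDegree_eq_zero.1 (show H.natDegree = 0 by omega)
  have h5 := natDegree_coeff_le_swap (C H') 0
  rw [coeff_C_zero] at h5
  obtain ⟨c, rfl⟩ := natDegree_eq_zero.1 (show H'.natDegree = 0 by omega)
  exact ⟨c, by rw [hH, mul_comm]⟩

open IntermediateField in
include hθ in
/-- The kernel of the relation matrix of a birational parametrization is at most one-dimensional. -/
theorem eq_smul_of_relations (htop : K⟮mon θ (1, 0), mon θ (0, 1)⟯ = ⊤) {F G : Δ.Pts → K}
    (hF0 : F ≠ 0) (hF : ∑ a, C (F a) * sh.dform θ a = 0) (hG : ∑ a, C (G a) * sh.dform θ a = 0) :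
    ∃ c : K, G = c • F := by
  obtain ⟨F₀, hF₀, hrel⟩ := exists_irreducible_relation (mon_fst_not_const sh hθ) (mon θ (0, 1))
  obtain ⟨c, hc⟩ := sh.eq_C_mul_of_relation hθ hF₀ hrel htop ((sh.sum_dform_eq_zero_iff hθ F).1 hF)
  obtain ⟨c', hc'⟩ := sh.eq_C_mul_of_relation hθ hF₀ hrel htop ((sh.sum_dform_eq_zero_iff hθ G).1 hG)
  have hc0 : c ≠ 0 := by
    rintro rfl
    apply hF0
    apply sh.poly_injective
    rw [hc]
    simp [poly]
  refine ⟨c' * c⁻¹, sh.poly_injective ?_⟩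
  rw [poly_smul, hc, hc', ← mul_assoc, ← C_mul, ← C_mul, mul_assoc, inv_mul_cancel₀ hc0, mul_one]

end Shape

end LatticePolygon

namespace LatticePolygon

open Polynomial
open scoped Polynomial.Bivariate

variable {Δ : LatticePolygon} {d : Δ.TangencyProfile} {K : Type*} [Field K]

instance : DecidableEq (Idx d) := Classical.decEq _

/-! ### General parameters -/

/-- The leading coefficient at the point `j` of the Laurent monomial with exponent `v`. -/
def mval (θ : Par d → K) (j : Idx d) (v : ℤ × ℤ) : K :=
  θ (Sum.inl 0) ^ v.1 * θ (Sum.inl 1) ^ v.2 *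
    ∏ k ∈ Finset.univ.erase j, (θ (Sum.inr j) - θ (Sum.inr k)) ^ k.exp v

/-- The coordinate of the point `j` on its toric divisor. -/
def sval (θ : Par d → K) (j : Idx d) : K := mval θ j j.1.tangent

/-- The parameters are general: they are regular, and points on the same toric divisor are mapped
to different points. -/
structure IsGeneric (θ : Par d → K) : Prop extends IsRegular θ where
  sval_ne : ∀ j j' : Idx d, j ≠ j' → j.1 = j'.1 → sval θ j ≠ sval θ j'

section Values

variable {θ : Par d → K} (hθ : IsRegular θ)
include hθ

theorem IsRegular.sub_ne_zero {j k : Idx d} (h : k ∈ Finset.univ.erase j) :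
    θ (Sum.inr j) - θ (Sum.inr k) ≠ 0 :=
  _root_.sub_ne_zero.2 fun h' => Finset.ne_of_mem_erase h (hθ.inj h').symm

theorem mval_ne_zero (j : Idx d) (v : ℤ × ℤ) : mval θ j v ≠ 0 :=
  mul_ne_zero (mul_ne_zero (zpow_ne_zero _ (hθ.ne_zero 0)) (zpow_ne_zero _ (hθ.ne_zero 1)))
    (Finset.prod_ne_zero_iff.2 fun _ hk => zpow_ne_zero _ (hθ.sub_ne_zero hk))

theorem mval_add (j : Idx d) (v w : ℤ × ℤ) : mval θ j (v + w) = mval θ j v * mval θ j w := by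
  have h1 : ∀ k ∈ Finset.univ.erase j, (θ (Sum.inr j) - θ (Sum.inr k)) ^ k.exp (v + w) =
      (θ (Sum.inr j) - θ (Sum.inr k)) ^ k.exp v * (θ (Sum.inr j) - θ (Sum.inr k)) ^ k.exp w := by
    intro k hk
    rw [← zpow_add₀ (hθ.sub_ne_zero hk), Idx.exp, Idx.exp, Idx.exp, latticePairing_add, mul_add]
  rw [mval, Finset.prod_congr rfl h1, Finset.prod_mul_distrib]
  simp only [Prod.fst_add, Prod.snd_add, zpow_add₀ (hθ.ne_zero _), mval]
  ring

theorem mval_nsmul (j : Idx d) (v : ℤ × ℤ) (n : ℕ) : mval θ j ((n : ℤ) • v) = mval θ j v ^ n := by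
  induction n with
  | zero => simp [mval, Idx.exp, latticePairing]
  | succ n ih => rw [pow_succ, ← ih, ← mval_add hθ, Nat.cast_succ, add_smul, one_smul]

end Values

/-- The support of a bivariate polynomial. -/
def supp (G : K[X][Y]) : Set (ℤ × ℤ) := {t | ∃ c r : ℕ, t = ((c : ℤ), (r : ℤ)) ∧ (G.coeff r).coeff c ≠ 0}

theorem mult_nonempty (i : Δ.Side) : Nonempty (d.mult i).ToType := by
  by_contra h
  rw [not_nonempty_iff] at h
  have h1 := Multiset.card_coe (d.mult i)
  rw [Fintype.card_eq_zero, eq_comm, Multiset.card_eq_zero] at h1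
  have h2 := d.sum_eq i
  have := i.length_pos
  rw [h1, Multiset.sum_zero] at h2
  omega

theorem tail_exp_tangent (j : Idx d) {k : Idx d} (h : k.1 = j.1) : k.exp j.1.tangent = 0 := by
  rw [Idx.exp, h, Side.pairing_tangent, mul_zero]

/-- At a point over the side `i`, the terms of lowest order in the relation come from the face of
the support of `F₀` in the direction of `i`. After division by one monomial they form a polynomial
`Q` in one variable that vanishes at the coordinate `sval` of the point. These coordinates are
distinct for the points over `i`, so the degree of `Q`, at most the length of the face, is at least
their number. -/
theorem IsGeneric.edge_length {θ : Par d → K} (hθ : IsGeneric θ) {F₀ : K[X][Y]} (hF₀ : F₀ ≠ 0)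
    (hrel : aevalAeval (Shape.mon θ (1, 0)) (Shape.mon θ (0, 1)) F₀ = 0) (i : Δ.Side) :
    ∃ t ∈ supp F₀, ∃ k : ℕ, t + (k : ℤ) • i.tangent ∈ supp F₀ ∧
      (∀ m ∈ supp F₀, latticePairing i.1 t ≤ latticePairing i.1 m) ∧
      Multiset.card (d.mult i) ≤ k := by
  classical
  have hreg := hθ.toIsRegular
  set M := (Bivariate.swap F₀).natDegree + 1 with hM
  set N := F₀.natDegree + 1 with hN
  set T := Finset.range M ×ˢ Finset.range N with hT
  let F : ℕ × ℕ → K := fun t => (F₀.coeff t.2).coeff t.1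
  let vec : ℕ × ℕ → ℤ × ℤ := fun t => ((t.1 : ℤ), (t.2 : ℤ))
  have hTmem : ∀ t, F t ≠ 0 → t ∈ T := by
    intro t ht
    rw [hT, Finset.mem_product, Finset.mem_range, Finset.mem_range, hM, hN, Nat.lt_succ_iff,
      Nat.lt_succ_iff]
    constructor
    · by_contra hcon
      apply ht
      change (F₀.coeff t.2).coeff t.1 = 0
      rw [← coeff_swap, coeff_eq_zero_of_natDegree_lt (p := Bivariate.swap F₀) (by omega), coeff_zero]
    · by_contra hcon
      apply ht
      change (F₀.coeff t.2).coeff t.1 = 0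
      rw [coeff_eq_zero_of_natDegree_lt (p := F₀) (by omega), coeff_zero]
  have hsupp : ∀ t, F t ≠ 0 → vec t ∈ supp F₀ := fun t ht => ⟨t.1, t.2, rfl, ht⟩
  have hsum : ∑ t ∈ T, RatFunc.C (F t * (θ (Sum.inl 0) ^ (t.1 : ℤ) * θ (Sum.inl 1) ^ (t.2 : ℤ))) *
      ∏ k : Idx d, (RatFunc.X - RatFunc.C (θ (Sum.inr k))) ^ k.exp (vec t) = 0 := by
    rw [aevalAeval_eq_sum _ _ F₀ (Nat.lt_succ_self _) (Nat.lt_succ_self _)] at hrel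
    rw [← hrel]
    refine Finset.sum_congr rfl fun t _ => ?_
    rw [← Shape.mon_nat hreg, Shape.mon, map_mul, mul_assoc, RatFunc.algebraMap_eq_C]
  -- the face of the support
  set Sf := T.filter fun t => F t ≠ 0 with hSf
  have hne : Sf.Nonempty := by
    by_contra hcon
    rw [Finset.not_nonempty_iff_eq_empty] at hcon
    apply hF₀
    ext r c
    by_contra h
    have h1 : (c, r) ∈ Sf := Finset.mem_filter.2 ⟨hTmem (c, r) h, h⟩
    rw [hcon] at h1
    exact Finset.notMem_empty _ h1
  obtain ⟨tm, htm, hmin⟩ := Finset.exists_min_image Sf (fun t => latticePairing i.1 (vec t)) hne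
  set m := latticePairing i.1 (vec tm) with hm
  obtain ⟨u, hu⟩ := Side.exists_coord (i := i)
  set Fc := Sf.filter fun t => latticePairing i.1 (vec t) = m with hFc
  have hFcne : Fc.Nonempty := ⟨tm, Finset.mem_filter.2 ⟨htm, rfl⟩⟩
  obtain ⟨t₀, ht₀, hmin₀⟩ := Finset.exists_min_image Fc (fun t => latticePairing u (vec t)) hFcne
  obtain ⟨t₁, ht₁, hmax₁⟩ := Finset.exists_max_image Fc (fun t => latticePairing u (vec t)) hFcne
  let kk : ℕ × ℕ → ℕ := fun t => (latticePairing u (vec t) - latticePairing u (vec t₀)).toNat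
  have hFcF : ∀ t ∈ Fc, F t ≠ 0 := fun t ht =>
    (Finset.mem_filter.1 (Finset.mem_filter.1 ht).1).2
  have hline : ∀ t ∈ Fc, vec t = vec t₀ + (kk t : ℤ) • i.tangent := by
    intro t ht
    have h1 := hmin₀ t ht
    have h2 : ((kk t : ℕ) : ℤ) = latticePairing u (vec t - vec t₀) := by
      rw [latticePairing_sub]; simp only [kk]; omega
    rw [h2]
    refine eq_add_of_sub_eq' (hu _ ?_)
    rw [latticePairing_sub, (Finset.mem_filter.1 ht).2, (Finset.mem_filter.1 ht₀).2, sub_self]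
  have hvec : Function.Injective vec := fun t t' h => by
    simp only [vec, Prod.mk.injEq, Nat.cast_inj] at h
    exact Prod.ext h.1 h.2
  refine ⟨vec t₀, hsupp _ (hFcF _ ht₀), kk t₁, ?_, ?_, ?_⟩
  · rw [← hline t₁ ht₁]
    exact hsupp _ (hFcF _ ht₁)
  · rintro _ ⟨c, r, rfl, hcr⟩
    rw [(Finset.mem_filter.1 ht₀).2]
    exact hmin (c, r) (Finset.mem_filter.2 ⟨hTmem (c, r) hcr, hcr⟩)
  -- the polynomial on the face
  let Q : K[X] := ∑ t ∈ Fc, C (F t) * X ^ kk t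
  have hQ0 : Q ≠ 0 := by
    intro h
    have h1 := congrArg (fun q => q.coeff 0) h
    simp only [Q, finsetSum_coeff, coeff_C_mul, coeff_X_pow, coeff_zero] at h1
    rw [Finset.sum_eq_single t₀] at h1
    · simp only [kk, sub_self, Int.toNat_zero, if_true, mul_one] at h1
      exact hFcF _ ht₀ h1
    · intro t ht htt
      rw [if_neg, mul_zero]
      intro h2
      apply htt
      apply hvec
      rw [hline t ht, ← h2]
      simp
    · intro h2
      exact absurd ht₀ h2
  have hQdeg : Q.natDegree ≤ kk t₁ := by
    refine natDegree_sum_le_of_forall_le _ _ fun t ht => (natDegree_C_mul_X_pow_le _ _).trans ?_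
    have := hmax₁ t ht
    simp only [kk]
    omega
  have hroot : ∀ x : (d.mult i).ToType, Q.eval (sval θ ⟨i, x⟩) = 0 := by
    intro x
    set j : Idx d := ⟨i, x⟩ with hj
    have h1 := initial_form_eq_zero hreg.inj T
      (fun t => F t * (θ (Sum.inl 0) ^ (t.1 : ℤ) * θ (Sum.inl 1) ^ (t.2 : ℤ)))
      (fun t k => k.exp (vec t)) hsum j (j.mult * m) (fun t ht hct => by
        rw [Idx.exp]
        refine mul_le_mul_of_nonneg_left (hmin t (Finset.mem_filter.2 ⟨ht, ?_⟩)) (Int.natCast_nonneg _)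
        exact left_ne_zero_of_mul hct)
    have h2 : ∑ t ∈ Fc, F t * mval θ j (vec t) = 0 := by
      rw [← h1, hFc, hSf, Finset.filter_filter, Finset.sum_filter, Finset.sum_filter]
      refine Finset.sum_congr rfl fun t _ => ?_
      have h3 : (j.exp (vec t) = j.mult * m) ↔ latticePairing i.1 (vec t) = m := by
        rw [Idx.exp]
        constructor
        · exact fun h => mul_left_cancel₀ (by exact_mod_cast j.mult_pos.ne') h
        · exact fun h => by rw [h]
      by_cases h4 : latticePairing i.1 (vec t) = m
      · by_cases h5 : F t = 0
        · simp [h5]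
        · rw [if_pos ⟨h5, h4⟩, if_pos (h3.2 h4), mval]
          ring
      · rw [if_neg (fun h => h4 h.2), if_neg (fun h => h4 (h3.1 h))]
    -- The leading coefficients are multiplicative in the exponent, and along the face the exponents
    -- differ by multiples of the tangent vector.
    have h3 : mval θ j (vec t₀) * Q.eval (sval θ j) = 0 := by
      rw [← h2, eval_finsetSum, Finset.mul_sum]
      refine Finset.sum_congr rfl fun t ht => ?_
      rw [hline t ht, mval_add hreg, mval_nsmul hreg]
      simp only [eval_mul, eval_C, eval_pow, eval_X, sval]
      ring
    exact (mul_eq_zero.1 h3).resolve_left (mval_ne_zero hreg _ _)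
  rw [← Multiset.card_coe]
  refine le_trans ?_ hQdeg
  have hinj : Function.Injective fun x : (d.mult i).ToType => sval θ ⟨i, x⟩ := by
    intro x x' hxx
    by_contra hne
    exact hθ.sval_ne ⟨i, x⟩ ⟨i, x'⟩ (fun h => hne (by simpa using h)) rfl hxx
  have h1 := Polynomial.card_le_degree_of_subset_roots (p := Q)
    (Z := Finset.univ.image fun x : (d.mult i).ToType => sval θ ⟨i, x⟩) (by
      intro s hs
      rw [Finset.mem_val, Finset.mem_image] at hs
      obtain ⟨x, -, rfl⟩ := hs
      exact (mem_roots hQ0).2 (hroot x))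
  rwa [Finset.card_image_of_injective _ hinj, Finset.card_univ] at h1


theorem finite_supp (G : K[X][Y]) : (supp G).Finite := by
  refine ((Finset.range ((Bivariate.swap G).natDegree + 1) ×ˢ
    Finset.range (G.natDegree + 1)).image fun t : ℕ × ℕ => ((t.1 : ℤ), (t.2 : ℤ))).finite_toSet.subset ?_
  rintro _ ⟨c, r, rfl, h⟩
  rw [Finset.mem_coe, Finset.mem_image]
  refine ⟨(c, r), ?_, rfl⟩
  rw [Finset.mem_product, Finset.mem_range, Finset.mem_range, Nat.lt_succ_iff, Nat.lt_succ_iff]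
  constructor
  · by_contra hcon
    apply h
    rw [← coeff_swap, coeff_eq_zero_of_natDegree_lt (p := Bivariate.swap G) (not_le.1 hcon), coeff_zero]
  · by_contra hcon
    apply h
    rw [coeff_eq_zero_of_natDegree_lt (p := G) (not_le.1 hcon), coeff_zero]

theorem supp_nonempty {G : K[X][Y]} (hG : G ≠ 0) : (supp G).Nonempty := by
  by_contra hcon
  apply hG
  ext r c
  by_contra h
  exact hcon ⟨_, c, r, rfl, h⟩

theorem _root_.ConvexSeq.le_of_support {h : ℕ} {L : ℕ → ℤ} (hL : ConvexSeq h L) (hpos : 0 < h)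
    {x : ℤ} {r : ℕ} (hr : r ≤ h)
    (hx : ∀ c : ℤ, L (stepsBelow h L c) - c * stepsBelow h L c ≤ x - c * r) : L r ≤ x := by
  rcases hr.lt_or_eq with h1 | rfl
  · have h2 := hx (L (r + 1) - L r)
    rw [← hL.support_slope h1] at h2
    linarith
  · obtain ⟨k, rfl⟩ : ∃ k, r = k + 1 := ⟨r - 1, by omega⟩
    have h2 := hx (L (k + 1) - L k)
    rw [← hL.support_slope (Nat.lt_succ_self k)] at h2
    push_cast at h2
    linarith

theorem TangencyProfile.card_eq_length {i : Δ.Side} (hi : d.IsTrivialOn i) :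
    Multiset.card (d.mult i) = i.length := by
  conv_rhs => rw [← d.sum_eq i, Multiset.eq_replicate_card.2 hi, Multiset.sum_replicate]
  simp

open IntermediateField in
/-- The equation of a curve with general parameters. -/
theorem IsGeneric.exists_equation (sh : Δ.Shape) {θ : Par d → K} (hθ : IsGeneric θ)
    (hd : ∀ i : Δ.Side, ¬ i.IsHorizontal → d.IsTrivialOn i) :
    K⟮Shape.mon θ (1, 0), Shape.mon θ (0, 1)⟯ = ⊤ ∧ ∃ F : Δ.Pts → K, Irreducible (sh.poly F) ∧
      aevalAeval (Shape.mon θ (1, 0)) (Shape.mon θ (0, 1)) (sh.poly F) = 0 ∧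
      ∀ a, IsVertex a → F a ≠ 0 := by
  have hreg := hθ.toIsRegular
  have hx := Shape.mon_fst_not_const sh hreg
  obtain ⟨F₀, hF₀, hrel⟩ := exists_irreducible_relation hx (Shape.mon θ (0, 1))
  have hne := hF₀.ne_zero
  have hrow : ∀ t ∈ supp F₀, 0 ≤ t.2 ∧ t.2 ≤ F₀.natDegree := by
    rintro _ ⟨c, r, rfl, h⟩
    refine ⟨Int.natCast_nonneg _, ?_⟩
    by_contra hcon
    apply h
    rw [coeff_eq_zero_of_natDegree_lt (p := F₀) (by omega), coeff_zero]
  have hle : F₀.natDegree ≤ sh.h :=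
    (natDegree_relation_le hx hF₀ hrel).trans (Shape.mapDegree_mon_fst sh hreg).le
  have hdeg0 := natDegree_ne_zero_of_aevalAeval hx hne hrel
  have hmin : ∃ t ∈ supp F₀, t.1 = 0 := by
    by_contra! hcon
    -- Without a term in column zero, `F₀` would be divisible by `X`. This anchors the left boundary
    -- of the support to that of `Δ`.
    have h1 : C X ∣ F₀ := by
      rw [C_dvd_iff_dvd_coeff]
      intro r
      rw [X_dvd_iff]
      by_contra h
      exact hcon _ ⟨0, r, rfl, h⟩ rfl
    obtain ⟨H, hH⟩ := h1
    rcases hF₀.isUnit_or_isUnit hH with h2 | h2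
    · exact not_isUnit_X (isUnit_C.1 h2)
    · apply hdeg0
      rw [hH]
      exact Nat.le_zero.1 ((natDegree_mul_le).trans (by
        rw [natDegree_C, natDegree_eq_zero_of_isUnit h2]))
  have hcol : ∀ t ∈ supp F₀, 0 ≤ t.1 := by
    rintro _ ⟨c, r, rfl, h⟩
    exact Int.natCast_nonneg _
  -- The profile is trivial on left sides, so each left face of the support is at least as long as
  -- the side. The height of the support is at most the degree of `x`, which is `h`.
  have hleft := sh.L_conv.boundary_of_faces (S := supp F₀)
    (fun t ht => ⟨(hrow t ht).1, (hrow t ht).2.trans (by exact_mod_cast hle)⟩) (by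
      intro c
      rcases Nat.eq_zero_or_pos (stepsEq sh.h sh.L c) with h0 | h0
      · obtain ⟨a, ha, hamin⟩ := (finite_supp F₀).exists_minimalFor
          (fun t : ℤ × ℤ => t.1 - c * t.2) _ (supp_nonempty hne)
        have : ∀ m ∈ supp F₀, a.1 - c * a.2 ≤ m.1 - c * m.2 :=
          fun m hm => (le_total _ _).elim id (hamin hm)
        exact ⟨a, ha, a, ha, this, this, by rw [h0]; simp⟩
      · obtain ⟨k, hk⟩ := Finset.card_pos.1 h0
        simp only [Finset.mem_filter, Finset.mem_range] at hk
        obtain ⟨i, hi⟩ := sh.exists_left hk.1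
        rw [hk.2] at hi
        obtain ⟨t, ht, n, htn, hmin', hn⟩ := hθ.edge_length hne hrel i
        rw [TangencyProfile.card_eq_length (hd i (by simp [Side.IsHorizontal, hi])),
          sh.left_length hi] at hn
        have htan : i.tangent = (c, 1) := by simp [Side.tangent, hi]
        rw [htan] at htn
        have h1 : ∀ m ∈ supp F₀, t.1 - c * t.2 ≤ m.1 - c * m.2 := fun m hm => by
          have := hmin' m hm
          rw [hi] at this
          simp only [latticePairing] at this
          linarith
        refine ⟨t, ht, _, htn, h1, fun m hm => ?_, ?_⟩
        · have := h1 m hm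
          simp only [Prod.fst_add, Prod.snd_add, Prod.smul_fst, Prod.smul_snd, smul_eq_mul]
          linarith
        · simp only [Prod.snd_add, Prod.smul_snd, smul_eq_mul]
          have : ((stepsEq sh.h sh.L c : ℕ) : ℤ) ≤ n := by exact_mod_cast hn
          linarith)
    (by
      obtain ⟨t, ht, ht0⟩ := hmin
      exact ⟨t, ht, fun m hm => by rw [ht0]; exact hcol m hm, by rw [ht0, sh.L_min]⟩)
  -- The top of the left boundary lies in the support, so the degree bound is attained, and this is
  -- birationality. It also gives the degree in `X`, which anchors the right boundary.
  have hdeg : F₀.natDegree = sh.h := by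
    refine le_antisymm hle ?_
    obtain ⟨c, hc⟩ := exists_stepsBelow_eq sh.h sh.L
    have h1 := (hrow _ (hleft c).1).2
    rw [hc c le_rfl] at h1
    dsimp only at h1
    exact_mod_cast h1
  have htop : K⟮Shape.mon θ (1, 0), Shape.mon θ (0, 1)⟯ = ⊤ := by
    rw [← natDegree_relation_eq_iff hx hF₀ hrel, hdeg, Shape.mapDegree_mon_fst sh hreg]
  have hdegX := (sh.natDegree_relation hreg hF₀ hrel htop).2
  have hcol' : ∀ t ∈ supp F₀, t.1 ≤ sh.e := by
    rintro _ ⟨c, r, rfl, h⟩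
    by_contra hcon
    apply h
    rw [← coeff_swap, coeff_eq_zero_of_natDegree_lt (p := Bivariate.swap F₀) (by rw [hdegX]; omega),
      coeff_zero]
  have hmax : ∃ t ∈ supp F₀, t.1 = sh.e := by
    have h1 : (Bivariate.swap F₀).leadingCoeff ≠ 0 := by simpa using hne
    obtain ⟨r, hr⟩ : ∃ r, (Bivariate.swap F₀).leadingCoeff.coeff r ≠ 0 := by
      by_contra! hcon
      exact h1 (Polynomial.ext (by simpa using hcon))
    rw [leadingCoeff, coeff_swap, hdegX] at hr
    exact ⟨_, ⟨sh.e, r, rfl, hr⟩, rfl⟩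
  have hright := sh.R_conv.boundary_of_faces (S := {t | (-t.1, t.2) ∈ supp F₀})
    (fun t ht => ⟨(hrow _ ht).1, (hrow _ ht).2.trans (by exact_mod_cast hle)⟩) (by
      intro c
      rcases Nat.eq_zero_or_pos (stepsEq sh.h (fun k => - sh.R k) c) with h0 | h0
      · obtain ⟨a, ha, hamin⟩ := (finite_supp F₀).exists_minimalFor
          (fun t : ℤ × ℤ => -t.1 - c * t.2) _ (supp_nonempty hne)
        have : ∀ m : ℤ × ℤ, (-m.1, m.2) ∈ supp F₀ → -a.1 - c * a.2 ≤ m.1 - c * m.2 :=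
          fun m hm => by
            have h1 : -a.1 - c * a.2 ≤ -(-m.1) - c * m.2 := (le_total _ _).elim id (hamin hm)
            linarith
        have ha' : (-a.1, a.2) ∈ {t : ℤ × ℤ | (-t.1, t.2) ∈ supp F₀} := by
          simpa using ha
        exact ⟨_, ha', _, ha', this, this, by rw [h0]; simp⟩
      · obtain ⟨k, hk⟩ := Finset.card_pos.1 h0
        simp only [Finset.mem_filter, Finset.mem_range] at hk
        obtain ⟨i, hi⟩ := sh.exists_right hk.1
        rw [show sh.R (k + 1) - sh.R k = -c by omega] at hi
        obtain ⟨t, ht, n, htn, hmin', hn⟩ := hθ.edge_length hne hrel i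
        rw [TangencyProfile.card_eq_length (hd i (by simp [Side.IsHorizontal, hi])),
          sh.right_length hi, neg_neg] at hn
        have htan : i.tangent = (c, -1) := by simp [Side.tangent, hi]
        rw [htan] at htn
        have h1 : ∀ m : ℤ × ℤ, (-m.1, m.2) ∈ supp F₀ → -t.1 - c * t.2 ≤ m.1 - c * m.2 := fun m hm => by
          have := hmin' _ hm
          rw [hi] at this
          simp only [latticePairing] at this
          linarith
        refine ⟨(-(t + (n : ℤ) • (c, -1)).1, (t + (n : ℤ) • (c, -1)).2), by
            rw [Set.mem_ofPred_eq, neg_neg]; exact htn,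
          (-t.1, t.2), by simpa using ht, fun m hm => ?_, fun m hm => ?_, ?_⟩
        · have := h1 m hm
          simp only [Prod.fst_add, Prod.snd_add, Prod.smul_fst, Prod.smul_snd, smul_eq_mul]
          linarith
        · exact h1 m hm
        · simp only [Prod.snd_add, Prod.smul_snd, smul_eq_mul]
          have : ((stepsEq sh.h (fun k => - sh.R k) c : ℕ) : ℤ) ≤ n := by exact_mod_cast hn
          linarith)
    (by
      obtain ⟨t, ht, ht0⟩ := hmax
      refine ⟨(-t.1, t.2), by simpa using ht, fun m hm => ?_, ?_⟩
      · have := hcol' _ hm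
        dsimp only at this ⊢
        linarith
      · dsimp only
        rw [ht0, sh.R_max])
  have hsupp : ∀ c r, (F₀.coeff r).coeff c ≠ 0 → ∃ a, sh.row a = r ∧ sh.col a = c := by
    intro c r hcr
    have hmem : ((c : ℤ), (r : ℤ)) ∈ supp F₀ := ⟨c, r, rfl, hcr⟩
    have hr : r ≤ sh.h := by
      have := (hrow _ hmem).2
      dsimp only at this
      omega
    have h1 := sh.L_conv.le_of_support sh.h_pos (x := c) hr fun s => (hleft s).2 _ hmem
    have h2 := sh.R_conv.le_of_support sh.h_pos (x := -c) hr fun s =>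
      (hright s).2 (-(c : ℤ), (r : ℤ)) (by simpa using hmem)
    refine ⟨sh.pt hr (x := c) h1 (by linarith), by simp, ?_⟩
    exact_mod_cast sh.col_pt hr (x := c) h1 (by linarith)
  refine ⟨htop, fun a => (F₀.coeff (sh.row a)).coeff (sh.col a), ?_, ?_, ?_⟩
  · rw [← sh.poly_eq_of_coeff F₀ hsupp]; exact hF₀
  · rw [← sh.poly_eq_of_coeff F₀ hsupp]; exact hrel
  · intro a ha
    dsimp only
    rcases sh.vertex_cases ha with ⟨h1, c, hc⟩ | ⟨h1, c, hc⟩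
    · obtain ⟨c', r', h2, h3⟩ := (hleft c).1
      rw [← hc, ← h1, Prod.mk.injEq] at h2
      rw [show sh.row a = r' by exact_mod_cast h2.2, show sh.col a = c' by exact_mod_cast h2.1]
      exact h3
    · obtain ⟨c', r', h2, h3⟩ := (hright c).1
      dsimp only at h2
      rw [← hc, neg_neg, ← h1, Prod.mk.injEq] at h2
      rw [show sh.row a = r' by exact_mod_cast h2.2, show sh.col a = c' by exact_mod_cast h2.1]
      exact h3


/-- The property holds on a nonempty principal open subset of the affine space. -/
def HoldsGenerically {ι : Type*} (P : (ι → K) → Prop) : Prop :=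
  ∃ q : MvPolynomial ι K, q ≠ 0 ∧ ∀ θ, MvPolynomial.eval θ q ≠ 0 → P θ

namespace HoldsGenerically

variable {ι : Type*} {P Q : (ι → K) → Prop}

theorem mono (hP : HoldsGenerically P) (h : ∀ θ, P θ → Q θ) : HoldsGenerically Q :=
  let ⟨q, hq, hqP⟩ := hP
  ⟨q, hq, fun θ hθ => h θ (hqP θ hθ)⟩

theorem and (hP : HoldsGenerically P) (hQ : HoldsGenerically Q) :
    HoldsGenerically fun θ => P θ ∧ Q θ := by
  obtain ⟨q, hq, hqP⟩ := hP
  obtain ⟨r, hr, hrQ⟩ := hQ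
  refine ⟨q * r, mul_ne_zero hq hr, fun θ hθ => ?_⟩
  rw [map_mul] at hθ
  exact ⟨hqP θ (left_ne_zero_of_mul hθ), hrQ θ (right_ne_zero_of_mul hθ)⟩

theorem forall_finite {κ : Type*} [Finite κ] {P : κ → (ι → K) → Prop}
    (hP : ∀ k, HoldsGenerically (P k)) : HoldsGenerically fun θ => ∀ k, P k θ := by
  have := Fintype.ofFinite κ
  choose q hq hqP using hP
  refine ⟨∏ k, q k, Finset.prod_ne_zero_iff.2 fun k _ => hq k, fun θ hθ k => hqP k θ ?_⟩
  rw [map_prod] at hθ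
  exact Finset.prod_ne_zero_iff.1 hθ k (Finset.mem_univ k)

theorem of_eval_ne_zero (q : MvPolynomial ι K) (h : ∃ θ, MvPolynomial.eval θ q ≠ 0) :
    HoldsGenerically fun θ => MvPolynomial.eval θ q ≠ 0 :=
  ⟨q, ne_zero_of_eval_ne_zero h.choose_spec, fun _ h => h⟩

theorem of_forall (h : ∀ θ, P θ) : HoldsGenerically P := ⟨1, one_ne_zero, fun θ _ => h θ⟩

theorem imp_const {p : Prop} (h : p → HoldsGenerically P) : HoldsGenerically fun θ => p → P θ := by
  by_cases hp : p
  · exact (h hp).mono fun θ h _ => h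
  · exact of_forall fun θ h => absurd h hp

end HoldsGenerically

theorem exists_injective_values (ι K : Type*) [Finite ι] [Infinite K] :
    ∃ p : ι → K, Function.Injective p := by
  obtain ⟨n, ⟨e⟩⟩ := Finite.exists_equiv_fin ι
  exact ⟨fun j => Infinite.natEmbedding K (e j), fun j j' h =>
    e.injective (Fin.ext ((Infinite.natEmbedding K).injective h))⟩

theorem holdsGenerically_isRegular [Infinite K] : HoldsGenerically fun θ : Par d → K => IsRegular θ := by
  have h1 : HoldsGenerically fun θ : Par d → K => ∀ l : Fin 2, θ (Sum.inl l) ≠ 0 :=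
    HoldsGenerically.forall_finite fun l =>
      (HoldsGenerically.of_eval_ne_zero (MvPolynomial.X (Sum.inl l)) ⟨fun _ => 1, by simp⟩).mono
        fun θ hθ => by simpa using hθ
  have h2 : HoldsGenerically fun θ : Par d → K => ∀ t : Idx d × Idx d, t.1 ≠ t.2 →
      θ (Sum.inr t.1) ≠ θ (Sum.inr t.2) :=
    HoldsGenerically.forall_finite fun t => HoldsGenerically.imp_const fun ht => by
      refine (HoldsGenerically.of_eval_ne_zero (MvPolynomial.X (Sum.inr t.1) -
        MvPolynomial.X (Sum.inr t.2)) ?_).mono fun θ hθ => ?_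
      · obtain ⟨p, hp⟩ := exists_injective_values (Idx d) K
        refine ⟨Sum.elim (fun _ => 1) p, ?_⟩
        simpa [sub_eq_zero] using hp.ne ht
      · simpa [sub_eq_zero] using hθ
  refine (h1.and h2).mono fun θ hθ => ⟨hθ.1, fun j j' h => ?_⟩
  by_contra hne
  exact hθ.2 (j, j') hne h

/-- The numerator of the coordinate of a point on its toric divisor. -/
def svalNum (n : ℤ) (j : Idx d) : MvPolynomial (Par d) K :=
  ∏ k ∈ Finset.univ.erase j, (MvPolynomial.X (Sum.inr j) - MvPolynomial.X (Sum.inr k)) ^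
    (n * k.exp j.1.tangent).toNat

theorem eval_svalNum (θ : Par d → K) (n : ℤ) (j : Idx d) : MvPolynomial.eval θ (svalNum n j) =
    ∏ k ∈ Finset.univ.erase j, (θ (Sum.inr j) - θ (Sum.inr k)) ^ (n * k.exp j.1.tangent).toNat := by
  simp [svalNum, map_prod]

theorem sval_mul_svalNum {θ : Par d → K} (hθ : IsRegular θ) (j : Idx d) :
    sval θ j * MvPolynomial.eval θ (svalNum (-1) j) =
      θ (Sum.inl 0) ^ j.1.tangent.1 * θ (Sum.inl 1) ^ j.1.tangent.2 *
        MvPolynomial.eval θ (svalNum 1 j) := by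
  rw [eval_svalNum, eval_svalNum, sval, mval, mul_assoc, ← Finset.prod_mul_distrib]
  congr 1
  refine Finset.prod_congr rfl fun k hk => ?_
  rw [← zpow_natCast, ← zpow_natCast, ← zpow_add₀ (hθ.sub_ne_zero hk)]
  congr 1
  omega

/-- Equality of two coordinates on a divisor is a polynomial condition, as the scalars cancel. To
see that it is not identically satisfied, let the first point collide with a point `k₀` over another
side at which the coordinate has a zero: one of the two cross products vanishes there and the other
does not. -/
theorem holdsGenerically_isGeneric [Infinite K] (sh : Δ.Shape) :
    HoldsGenerically fun θ : Par d → K => IsGeneric θ := by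
  have h2 : HoldsGenerically fun θ : Par d → K => ∀ t : Idx d × Idx d, t.1 ≠ t.2 ∧ t.1.1 = t.2.1 →
      MvPolynomial.eval θ (svalNum 1 t.1 * svalNum (-1) t.2 - svalNum 1 t.2 * svalNum (-1) t.1) ≠ 0 := by
    refine HoldsGenerically.forall_finite fun t => HoldsGenerically.imp_const fun ht => ?_
    obtain ⟨ht1, ht2⟩ := ht
    refine HoldsGenerically.of_eval_ne_zero _ ?_
    obtain ⟨i, hi⟩ := sh.exists_pairing_tangent_pos t.1.1
    obtain ⟨x⟩ := mult_nonempty (d := d) i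
    set k₀ : Idx d := ⟨i, x⟩ with hk₀
    have hk₀e : 0 < k₀.exp t.1.1.tangent :=
      mul_pos (by exact_mod_cast k₀.mult_pos) hi
    have hk₀1 : k₀ ≠ t.1 := by
      intro h
      rw [tail_exp_tangent t.1 (by rw [h])] at hk₀e
      exact lt_irrefl _ hk₀e
    have hk₀2 : k₀ ≠ t.2 := by
      intro h
      rw [tail_exp_tangent t.1 (by rw [h, ht2])] at hk₀e
      exact lt_irrefl _ hk₀e
    obtain ⟨p, hp⟩ := exists_injective_values (Idx d) K
    let p' : Idx d → K := Function.update p t.1 (p k₀)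
    refine ⟨Sum.elim (fun _ => 1) p', ?_⟩
    have hp1 : p' t.1 = p k₀ := Function.update_self _ _ _
    have hp' : ∀ k, k ≠ t.1 → p' k = p k := fun k hk => Function.update_of_ne hk _ _
    rw [map_sub, map_mul, map_mul, eval_svalNum _ 1 t.1]
    have h0 : ∏ k ∈ Finset.univ.erase t.1, ((Sum.elim (fun _ => 1) p' : Par d → K) (Sum.inr t.1) -
        (Sum.elim (fun _ => 1) p' : Par d → K) (Sum.inr k)) ^ (1 * k.exp t.1.1.tangent).toNat = 0 := by
      refine Finset.prod_eq_zero (Finset.mem_erase.2 ⟨hk₀1, Finset.mem_univ _⟩) ?_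
      rw [Sum.elim_inr, Sum.elim_inr, hp1, hp' _ hk₀1, sub_self, zero_pow]
      omega
    rw [h0, zero_mul, zero_sub, neg_ne_zero, eval_svalNum, eval_svalNum]
    refine mul_ne_zero (Finset.prod_ne_zero_iff.2 fun k hk => pow_ne_zero _ ?_)
      (Finset.prod_ne_zero_iff.2 fun k hk => ?_)
    · have hk2 := Finset.ne_of_mem_erase hk
      rw [Sum.elim_inr, Sum.elim_inr, hp' _ ht1.symm, sub_ne_zero]
      by_cases hk1 : k = t.1
      · rw [hk1, hp1]; exact hp.ne hk₀2.symm
      · rw [hp' _ hk1]; exact hp.ne hk2.symm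
    · have hk1 := Finset.ne_of_mem_erase hk
      by_cases hkk : k = k₀
      -- The colliding point occurs in the numerator only, so the denominator of the first
      -- coordinate is unaffected.
      · rw [hkk, show (-1 * k₀.exp t.1.1.tangent).toNat = 0 by omega, pow_zero]
        exact one_ne_zero
      · apply pow_ne_zero
        rw [Sum.elim_inr, Sum.elim_inr, hp1, hp' _ hk1, sub_ne_zero]
        exact hp.ne (Ne.symm hkk)
  refine (holdsGenerically_isRegular.and h2).mono fun θ ⟨hreg, hθ⟩ => ⟨hreg, fun j j' hne hjj hs => ?_⟩
  refine hθ (j, j') ⟨hne, hjj⟩ ?_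
  have e1 := sval_mul_svalNum hreg j
  have e2 := sval_mul_svalNum hreg j'
  rw [← hjj, ← hs] at e2
  set c := θ (Sum.inl 0) ^ j.1.tangent.1 * θ (Sum.inl 1) ^ j.1.tangent.2 with hc
  have hc0 : c ≠ 0 := mul_ne_zero (zpow_ne_zero _ (hreg.ne_zero 0)) (zpow_ne_zero _ (hreg.ne_zero 1))
  rw [map_sub, map_mul, map_mul]
  apply mul_left_cancel₀ hc0
  rw [mul_zero]
  linear_combination (-1 : K) * MvPolynomial.eval θ (svalNum (-1) j') * e1 +
    MvPolynomial.eval θ (svalNum (-1) j) * e2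

end LatticePolygon

namespace LatticePolygon

variable {Δ : LatticePolygon}

/-! ### Multiples of the polygon -/

/-- A sum of integral intervals is an integral interval. It distributes a column among the rows in
the decomposition of points of `nΔ`. -/
theorem exists_sum_eq_of_le {τ : Type*} [DecidableEq τ] (s : Finset τ) {l r : τ → ℤ}
    (hlr : ∀ t ∈ s, l t ≤ r t) {x : ℤ} (h1 : ∑ t ∈ s, l t ≤ x) (h2 : x ≤ ∑ t ∈ s, r t) :
    ∃ f : τ → ℤ, (∀ t ∈ s, l t ≤ f t ∧ f t ≤ r t) ∧ ∑ t ∈ s, f t = x := by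
  induction s using Finset.induction_on generalizing x with
  | empty => exact ⟨l, by simp, by simp only [Finset.sum_empty] at *; omega⟩
  | insert a s ha ih =>
    rw [Finset.sum_insert ha] at h1 h2
    have hs : ∑ t ∈ s, l t ≤ ∑ t ∈ s, r t :=
      Finset.sum_le_sum fun t ht => hlr t (Finset.mem_insert_of_mem ht)
    have hla := hlr a (Finset.mem_insert_self _ _)
    obtain ⟨f, hf, hfx⟩ := ih (fun t ht => hlr t (Finset.mem_insert_of_mem ht))
      (x := x - max (l a) (x - ∑ t ∈ s, r t)) (by omega) (by omega)
    refine ⟨Function.update f a (max (l a) (x - ∑ t ∈ s, r t)), ?_, ?_⟩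
    · intro t ht
      by_cases hta : t = a
      · subst hta
        rw [Function.update_self]
        omega
      · rw [Function.update_of_ne hta]
        exact hf t ((Finset.mem_insert.1 ht).resolve_left hta)
    · have h3 : ∑ t ∈ s, Function.update f a (max (l a) (x - ∑ t ∈ s, r t)) t = ∑ t ∈ s, f t :=
        Finset.sum_congr rfl fun t ht => Function.update_of_ne (by rintro rfl; exact ha ht) _ _
      rw [Finset.sum_insert ha, Function.update_self, h3, hfx]
      ring

theorem Shape.ht_eq_base (sh : Δ.Shape) (i : Δ.Side) (v : ℤ × ℤ) :
    i.ht ((sh.x₁, sh.y₀) + v) = latticePairing i.1 v + i.ht (sh.x₁, sh.y₀) := by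
  rw [Side.ht, Side.ht, latticePairing_add]; ring

/-- The lattice points of the multiple `nΔ` are sums of `n` lattice points of `Δ`. -/
theorem Shape.exists_multiset (sh : Δ.Shape) {n : ℕ} {m : ℤ × ℤ}
    (hm : ∀ i : Δ.Side, 0 ≤ latticePairing i.1 m + n * i.ht (sh.x₁, sh.y₀)) :
    ∃ l : Multiset Δ.Pts, Multiset.card l = n ∧
      (l.map fun a : Δ.Pts => a.1).sum = n • (sh.x₁, sh.y₀) + m := by
  have hp := sh.h_pos
  have hleft : ∀ k < sh.h, n * sh.L k + (sh.L (k + 1) - sh.L k) * (m.2 - n * k) ≤ m.1 := by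
    intro k hk
    obtain ⟨i, hi⟩ := sh.exists_left hk
    have := hm i
    rw [sh.ht_left hk hi, hi] at this
    simp only [latticePairing] at this
    linarith
  have hright : ∀ k < sh.h, m.1 ≤ n * sh.R k + (sh.R (k + 1) - sh.R k) * (m.2 - n * k) := by
    intro k hk
    obtain ⟨i, hi⟩ := sh.exists_right hk
    have := hm i
    rw [sh.ht_right hk hi, hi] at this
    simp only [latticePairing] at this
    linarith
  have hbot : 0 ≤ m.2 := by
    rcases (sh.L_le_R 0 (Nat.zero_le _)).lt_or_eq with h0 | h0
    · obtain ⟨i, hi⟩ := sh.exists_bottom h0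
      have := hm i
      rw [sh.ht_bottom hi, hi] at this
      simp only [latticePairing] at this
      linarith
    · have h1 := (sh.nondeg 0 hp).resolve_left (by omega)
      have h2 := hleft 0 hp
      have h3 := hright 0 hp
      by_contra hcon
      push_cast at h2 h3
      simp only [zero_add, mul_zero, sub_zero] at h1 h2 h3
      rw [h0] at h2
      nlinarith
  have htop : m.2 ≤ n * sh.h := by
    rcases (sh.L_le_R sh.h le_rfl).lt_or_eq with h0 | h0
    · obtain ⟨i, hi⟩ := sh.exists_top h0
      have := hm i
      rw [sh.ht_top hi, hi] at this
      simp only [latticePairing] at this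
      linarith
    · obtain ⟨k, hk⟩ : ∃ k, sh.h = k + 1 := ⟨sh.h - 1, by omega⟩
      have h1 := (sh.nondeg k (by omega)).resolve_right (by rw [← hk]; omega)
      have h2 := hleft k (by omega)
      have h3 := hright k (by omega)
      rw [hk] at h0 ⊢
      by_contra hcon
      push_cast at hcon
      rw [h0] at h2
      have h4 : n * sh.L k + (sh.R (k + 1) - sh.L k) * (m.2 - n * k) ≤
        n * sh.R k + (sh.R (k + 1) - sh.R k) * (m.2 - n * k) := h2.trans h3
      nlinarith
  rcases Nat.eq_zero_or_pos n with rfl | hn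
  · refine ⟨0, by simp, ?_⟩
    have h1 : m.2 = 0 := by push_cast at htop; omega
    have h2 := hleft 0 hp
    have h3 := hright 0 hp
    rw [h1] at h2 h3
    simp only [Nat.cast_zero, zero_mul, sub_zero, mul_zero, add_zero, zero_add] at h2 h3
    rw [Multiset.map_zero, Multiset.sum_zero, zero_smul, zero_add]
    exact Prod.ext (by simp only [Prod.fst_zero]; omega) (by simp [h1])
  obtain ⟨y, hy⟩ := Int.eq_ofNat_of_zero_le hbot
  have hyn : y ≤ n * sh.h := by rw [hy] at htop; exact_mod_cast htop
  -- Distribute the total height as evenly as possible: `r` points in row `q + 1` and the others in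
  -- row `q`. On such a distribution the sums of the row ends are the boundary of `nΔ`.
  set q := y / n with hq
  set r := y % n with hr
  have hqr : n * q + r = y := Nat.div_add_mod y n
  have hrn : r < n := Nat.mod_lt _ hn
  have hqh : q ≤ sh.h := Nat.div_le_of_le_mul hyn
  have hqh' : 0 < r → q < sh.h := by
    intro h0
    by_contra hcon
    have : n * sh.h ≤ n * q := Nat.mul_le_mul_left n (not_lt.1 hcon)
    omega
  let ρ : Fin n → ℕ := fun t => if (t : ℕ) < r then q + 1 else q
  have hρ : ∀ t, ρ t ≤ sh.h := by
    intro t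
    simp only [ρ]
    split_ifs with h
    · exact hqh' (by omega)
    · exact hqh
  have hsum : ∀ g : ℕ → ℤ, ∑ t, g (ρ t) = n * g q + r * (g (q + 1) - g q) := by
    intro g
    have h1 : ∀ t : Fin n, g (ρ t) = g q + if (t : ℕ) < r then (g (q + 1) - g q) else 0 := by
      intro t
      simp only [ρ]
      split_ifs <;> ring
    simp only [h1, Finset.sum_add_distrib, Finset.sum_const, Finset.card_univ, Fintype.card_fin,
      nsmul_eq_mul, Finset.sum_ite, Finset.sum_const_zero, add_zero]
    congr 2
    have h2 : (Finset.univ.filter fun t : Fin n => (t : ℕ) < r) = Finset.univ.filter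
        fun t : Fin n => t < (⟨r, hrn⟩ : Fin n) := by
      ext t; simp [Fin.lt_def]
    rw [h2, Finset.filter_gt_eq_Iio, Fin.card_Iio]
    simp
  have hL : ∑ t, sh.L (ρ t) ≤ m.1 := by
    rw [hsum]
    rcases hqh.lt_or_eq with h | h
    · have := hleft q h
      rw [hy, ← hqr] at this
      push_cast at this
      linarith
    · have hr0 : r = 0 := by by_contra h0; have := hqh' (by omega); omega
      obtain ⟨k, hk⟩ : ∃ k, sh.h = k + 1 := ⟨sh.h - 1, by omega⟩
      have := hleft k (by omega)
      rw [hy, ← hqr, hr0, h, hk] at this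
      rw [hr0, h, hk]
      push_cast at this ⊢
      linarith
  have hR : m.1 ≤ ∑ t, sh.R (ρ t) := by
    rw [hsum]
    rcases hqh.lt_or_eq with h | h
    · have := hright q h
      rw [hy, ← hqr] at this
      push_cast at this
      linarith
    · have hr0 : r = 0 := by by_contra h0; have := hqh' (by omega); omega
      obtain ⟨k, hk⟩ : ∃ k, sh.h = k + 1 := ⟨sh.h - 1, by omega⟩
      have := hright k (by omega)
      rw [hy, ← hqr, hr0, h, hk] at this
      rw [hr0, h, hk]
      push_cast at this ⊢
      linarith
  obtain ⟨f, hf, hfx⟩ := exists_sum_eq_of_le Finset.univ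
    (fun t _ => sh.L_le_R _ (hρ t)) hL hR
  refine ⟨Finset.univ.val.map fun t => sh.pt (hρ t) (hf t (Finset.mem_univ t)).1
    (hf t (Finset.mem_univ t)).2, by simp, ?_⟩
  rw [Multiset.map_map]
  change ∑ t, (sh.x₁ + f t, sh.y₀ + (ρ t : ℤ)) = _
  ext
  · rw [Prod.fst_sum, Prod.fst_add, Prod.smul_fst]
    simp only [Finset.sum_add_distrib, hfx]
    simp
  · rw [Prod.snd_sum, Prod.snd_add, Prod.smul_snd]
    simp only [Finset.sum_add_distrib]
    rw [hsum fun k => (k : ℤ), hy, ← hqr]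
    simp

/-! ### The support of a toric family -/

theorem IsToric.multiset {R : Type*} [CommMonoid R] {Z : Δ.Pts → R} (hZ : IsToric Z)
    {l l' : Multiset Δ.Pts} (hcard : Multiset.card l = Multiset.card l')
    (hsum : (l.map fun a : Δ.Pts => a.1).sum = (l'.map fun a : Δ.Pts => a.1).sum) :
    (l.map Z).prod = (l'.map Z).prod := by
  have h1 : ∀ l : Multiset Δ.Pts, (l.map Z).prod = ∏ a, Z a ^ l.count a := by
    intro l
    rw [Finset.prod_multiset_map_count]
    refine Finset.prod_subset (Finset.subset_univ _) fun a _ ha => ?_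
    rw [Multiset.count_eq_zero_of_notMem (by simpa using ha), pow_zero]
  have h2 : ∀ l : Multiset Δ.Pts, (l.map fun a : Δ.Pts => a.1).sum = ∑ a, l.count a • a.1 := by
    intro l
    rw [Finset.sum_multiset_map_count]
    refine Finset.sum_subset (Finset.subset_univ _) fun a _ ha => ?_
    rw [Multiset.count_eq_zero_of_notMem (by simpa using ha), zero_smul]
  have h3 : ∀ l : Multiset Δ.Pts, Multiset.card l = ∑ a, l.count a := by
    intro l
    exact (Multiset.sum_count_eq_card (s := Finset.univ) (fun a _ => Finset.mem_univ a)).symm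
  rw [h1, h1]
  refine hZ _ _ ?_ ?_
  · rw [← h3, ← h3, hcard]
  · rw [← h2, ← h2, hsum]

/-- If the values on a multiset do not vanish, then neither do those on an equivalent one. -/
theorem IsToric.ne_zero_of_multiset {R : Type*} [CommMonoidWithZero R] [NoZeroDivisors R]
    [Nontrivial R] {Z : Δ.Pts → R}
    (hZ : IsToric Z) {l l' : Multiset Δ.Pts} (hcard : Multiset.card l = Multiset.card l')
    (hsum : (l.map fun a : Δ.Pts => a.1).sum = (l'.map fun a : Δ.Pts => a.1).sum)
    (hl : ∀ a ∈ l, Z a ≠ 0) {a : Δ.Pts} (ha : a ∈ l') : Z a ≠ 0 := by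
  have h1 := hZ.multiset hcard hsum
  have h2 : (l.map Z).prod ≠ 0 := by
    rw [Ne, Multiset.prod_eq_zero_iff, Multiset.mem_map]
    rintro ⟨b, hb, hb0⟩
    exact hl b hb hb0
  intro h0
  apply h2
  rw [h1, Multiset.prod_eq_zero_iff, Multiset.mem_map]
  exact ⟨a, ha, h0⟩

/-- The orbit decomposition of a projective toric surface: the nonvanishing coordinates are those of
the whole polygon, of a side, or of a vertex. Two equivalent multisets of lattice points have equal
products, so nonvanishing propagates. -/
theorem IsToric.support {R : Type*} [CommMonoidWithZero R] [NoZeroDivisors R] [Nontrivial R]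
    (sh : Δ.Shape) {Z : Δ.Pts → R} (hZ : IsToric Z) (hZ0 : ∃ a, Z a ≠ 0) :
    (∀ a, Z a ≠ 0) ∨ (∃ i : Δ.Side, ∀ a, Z a ≠ 0 ↔ i.ht a.1 = 0) ∨
      ∃ a, IsVertex a ∧ (∃ i : Δ.Side, i.ht a.1 = 0) ∧ Z a ≠ 0 ∧ ∀ b, b ≠ a → Z b = 0 := by
  classical
  by_cases hface : ∃ i : Δ.Side, ∀ a, Z a ≠ 0 → i.ht a.1 = 0
  · right
    obtain ⟨i, hi⟩ := hface
    obtain ⟨b, hb⟩ := hZ0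
    by_cases hone : ∀ c, Z c ≠ 0 → c = b
    · refine Or.inr ⟨b, fun c e hce => ?_, ⟨i, hi b hb⟩, hb,
        fun c hc => by_contra fun h => hc (hone c h)⟩
      refine hone c (hZ.ne_zero_of_multiset (l := {b, b}) (l' := {c, e}) (by simp) ?_ ?_ (by simp))
      · simp [hce]
      · intro a ha
        simp at ha
        rwa [ha]
    · push Not at hone
      obtain ⟨c, hc, hcb⟩ := hone
      refine Or.inl ⟨i, fun e => ⟨hi e, fun he => ?_⟩⟩
      -- three points of an edge
      have key : ∀ k₁ k₂ : ℕ, ∀ (h₁ : k₁ ≤ i.length) (h₂ : k₂ ≤ i.length), k₁ < k₂ →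
          Z (i.edgePt k₁ h₁) ≠ 0 → Z (i.edgePt k₂ h₂) ≠ 0 → Z e ≠ 0 := by
        intro k₁ k₂ h₁ h₂ hlt hk₁ hk₂
        obtain ⟨k, hk, rfl⟩ := i.exists_edgePt he
        have hval : ∀ k (hk : k ≤ i.length), (i.edgePt k hk).1 =
          i.origin.1 + (k : ℤ) • i.tangent := fun k hk => rfl
        rcases lt_or_ge k k₁ with h | h
        · refine hZ.ne_zero_of_multiset
            (l := Multiset.replicate (k₂ - k) (i.edgePt k₁ h₁))
            (l' := Multiset.replicate (k₂ - k₁) (i.edgePt k hk) +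
              Multiset.replicate (k₁ - k) (i.edgePt k₂ h₂)) ?_ ?_ ?_
            (a := i.edgePt k hk) ?_
          · simp; omega
          · simp only [Multiset.map_add, Multiset.map_replicate, Multiset.sum_add,
              Multiset.sum_replicate, hval]
            have e1 : ((k₂ - k : ℕ) : ℤ) = k₂ - k := by omega
            have e2 : ((k₂ - k₁ : ℕ) : ℤ) = k₂ - k₁ := by omega
            have e3 : ((k₁ - k : ℕ) : ℤ) = k₁ - k := by omega
            simp only [← natCast_zsmul, e1, e2, e3]
            module
          · intro a ha
            rw [Multiset.eq_of_mem_replicate ha]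
            exact hk₁
          · rw [Multiset.mem_add, Multiset.mem_replicate]
            exact Or.inl ⟨by omega, rfl⟩
        rcases lt_or_ge k₂ k with h' | h'
        · refine hZ.ne_zero_of_multiset
            (l := Multiset.replicate (k - k₁) (i.edgePt k₂ h₂))
            (l' := Multiset.replicate (k₂ - k₁) (i.edgePt k hk) +
              Multiset.replicate (k - k₂) (i.edgePt k₁ h₁)) ?_ ?_ ?_
            (a := i.edgePt k hk) ?_
          · simp; omega
          · simp only [Multiset.map_add, Multiset.map_replicate, Multiset.sum_add,
              Multiset.sum_replicate, hval]
            have e1 : ((k - k₁ : ℕ) : ℤ) = k - k₁ := by omega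
            have e2 : ((k₂ - k₁ : ℕ) : ℤ) = k₂ - k₁ := by omega
            have e3 : ((k - k₂ : ℕ) : ℤ) = k - k₂ := by omega
            simp only [← natCast_zsmul, e1, e2, e3]
            module
          · intro a ha
            rw [Multiset.eq_of_mem_replicate ha]
            exact hk₂
          · rw [Multiset.mem_add, Multiset.mem_replicate]
            exact Or.inl ⟨by omega, rfl⟩
        · refine hZ.ne_zero_of_multiset
            (l := Multiset.replicate (k₂ - k) (i.edgePt k₁ h₁) +
              Multiset.replicate (k - k₁) (i.edgePt k₂ h₂))
            (l' := Multiset.replicate (k₂ - k₁) (i.edgePt k hk)) ?_ ?_ ?_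
            (a := i.edgePt k hk) ?_
          · simp; omega
          · simp only [Multiset.map_add, Multiset.map_replicate, Multiset.sum_add,
              Multiset.sum_replicate, hval]
            have e1 : ((k₂ - k : ℕ) : ℤ) = k₂ - k := by omega
            have e2 : ((k₂ - k₁ : ℕ) : ℤ) = k₂ - k₁ := by omega
            have e3 : ((k - k₁ : ℕ) : ℤ) = k - k₁ := by omega
            simp only [← natCast_zsmul, e1, e2, e3]
            module
          · intro a ha
            rcases Multiset.mem_add.1 ha with ha | ha <;> rw [Multiset.eq_of_mem_replicate ha]
            · exact hk₁
            · exact hk₂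
          · rw [Multiset.mem_replicate]
            exact ⟨by omega, rfl⟩
      obtain ⟨k₁, h₁, rfl⟩ := i.exists_edgePt (hi b hb)
      obtain ⟨k₂, h₂, rfl⟩ := i.exists_edgePt (hi c hc)
      rcases lt_trichotomy k₁ k₂ with h | rfl | h
      · exact key k₁ k₂ h₁ h₂ h hb hc
      · exact absurd rfl hcb
      · exact key k₂ k₁ h₂ h₁ h hc hb
  · left
    push Not at hface
    choose b hb hbi using hface
    intro e
    obtain ⟨M, hM⟩ : ∃ M : ℕ, ∀ i : Δ.Side, i.ht e.1 ≤ M := by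
      refine ⟨∑ i : Δ.Side, (i.ht e.1).toNat, fun i => ?_⟩
      have h1 := Finset.single_le_sum (f := fun i : Δ.Side => (i.ht e.1).toNat)
        (fun _ _ => Nat.zero_le _) (Finset.mem_univ i)
      have h2 := Int.self_le_toNat (i.ht e.1)
      push_cast at h1 ⊢
      have h3 : ((i.ht e.1).toNat : ℤ) ≤ ∑ i : Δ.Side, ((i.ht e.1).toNat : ℤ) := by exact_mod_cast h1
      exact h2.trans h3
    -- For each side `b i` is a nonvanishing coordinate off that side, so a multiple `M + 1` of
    -- their sum has distance more than `M` from every side. Removing `e` leaves a point of the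
    -- multiple with one summand less, and this exhibits an equivalent multiset that contains `e`.
    set N := Fintype.card Δ.Side with hN
    have hNpos : 0 < N := by
      obtain ⟨i, -⟩ := sh.exists_left sh.h_pos
      exact Fintype.card_pos_iff.2 ⟨i⟩
    let D : Multiset Δ.Pts := (M + 1) • Finset.univ.val.map b
    have hDcard : Multiset.card D = (M + 1) * N := by simp [D, hN, Finset.card_univ]
    have hDsum : (D.map fun a : Δ.Pts => a.1).sum = (M + 1) • ∑ i, (b i).1 := by
      simp only [D, Multiset.map_nsmul, Multiset.sum_nsmul, Multiset.map_map]
      rfl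
    have hcardpos : 0 < (M + 1) * N := by positivity
    obtain ⟨l, hl, hlsum⟩ := sh.exists_multiset (n := (M + 1) * N - 1)
      (m := (M + 1) • ∑ i, (b i).1 - e.1 - ((M + 1) * N - 1) • (sh.x₁, sh.y₀)) (by
        intro i
        have h1 : ∀ n : ℕ, latticePairing i.1 (n • (sh.x₁, sh.y₀)) =
            n * latticePairing i.1 (sh.x₁, sh.y₀) := fun n => by
          rw [← natCast_zsmul, latticePairing_zsmul]
        have h2 : latticePairing i.1 ((M + 1) • ∑ i', (b i').1) =
            (M + 1) * (∑ i', i.ht (b i').1 + N * i.level) := by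
          rw [← natCast_zsmul, latticePairing_zsmul]
          have : latticePairing i.1 (∑ i', (b i').1) = ∑ i', latticePairing i.1 (b i').1 := by
            simp only [latticePairing, Prod.fst_sum, Prod.snd_sum, Finset.mul_sum,
              ← Finset.sum_add_distrib]
          rw [this]
          simp only [Side.ht, Finset.sum_sub_distrib, Finset.sum_const, Finset.card_univ, ← hN,
            nsmul_eq_mul]
          push_cast
          ring
        have h3 : 1 ≤ ∑ i', i.ht (b i').1 := by
          have h4 := Finset.single_le_sum (f := fun i' : Δ.Side => i.ht (b i').1)
            (fun _ _ => Side.ht_nonneg _) (Finset.mem_univ i)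
          have h5 := Side.ht_nonneg (i := i) (b i)
          have h6 := hbi i
          omega
        have h4 := hM i
        have h5 : (((M + 1) * N - 1 : ℕ) : ℤ) = (M + 1) * N - 1 := by
          rw [Nat.cast_sub hcardpos]; push_cast; ring
        rw [latticePairing_sub, latticePairing_sub, h1, h2, h5]
        simp only [Side.ht] at h4 h3 ⊢
        nlinarith)
    refine hZ.ne_zero_of_multiset (l := D) (l' := e ::ₘ l) ?_ ?_ ?_ (Multiset.mem_cons_self _ _)
    · rw [Multiset.card_cons, hl, hDcard]; omega
    · rw [Multiset.map_cons, Multiset.sum_cons, hlsum, hDsum]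
      abel
    · intro a ha
      have := Multiset.mem_of_mem_nsmul ha
      rw [Multiset.mem_map] at this
      obtain ⟨i, -, rfl⟩ := this
      exact hb i

end LatticePolygon

namespace LatticePolygon

open Polynomial
open scoped Polynomial.Bivariate

variable {Δ : LatticePolygon} {K : Type*} [Field K]

/-! ### Integrality of the curve of an irreducible equation -/

/-- The support of a product reaches the sum of the minima of a linear functional. -/
theorem exists_mem_supp_mul (i : Δ.Side) {F H : K[X][Y]} {s : ℤ × ℤ} (hs : s ∈ supp F)
    (hsmin : ∀ t ∈ supp F, latticePairing i.1 s ≤ latticePairing i.1 t) {t : ℤ × ℤ} (ht : t ∈ supp H) :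
    ∃ m ∈ supp (F * H), latticePairing i.1 m ≤ latticePairing i.1 s + latticePairing i.1 t := by
  obtain ⟨u, hu⟩ := Side.exists_coord (i := i)
  -- The order is lexicographic: first the normal, then a coordinate along the side. The minimal
  -- term of each factor is then unique and their product cannot cancel.
  have hmin : ∀ G : K[X][Y], (supp G).Nonempty → ∃ c r : ℕ, (G.coeff r).coeff c ≠ 0 ∧
      ∀ c' r' : ℕ, (G.coeff r').coeff c' ≠ 0 →
        toLex (latticePairing i.1 ((c : ℤ), (r : ℤ)), latticePairing u ((c : ℤ), (r : ℤ))) ≤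
        toLex (latticePairing i.1 ((c' : ℤ), (r' : ℤ)), latticePairing u ((c' : ℤ), (r' : ℤ))) := by
    intro G hG
    obtain ⟨m, ⟨c, r, rfl, hcr⟩, hm⟩ := (finite_supp G).exists_minimalFor
      (fun t => toLex (latticePairing i.1 t, latticePairing u t)) _ hG
    exact ⟨c, r, hcr, fun c' r' h => (le_total _ _).elim id (hm ⟨c', r', rfl, h⟩)⟩
  obtain ⟨c₁, r₁, h₁, hm₁⟩ := hmin F ⟨s, hs⟩
  obtain ⟨c₂, r₂, h₂, hm₂⟩ := hmin H ⟨t, ht⟩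
  have hadd : ∀ (n : ℤ × ℤ) (c r c' r' : ℕ), latticePairing n (((c + c' : ℕ) : ℤ), ((r + r' : ℕ) : ℤ)) =
      latticePairing n ((c : ℤ), (r : ℤ)) + latticePairing n ((c' : ℤ), (r' : ℤ)) := by
    intro n c r c' r'
    simp only [latticePairing]; push_cast; ring
  have huniq : ∀ c r c' r' : ℕ, c + c' = c₁ + c₂ → r + r' = r₁ + r₂ → (F.coeff r).coeff c ≠ 0 →
      (H.coeff r').coeff c' ≠ 0 → c = c₁ ∧ r = r₁ := by
    intro c r c' r' hc hr hF hH
    have e1 := hm₁ c r hF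
    have e2 := hm₂ c' r' hH
    rw [Prod.Lex.toLex_le_toLex] at e1 e2
    have p1 := hadd i.1 c r c' r'
    have p2 := hadd u c r c' r'
    rw [hc, hr, hadd] at p1 p2
    simp only at e1 e2
    have q1 : latticePairing i.1 ((c : ℤ), (r : ℤ)) = latticePairing i.1 ((c₁ : ℤ), (r₁ : ℤ)) := by omega
    have q2 : latticePairing u ((c : ℤ), (r : ℤ)) = latticePairing u ((c₁ : ℤ), (r₁ : ℤ)) := by omega
    have := hu (((c : ℤ), (r : ℤ)) - ((c₁ : ℤ), (r₁ : ℤ))) (by rw [latticePairing_sub, q1, sub_self])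
    rw [latticePairing_sub, q2, sub_self, zero_smul, sub_eq_zero, Prod.mk.injEq] at this
    exact ⟨by exact_mod_cast this.1, by exact_mod_cast this.2⟩
  refine ⟨(((c₁ + c₂ : ℕ) : ℤ), ((r₁ + r₂ : ℕ) : ℤ)), ⟨_, _, rfl, ?_⟩, ?_⟩
  · rw [coeff_mul, finsetSum_coeff, Finset.sum_eq_single (r₁, r₂)]
    · rw [coeff_mul, Finset.sum_eq_single (c₁, c₂)]
      · exact mul_ne_zero h₁ h₂
      · rintro ⟨c, c'⟩ hcc hne
        by_contra hcon
        rw [Finset.HasAntidiagonal.mem_antidiagonal] at hcc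
        have := huniq c r₁ c' r₂ hcc rfl (left_ne_zero_of_mul hcon) (right_ne_zero_of_mul hcon)
        apply hne
        simp only at hcc
        ext <;> simp only <;> omega
      · intro h
        exact h (Finset.HasAntidiagonal.mem_antidiagonal.2 rfl) |>.elim
    · rintro ⟨r, r'⟩ hrr hne
      rw [Finset.HasAntidiagonal.mem_antidiagonal] at hrr
      rw [coeff_mul]
      refine Finset.sum_eq_zero fun cc hcc => ?_
      rw [Finset.HasAntidiagonal.mem_antidiagonal] at hcc
      by_contra hcon
      have := huniq cc.1 r cc.2 r' hcc hrr (left_ne_zero_of_mul hcon) (right_ne_zero_of_mul hcon)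
      apply hne
      simp only at hrr
      ext <;> simp only <;> omega
    · intro h
      exact h (Finset.HasAntidiagonal.mem_antidiagonal.2 rfl) |>.elim
  · obtain ⟨c, r, rfl, hcr⟩ := hs
    obtain ⟨c', r', rfl, hcr'⟩ := ht
    have e1 := hm₁ c r hcr
    have e2 := hm₂ c' r' hcr'
    rw [Prod.Lex.toLex_le_toLex] at e1 e2
    rw [hadd]
    simp only at e1 e2
    omega

namespace Shape

variable (sh : Δ.Shape)

/-- The homomorphism from the homogeneous coordinate ring of the ambient space to the polynomial
ring, which sends the coordinate of `a` to the monomial of `a` in degree one. -/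
def monomialMap (K : Type*) [Field K] : MvPolynomial Δ.Pts K →ₐ[K] (Polynomial (Polynomial (Polynomial K))) :=
  MvPolynomial.aeval fun a => (monomial 1 (monomial (sh.row a) (monomial (sh.col a) (1 : K))) :
    Polynomial (Polynomial (Polynomial K)))

theorem monomialMap_monomial (u : Δ.Pts →₀ ℕ) (c : K) :
    sh.monomialMap K (MvPolynomial.monomial u c) =
      monomial (∑ a, u a) (monomial (∑ a, u a * sh.row a) (monomial (∑ a, u a * sh.col a) c)) := by
  have h1 : ∀ s : Finset Δ.Pts, ∏ a ∈ s, (monomial 1 (monomial (sh.row a)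
      (monomial (sh.col a) (1 : K))) : (Polynomial (Polynomial (Polynomial K)))) ^ u a =
      monomial (∑ a ∈ s, u a) (monomial (∑ a ∈ s, u a * sh.row a)
        (monomial (∑ a ∈ s, u a * sh.col a) 1)) := by
    intro s
    induction s using Finset.induction_on with
    | empty => simp only [Finset.prod_empty, Finset.sum_empty, monomial_zero_left, map_one]
    | insert a s ha ih =>
      rw [Finset.prod_insert ha, ih, Finset.sum_insert ha, Finset.sum_insert ha, Finset.sum_insert ha]
      simp only [monomial_pow, monomial_mul_monomial, one_pow, one_mul, mul_one]
      rw [mul_comm (sh.row a), mul_comm (sh.col a)]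
  rw [monomialMap, MvPolynomial.aeval_monomial, Finsupp.prod_fintype _ _ (by simp), h1]
  have : algebraMap K (Polynomial (Polynomial (Polynomial K))) c = C (C (C c)) := rfl
  rw [this, C_mul_monomial, C_mul_monomial, C_mul_monomial, mul_one]

theorem monomialMap_linearForm (C₀ : LinearSystem K Δ) :
    sh.monomialMap K C₀.linearForm = monomial 1 (sh.poly C₀.coeff) := by
  rw [LinearSystem.linearForm, map_sum, poly, map_sum]
  refine Finset.sum_congr rfl fun a _ => ?_
  rw [map_mul, monomialMap, MvPolynomial.aeval_X, MvPolynomial.aeval_C]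
  have : algebraMap K (Polynomial (Polynomial (Polynomial K))) (C₀.coeff a) = C (C (C (C₀.coeff a))) := rfl
  rw [this, C_mul_monomial, C_mul_monomial, C_mul_monomial, mul_one]

theorem sum_smul_pts (u : Δ.Pts → ℕ) : ∑ a, u a • a.1 = (∑ a, u a) • (sh.x₁, sh.y₀) +
    (((∑ a, u a * sh.col a : ℕ) : ℤ), ((∑ a, u a * sh.row a : ℕ) : ℤ)) := by
  have h1 : ∀ a : Δ.Pts, a.1 = (sh.x₁, sh.y₀) + ((sh.col a : ℤ), (sh.row a : ℤ)) := fun a =>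
    Prod.ext (sh.fst_eq a) (sh.snd_eq a)
  simp only [Finset.sum_smul]
  rw [Finset.sum_congr rfl fun a _ => by rw [h1 a, smul_add], Finset.sum_add_distrib]
  congr 1
  ext
  · rw [Prod.fst_sum]; push_cast; exact Finset.sum_congr rfl fun a _ => by simp
  · rw [Prod.snd_sum]; push_cast; exact Finset.sum_congr rfl fun a _ => by simp

/-- The toric ideal is generated by binomials. -/
theorem mem_span_toricBinomials {G : MvPolynomial Δ.Pts K} (hG : sh.monomialMap K G = 0) :
    G ∈ Ideal.span (Δ.toricBinomials K) := by
  classical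
  let wt : (Δ.Pts →₀ ℕ) → ℕ × ℕ × ℕ := fun u =>
    (∑ a, u a, ∑ a, u a * sh.row a, ∑ a, u a * sh.col a)
  have hbin : ∀ u v : Δ.Pts →₀ ℕ, wt u = wt v →
      (MvPolynomial.monomial u (1 : K) - MvPolynomial.monomial v 1) ∈
        Ideal.span (Δ.toricBinomials K) := by
    intro u v huv
    simp only [wt, Prod.mk.injEq] at huv
    refine Ideal.subset_span ⟨u, v, huv.1, ?_, rfl⟩
    rw [sh.sum_smul_pts u, sh.sum_smul_pts v, huv.1, huv.2.1, huv.2.2]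
  -- One monomial is chosen for every degree and weight. Modulo binomials each monomial is the
  -- chosen one of its weight, and the vanishing image says that the coefficients of each weight sum
  -- to zero.
  let rep : ℕ × ℕ × ℕ → (Δ.Pts →₀ ℕ) := fun w => if h : ∃ u, wt u = w then h.choose else 0
  have hrep : ∀ u, wt (rep (wt u)) = wt u := by
    intro u
    have h : ∃ u', wt u' = wt u := ⟨u, rfl⟩
    simp only [rep, dif_pos h]
    exact h.choose_spec
  have h1 : G - ∑ u ∈ G.support, MvPolynomial.C (G.coeff u) * MvPolynomial.monomial (rep (wt u)) 1 ∈
      Ideal.span (Δ.toricBinomials K) := by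
    have : G - ∑ u ∈ G.support, MvPolynomial.C (G.coeff u) * MvPolynomial.monomial (rep (wt u)) 1 =
        ∑ u ∈ G.support, MvPolynomial.C (G.coeff u) *
          (MvPolynomial.monomial u 1 - MvPolynomial.monomial (rep (wt u)) 1) := by
      conv_lhs => enter [1]; rw [G.as_sum]
      rw [← Finset.sum_sub_distrib]
      refine Finset.sum_congr rfl fun u _ => ?_
      rw [mul_sub, MvPolynomial.C_mul_monomial, MvPolynomial.C_mul_monomial, mul_one]
    rw [this]
    exact Ideal.sum_mem _ fun u _ => Ideal.mul_mem_left _ _ (hbin _ _ (hrep u).symm)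
  have h2 : ∑ u ∈ G.support, MvPolynomial.C (G.coeff u) *
      MvPolynomial.monomial (rep (wt u)) (1 : K) = 0 := by
    rw [← Finset.sum_fiberwise_of_maps_to (s := G.support) (t := G.support.image wt) (g := wt)
      (fun u hu => Finset.mem_image_of_mem _ hu)]
    refine Finset.sum_eq_zero fun w _ => ?_
    have h3 : ∑ u ∈ G.support with wt u = w, G.coeff u = 0 := by
      have h4 := congrArg (fun P => ((P.coeff w.1).coeff w.2.1).coeff w.2.2) hG
      simp only [coeff_zero] at h4
      rw [← h4, G.as_sum, map_sum, finsetSum_coeff, finsetSum_coeff, finsetSum_coeff, ← G.as_sum,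
        Finset.sum_filter]
      refine Finset.sum_congr rfl fun u _ => ?_
      rw [monomialMap_monomial]
      simp only [coeff_monomial, wt, Prod.ext_iff]
      by_cases e1 : ∑ a, u a = w.1 <;> by_cases e2 : ∑ a, u a * sh.row a = w.2.1 <;>
        by_cases e3 : ∑ a, u a * sh.col a = w.2.2 <;> simp [e1, e2, e3, coeff_monomial]
    rw [Finset.sum_congr rfl (g := fun u => MvPolynomial.C (G.coeff u) *
      MvPolynomial.monomial (rep w) 1) (fun u hu => by rw [(Finset.mem_filter.1 hu).2]),
      ← Finset.sum_mul, ← map_sum, h3, map_zero, zero_mul]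
  rwa [h2, sub_zero] at h1

/-- The monomials of `nΔ` are in the image of the homogeneous coordinate ring. -/
theorem exists_monomialMap_eq {n c r : ℕ}
    (h : ∀ i : Δ.Side, 0 ≤ latticePairing i.1 ((c : ℤ), (r : ℤ)) + n * i.ht (sh.x₁, sh.y₀)) :
    ∃ G : MvPolynomial Δ.Pts K, sh.monomialMap K G = monomial n (monomial r (monomial c 1)) := by
  obtain ⟨l, hl, hls⟩ := sh.exists_multiset h
  have hcard : ∑ a, (Multiset.toFinsupp l) a = n := by
    rw [← hl]
    simp only [Multiset.toFinsupp_apply]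
    exact Multiset.sum_count_eq_card (s := Finset.univ) fun a _ => Finset.mem_univ a
  have hsum : ∑ a, (Multiset.toFinsupp l) a • a.1 = n • (sh.x₁, sh.y₀) + ((c : ℤ), (r : ℤ)) := by
    rw [← hls, Finset.sum_multiset_map_count]
    simp only [Multiset.toFinsupp_apply]
    refine (Finset.sum_subset (Finset.subset_univ _) fun a _ ha => ?_).symm
    rw [Multiset.count_eq_zero_of_notMem (by simpa using ha), zero_smul]
  rw [sh.sum_smul_pts, hcard] at hsum
  have h3 := add_left_cancel hsum
  rw [Prod.mk.injEq, Nat.cast_inj, Nat.cast_inj] at h3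
  exact ⟨MvPolynomial.monomial (Multiset.toFinsupp l) 1, by
    rw [monomialMap_monomial, hcard, h3.1, h3.2]⟩

/-- The part of degree `n` is supported in `nΔ`. -/
theorem supp_coeff_monomialMap (G : MvPolynomial Δ.Pts K) (n : ℕ) {t : ℤ × ℤ}
    (ht : t ∈ supp ((sh.monomialMap K G).coeff n)) (i : Δ.Side) :
    0 ≤ latticePairing i.1 t + n * i.ht (sh.x₁, sh.y₀) := by
  obtain ⟨c, r, rfl, hcr⟩ := ht
  rw [G.as_sum, map_sum, finsetSum_coeff, finsetSum_coeff, finsetSum_coeff] at hcr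
  obtain ⟨u, -, hu⟩ := Finset.exists_ne_zero_of_sum_ne_zero hcr
  rw [monomialMap_monomial, coeff_monomial] at hu
  split_ifs at hu with h1
  · rw [coeff_monomial] at hu
    split_ifs at hu with h2
    · rw [coeff_monomial] at hu
      split_ifs at hu with h3
      · subst h1 h2 h3
        have h4 : latticePairing i.1 (((∑ a, u a * sh.col a : ℕ) : ℤ), ((∑ a, u a * sh.row a : ℕ) : ℤ)) +
            (∑ a, u a : ℕ) * i.ht (sh.x₁, sh.y₀) = ∑ a, (u a : ℤ) * i.ht a.1 := by
          have h5 : ∀ a : Δ.Pts, i.ht a.1 =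
              latticePairing i.1 ((sh.col a : ℤ), (sh.row a : ℤ)) + i.ht (sh.x₁, sh.y₀) := fun a => by
            rw [← sh.ht_eq_base]
            congr 1
            exact Prod.ext (sh.fst_eq a) (sh.snd_eq a)
          simp only [h5, latticePairing]
          push_cast
          rw [Finset.mul_sum, Finset.mul_sum, Finset.sum_mul, ← Finset.sum_add_distrib,
            ← Finset.sum_add_distrib]
          exact Finset.sum_congr rfl fun a _ => by ring
        rw [h4]
        exact Finset.sum_nonneg fun a _ => mul_nonneg (Int.natCast_nonneg _) (Side.ht_nonneg a)
      · exact absurd rfl hu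
    · simp at hu
  · simp at hu

variable {θx θy : RatFunc K}

/-- The curve of an irreducible equation that does not vanish at the vertices is integral. -/
theorem isIntegralCurve {C₀ : LinearSystem K Δ} (hirr : Irreducible (sh.poly C₀.coeff))
    (hx : ¬ ∃ c, θx = RatFunc.C c) (hx0 : θx ≠ 0) (hy0 : θy ≠ 0)
    (hrel : aevalAeval θx θy (sh.poly C₀.coeff) = 0) (hv : ∀ a, IsVertex a → C₀.coeff a ≠ 0) :
    C₀.IsIntegralCurve := by
  classical
  let ev : K[X][Y] →ₐ[K] RatFunc K := aevalAeval θx θy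
  -- The degree is kept as a variable and the torus coordinates are evaluated at a point of the
  -- curve over `K(t)`. The kernel is prime, and it remains to identify it with the saturated ideal
  -- of the curve.
  let φ : MvPolynomial Δ.Pts K →+* Polynomial (RatFunc K) :=
    (mapRingHom ev.toRingHom).comp (sh.monomialMap K).toRingHom
  have hφ : ∀ G, φ G = (sh.monomialMap K G).map ev.toRingHom := fun G => rfl
  have hdeg := natDegree_ne_zero_of_aevalAeval hx hirr.ne_zero hrel
  have hφlin : φ C₀.linearForm = 0 := by
    rw [hφ, monomialMap_linearForm, map_monomial]
    change monomial 1 (ev (sh.poly C₀.coeff)) = 0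
    rw [show ev (sh.poly C₀.coeff) = 0 from hrel, map_zero]
  have hspan : Ideal.span C₀.equations ≤ RingHom.ker φ := by
    rw [Ideal.span_le]
    rintro G (⟨u, v, h1, h2, rfl⟩ | rfl)
    · have h3 : sh.monomialMap K (MvPolynomial.monomial u 1 - MvPolynomial.monomial v 1) = 0 := by
        rw [sh.sum_smul_pts, sh.sum_smul_pts, h1] at h2
        have h3 := add_left_cancel h2
        rw [Prod.mk.injEq, Nat.cast_inj, Nat.cast_inj] at h3
        rw [map_sub, monomialMap_monomial, monomialMap_monomial, h1, h3.1, h3.2, sub_self]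
      rw [SetLike.mem_coe, RingHom.mem_ker, hφ, h3, Polynomial.map_zero]
    · exact hφlin
  have hker : ∀ G, φ G = 0 → G ∈ Ideal.span C₀.equations := by
    intro G hG
    have hdvd : ∀ n, sh.poly C₀.coeff ∣ (sh.monomialMap K G).coeff n := by
      intro n
      refine dvd_of_aevalAeval_eq_zero hx hirr hrel ?_
      have := congrArg (fun P => P.coeff n) hG
      rw [hφ] at this
      simp only [coeff_map, coeff_zero] at this
      exact this
    choose H hH using hdvd
    have hmem : ∀ n, ∃ G' : MvPolynomial Δ.Pts K, sh.monomialMap K G' = monomial (n - 1) (H n) ∧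
        (n = 0 → H n = 0) := by
      intro n
      rcases Nat.eq_zero_or_pos n with rfl | hn
      -- In degree zero the image consists of constants, which the equation, of positive degree,
      -- divides only if they vanish.
      · have h0 : H 0 = 0 := by
          by_contra hne
          have h1 : ((sh.monomialMap K G).coeff 0).natDegree = 0 := by
            rw [natDegree_eq_zero_iff_degree_le_zero, degree_le_zero_iff]
            ext r c
            rcases Nat.eq_zero_or_pos r with rfl | hr
            · rw [coeff_C_zero]
            rw [coeff_C_of_ne_zero hr.ne', coeff_zero]
            by_contra hcr
            have hm : ∀ i : Δ.Side, 0 ≤ latticePairing i.1 ((c : ℤ), (r : ℤ)) +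
                (0 : ℕ) * i.ht (sh.x₁, sh.y₀) :=
              sh.supp_coeff_monomialMap G 0 ⟨c, r, rfl, hcr⟩
            obtain ⟨l, hl, hls⟩ := sh.exists_multiset hm
            rw [Multiset.card_eq_zero] at hl
            rw [hl] at hls
            simp only [Multiset.map_zero, Multiset.sum_zero, zero_smul, zero_add] at hls
            have := congrArg Prod.snd hls
            simp at this
            omega
          have h2 := congrArg natDegree (hH 0)
          rw [h1, natDegree_mul hirr.ne_zero hne] at h2
          omega
        exact ⟨0, by rw [h0, map_zero, map_zero], fun _ => h0⟩
      · have hex : ∀ c r : ℕ, ((H n).coeff r).coeff c ≠ 0 → ∃ G' : MvPolynomial Δ.Pts K,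
            sh.monomialMap K G' = monomial (n - 1) (monomial r (monomial c 1)) := by
          intro c r hcr
          refine sh.exists_monomialMap_eq fun i => ?_
          have ho := i.isVertex_edgePt (Nat.zero_le _) (Or.inl rfl)
          rw [i.edgePt_zero] at ho
          have hval : ∀ a : Δ.Pts, latticePairing i.1 ((sh.col a : ℤ), (sh.row a : ℤ)) =
              i.ht a.1 - i.ht (sh.x₁, sh.y₀) := fun a => by
            have h5 := sh.ht_eq_base i ((sh.col a : ℤ), (sh.row a : ℤ))
            rw [show ((sh.x₁, sh.y₀) + ((sh.col a : ℤ), (sh.row a : ℤ)) : ℤ × ℤ) = a.1 from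
              Prod.ext (sh.fst_eq a).symm (sh.snd_eq a).symm] at h5
            omega
          -- The equation is nonzero at a vertex of each side, so minima of functionals add in the
          -- product. As the product lies in `nΔ`, the cofactor lies in `(n - 1)Δ` and lifts to the
          -- coordinate ring.
          obtain ⟨m, hm, hmle⟩ := exists_mem_supp_mul i (F := sh.poly C₀.coeff) (H := H n)
            (s := ((sh.col i.origin : ℤ), (sh.row i.origin : ℤ)))
            ⟨_, _, rfl, by rw [sh.coeff_poly]; exact hv _ ho⟩ (by
              rintro _ ⟨c', r', rfl, h⟩
              obtain ⟨a, rfl, rfl⟩ : ∃ a, sh.row a = r' ∧ sh.col a = c' := by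
                by_contra! hcon
                exact h (sh.coeff_poly_eq_zero _ hcon)
              rw [hval, hval, i.ht_origin]
              have := Side.ht_nonneg (i := i) a
              omega) (t := ((c : ℤ), (r : ℤ))) ⟨c, r, rfl, hcr⟩
          rw [← hH] at hm
          have h6 := sh.supp_coeff_monomialMap G n hm i
          rw [hval, i.ht_origin] at hmle
          have h7 : ((n - 1 : ℕ) : ℤ) = n - 1 := by omega
          rw [h7]
          linarith
        choose! g hg using hex
        refine ⟨∑ r ∈ (H n).support, ∑ c ∈ ((H n).coeff r).support,
          MvPolynomial.C (((H n).coeff r).coeff c) * g c r, ?_, by omega⟩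
        conv_rhs => rw [(H n).as_sum_support, map_sum]
        rw [map_sum]
        refine Finset.sum_congr rfl fun r hr => ?_
        conv_rhs => rw [((H n).coeff r).as_sum_support, map_sum, map_sum]
        rw [map_sum]
        refine Finset.sum_congr rfl fun c hc => ?_
        rw [map_mul, hg c r (mem_support_iff.1 hc), monomialMap, MvPolynomial.aeval_C]
        have : algebraMap K (Polynomial (Polynomial (Polynomial K))) (((H n).coeff r).coeff c) =
          Polynomial.C (Polynomial.C (Polynomial.C (((H n).coeff r).coeff c))) := rfl
        rw [this, C_mul_monomial, C_mul_monomial, C_mul_monomial, mul_one]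
    choose g hg hg0 using hmem
    have hzero : sh.monomialMap K (G - C₀.linearForm *
        ∑ n ∈ (sh.monomialMap K G).support, g n) = 0 := by
      rw [map_sub, map_mul, map_sum, monomialMap_linearForm, sub_eq_zero, Finset.mul_sum]
      conv_lhs => rw [(sh.monomialMap K G).as_sum_support]
      refine Finset.sum_congr rfl fun n _ => ?_
      rw [hg, monomial_mul_monomial, hH n]
      rcases Nat.eq_zero_or_pos n with rfl | hn
      · rw [hg0 0 rfl, mul_zero, map_zero, map_zero]
      · rw [Nat.add_sub_cancel' hn]
    have h1 := sh.mem_span_toricBinomials hzero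
    have h2 := Ideal.span_mono (s := Δ.toricBinomials K) (t := C₀.equations)
      Set.subset_union_left h1
    have h3 := Ideal.mul_mem_right (∑ n ∈ (sh.monomialMap K G).support, g n) _
      (Ideal.subset_span (s := C₀.equations) (Set.mem_union_right _ rfl : C₀.linearForm ∈ C₀.equations))
    have := Ideal.add_mem _ h2 h3
    rwa [sub_add_cancel] at this
  have heq : C₀.ideal = RingHom.ker φ := by
    ext G
    constructor
    · intro hG
      -- Saturation adds nothing, since `φ` maps the coordinate to a nonzero element of a domain.
      obtain ⟨N, hN⟩ := hG sh.base
      have h1 := hspan hN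
      rw [RingHom.mem_ker, map_mul, map_pow, mul_eq_zero] at h1
      rcases h1 with h1 | h1
      · exfalso
        have h2 := eq_zero_of_pow_eq_zero h1
        rw [hφ, monomialMap, MvPolynomial.aeval_X, map_monomial, monomial_eq_zero_iff] at h2
        change ev _ = 0 at h2
        rw [← C_mul_X_pow_eq_monomial, ← C_mul_X_pow_eq_monomial] at h2
        simp only [ev, map_mul, map_pow, aevalAeval_C, aevalAeval_Y, aeval_X, map_one, one_mul] at h2
        exact mul_ne_zero (pow_ne_zero _ hx0) (pow_ne_zero _ hy0) h2
      · exact h1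
    · intro hG a
      exact ⟨0, by rw [pow_zero, one_mul]; exact hker G hG⟩
  rw [LinearSystem.IsIntegralCurve, heq]
  exact RingHom.ker_isPrime φ

end Shape

/-- A curve whose equation does not vanish at the vertices is torically transverse. -/
theorem isToricallyTransverse {C₀ : LinearSystem K Δ} (hv : ∀ a, IsVertex a → C₀.coeff a ≠ 0) :
    C₀.IsToricallyTransverse := by
  rintro z ⟨hz, hlin⟩ ⟨-, a, ha⟩
  rw [mem_toricSurface_iff] at hz
  have hza : z.rep a ≠ 0 := by
    intro h
    apply z.rep_nonzero
    ext b
    by_cases hb : b = a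
    · rw [hb, h]; rfl
    · rw [ha b hb]; rfl
  have hvert : IsVertex a := by
    intro b c hbc
    by_contra hne
    refine hz.ne_zero_of_multiset (l := {a, a}) (l' := {b, c}) (by simp) (by simp [hbc]) ?_
      (a := b) (by simp) (ha b hne)
    intro e he
    simp at he
    rwa [he]
  rw [LinearSystem.linearForm, map_sum, Finset.sum_eq_single a] at hlin
  · rw [map_mul, MvPolynomial.eval_C, MvPolynomial.eval_X, mul_eq_zero] at hlin
    exact hlin.elim (hv a hvert) hza
  · intro b _ hb
    rw [map_mul, MvPolynomial.eval_X, ha b hb, mul_zero]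
  · simp

end LatticePolygon

namespace LatticePolygon

open Polynomial

variable {Δ : LatticePolygon}

/-! ### Lattice frames -/

namespace Shape

variable (sh : Δ.Shape)

include sh in
/-- The tangent vector of a side is completed to a basis of the lattice by a vector from the side to
a lattice point at distance one. -/
theorem exists_frame (i : Δ.Side) : ∃ (o₂ : Δ.Pts) (u : ℤ × ℤ), i.ht o₂.1 = 1 ∧
    ∀ v : ℤ × ℤ, v = latticePairing u v • i.tangent + latticePairing i.1 v • (o₂.1 - i.origin.1) := by
  obtain ⟨o₂, ho₂⟩ := sh.exists_ht_one i
  obtain ⟨u, hu⟩ := Side.exists_coord (i := i)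
  have h1 : latticePairing i.1 (o₂.1 - i.origin.1) = 1 := by
    rw [latticePairing_sub, ← ho₂, i.ht_eq]
  refine ⟨o₂, u - latticePairing u (o₂.1 - i.origin.1) • i.1, ho₂, fun v => ?_⟩
  have h2 := hu (v - latticePairing i.1 v • (o₂.1 - i.origin.1)) (by
    rw [latticePairing_sub, latticePairing_zsmul, h1]; ring)
  have h3 : latticePairing (u - latticePairing u (o₂.1 - i.origin.1) • i.1) v =
      latticePairing u (v - latticePairing i.1 v • (o₂.1 - i.origin.1)) := by
    simp only [latticePairing, Prod.fst_sub, Prod.snd_sub, Prod.smul_fst, Prod.smul_snd, smul_eq_mul]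
    ring
  rw [h3, ← h2, sub_add_cancel]

include sh in
/-- No side contains another one. -/
theorem exists_mem_face_notMem {i i' : Δ.Side} (h : i ≠ i') : ∃ a ∈ Δ.face i.1, a ∉ Δ.face i'.1 := by
  by_contra! hcon
  obtain ⟨o₂, u, -, hu⟩ := sh.exists_frame i
  have h1 := (Side.mem_face_iff _).1 (hcon _ ((Side.mem_face_iff _).2 i.ht_origin))
  have h2 := (Side.mem_face_iff _).1 (hcon _ ((Side.mem_face_iff _).2 (i.ht_edgePt 1 i.length_pos)))
  have h3 : latticePairing i'.1 i.tangent = 0 := by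
    rw [Side.ht] at h1 h2
    simp only [Side.edgePt, Nat.cast_one, one_smul, latticePairing_add] at h2
    omega
  set c := latticePairing i'.1 (o₂.1 - i.origin.1) with hc
  have h4 : ∀ v, latticePairing i'.1 v = c * latticePairing i.1 v := by
    intro v
    conv_lhs => rw [hu v]
    rw [latticePairing_add, latticePairing_zsmul, latticePairing_zsmul, h3, ← hc]
    ring
  have hc0 : 0 ≤ c := by
    have := Side.ht_nonneg (i := i') o₂
    rw [hc, latticePairing_sub]
    rw [Side.ht] at h1 this
    omega
  have e1 := h4 (1, 0)
  have e2 := h4 (0, 1)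
  simp only [latticePairing, mul_one, mul_zero, add_zero, zero_add] at e1 e2
  have hg := i'.2.1
  rw [e1, e2, Int.gcd_mul_left, i.2.1, mul_one] at hg
  have : c = 1 := by omega
  rw [this, one_mul] at e1 e2
  exact h (Subtype.ext (Prod.ext e1.symm e2.symm))

end Shape

/-- The value of a toric family at a point in terms of a lattice frame. -/
theorem IsToric.frame {R : Type*} [CommMonoid R] {Z : Δ.Pts → R} (hZ : IsToric Z)
    {a o o₁ o₂ : Δ.Pts} {k k' l l' : ℕ}
    (h : a.1 - o.1 = ((k : ℤ) - k') • (o₁.1 - o.1) + ((l : ℤ) - l') • (o₂.1 - o.1)) :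
    Z a * (Z o₁ ^ k' * Z o ^ k * (Z o₂ ^ l' * Z o ^ l)) =
      Z o * (Z o₁ ^ k * Z o ^ k' * (Z o₂ ^ l * Z o ^ l')) := by
  have := hZ.multiset
    (l := a ::ₘ (Multiset.replicate k' o₁ + Multiset.replicate k o +
      (Multiset.replicate l' o₂ + Multiset.replicate l o)))
    (l' := o ::ₘ (Multiset.replicate k o₁ + Multiset.replicate k' o +
      (Multiset.replicate l o₂ + Multiset.replicate l' o))) (by simp; omega) (by
      simp only [Multiset.map_cons, Multiset.map_add, Multiset.map_replicate, Multiset.sum_cons,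
        Multiset.sum_add, Multiset.sum_replicate]
      rw [← sub_eq_zero]
      rw [← sub_eq_zero] at h
      rw [← h]
      simp only [← natCast_zsmul]
      module)
  simpa using this

/-- Natural exponents on both sides of `frame` encode positive and negative parts; where nothing
vanishes they combine to integral powers. -/
theorem IsToric.eq_zpow {L : Type*} [Field L] {Z : Δ.Pts → L} (hZ : IsToric Z) (h0 : ∀ a, Z a ≠ 0)
    {a o o₁ o₂ : Δ.Pts} {k l : ℤ} (h : a.1 - o.1 = k • (o₁.1 - o.1) + l • (o₂.1 - o.1)) :
    Z a = Z o * ((Z o₁ / Z o) ^ k * (Z o₂ / Z o) ^ l) := by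
  have hk : k = (k.toNat : ℤ) - ((-k).toNat : ℤ) := by omega
  have hl : l = (l.toNat : ℤ) - ((-l).toNat : ℤ) := by omega
  have h1 := hZ.frame (a := a) (o := o) (o₁ := o₁) (o₂ := o₂) (k := k.toNat) (k' := (-k).toNat)
    (l := l.toNat) (l' := (-l).toNat) (by rw [← hk, ← hl]; exact h)
  have h2 : ∀ (b : Δ.Pts) (n : ℤ), (Z b / Z o) ^ n =
      Z b ^ n.toNat * Z o ^ (-n).toNat / (Z b ^ (-n).toNat * Z o ^ n.toNat) := by
    intro b n
    have hn : n = (n.toNat : ℤ) - ((-n).toNat : ℤ) := by omega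
    conv_lhs => rw [hn]
    rw [zpow_sub₀ (div_ne_zero (h0 _) (h0 _)), zpow_natCast, zpow_natCast, div_pow, div_pow,
      div_div_div_eq]
    ring
  have e1 := h0 o
  have e2 := h0 o₁
  have e3 := h0 o₂
  rw [h2, h2, div_mul_div_comm, mul_div_assoc', eq_div_iff (by positivity)]
  exact h1

theorem zpow_latticePairing {L : Type*} [Field L] {A B : L} (hA : A ≠ 0) (hB : B ≠ 0)
    (u n v : ℤ × ℤ) : A ^ latticePairing u v * B ^ latticePairing n v =
      (A ^ u.1 * B ^ n.1) ^ v.1 * (A ^ u.2 * B ^ n.2) ^ v.2 := by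
  simp only [latticePairing, zpow_add₀ hA, zpow_add₀ hB, mul_zpow, zpow_mul]
  ring

theorem zpow_pair_zsmul {L : Type*} [Field L] {x y : L} (v : ℤ × ℤ) (k : ℤ) :
    x ^ (k • v).1 * y ^ (k • v).2 = (x ^ v.1 * y ^ v.2) ^ k := by
  rw [mul_zpow, ← zpow_mul, ← zpow_mul, Prod.smul_fst, Prod.smul_snd, smul_eq_mul, smul_eq_mul,
    mul_comm k, mul_comm k]

/-- A nowhere vanishing toric family is a family of Laurent monomials. -/
theorem IsToric.exists_eq_monomial (sh : Δ.Shape) {L : Type*} [Field L] {Z : Δ.Pts → L}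
    (hZ : IsToric Z) (h0 : ∀ a, Z a ≠ 0) : ∃ c x y : L, c ≠ 0 ∧ x ≠ 0 ∧ y ≠ 0 ∧
      ∀ a, Z a = c * (x ^ sh.col a * y ^ sh.row a) := by
  obtain ⟨i, -⟩ := sh.exists_left sh.h_pos
  obtain ⟨o₂, u, -, hu⟩ := sh.exists_frame i
  set o := i.origin
  set o₁ := i.edgePt 1 i.length_pos
  have ht : i.tangent = o₁.1 - o.1 := by
    simp only [o₁, o, Side.edgePt, Nat.cast_one, one_smul, add_sub_cancel_left]
  set A := Z o₁ / Z o
  set B := Z o₂ / Z o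
  have hA : A ≠ 0 := div_ne_zero (h0 _) (h0 _)
  have hB : B ≠ 0 := div_ne_zero (h0 _) (h0 _)
  have hx : A ^ u.1 * B ^ i.1.1 ≠ 0 := mul_ne_zero (zpow_ne_zero _ hA) (zpow_ne_zero _ hB)
  have hy : A ^ u.2 * B ^ i.1.2 ≠ 0 := mul_ne_zero (zpow_ne_zero _ hA) (zpow_ne_zero _ hB)
  refine ⟨Z o * (A ^ latticePairing u ((sh.x₁, sh.y₀) - o.1) *
    B ^ latticePairing i.1 ((sh.x₁, sh.y₀) - o.1)), A ^ u.1 * B ^ i.1.1, A ^ u.2 * B ^ i.1.2,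
    mul_ne_zero (h0 _) (mul_ne_zero (zpow_ne_zero _ hA) (zpow_ne_zero _ hB)), hx, hy, fun a => ?_⟩
  have h1 := hZ.eq_zpow h0 (a := a) (o := o) (o₁ := o₁) (o₂ := o₂)
    (k := latticePairing u (a.1 - o.1)) (l := latticePairing i.1 (a.1 - o.1)) (by
      rw [← ht]; exact hu _)
  rw [h1]
  have h2 : a.1 - o.1 = ((sh.x₁, sh.y₀) - o.1) + ((sh.col a : ℤ), (sh.row a : ℤ)) := by
    have : a.1 = (sh.x₁, sh.y₀) + ((sh.col a : ℤ), (sh.row a : ℤ)) :=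
      Prod.ext (sh.fst_eq a) (sh.snd_eq a)
    rw [this]; abel
  rw [h2, latticePairing_add, latticePairing_add, zpow_add₀ hA, zpow_add₀ hB, mul_mul_mul_comm,
    zpow_latticePairing hA hB u i.1 ((sh.col a : ℤ), (sh.row a : ℤ)), zpow_natCast, zpow_natCast]
  ring

/-- The Laurent monomials are generated by the quotients of the members of the family. -/
theorem Shape.mem_of_quotients (sh : Δ.Shape) {L : Type*} [Field L] {Z : Δ.Pts → L} {c x y : L}
    (hc : c ≠ 0) (hx : x ≠ 0) (hy : y ≠ 0) (hZ : ∀ a, Z a = c * (x ^ sh.col a * y ^ sh.row a))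
    {S : Subfield L} (hS : ∀ a b, Z a / Z b ∈ S) : x ∈ S ∧ y ∈ S := by
  obtain ⟨i, -⟩ := sh.exists_left sh.h_pos
  obtain ⟨o₂, u, -, hu⟩ := sh.exists_frame i
  have hq : ∀ a b : Δ.Pts, x ^ (a.1 - b.1).1 * y ^ (a.1 - b.1).2 ∈ S := by
    intro a b
    have h1 : x ^ (a.1 - b.1).1 * y ^ (a.1 - b.1).2 = Z a / Z b := by
      rw [hZ, hZ, Prod.fst_sub, Prod.snd_sub, sh.fst_eq a, sh.fst_eq b, sh.snd_eq a, sh.snd_eq b,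
        add_sub_add_left_eq_sub, add_sub_add_left_eq_sub, zpow_sub₀ hx, zpow_sub₀ hy]
      simp only [zpow_natCast]
      field_simp
    rw [h1]
    exact hS a b
  have key : ∀ v : ℤ × ℤ, x ^ v.1 * y ^ v.2 ∈ S := by
    intro v
    have ht : i.tangent = (i.edgePt 1 i.length_pos).1 - i.origin.1 := by
      simp only [Side.edgePt, Nat.cast_one, one_smul, add_sub_cancel_left]
    rw [hu v, ht, Prod.fst_add, Prod.snd_add, zpow_add₀ hx, zpow_add₀ hy, mul_mul_mul_comm,
      zpow_pair_zsmul, zpow_pair_zsmul]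
    exact mul_mem (zpow_mem (hq _ _) _) (zpow_mem (hq _ _) _)
  exact ⟨by simpa using key (1, 0), by simpa using key (0, 1)⟩

end LatticePolygon

/-! ### Binary forms -/

section BinaryForms

open Polynomial

variable {K : Type*} [Field K] {f : MvPolynomial (Fin 2) K} {D : ℕ}

/-- The dehomogenization of binary forms. -/
def dehom : MvPolynomial (Fin 2) K →ₐ[K] K[X] := MvPolynomial.aeval ![X, 1]

theorem dehom_X_zero : dehom (MvPolynomial.X 0 : MvPolynomial (Fin 2) K) = X := by simp [dehom]

theorem dehom_X_one : dehom (MvPolynomial.X 1 : MvPolynomial (Fin 2) K) = 1 := by simp [dehom]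

theorem dehom_C (c : K) : dehom (MvPolynomial.C c) = C c := by
  rw [dehom, MvPolynomial.aeval_C, Polynomial.algebraMap_eq]

theorem homogenize_dehom (hf : f.IsHomogeneous D) :
    (dehom f).homogenize D = f :=
  homogenize_eq_of_isHomogeneous hf rfl

theorem natDegree_dehom_le (hf : f.IsHomogeneous D) :
    (dehom f).natDegree ≤ D := by
  rw [f.as_sum, map_sum, dehom]
  refine natDegree_sum_le_of_forall_le _ _ fun m hm => ?_
  rw [MvPolynomial.aeval_monomial, Finsupp.prod_fintype _ _ (by simp), Fin.prod_univ_two]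
  simp only [Matrix.cons_val_zero, Matrix.cons_val_one, one_pow, mul_one]
  have h1 : m.weight 1 = D := hf (by simpa using hm)
  rw [Finsupp.weight_apply, Finsupp.sum_fintype _ _ (by simp), Fin.sum_univ_two] at h1
  simp only [Pi.one_apply, smul_eq_mul, mul_one] at h1
  refine (natDegree_C_mul_X_pow_le _ _).trans (by omega)

theorem dehom_eq_zero_iff (hf : f.IsHomogeneous D) :
    dehom f = 0 ↔ f = 0 := by
  rw [← homogenize_eq_zero_iff (natDegree_dehom_le hf), (homogenize_dehom hf)]

theorem pow_dvd_dehom_iff (hf : f.IsHomogeneous D) (t : K) (n : ℕ) :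
    (MvPolynomial.X 0 - MvPolynomial.C t * MvPolynomial.X 1) ^ n ∣ f ↔
      (X - C t) ^ n ∣ dehom f := by
  have hlin : dehom
      (MvPolynomial.X 0 - MvPolynomial.C t * MvPolynomial.X 1) = X - C t := by
    rw [map_sub, map_mul, dehom_X_zero, dehom_X_one, dehom_C, mul_one]
  constructor
  · rintro ⟨g, rfl⟩
    rw [map_mul, map_pow, hlin]
    exact dvd_mul_right _ _
  · intro h
    by_cases h0 : dehom f = 0
    · rw [(dehom_eq_zero_iff hf).1 h0]; exact dvd_zero _
    obtain ⟨g, hg⟩ := h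
    have hg0 : g ≠ 0 := by rintro rfl; exact h0 (by rw [hg, mul_zero])
    have hd := (natDegree_dehom_le hf)
    have hp : ((X - C t) ^ n).natDegree = n := by simp
    rw [hg, natDegree_mul (pow_ne_zero _ (X_sub_C_ne_zero t)) hg0, hp] at hd
    obtain ⟨D', rfl⟩ := Nat.exists_eq_add_of_le (show n ≤ D by omega)
    have h1 := (homogenize_dehom hf)
    rw [hg, homogenize_mul _ _ hp.le (by omega : g.natDegree ≤ D')] at h1
    rw [← h1]
    refine dvd_mul_of_dvd_left (Eq.dvd ?_) _
    refine (homogenize_eq_of_isHomogeneous ?_ ?_).symm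
    · have := ((MvPolynomial.isHomogeneous_X K (0 : Fin 2)).sub
        (MvPolynomial.isHomogeneous_C_mul_X t (1 : Fin 2))).pow n
      rwa [one_mul] at this
    · rw [← hlin, ← map_pow]
      rfl

theorem emultiplicity_dehom (hf : f.IsHomogeneous D) (t : K) :
    emultiplicity (MvPolynomial.X 0 - MvPolynomial.C t * MvPolynomial.X 1) f =
      emultiplicity (X - C t) (dehom f) :=
  emultiplicity_eq_emultiplicity_iff.2 fun n => pow_dvd_dehom_iff hf t n

theorem eval_dehom (f : MvPolynomial (Fin 2) K) (t : K) :
    (dehom f).eval t = MvPolynomial.eval ![t, 1] f := by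
  have : (evalRingHom t).comp (dehom : MvPolynomial (Fin 2) K →ₐ[K] K[X]).toRingHom =
      MvPolynomial.eval ![t, 1] := by
    apply MvPolynomial.ringHom_ext
    · intro r; simp
    · intro j; fin_cases j <;> simp [dehom]
  exact congrArg (fun φ => φ f) this

theorem algebraMap_dehom (f : MvPolynomial (Fin 2) K) :
    algebraMap K[X] (RatFunc K) (dehom f) =
      MvPolynomial.aeval ![RatFunc.X, 1] f := by
  have : (algebraMap K[X] (RatFunc K)).comp (dehom : MvPolynomial (Fin 2) K →ₐ[K] K[X]).toRingHom =
      (MvPolynomial.aeval ![(RatFunc.X : RatFunc K), 1]).toRingHom := by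
    apply MvPolynomial.ringHom_ext
    · intro r; simp
    · intro j; fin_cases j <;> simp [dehom]
  exact congrArg (fun φ => φ f) this

end BinaryForms

namespace LatticePolygon

open Polynomial

variable {Δ : LatticePolygon} {K : Type*} [Field K]

theorem LineMap.eval_pointForm (p : ℙ K (Fin 2 → K)) :
    MvPolynomial.eval p.rep (LineMap.pointForm p) = 0 := by
  simp [LineMap.pointForm]
  ring

theorem LineMap.pointForm_eq {p : ℙ K (Fin 2 → K)} (hp : p.rep 1 ≠ 0) :
    LineMap.pointForm p = MvPolynomial.C (p.rep 1) *
      (MvPolynomial.X 0 - MvPolynomial.C (p.rep 0 / p.rep 1) * MvPolynomial.X 1) := by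
  rw [LineMap.pointForm, mul_sub, ← mul_assoc, ← map_mul, mul_div_cancel₀ _ hp]

theorem LineMap.emultiplicity_pointForm {p : ℙ K (Fin 2 → K)} (hp : p.rep 1 ≠ 0)
    {f : MvPolynomial (Fin 2) K} {D : ℕ} (hf : f.IsHomogeneous D) :
    emultiplicity (LineMap.pointForm p) f =
      emultiplicity (X - C (p.rep 0 / p.rep 1)) (dehom f) := by
  rw [← emultiplicity_dehom hf, pointForm_eq hp]
  refine emultiplicity_eq_of_associated_left ?_
  refine ⟨(Units.mk0 _ hp).map (MvPolynomial.C : K →+* MvPolynomial (Fin 2) K).toMonoidHom, ?_⟩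
  rw [mul_comm]
  rfl

theorem LineMap.emultiplicity_pointForm_eq_zero {p : ℙ K (Fin 2 → K)}
    {f : MvPolynomial (Fin 2) K} (hf : MvPolynomial.eval p.rep f ≠ 0) :
    emultiplicity (LineMap.pointForm p) f = 0 := by
  rw [emultiplicity_eq_zero]
  rintro ⟨g, rfl⟩
  rw [map_mul, eval_pointForm, zero_mul] at hf
  exact hf rfl

end LatticePolygon

namespace LatticePolygon

open Polynomial
open scoped Polynomial.Bivariate

variable {Δ : LatticePolygon} {d : Δ.TangencyProfile} {K : Type*} [Field K]

/-! ### The morphism with given parameters -/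

namespace Shape

variable (sh : Δ.Shape) {θ : Par d → K}

theorem dehom_hform (a : Δ.Pts) : dehom (sh.hform θ a) = sh.dform θ a := sh.aeval_hform θ a

theorem eval_hform (p : Fin 2 → K) (a : Δ.Pts) : MvPolynomial.eval p (sh.hform θ a) =
    θ (Sum.inl 0) ^ sh.col a * θ (Sum.inl 1) ^ sh.row a *
      ∏ j : Idx d, (p 0 - θ (Sum.inr j) * p 1) ^ j.weight a := by
  simp [hform, map_prod]

variable (hθ : IsRegular θ)
include hθ

theorem eval_hform_ne_zero_iff (p : Fin 2 → K) (a : Δ.Pts) :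
    MvPolynomial.eval p (sh.hform θ a) ≠ 0 ↔
      ∀ j : Idx d, p 0 = θ (Sum.inr j) * p 1 → a ∈ Δ.face j.1.1 := by
  have h1 := hθ.ne_zero 0
  have h2 := hθ.ne_zero 1
  rw [eval_hform, mul_ne_zero_iff_left (by positivity), Finset.prod_ne_zero_iff]
  refine forall_congr' fun j => ?_
  simp only [Finset.mem_univ, true_implies, ← j.weight_eq_zero_iff]
  rw [Ne, pow_eq_zero_iff', sub_eq_zero, not_and, not_ne_iff]

omit sh in
theorem idx_unique {p : Fin 2 → K} (hp : p ≠ 0) {j k : Idx d} (hj : p 0 = θ (Sum.inr j) * p 1)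
    (hk : p 0 = θ (Sum.inr k) * p 1) : j = k := by
  have hp1 : p 1 ≠ 0 := by
    intro h
    apply hp
    ext l
    fin_cases l
    · simp [hj, h]
    · exact h
  exact hθ.inj (mul_right_cancel₀ hp1 (hj.symm.trans hk))

/-- The morphism with given parameters. -/
def lineMap : LineMap K Δ where
  degree := sh.paramDegree d
  form := sh.hform θ
  isHomogeneous := sh.isHomogeneous_hform θ
  no_common_zero p hp := by
    by_cases h : ∃ j : Idx d, p 0 = θ (Sum.inr j) * p 1
    · obtain ⟨j, hj⟩ := h
      refine ⟨j.1.origin, (sh.eval_hform_ne_zero_iff hθ _ _).2 fun k hk => ?_⟩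
      rw [← idx_unique hθ hp hj hk]
      exact (Side.mem_face_iff _).2 j.1.ht_origin
    · push Not at h
      exact ⟨sh.base, (sh.eval_hform_ne_zero_iff hθ _ _).2 fun k hk => absurd hk (h k)⟩
  mem_toricSurface G hG := (forall_toricBinomials_iff _).2 (sh.isToric_hform θ) G hG

theorem emultiplicity_dform (j : Idx d) (a : Δ.Pts) :
    emultiplicity (X - C (θ (Sum.inr j))) (sh.dform θ a) = j.weight a := by
  classical
  have h1 := hθ.ne_zero 0
  have h2 := hθ.ne_zero 1
  rw [dform, ← Finset.mul_prod_erase _ _ (Finset.mem_univ j), mul_left_comm, emultiplicity_eq_coe]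
  refine ⟨dvd_mul_right _ _, fun h => ?_⟩
  rw [pow_succ] at h
  have h3 := (mul_dvd_mul_iff_left (pow_ne_zero _ (X_sub_C_ne_zero _))).1 h
  rw [dvd_iff_isRoot, IsRoot.def, eval_mul, eval_C, eval_prod] at h3
  refine mul_ne_zero (by positivity) (Finset.prod_ne_zero_iff.2 fun k hk => ?_) h3
  simp only [eval_pow, eval_sub, eval_X, eval_C]
  exact pow_ne_zero _ (sub_ne_zero.2 fun h => Finset.ne_of_mem_erase hk (hθ.inj h).symm)

theorem emultiplicity_hform {p : ℙ K (Fin 2 → K)} {j : Idx d} (hj : p.rep 0 = θ (Sum.inr j) * p.rep 1)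
    (a : Δ.Pts) : emultiplicity (LineMap.pointForm p) (sh.hform θ a) = j.weight a := by
  have hp1 : p.rep 1 ≠ 0 := by
    intro h
    apply p.rep_nonzero
    ext l
    fin_cases l
    · simp [hj, h]
    · exact h
  rw [LineMap.emultiplicity_pointForm hp1 (sh.isHomogeneous_hform θ a), dehom_hform, hj,
    mul_div_cancel_right₀ _ hp1, emultiplicity_dform sh hθ]

/-- The order of a coordinate is the tangency times its distance from the side, and the minimum over
coordinates off the side occurs at distance one. -/
theorem pullbackMult_self {p : ℙ K (Fin 2 → K)} {j : Idx d} (hj : p.rep 0 = θ (Sum.inr j) * p.rep 1) :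
    (sh.lineMap hθ).pullbackMult j.1 p = j.mult := by
  rw [LineMap.pullbackMult]
  apply le_antisymm
  · obtain ⟨a, ha⟩ := sh.exists_ht_one j.1
    have ha' : a ∉ Δ.face j.1.1 := fun h => by rw [Side.mem_face_iff] at h; omega
    refine (iInf_le _ ⟨a, ha'⟩).trans ?_
    change emultiplicity _ (sh.hform θ a) ≤ _
    rw [emultiplicity_hform sh hθ hj, Idx.weight, ha]
    simp
  · refine le_iInf fun a => ?_
    change _ ≤ emultiplicity _ (sh.hform θ a.1)
    rw [emultiplicity_hform sh hθ hj, Idx.weight]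
    have h1 := Side.ht_nonneg (i := j.1) a.1
    have h2 : j.1.ht a.1.1 ≠ 0 := fun h => a.2 ((Side.mem_face_iff _).2 h)
    have h3 : 1 ≤ (j.1.ht a.1.1).toNat := by omega
    exact_mod_cast Nat.le_mul_of_pos_right _ h3

theorem pullbackMult_eq_zero {p : ℙ K (Fin 2 → K)} {i : Δ.Side}
    (hp : ∀ j : Idx d, p.rep 0 = θ (Sum.inr j) * p.rep 1 → j.1 ≠ i) :
    (sh.lineMap hθ).pullbackMult i p = 0 := by
  rw [LineMap.pullbackMult, ← nonpos_iff_eq_zero]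
  have key : ∀ a, a ∉ Δ.face i.1 → (∀ j : Idx d, p.rep 0 = θ (Sum.inr j) * p.rep 1 →
      a ∈ Δ.face j.1.1) → ⨅ a : {a : Δ.Pts // a ∉ Δ.face i.1},
        emultiplicity (LineMap.pointForm p) ((sh.lineMap hθ).form a.1) ≤ 0 := by
    intro a ha h
    refine (iInf_le _ ⟨a, ha⟩).trans (le_of_eq ?_)
    exact LineMap.emultiplicity_pointForm_eq_zero ((sh.eval_hform_ne_zero_iff hθ _ _).2 h)
  by_cases h : ∃ j : Idx d, p.rep 0 = θ (Sum.inr j) * p.rep 1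
  · obtain ⟨j, hj⟩ := h
    obtain ⟨a, ha, ha'⟩ := sh.exists_mem_face_notMem (hp j hj)
    refine key a ha' fun k hk => ?_
    rwa [← idx_unique hθ p.rep_nonzero hj hk]
  · push Not at h
    obtain ⟨a, ha⟩ := sh.exists_ht_one i
    exact key a (fun h => by rw [Side.mem_face_iff] at h; omega) fun k hk => absurd hk (h k)

omit sh hθ in
theorem exists_point (t : K) : ∃ p : ℙ K (Fin 2 → K), p.rep 1 ≠ 0 ∧ p.rep 0 = t * p.rep 1 := by
  have h0 : ![t, 1] ≠ 0 := fun h => one_ne_zero (congrFun h 1)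
  refine ⟨Projectivization.mk K ![t, 1] h0, ?_⟩
  obtain ⟨c, hc⟩ := Projectivization.exists_smul_eq_mk_rep K ![t, 1] h0
  rw [← hc]
  refine ⟨by simp [Units.smul_def], ?_⟩
  simp [Units.smul_def, mul_comm]

omit sh hθ in
theorem point_ext {p q : ℙ K (Fin 2 → K)} {t : K} (hp1 : p.rep 1 ≠ 0) (hq1 : q.rep 1 ≠ 0)
    (hp : p.rep 0 = t * p.rep 1) (hq : q.rep 0 = t * q.rep 1) : p = q := by
  rw [← p.mk_rep, ← q.mk_rep, Projectivization.mk_eq_mk_iff']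
  refine ⟨p.rep 1 / q.rep 1, ?_⟩
  ext l
  fin_cases l
  · simp [hp, hq]; field_simp
  · simp [hq1]

theorem hasTangencyProfile_lineMap : (sh.lineMap hθ).HasTangencyProfile d := by
  classical
  choose pt hpt1 hpt using fun j : Idx d => exists_point (θ (Sum.inr j))
  intro i
  have hinj : Function.Injective fun j : (d.mult i).ToType => pt ⟨i, j⟩ := by
    intro j k hjk
    simp only at hjk
    have h1 := hpt ⟨i, j⟩
    rw [hjk] at h1
    have := idx_unique hθ (pt ⟨i, k⟩).rep_nonzero h1 (hpt ⟨i, k⟩)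
    simpa using this
  refine ⟨Finset.univ.map ⟨_, hinj⟩, fun p hp => pullbackMult_eq_zero sh hθ ?_, ?_⟩
  · rintro ⟨i', j⟩ hj rfl
    apply hp
    rw [Finset.mem_map]
    refine ⟨j, Finset.mem_univ _, ?_⟩
    have hp1 : p.rep 1 ≠ 0 := by
      intro h
      apply p.rep_nonzero
      ext l
      fin_cases l
      · simp [hj, h]
      · exact h
    exact point_ext (hpt1 _) hp1 (hpt ⟨i', j⟩) hj
  · rw [Finset.map_val, Multiset.map_map, ← Multiset.map_univ (d.mult i)]
    refine Multiset.map_congr rfl fun j _ => ?_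
    have h := pullbackMult_self sh hθ (hpt ⟨i, j⟩)
    rw [Function.comp_apply, Function.Embedding.coeFn_mk]
    exact h

open IntermediateField in
theorem adjoin_quotients_eq_top (htop : K⟮mon θ (1, 0), mon θ (0, 1)⟯ = ⊤) :
    (sh.lineMap hθ).IsBirationalOntoImage := by
  rw [LineMap.IsBirationalOntoImage, eq_top_iff, ← htop, adjoin_le_iff]
  set E := adjoin K {r : RatFunc K | ∃ a b : Δ.Pts,
    r = MvPolynomial.aeval ![RatFunc.X, 1] ((sh.lineMap hθ).form a) /
      MvPolynomial.aeval ![RatFunc.X, 1] ((sh.lineMap hθ).form b)} with hE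
  have h1 := sh.mem_of_quotients (L := RatFunc K)
    (Z := fun a => MvPolynomial.aeval ![RatFunc.X, 1] ((sh.lineMap hθ).form a))
    (mon_prod_ne_zero _) (mon_ne_zero hθ _) (mon_ne_zero hθ _)
    (fun a => by rw [← algebraMap_dform sh hθ, ← dehom_hform, algebraMap_dehom]; rfl)
    (S := E.toSubfield) (fun a b => subset_adjoin _ _ ⟨a, b, rfl⟩)
  rintro z (rfl | rfl)
  · exact h1.1
  · exact h1.2

end Shape

theorem bind₁_linearForm (C₀ : LinearSystem K Δ) (f : Δ.Pts → MvPolynomial (Fin 2) K) :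
    MvPolynomial.bind₁ f C₀.linearForm = ∑ a, MvPolynomial.C (C₀.coeff a) * f a := by
  simp [LinearSystem.linearForm]

theorem bind₁_linearForm_eq_zero_iff (C₀ : LinearSystem K Δ) {f : Δ.Pts → MvPolynomial (Fin 2) K}
    {D : ℕ} (hf : ∀ a, (f a).IsHomogeneous D) : MvPolynomial.bind₁ f C₀.linearForm = 0 ↔
      ∑ a, C (C₀.coeff a) * dehom (f a) = 0 := by
  have hh : (MvPolynomial.bind₁ f C₀.linearForm).IsHomogeneous D := by
    rw [bind₁_linearForm]
    refine MvPolynomial.IsHomogeneous.sum _ _ _ fun a _ => ?_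
    have := (MvPolynomial.isHomogeneous_C (Fin 2) (C₀.coeff a)).mul (hf a)
    rwa [zero_add] at this
  rw [← dehom_eq_zero_iff hh, bind₁_linearForm, map_sum]
  simp only [map_mul, dehom_C]

/-- The curves with general parameters. -/
theorem IsGeneric.exists_mem_severi (sh : Δ.Shape) {θ : Par d → K} (hθ : IsGeneric θ)
    (hd : ∀ i : Δ.Side, ¬ i.IsHorizontal → d.IsTrivialOn i) :
    ∃ C₀ ∈ severi K d, ((sh.relMatrix K d).map (MvPolynomial.eval θ)).mulVec C₀.coeff = 0 := by
  have hreg := hθ.toIsRegular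
  obtain ⟨htop, F, hirr, hrel, hv⟩ := hθ.exists_equation sh hd
  have hF : F ≠ 0 := by
    rintro rfl
    exact hirr.ne_zero (by simp [Shape.poly])
  obtain ⟨c, hc, hcF⟩ := LinearSystem.exists_coeff_of F hF
  set C₀ := LinearSystem.of F hF
  have hpoly : sh.poly C₀.coeff = C (C c) * sh.poly F := by rw [hcF, sh.poly_smul]
  have hunit : IsUnit (C (C c) : K[X][Y]) := isUnit_C.2 (isUnit_C.2 hc.isUnit)
  have hrel' : aevalAeval (Shape.mon θ (1, 0)) (Shape.mon θ (0, 1)) (sh.poly C₀.coeff) = 0 := by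
    rw [hpoly, map_mul, hrel, mul_zero]
  have hv' : ∀ a, IsVertex a → C₀.coeff a ≠ 0 := fun a ha => by
    rw [hcF]; exact mul_ne_zero hc (hv a ha)
  have hsum := (sh.sum_dform_eq_zero_iff hreg C₀.coeff).2 hrel'
  refine ⟨C₀, ⟨?_, isToricallyTransverse hv', sh.lineMap hreg, ⟨?_, ?_⟩, ?_⟩, ?_⟩
  · exact sh.isIntegralCurve (by rw [hpoly]; exact (irreducible_isUnit_mul hunit).2 hirr)
      (sh.mon_fst_not_const hreg) (Shape.mon_ne_zero hreg _) (Shape.mon_ne_zero hreg _) hrel' hv'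
  · exact (bind₁_linearForm_eq_zero_iff C₀ (sh.isHomogeneous_hform θ)).2
      (by simpa only [sh.dehom_hform] using hsum)
  · exact sh.adjoin_quotients_eq_top hreg htop
  · exact sh.hasTangencyProfile_lineMap hreg
  · exact (sh.relMatrix_mulVec_eq_zero_iff θ _).2 hsum

end LatticePolygon

/-! ### Change of the affine coordinate on the projective line -/

section Shear

open Polynomial

variable {K : Type*} [Field K]

theorem aeval_mul_of_isHomogeneous {A : Type*} [CommRing A] [Algebra K A] {σ : Type*} [Fintype σ]
    {f : MvPolynomial σ K} {D : ℕ} (hf : f.IsHomogeneous D) (u : A) (v : σ → A) :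
    MvPolynomial.aeval (fun j => u * v j) f = u ^ D * MvPolynomial.aeval v f := by
  conv_lhs => rw [f.as_sum]
  conv_rhs => rw [f.as_sum]
  rw [map_sum, map_sum, Finset.mul_sum]
  refine Finset.sum_congr rfl fun m hm => ?_
  have h1 : m.weight 1 = D := hf (by simpa using hm)
  rw [Finsupp.weight_apply, Finsupp.sum_fintype _ _ (by simp)] at h1
  simp only [Pi.one_apply, smul_eq_mul, mul_one] at h1
  rw [MvPolynomial.aeval_monomial, MvPolynomial.aeval_monomial, Finsupp.prod_fintype _ _ (by simp),
    Finsupp.prod_fintype _ _ (by simp)]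
  simp only [mul_pow, Finset.prod_mul_distrib, Finset.prod_pow_eq_pow_sum, h1]
  ring

/-- A change of coordinates that moves the point at infinity to the point `[1 : c]`. -/
def shear (c : K) : MvPolynomial (Fin 2) K ≃ₐ[K] MvPolynomial (Fin 2) K :=
  AlgEquiv.ofAlgHom
    (MvPolynomial.aeval ![MvPolynomial.X 0, MvPolynomial.X 1 + MvPolynomial.C c * MvPolynomial.X 0])
    (MvPolynomial.aeval ![MvPolynomial.X 0, MvPolynomial.X 1 - MvPolynomial.C c * MvPolynomial.X 0])
    (by apply MvPolynomial.algHom_ext; intro j; fin_cases j <;> simp [MvPolynomial.algebraMap_eq])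
    (by apply MvPolynomial.algHom_ext; intro j; fin_cases j <;> simp [MvPolynomial.algebraMap_eq])

theorem shear_apply (c : K) (f : MvPolynomial (Fin 2) K) : shear c f =
    MvPolynomial.aeval ![MvPolynomial.X 0, MvPolynomial.X 1 + MvPolynomial.C c * MvPolynomial.X 0] f :=
  rfl

theorem isHomogeneous_shear (c : K) {f : MvPolynomial (Fin 2) K} {D : ℕ} (hf : f.IsHomogeneous D) :
    (shear c f).IsHomogeneous D := by
  have := hf.aeval (S := K) (τ := Fin 2) ![MvPolynomial.X 0, MvPolynomial.X 1 + MvPolynomial.C c * MvPolynomial.X 0]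
    (n := 1) (by
      intro j
      fin_cases j
      · exact MvPolynomial.isHomogeneous_X K (0 : Fin 2)
      · exact (MvPolynomial.isHomogeneous_X K (1 : Fin 2)).add (MvPolynomial.isHomogeneous_C_mul_X c 0))
  rwa [one_mul] at this

theorem eval_shear (c : K) (f : MvPolynomial (Fin 2) K) (p : Fin 2 → K) :
    MvPolynomial.eval p (shear c f) = MvPolynomial.eval ![p 0, p 1 + c * p 0] f := by
  have : (MvPolynomial.eval p).comp (shear c : MvPolynomial (Fin 2) K →+* MvPolynomial (Fin 2) K) =
      MvPolynomial.eval ![p 0, p 1 + c * p 0] := by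
    apply MvPolynomial.ringHom_ext
    · intro r; simp [shear_apply]
    · intro j; fin_cases j <;> simp [shear_apply]
  exact congrArg (fun φ => φ f) this

theorem eval_dehom_shear (c : K) (f : MvPolynomial (Fin 2) K) (t : K) :
    (dehom (shear c f)).eval t = MvPolynomial.eval ![t, 1 + c * t] f := by
  rw [eval_dehom, eval_shear]
  simp

theorem algebraMap_dehom_shear (c : K) (f : MvPolynomial (Fin 2) K) :
    algebraMap K[X] (RatFunc K) (dehom (shear c f)) =
      MvPolynomial.aeval ![(RatFunc.X : RatFunc K), 1 + RatFunc.C c * RatFunc.X] f := by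
  have : ((algebraMap K[X] (RatFunc K)).comp (dehom : MvPolynomial (Fin 2) K →ₐ[K] K[X]).toRingHom).comp
      (shear c : MvPolynomial (Fin 2) K →+* MvPolynomial (Fin 2) K) =
      (MvPolynomial.aeval ![(RatFunc.X : RatFunc K), 1 + RatFunc.C c * RatFunc.X]).toRingHom := by
    apply MvPolynomial.ringHom_ext
    · intro r; simp [dehom, shear_apply]
    · intro j; fin_cases j <;> simp [dehom, shear_apply]
  exact congrArg (fun φ => φ f) this

open IntermediateField in
/-- Birationality does not depend on the affine coordinate. -/
theorem adjoin_shear_eq_top {ι : Type*} {f : ι → MvPolynomial (Fin 2) K} {D : ℕ}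
    (hf : ∀ a, (f a).IsHomogeneous D) (c : K)
    (htop : adjoin K {r : RatFunc K | ∃ a b, r = MvPolynomial.aeval ![RatFunc.X, 1] (f a) /
      MvPolynomial.aeval ![RatFunc.X, 1] (f b)} = ⊤) :
    adjoin K {r : RatFunc K | ∃ a b, r = algebraMap K[X] (RatFunc K) (dehom (shear c (f a))) /
      algebraMap K[X] (RatFunc K) (dehom (shear c (f b)))} = ⊤ := by
  set u : RatFunc K := 1 + RatFunc.C c * RatFunc.X with hu
  have hu0 : u ≠ 0 := by
    intro h
    have h1 : algebraMap K[X] (RatFunc K) (1 + C c * X) = 0 := by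
      rw [map_add, map_mul, RatFunc.algebraMap_C, RatFunc.algebraMap_X, map_one]; exact h
    rw [map_eq_zero_iff _ (IsFractionRing.injective K[X] (RatFunc K))] at h1
    have := congrArg (eval 0) h1
    simp at this
  have hnc : ¬ ∃ c', (RatFunc.X / u : RatFunc K) = RatFunc.C c' := by
    rintro ⟨c', hc'⟩
    rw [div_eq_iff hu0] at hc'
    have h1 : algebraMap K[X] (RatFunc K) X = algebraMap K[X] (RatFunc K) (C c' * (1 + C c * X)) := by
      simp only [map_add, map_mul, RatFunc.algebraMap_C, RatFunc.algebraMap_X, map_one]; exact hc'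
    have h2 := IsFractionRing.injective K[X] (RatFunc K) h1
    have h3 := congrArg (eval 0) h2
    simp at h3
    rw [← h3] at h2
    simp at h2
  -- The substitution `t ↦ t / (1 + c t)` relates the two affine coordinates. By homogeneity the new
  -- forms are the substituted old ones times a common factor, which cancels in quotients.
  obtain ⟨τ, hτ⟩ := exists_algHom_of_ker_eq (IsScalarTower.toAlgHom K K[X] (RatFunc K))
    (aeval (RatFunc.X / u) : K[X] →ₐ[K] RatFunc K) (fun p => by
      rw [IsScalarTower.coe_toAlgHom', map_eq_zero_iff _ (IsFractionRing.injective K[X] (RatFunc K))]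
      constructor
      · rintro rfl; exact map_zero _
      · intro h
        by_contra hp
        exact RatFunc.transcendental_of_ne_C _ hnc ⟨p, hp, h⟩)
    (fun z => ⟨z.num, z.denom, (RatFunc.num_div_denom z).symm⟩)
  have hτX : τ RatFunc.X = RatFunc.X / u := by
    have := hτ X
    rwa [IsScalarTower.coe_toAlgHom', RatFunc.algebraMap_X, aeval_X] at this
  have hform : ∀ a, algebraMap K[X] (RatFunc K) (dehom (shear c (f a))) =
      u ^ D * τ (MvPolynomial.aeval ![RatFunc.X, 1] (f a)) := by
    intro a
    have h1 : τ (MvPolynomial.aeval ![RatFunc.X, 1] (f a)) =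
        MvPolynomial.aeval ![RatFunc.X / u, 1] (f a) := by
      rw [← AlgHom.comp_apply]
      congr 1
      apply MvPolynomial.algHom_ext
      intro j; fin_cases j <;> simp [hτX]
    rw [algebraMap_dehom_shear, h1, ← aeval_mul_of_isHomogeneous (hf a)]
    congr 2
    ext j
    fin_cases j
    · simp [mul_div_cancel₀ _ hu0]
    · simp [hu]
  set E := adjoin K {r : RatFunc K | ∃ a b, r = algebraMap K[X] (RatFunc K) (dehom (shear c (f a))) /
      algebraMap K[X] (RatFunc K) (dehom (shear c (f b)))}
  have h1 : RatFunc.X / u ∈ E := by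
    have h2 : τ RatFunc.X ∈ (⊤ : IntermediateField K (RatFunc K)).map τ := ⟨_, mem_top, rfl⟩
    rw [← htop, adjoin_map] at h2
    rw [← hτX]
    refine (adjoin_le_iff.2 ?_ : _ ≤ E) h2
    rintro _ ⟨_, ⟨a, b, rfl⟩, rfl⟩
    refine subset_adjoin _ _ ⟨a, b, ?_⟩
    rw [hform, hform, mul_div_mul_left _ _ (pow_ne_zero _ hu0), map_div₀]
  have h2 : (RatFunc.X : RatFunc K) ∈ E := by
    have h3 : (RatFunc.X : RatFunc K) = RatFunc.X / u / (1 - RatFunc.C c * (RatFunc.X / u)) := by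
      have : 1 - RatFunc.C c * (RatFunc.X / u) = 1 / u := by
        rw [eq_div_iff hu0, sub_mul, mul_assoc, div_mul_cancel₀ _ hu0, hu]; ring
      rw [this]; field_simp
    rw [h3]
    exact div_mem h1 (sub_mem (one_mem _) (mul_mem (E.algebraMap_mem c) h1))
  rw [eq_top_iff, ← RatFunc.adjoin_X (K := K)]
  exact adjoin_simple_le_iff.2 h2

end Shear

/-! ### Multisets of values and multiplicities of roots -/

section Multisets

theorem exists_equiv_of_map_eq {α β γ : Type*} [Fintype α] [Fintype β] {f : α → γ} {g : β → γ}
    (h : Finset.univ.val.map f = Finset.univ.val.map g) : ∃ e : α ≃ β, ∀ a, g (e a) = f a := by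
  classical
  have hcard : ∀ c, Fintype.card {a // f a = c} = Fintype.card {b // g b = c} := by
    intro c
    have := congrArg (Multiset.count c) h
    rw [Multiset.count_map, Multiset.count_map] at this
    rw [Fintype.card_subtype, Fintype.card_subtype]
    simpa only [Finset.card, Finset.filter_val, eq_comm] using this
  exact ⟨Equiv.ofFiberEquiv fun c => Fintype.equivOfCardEq (hcard c), Equiv.ofFiberEquiv_map _⟩

open Polynomial in
theorem eq_prod_of_roots_mem_range {K ι : Type*} [Field K] [IsAlgClosed K] [Fintype ι] {θ : ι → K}
    (hθ : Function.Injective θ) {g : K[X]} (hg : ∀ t, g.IsRoot t → t ∈ Set.range θ) :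
    g = C g.leadingCoeff * ∏ j, (X - C (θ j)) ^ g.rootMultiplicity (θ j) := by
  classical
  conv_lhs => rw [(IsAlgClosed.splits g).eq_prod_roots]
  congr 1
  rw [Finset.prod_multiset_map_count]
  simp only [count_roots]
  rw [← Finset.prod_image (s := Finset.univ) (g := θ)
    (f := fun t => (X - C t) ^ g.rootMultiplicity t) (fun _ _ _ _ h => hθ h)]
  refine Finset.prod_subset ?_ ?_
  · intro t ht
    rw [Multiset.mem_toFinset] at ht
    obtain ⟨j, rfl⟩ := hg t (isRoot_of_mem_roots ht)
    exact Finset.mem_image_of_mem _ (Finset.mem_univ _)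
  · intro t _ ht
    rw [Multiset.mem_toFinset, ← Multiset.count_eq_zero, count_roots] at ht
    rw [ht, pow_zero]

open Polynomial in
theorem emultiplicity_X_sub_C {K : Type*} [Field K] {g : K[X]} (hg : g ≠ 0) (t : K) :
    emultiplicity (X - C t) g = g.rootMultiplicity t := by
  rw [emultiplicity_eq_coe]
  exact ⟨pow_rootMultiplicity_dvd g t, by
    rw [← le_rootMultiplicity_iff hg]; omega⟩

end Multisets

namespace LatticePolygon

open Polynomial
open scoped Polynomial.Bivariate

variable {Δ : LatticePolygon} {d : Δ.TangencyProfile} {K : Type*} [Field K]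

/-! ### The parameters of a curve -/

namespace LineMap

variable {f : LineMap K Δ}

/-- A morphism with a tangency profile does not map the line into the toric boundary. -/
theorem HasTangencyProfile.form_ne_zero (sh : Δ.Shape) (hf : f.HasTangencyProfile d) (a : Δ.Pts) :
    f.form a ≠ 0 := by
  have hface : ∀ i : Δ.Side, ¬ ∀ b, b ∉ Δ.face i.1 → f.form b = 0 := by
    intro i hi
    -- If all coordinates off a side vanished identically, every pullback multiplicity would be
    -- infinite, while a profile consists of finite numbers and is zero off a finite set.
    have htop : ∀ p, f.pullbackMult i p = ⊤ := fun p => by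
      rw [pullbackMult, iInf_eq_top]
      intro b
      rw [hi b.1 b.2, emultiplicity_zero]
    obtain ⟨Z, hZ, hZd⟩ := hf i
    obtain ⟨p, -⟩ := Shape.exists_point (0 : K)
    have hp : p ∈ Z := by
      by_contra h
      have := hZ p h
      rw [htop] at this
      exact ENat.top_ne_zero this
    have h1 : f.pullbackMult i p ∈ Z.val.map (f.pullbackMult i) := Multiset.mem_map_of_mem _ hp
    rw [hZd, htop, Multiset.mem_map] at h1
    obtain ⟨k, -, hk⟩ := h1
    exact ENat.natCast_ne_top k hk
  obtain ⟨b, hb⟩ := f.no_common_zero 1 one_ne_zero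
  rcases f.isToric.support sh ⟨b, fun h => hb (by rw [h, map_zero])⟩ with h | ⟨i, hi⟩ | ⟨b, -, ⟨i, hi⟩, -, h⟩
  · exact h a
  · refine absurd (fun b hb => ?_) (hface i)
    by_contra h
    exact hb ((Side.mem_face_iff _).2 ((hi b).1 h))
  · refine absurd (fun c hc => h c ?_) (hface i)
    rintro rfl
    exact hc ((Side.mem_face_iff _).2 hi)

/-- The point `[1 : c]` will be moved to infinity; then all preimages of the toric boundary have a
finite coordinate. -/
theorem exists_affine (hf : ∀ a, f.form a ≠ 0) [Infinite K] :
    ∃ c : K, ∀ a, MvPolynomial.eval ![1, c] (f.form a) ≠ 0 := by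
  have h1 : (MvPolynomial.X 0 * ∏ a, f.form a : MvPolynomial (Fin 2) K) ≠ 0 :=
    mul_ne_zero (MvPolynomial.X_ne_zero _) (Finset.prod_ne_zero_iff.2 fun a _ => hf a)
  obtain ⟨p, hp⟩ := exists_eval_ne_zero h1
  rw [map_mul, MvPolynomial.eval_X, map_prod] at hp
  have hp0 := left_ne_zero_of_mul hp
  refine ⟨p 1 / p 0, fun a ha => Finset.prod_ne_zero_iff.1 (right_ne_zero_of_mul hp) a
    (Finset.mem_univ a) ?_⟩
  have h2 := (f.isHomogeneous a).eval_smul (p 0) ![1, p 1 / p 0]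
  rw [ha, mul_zero] at h2
  rw [← h2]
  congr 1
  congr 1
  ext l
  fin_cases l
  · simp
  · simp [mul_div_cancel₀ _ hp0]

theorem toFun_mem_points {C₀ : LinearSystem K Δ} (hrel : MvPolynomial.bind₁ f.form C₀.linearForm = 0)
    (p : ℙ K (Fin 2 → K)) : f.toFun p ∈ C₀.points := by
  have htor : IsToric (f.lift p.rep) := f.isToric.map (MvPolynomial.eval p.rep)
  refine ⟨(mk_mem_toricSurface_iff _).2 htor, ?_⟩
  obtain ⟨c, hc⟩ := Projectivization.exists_smul_eq_mk_rep K _ (f.lift_ne_zero p.rep_nonzero)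
  have h1 := congrArg (MvPolynomial.eval p.rep) hrel
  rw [bind₁_linearForm, map_sum, map_zero] at h1
  rw [toFun, ← hc, LinearSystem.linearForm, map_sum]
  have h2 := congrArg (fun r => (c : K) * r) h1
  simp only [mul_zero, Finset.mul_sum] at h2
  rw [← h2]
  refine Finset.sum_congr rfl fun a _ => ?_
  simp only [map_mul, MvPolynomial.eval_C, MvPolynomial.eval_X, Pi.smul_apply, lift, Units.smul_def,
    smul_eq_mul]
  ring

/-- The toric divisor that contains the image of a point of the toric boundary. -/
theorem exists_side (sh : Δ.Shape) {C₀ : LinearSystem K Δ} (hC : C₀.IsToricallyTransverse)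
    (hrel : MvPolynomial.bind₁ f.form C₀.linearForm = 0) {p : Fin 2 → K} (hp : p ≠ 0)
    (h0 : ∃ a, MvPolynomial.eval p (f.form a) = 0) :
    ∃ i : Δ.Side, ∀ a, MvPolynomial.eval p (f.form a) ≠ 0 ↔ i.ht a.1 = 0 := by
  have htor : IsToric (f.lift p) := f.isToric.map (MvPolynomial.eval p)
  rcases htor.support sh (f.no_common_zero p hp) with h | h | ⟨a, -, -, -, h⟩
  · obtain ⟨a, ha⟩ := h0
    exact absurd ha (h a)
  · exact h
  · exfalso
    set P := Projectivization.mk K p hp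
    have hPp : ∀ b, MvPolynomial.eval P.rep (f.form b) = 0 ↔ MvPolynomial.eval p (f.form b) = 0 := by
      intro b
      obtain ⟨c, hc⟩ := Projectivization.exists_smul_eq_mk_rep K p hp
      rw [← hc, Units.smul_def, (f.isHomogeneous b).eval_smul, mul_eq_zero,
        or_iff_right (pow_ne_zero _ c.ne_zero)]
    have h1 := toFun_mem_points hrel P
    refine hC _ h1 ⟨h1.1, a, fun b hb => ?_⟩
    obtain ⟨c, hc⟩ := Projectivization.exists_smul_eq_mk_rep K _ (f.lift_ne_zero P.rep_nonzero)
    rw [toFun, ← hc, Units.smul_def, Pi.smul_apply, lift, (hPp b).2 (h b hb), smul_zero]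

variable (f) in
/-- The affine coordinates of the morphism. -/
def affine (c : K) (a : Δ.Pts) : K[X] := dehom (shear c (f.form a))

theorem affine_ne_zero (c : K) (hf : ∀ a, f.form a ≠ 0) (a : Δ.Pts) : f.affine c a ≠ 0 := by
  rw [affine, Ne, dehom_eq_zero_iff (isHomogeneous_shear c (f.isHomogeneous a)),
    map_eq_zero_iff _ (shear c).injective]
  exact hf a

theorem isToric_affine (c : K) : IsToric (f.affine c) := (f.isToric.map (shear c)).map dehom

theorem eval_affine (c t : K) (a : Δ.Pts) :
    (f.affine c a).eval t = MvPolynomial.eval ![t, 1 + c * t] (f.form a) := eval_dehom_shear _ _ _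

theorem affine_point_ne_zero (c t : K) : ![t, 1 + c * t] ≠ 0 := by
  intro h
  have h1 : t = 0 := congrFun h 0
  have h2 : 1 + c * t = 0 := congrFun h 1
  rw [h1] at h2
  simp at h2

/-- The orders of vanishing of the coordinates at a point of the toric boundary are proportional to
the distances from a side. -/
theorem rootMultiplicity_affine (sh : Δ.Shape) (c t : K) (hf : ∀ a, f.form a ≠ 0) {i : Δ.Side}
    (hi : ∀ a, MvPolynomial.eval ![t, 1 + c * t] (f.form a) ≠ 0 ↔ i.ht a.1 = 0) :
    ∃ m : ℕ, 0 < m ∧ ∀ a, (f.affine c a).rootMultiplicity t = m * (i.ht a.1).toNat := by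
  obtain ⟨o₂, u, ho₂, hu⟩ := sh.exists_frame i
  have hne := affine_ne_zero c hf
  have hface : ∀ a, i.ht a.1 = 0 → (f.affine c a).rootMultiplicity t = 0 := by
    intro a ha
    apply rootMultiplicity_eq_zero
    rw [IsRoot.def, eval_affine]
    exact (hi a).2 ha
  have hpow : ∀ (a : Δ.Pts) (n : ℕ), ((f.affine c a) ^ n).rootMultiplicity t =
      n * (f.affine c a).rootMultiplicity t := by
    intro a n
    classical
    rw [← count_roots, roots_pow, Multiset.count_nsmul, count_roots]
  -- The multiplicity is the order of a coordinate at distance one. The others follow from the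
  -- lattice frame, because coordinates on the side itself do not vanish at the point.
  refine ⟨(f.affine c o₂).rootMultiplicity t, ?_, fun a => ?_⟩
  · rw [rootMultiplicity_pos (hne _), IsRoot.def, eval_affine]
    by_contra h
    rw [← Ne, hi] at h
    omega
  · set k := latticePairing u (a.1 - i.origin.1)
    have hl : latticePairing i.1 (a.1 - i.origin.1) = i.ht a.1 := by
      rw [i.ht_eq, latticePairing_sub]
    have hnn := Side.ht_nonneg (i := i) a
    have h1 := (isToric_affine (f := f) c).frame (a := a) (o := i.origin)
      (o₁ := i.edgePt 1 i.length_pos) (o₂ := o₂) (k := k.toNat) (k' := (-k).toNat)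
      (l := (i.ht a.1).toNat) (l' := 0) (by
        rw [show ((k.toNat : ℤ) - (-k).toNat) = k by omega,
          show (((i.ht a.1).toNat : ℤ) - (0 : ℕ)) = i.ht a.1 by omega]
        have := hu (a.1 - i.origin.1)
        rw [hl] at this
        rw [show (i.edgePt 1 i.length_pos).1 - i.origin.1 = i.tangent by simp [Side.edgePt]]
        exact this)
    have h2 := congrArg (rootMultiplicity t) h1
    have hn : ∀ (b : Δ.Pts) (n : ℕ), f.affine c b ^ n ≠ 0 := fun b n => pow_ne_zero _ (hne b)
    rw [rootMultiplicity_mul (by simp [hne]), rootMultiplicity_mul (by simp [hne]),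
      rootMultiplicity_mul (by simp [hne]), rootMultiplicity_mul (by simp [hne]),
      rootMultiplicity_mul (by simp [hne]), rootMultiplicity_mul (by simp [hne]),
      rootMultiplicity_mul (by simp [hne]), rootMultiplicity_mul (by simp [hne])] at h2
    simp only [hpow, hface _ i.ht_origin, hface _ (i.ht_edgePt 1 i.length_pos), mul_zero, zero_mul,
      add_zero, zero_add] at h2
    rw [h2, mul_comm]

theorem emultiplicity_form (c t : K) (hf : ∀ a, f.form a ≠ 0) {p : ℙ K (Fin 2 → K)} {l : K}
    (hl : l ≠ 0) (hp : p.rep = l • ![t, 1 + c * t]) (a : Δ.Pts) :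
    emultiplicity (pointForm p) (f.form a) = (f.affine c a).rootMultiplicity t := by
  rw [← emultiplicity_X_sub_C (affine_ne_zero c hf a), affine,
    ← emultiplicity_dehom (isHomogeneous_shear c (f.isHomogeneous a)),
    ← emultiplicity_map_eq (shear c) (a := pointForm p)]
  refine emultiplicity_eq_of_associated_left ?_
  refine ⟨(Units.mk0 _ hl).map (MvPolynomial.C : K →+* MvPolynomial (Fin 2) K).toMonoidHom, ?_⟩
  rw [pointForm, hp, shear_apply]
  simp [MvPolynomial.algebraMap_eq]
  ring

theorem eval_rep {p : ℙ K (Fin 2 → K)} {l : K} (hl : l ≠ 0) {v : Fin 2 → K} (hp : p.rep = l • v)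
    (a : Δ.Pts) : MvPolynomial.eval p.rep (f.form a) = 0 ↔ MvPolynomial.eval v (f.form a) = 0 := by
  rw [hp, (f.isHomogeneous a).eval_smul, mul_eq_zero, or_iff_right (pow_ne_zero _ hl)]

theorem pullbackMult_eq_zero_of_eval (i : Δ.Side) {p : ℙ K (Fin 2 → K)} {a : Δ.Pts}
    (ha : a ∉ Δ.face i.1) (h : MvPolynomial.eval p.rep (f.form a) ≠ 0) : f.pullbackMult i p = 0 := by
  rw [pullbackMult, ← nonpos_iff_eq_zero]
  exact (iInf_le _ ⟨a, ha⟩).trans (emultiplicity_pointForm_eq_zero h).le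

theorem pullbackMult_eq (sh : Δ.Shape) (c t : K) (hf : ∀ a, f.form a ≠ 0) {p : ℙ K (Fin 2 → K)}
    {l : K} (hl : l ≠ 0) (hp : p.rep = l • ![t, 1 + c * t]) {i : Δ.Side} {m : ℕ}
    (hm : ∀ a, (f.affine c a).rootMultiplicity t = m * (i.ht a.1).toNat) :
    f.pullbackMult i p = m := by
  rw [pullbackMult]
  simp only [emultiplicity_form c t hf hl hp, hm]
  apply le_antisymm
  · obtain ⟨a, ha⟩ := sh.exists_ht_one i
    have ha' : a ∉ Δ.face i.1 := fun h => by rw [Side.mem_face_iff] at h; omega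
    refine (iInf_le _ ⟨a, ha'⟩).trans ?_
    simp [ha]
  · refine le_iInf fun a => ?_
    have h1 := Side.ht_nonneg (i := i) a.1
    have h2 : i.ht a.1.1 ≠ 0 := fun h => a.2 ((Side.mem_face_iff _).2 h)
    have h3 : 1 ≤ (i.ht a.1.1).toNat := by omega
    exact_mod_cast Nat.le_mul_of_pos_right _ h3

theorem exists_affine_point (c : K) (p : ℙ K (Fin 2 → K)) :
    (∃ l : K, l ≠ 0 ∧ p.rep = l • ![1, c]) ∨ ∃ l t : K, l ≠ 0 ∧ p.rep = l • ![t, 1 + c * t] := by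
  by_cases h : p.rep 1 = c * p.rep 0
  · left
    refine ⟨p.rep 0, fun h0 => p.rep_nonzero ?_, ?_⟩
    · ext l; fin_cases l
      · exact h0
      · simp [h, h0]
    · ext l; fin_cases l
      · simp
      · simp [h, mul_comm]
  · right
    have h' : p.rep 1 - c * p.rep 0 ≠ 0 := sub_ne_zero.2 h
    refine ⟨p.rep 1 - c * p.rep 0, p.rep 0 / (p.rep 1 - c * p.rep 0), h', ?_⟩
    ext l; fin_cases l
    · simp [mul_div_cancel₀ _ h']
    · simp only [Fin.mk_one, Pi.smul_apply, Matrix.cons_val_one, Matrix.cons_val_fin_one, smul_eq_mul]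
      field_simp
      ring

theorem exists_point_affine (c t : K) :
    ∃ (p : ℙ K (Fin 2 → K)) (l : K), l ≠ 0 ∧ p.rep = l • ![t, 1 + c * t] := by
  obtain ⟨l, hl⟩ := Projectivization.exists_smul_eq_mk_rep K _ (affine_point_ne_zero c t)
  exact ⟨_, l, l.ne_zero, hl.symm⟩

theorem affine_point_inj (c : K) {p : ℙ K (Fin 2 → K)} {l l' t t' : K}
    (hl : l ≠ 0) (h : p.rep = l • ![t, 1 + c * t]) (h' : p.rep = l' • ![t', 1 + c * t']) : t = t' := by
  have e := h.symm.trans h'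
  have e0 : l * t = l' * t' := congrFun e 0
  have e1 : l * (1 + c * t) = l' * (1 + c * t') := congrFun e 1
  have : l = l' := by linear_combination e1 - c * e0
  rw [← this] at e0
  exact mul_left_cancel₀ hl e0

theorem affine_point_ext (c : K) {p p' : ℙ K (Fin 2 → K)} {l l' t : K} (hl : l ≠ 0) (hl' : l' ≠ 0)
    (h : p.rep = l • ![t, 1 + c * t]) (h' : p'.rep = l' • ![t, 1 + c * t]) : p = p' := by
  rw [← p.mk_rep, ← p'.mk_rep, Projectivization.mk_eq_mk_iff']
  refine ⟨l / l', ?_⟩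
  rw [h, h', smul_smul, div_mul_cancel₀ _ hl']

open IntermediateField in
/-- The parameters of a curve of the Severi variety. -/
theorem exists_parameters [IsAlgClosed K] (sh : Δ.Shape) {C₀ : LinearSystem K Δ}
    (hC : C₀.IsToricallyTransverse) (hn : f.IsNormalizationOf C₀) (hprof : f.HasTangencyProfile d) :
    ∃ θ : Par d → K, IsRegular θ ∧ K⟮Shape.mon θ (1, 0), Shape.mon θ (0, 1)⟯ = ⊤ ∧
      ∑ a, C (C₀.coeff a) * sh.dform θ a = 0 := by
  classical
  have : Infinite K := IsAlgClosed.instInfinite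
  have hf := hprof.form_ne_zero sh
  obtain ⟨c, hc⟩ := exists_affine hf
  obtain ⟨hrel, hbir⟩ := hn
  -- points of the toric boundary
  have hinf : ∀ (i : Δ.Side) (p : ℙ K (Fin 2 → K)), f.pullbackMult i p ≠ 0 →
      ∃ (l t : K) (m : ℕ), l ≠ 0 ∧ p.rep = l • ![t, 1 + c * t] ∧ 0 < m ∧ f.pullbackMult i p = m ∧
        ∀ a, (f.affine c a).rootMultiplicity t = m * (i.ht a.1).toNat := by
    intro i p hp
    obtain ⟨b, hb⟩ := sh.exists_ht_one i
    have hb' : b ∉ Δ.face i.1 := fun h => by rw [Side.mem_face_iff] at h; omega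
    have hall : ∀ a, a ∉ Δ.face i.1 → MvPolynomial.eval p.rep (f.form a) = 0 := fun a ha => by
      by_contra h
      exact hp (pullbackMult_eq_zero_of_eval i ha h)
    rcases exists_affine_point c p with ⟨l, hl, hlp⟩ | ⟨l, t, hl, hlp⟩
    · exact absurd ((eval_rep hl hlp b).1 (hall b hb')) (hc b)
    · obtain ⟨i', hi'⟩ := exists_side sh hC hrel (affine_point_ne_zero c t)
        ⟨b, (eval_rep hl hlp b).1 (hall b hb')⟩
      have hii : i' = i := by
        by_contra hne
        obtain ⟨a, ha, ha'⟩ := sh.exists_mem_face_notMem hne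
        exact (hi' a).2 ((Side.mem_face_iff _).1 ha) ((eval_rep hl hlp a).1 (hall a ha'))
      subst hii
      obtain ⟨m, hm, hma⟩ := rootMultiplicity_affine sh c t hf hi'
      exact ⟨l, t, m, hl, hlp, hm, pullbackMult_eq sh c t hf hl hlp hma, hma⟩
  choose Z hZ hZd using hprof
  -- Equal multisets of multiplicities allow the actual boundary points to be indexed by the entries
  -- of the profile.
  have hequiv : ∀ i : Δ.Side, ∃ e : (d.mult i).ToType ≃ Z i,
      ∀ j, f.pullbackMult i (e j).1 = ((j.1 : ℕ) : ℕ∞) := by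
    intro i
    refine exists_equiv_of_map_eq (f := fun j : (d.mult i).ToType => ((j.1 : ℕ) : ℕ∞))
      (g := fun p : Z i => f.pullbackMult i p.1) ?_
    rw [Multiset.map_univ (d.mult i) (fun k => (k : ℕ∞)), ← hZd i]
    exact (Multiset.attach_map_val' (Z i).val (f.pullbackMult i)).symm
  choose e he using hequiv
  have hpos : ∀ j : Idx d, f.pullbackMult j.1 (e j.1 j.2).1 ≠ 0 := fun j => by
    rw [he]
    exact_mod_cast j.mult_pos.ne'
  choose l t m hl hlp hm hme hma using fun j : Idx d => hinf j.1 _ (hpos j)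
  have hmult : ∀ j : Idx d, m j = j.mult := fun j => by
    have := (hme j).symm.trans (he j.1 j.2)
    exact_mod_cast this
  have hw : ∀ (j : Idx d) a, (f.affine c a).rootMultiplicity (t j) = j.weight a := fun j a => by
    rw [hma, hmult]; rfl
  have hinj : Function.Injective t := by
    intro j k hjk
    have hside : j.1 = k.1 := by
      by_contra hne
      obtain ⟨a, ha, ha'⟩ := sh.exists_mem_face_notMem hne
      have h1 := hw j a
      rw [hjk, hw k a, (j.weight_eq_zero_iff a).2 ha, k.weight_eq_zero_iff] at h1
      exact ha' h1
    have h2 := hlp k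
    rw [← hjk] at h2
    have h3 := affine_point_ext c (hl j) (hl k) (hlp j) h2
    obtain ⟨i, j⟩ := j
    obtain ⟨i', k⟩ := k
    obtain rfl : i = i' := hside
    exact congrArg (Sigma.mk i) ((e i).injective (Subtype.ext h3))
  -- A zero of a coordinate is a preimage of the toric boundary, and the profile accounts for all of
  -- these.
  have hroots : ∀ a s, (f.affine c a).IsRoot s → s ∈ Set.range t := by
    intro a s hs
    obtain ⟨i, hi⟩ := exists_side sh hC hrel (affine_point_ne_zero c s)
      ⟨a, by rw [← eval_affine]; exact hs⟩
    obtain ⟨n, hn, hna⟩ := rootMultiplicity_affine sh c s hf hi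
    obtain ⟨p, l', hl', hp⟩ := exists_point_affine c s
    have h1 := pullbackMult_eq sh c s hf hl' hp hna
    have hpZ : p ∈ Z i := by
      by_contra h
      rw [hZ i p h] at h1
      exact hn.ne (by exact_mod_cast h1)
    obtain ⟨j, hj⟩ := (e i).surjective ⟨p, hpZ⟩
    refine ⟨⟨i, j⟩, ?_⟩
    have h2 := hlp ⟨i, j⟩
    rw [hj] at h2
    exact affine_point_inj c (hl ⟨i, j⟩) h2 hp
  have hprod : ∀ a, f.affine c a = C (f.affine c a).leadingCoeff *
      ∏ j : Idx d, (X - C (t j)) ^ j.weight a := by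
    intro a
    conv_lhs => rw [eq_prod_of_roots_mem_range hinj (hroots a)]
    simp only [hw]
  -- The leading coefficients again satisfy the toric relations and do not vanish, so they are
  -- monomials in two scalars; these are the remaining parameters.
  obtain ⟨c₀, x, y, hc₀, hx, hy, hlc⟩ := IsToric.exists_eq_monomial sh
    ((isToric_affine (f := f) c).map leadingCoeffHom)
    (fun a => leadingCoeff_ne_zero.2 (affine_ne_zero c hf a))
  let θ : Par d → K := Sum.elim ![x, y] t
  have hθ : IsRegular θ := ⟨fun l => by fin_cases l <;> simpa [θ], hinj⟩
  have hdf : ∀ a, f.affine c a = C c₀ * sh.dform θ a := by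
    intro a
    rw [hprod a, Shape.dform, ← mul_assoc, ← C_mul]
    congr 2
    exact hlc a
  refine ⟨θ, hθ, ?_, ?_⟩
  · have h1 := adjoin_shear_eq_top f.isHomogeneous c hbir
    rw [eq_top_iff, ← h1, adjoin_le_iff]
    rintro _ ⟨a, b, rfl⟩
    change algebraMap K[X] (RatFunc K) (f.affine c a) / algebraMap K[X] (RatFunc K) (f.affine c b) ∈ _
    rw [hdf, hdf, map_mul, map_mul, mul_div_mul_left _ _ (by
      rw [map_ne_zero_iff _ (IsFractionRing.injective K[X] (RatFunc K))]; simpa using hc₀),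
      Shape.algebraMap_dform sh hθ, Shape.algebraMap_dform sh hθ,
      mul_div_mul_left _ _ (Shape.mon_prod_ne_zero _)]
    have hx : Shape.mon θ (1, 0) ∈ K⟮Shape.mon θ (1, 0), Shape.mon θ (0, 1)⟯ :=
      subset_adjoin _ _ (by simp)
    have hy : Shape.mon θ (0, 1) ∈ K⟮Shape.mon θ (1, 0), Shape.mon θ (0, 1)⟯ :=
      subset_adjoin _ _ (by simp)
    exact div_mem (mul_mem (pow_mem hx _) (pow_mem hy _)) (mul_mem (pow_mem hx _) (pow_mem hy _))
  · rw [bind₁_linearForm] at hrel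
    have h1 := congrArg (fun g => dehom (shear c g)) hrel
    simp only [map_sum, map_mul, map_zero] at h1
    have h2 : ∀ a, dehom (shear c (MvPolynomial.C (C₀.coeff a))) = C (C₀.coeff a) := fun a => by
      simp [shear_apply, dehom]
    have h3 : C c₀ * ∑ a, C (C₀.coeff a) * sh.dform θ a = 0 := by
      rw [← h1, Finset.mul_sum]
      refine Finset.sum_congr rfl fun a _ => ?_
      rw [h2]
      change _ = _ * f.affine c a
      rw [hdf]
      ring
    exact (mul_eq_zero.1 h3).resolve_left (by simpa using hc₀)

end LineMap

end LatticePolygon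

/-! ### Derivatives by dual numbers -/

section DualNumbers

variable {K : Type*} [Field K] {σ : Type*} [Fintype σ]

/-- The value of a polynomial at a tangent vector. -/
theorem aeval_dualNumber (p q : σ → K) (h : MvPolynomial σ K) :
    MvPolynomial.aeval (fun j => (TrivSqZeroExt.inl (p j) + TrivSqZeroExt.inr (q j) : DualNumber K)) h =
      TrivSqZeroExt.inl (MvPolynomial.eval p h) +
        TrivSqZeroExt.inr (∑ j, q j * MvPolynomial.eval p (MvPolynomial.pderiv j h)) := by
  classical
  induction h using MvPolynomial.induction_on with
  | C c => simp [TrivSqZeroExt.algebraMap_eq_inl]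
  | add f g hf hg =>
    rw [map_add, hf, hg]
    ext <;> simp [mul_add, Finset.sum_add_distrib]
  | mul_X f j hf =>
    rw [map_mul, hf, MvPolynomial.aeval_X]
    ext
    · simp
    · simp [Derivation.leibniz, MvPolynomial.pderiv_X, Pi.single_apply, mul_add,
        Finset.sum_add_distrib, Finset.mul_sum]
      simp only [apply_ite (MvPolynomial.eval p), map_zero, mul_ite, mul_zero, Finset.sum_ite_eq,
        Finset.mem_univ, if_true]
      rw [add_comm, Finset.sum_mul]
      congr 1
      exact Finset.sum_congr rfl fun l _ => by ring

theorem linearIndependent_pair_of_eq {V : Type*} [AddCommGroup V] [Module K V] {u w u' w' : V} {l m : K}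
    (hl : l ≠ 0) (hu : u = l • u') (hw : w = l • w' + m • u')
    (h : LinearIndependent K ![u', w']) : LinearIndependent K ![u, w] := by
  rw [LinearIndependent.pair_iff] at h ⊢
  intro s t hst
  have h1 := h (s * l + t * m) (t * l) (by rw [← hst, hu, hw]; module)
  have ht : t = 0 := by simpa [hl] using h1.2
  refine ⟨?_, ht⟩
  simpa [ht, hl] using h1.1

end DualNumbers

namespace LatticePolygon

open Polynomial
open scoped Polynomial.Bivariate

variable {Δ : LatticePolygon} {d : Δ.TangencyProfile} {K : Type*} [Field K]

/-! ### Comparison of parametrizations -/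

open IntermediateField in
-- The kernel at a parameter is at most one-dimensional, so the properties of the constructed
-- equation pass to every equation at this parameter.
theorem IsGeneric.equation (sh : Δ.Shape) {θ : Par d → K} (hθ : IsGeneric θ)
    (hd : ∀ i : Δ.Side, ¬ i.IsHorizontal → d.IsTrivialOn i) {F : Δ.Pts → K} (hF : F ≠ 0)
    (hrel : ∑ a, C (F a) * sh.dform θ a = 0) :
    K⟮Shape.mon θ (1, 0), Shape.mon θ (0, 1)⟯ = ⊤ ∧ Irreducible (sh.poly F) ∧
      ∀ a, IsVertex a → F a ≠ 0 := by
  have hreg := hθ.toIsRegular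
  obtain ⟨htop, F', hirr, hrel', hv⟩ := hθ.exists_equation sh hd
  have hF' : F' ≠ 0 := by
    rintro rfl
    exact hirr.ne_zero (by simp [Shape.poly])
  obtain ⟨c, rfl⟩ := sh.eq_smul_of_relations hreg htop hF'
    ((sh.sum_dform_eq_zero_iff hreg F').2 hrel') hrel
  have hc : c ≠ 0 := by
    rintro rfl
    exact hF (zero_smul _ _)
  refine ⟨htop, ?_, fun a ha => mul_ne_zero hc (hv a ha)⟩
  rw [sh.poly_smul]
  exact (irreducible_isUnit_mul (isUnit_C.2 (isUnit_C.2 hc.isUnit))).2 hirr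

/-- The restriction of an equation to a side. -/
def Side.edgePoly (i : Δ.Side) (F : Δ.Pts → K) : K[X] :=
  ∑ k : Fin (i.length + 1), monomial k.1 (F (i.edgePt k.1 (Nat.lt_succ_iff.1 k.2)))

theorem Side.coeff_edgePoly (i : Δ.Side) (F : Δ.Pts → K) (k : ℕ) (hk : k ≤ i.length) :
    (i.edgePoly F).coeff k = F (i.edgePt k hk) := by
  simp only [edgePoly, finsetSum_coeff, coeff_monomial]
  rw [Finset.sum_eq_single ⟨k, Nat.lt_succ_iff.2 hk⟩]
  · simp
  · intro l _ hl
    rw [if_neg]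
    intro h
    exact hl (Fin.ext h)
  · simp

theorem Side.sum_face {A : Type*} [AddCommMonoid A] (i : Δ.Side) {g : Δ.Pts → A}
    (hg : ∀ a, i.ht a.1 ≠ 0 → g a = 0) :
    ∑ a, g a = ∑ k : Fin (i.length + 1), g (i.edgePt k.1 (Nat.lt_succ_iff.1 k.2)) := by
  refine (Fintype.sum_of_injective (fun k : Fin (i.length + 1) =>
    i.edgePt k.1 (Nat.lt_succ_iff.1 k.2)) (fun k l h => Fin.ext (i.edgePt_inj h)) _ _
    (fun a ha => hg a fun h => ha ?_) fun _ => rfl).symm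
  obtain ⟨k, hk, rfl⟩ := i.exists_edgePt h
  exact ⟨⟨k, Nat.lt_succ_iff.2 hk⟩, rfl⟩

theorem Side.aeval_edgePoly {A : Type*} [CommRing A] [Algebra K A] (i : Δ.Side) (F : Δ.Pts → K) (r : A) :
    aeval r (i.edgePoly F) = ∑ k : Fin (i.length + 1),
      algebraMap K A (F (i.edgePt k.1 (Nat.lt_succ_iff.1 k.2))) * r ^ k.1 := by
  rw [edgePoly, map_sum]
  simp only [aeval_monomial]

theorem IsToric.edge {R : Type*} [CommMonoid R] {Z : Δ.Pts → R} (hZ : IsToric Z) (i : Δ.Side)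
    {k : ℕ} (hk : k ≤ i.length) :
    Z (i.edgePt k hk) * Z i.origin ^ k = Z i.origin * Z (i.edgePt 1 i.length_pos) ^ k := by
  have := hZ.frame (a := i.edgePt k hk) (o := i.origin) (o₁ := i.edgePt 1 i.length_pos)
    (o₂ := i.origin) (k := k) (k' := 0) (l := 0) (l' := 0) (by simp [Side.edgePt])
  simpa using this

namespace LineMap

variable {f : LineMap K Δ} {C₀ : LinearSystem K Δ}

open IntermediateField in
/-- The normalization of a curve that is not contained in the toric boundary. -/
theorem IsNormalizationOf.form_ne_zero (sh : Δ.Shape) (hf : f.IsNormalizationOf C₀)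
    (hv : ∀ a, IsVertex a → C₀.coeff a ≠ 0) (a : Δ.Pts) : f.form a ≠ 0 := by
  obtain ⟨hrel, hbir⟩ := hf
  obtain ⟨b, hb⟩ := f.no_common_zero 1 one_ne_zero
  rw [bind₁_linearForm] at hrel
  rcases f.isToric.support sh ⟨b, fun h => hb (by rw [h, map_zero])⟩ with h | ⟨i, hi⟩ | ⟨b, hb, -, hb0, h⟩
  · exact h a
  · exfalso
    let Z : Δ.Pts → RatFunc K := fun a => MvPolynomial.aeval ![RatFunc.X, 1] (f.form a)
    have hZ : IsToric Z := f.isToric.map (MvPolynomial.aeval ![(RatFunc.X : RatFunc K), 1])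
    have hZ0 : ∀ a, Z a ≠ 0 ↔ i.ht a.1 = 0 := fun a => by
      rw [← hi a]
      simp only [Z]
      rw [← algebraMap_dehom, map_ne_zero_iff _ (IsFractionRing.injective K[X] (RatFunc K)),
        Ne, dehom_eq_zero_iff (f.isHomogeneous a)]
    have ho := (hZ0 _).2 i.ht_origin
    set ρ := Z (i.edgePt 1 i.length_pos) / Z i.origin with hρ
    have hedge : ∀ k (hk : k ≤ i.length), Z (i.edgePt k hk) = Z i.origin * ρ ^ k := fun k hk => by
      rw [hρ, div_pow, mul_div_assoc', eq_div_iff (pow_ne_zero _ ho), hZ.edge i hk]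
    have hP : aeval ρ (i.edgePoly C₀.coeff) = 0 := by
      have h1 := congrArg (MvPolynomial.aeval ![(RatFunc.X : RatFunc K), 1]) hrel
      rw [map_zero, map_sum, i.sum_face (fun a ha => by
        have : f.form a = 0 := by_contra fun h => ha ((hi a).1 h)
        rw [this, mul_zero, map_zero])] at h1
      have h2 : Z i.origin * aeval ρ (i.edgePoly C₀.coeff) = 0 := by
        rw [i.aeval_edgePoly, Finset.mul_sum, ← h1]
        refine Finset.sum_congr rfl fun k _ => ?_
        rw [map_mul, MvPolynomial.aeval_C]
        change _ = _ * Z _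
        rw [hedge]
        ring
      exact (mul_eq_zero.1 h2).resolve_left ho
    have hP0 : i.edgePoly C₀.coeff ≠ 0 := by
      intro h0
      have h1 := i.coeff_edgePoly C₀.coeff 0 (Nat.zero_le _)
      rw [h0, coeff_zero] at h1
      exact hv _ (i.isVertex_edgePt (Nat.zero_le _) (Or.inl rfl)) h1.symm
    -- On a map into a toric divisor, the coordinate along the divisor satisfies the restricted
    -- equation, which is nonzero because of the vertex. So it is constant, and the map would not be
    -- birational.
    obtain ⟨c, hc⟩ : ∃ c, ρ = RatFunc.C c := by
      by_contra hcon
      exact RatFunc.transcendental_of_ne_C _ hcon ⟨_, hP0, hP⟩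
    apply bot_ne_top_ratFunc (K := K)
    rw [← hbir, eq_comm, adjoin_eq_bot_iff]
    rintro _ ⟨a, b, rfl⟩
    change Z a / Z b ∈ _
    by_cases ha : i.ht a.1 = 0
    · by_cases hb : i.ht b.1 = 0
      · obtain ⟨k, hk, rfl⟩ := i.exists_edgePt ha
        obtain ⟨l, hl, rfl⟩ := i.exists_edgePt hb
        rw [hedge, hedge, mul_div_mul_left _ _ ho, hc]
        exact ⟨c ^ k / c ^ l, by simp [RatFunc.algebraMap_eq_C]⟩
      · rw [not_not.1 (mt (hZ0 b).1 hb), div_zero]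
        exact zero_mem _
    · rw [not_not.1 (mt (hZ0 a).1 ha), zero_div]
      exact zero_mem _
  · exfalso
    rw [Finset.sum_eq_single b (fun c _ hc => by rw [h c hc, mul_zero]) (by simp)] at hrel
    rcases mul_eq_zero.1 hrel with h1 | h1
    · exact hv b hb (by simpa using h1)
    · exact hb0 h1

/-- A linear change of coordinates in binary forms. -/
def linSubst (m : Fin 2 → Fin 2 → K) : MvPolynomial (Fin 2) K →ₐ[K] MvPolynomial (Fin 2) K :=
  MvPolynomial.aeval fun j => MvPolynomial.C (m j 0) * MvPolynomial.X 0 +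
    MvPolynomial.C (m j 1) * MvPolynomial.X 1

theorem aeval_linSubst {A : Type*} [CommRing A] [Algebra K A] (m : Fin 2 → Fin 2 → K) (v : Fin 2 → A)
    (h : MvPolynomial (Fin 2) K) : MvPolynomial.aeval v (linSubst m h) =
      MvPolynomial.aeval (fun j => algebraMap K A (m j 0) * v 0 + algebraMap K A (m j 1) * v 1) h := by
  rw [linSubst, ← AlgHom.comp_apply]
  congr 1
  apply MvPolynomial.algHom_ext
  intro j
  simp

theorem isHomogeneous_linSubst (m : Fin 2 → Fin 2 → K) {h : MvPolynomial (Fin 2) K} {D : ℕ}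
    (hh : h.IsHomogeneous D) : (linSubst m h).IsHomogeneous D := by
  have := hh.aeval (S := K) (τ := Fin 2) (fun j => MvPolynomial.C (m j 0) * MvPolynomial.X 0 +
    MvPolynomial.C (m j 1) * MvPolynomial.X 1) (n := 1) fun j =>
      (MvPolynomial.isHomogeneous_C_mul_X _ _).add (MvPolynomial.isHomogeneous_C_mul_X _ _)
  rwa [one_mul] at this

open IntermediateField in
/-- Any two parametrizations of a curve differ by a linear change of coordinates. -/
theorem IsNormalizationOf.exists_linSubst (sh : Δ.Shape) {θ : Par d → K} (hθ : IsGeneric θ)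
    (hd : ∀ i : Δ.Side, ¬ i.IsHorizontal → d.IsTrivialOn i)
    (hrel : ∑ a, C (C₀.coeff a) * sh.dform θ a = 0) (hf : f.IsNormalizationOf C₀) :
    ∃ m : Fin 2 → Fin 2 → K, m 0 0 * m 1 1 - m 0 1 * m 1 0 ≠ 0 ∧
      ∀ a b, f.form a * linSubst m (sh.hform θ b) = f.form b * linSubst m (sh.hform θ a) := by
  have hreg := hθ.toIsRegular
  obtain ⟨htop, hirr, hv⟩ := hθ.equation sh hd C₀.coeff_ne_zero hrel
  have hrelθ := (sh.sum_dform_eq_zero_iff hreg _).1 hrel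
  have hform := hf.form_ne_zero sh hv
  let Z : Δ.Pts → RatFunc K := fun a => MvPolynomial.aeval ![RatFunc.X, 1] (f.form a)
  have hZ : IsToric Z := f.isToric.map (MvPolynomial.aeval ![(RatFunc.X : RatFunc K), 1])
  have hZ0 : ∀ a, Z a ≠ 0 := fun a => by
    simp only [Z]
    rw [← algebraMap_dehom, map_ne_zero_iff _ (IsFractionRing.injective K[X] (RatFunc K)),
      Ne, dehom_eq_zero_iff (f.isHomogeneous a)]
    exact hform a
  obtain ⟨c, x, y, hc, hx, hy, hxy⟩ := hZ.exists_eq_monomial sh hZ0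
  have hrelf : aevalAeval x y (sh.poly C₀.coeff) = 0 := by
    rw [sh.aevalAeval_poly]
    have h1 := congrArg (MvPolynomial.aeval ![(RatFunc.X : RatFunc K), 1]) hf.1
    rw [bind₁_linearForm, map_zero, map_sum] at h1
    have h2 : c * ∑ a, algebraMap K (RatFunc K) (C₀.coeff a) * (x ^ sh.col a * y ^ sh.row a) = 0 := by
      rw [← h1, Finset.mul_sum]
      refine Finset.sum_congr rfl fun a _ => ?_
      rw [map_mul, MvPolynomial.aeval_C]
      change _ = _ * Z a
      rw [hxy]
      ring
    exact (mul_eq_zero.1 h2).resolve_left hc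
  have htopf : K⟮x, y⟯ = ⊤ := by
    rw [eq_top_iff, ← hf.2, adjoin_le_iff]
    rintro _ ⟨a, b, rfl⟩
    change Z a / Z b ∈ K⟮x, y⟯
    rw [hxy, hxy, mul_div_mul_left _ _ hc]
    have hx' : x ∈ K⟮x, y⟯ := subset_adjoin _ _ (by simp)
    have hy' : y ∈ K⟮x, y⟯ := subset_adjoin _ _ (by simp)
    exact div_mem (mul_mem (pow_mem hx' _) (pow_mem hy' _)) (mul_mem (pow_mem hx' _) (pow_mem hy' _))
  have hdeg := natDegree_ne_zero_of_aevalAeval (sh.mon_fst_not_const hreg) hirr.ne_zero hrelθ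
  -- Both pairs of torus coordinates satisfy the same irreducible equation, hence they differ by an
  -- automorphism of `K(t)`, which is fractional linear.
  obtain ⟨σ, hσx, hσy⟩ := exists_algEquiv_of_relation hirr hdeg hrelθ hrelf htop htopf
  obtain ⟨α, β, γ, δ, hdet, hσX⟩ := exists_mobius σ
  refine ⟨![![α, β], ![γ, δ]], by simpa using hdet, fun a b => ?_⟩
  set u : RatFunc K := RatFunc.C γ * RatFunc.X + RatFunc.C δ with hu
  have hu0 : u ≠ 0 := by
    intro h
    have h1 : algebraMap K[X] (RatFunc K) (C γ * X + C δ) = 0 := by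
      rw [map_add, map_mul, RatFunc.algebraMap_C, RatFunc.algebraMap_X, RatFunc.algebraMap_C]
      exact h
    rw [map_eq_zero_iff _ (IsFractionRing.injective K[X] (RatFunc K))] at h1
    have e1 : γ = 0 := by simpa using congrArg (fun q => q.coeff 1) h1
    have e2 : δ = 0 := by simpa using congrArg (fun q => q.coeff 0) h1
    rw [e1, e2] at hdet
    simp at hdet
  have hsub : ∀ a, MvPolynomial.aeval ![(RatFunc.X : RatFunc K), 1]
      (linSubst ![![α, β], ![γ, δ]] (sh.hform θ a)) = u ^ sh.paramDegree d *
        (σ (∏ j : Idx d, (RatFunc.X - RatFunc.C (θ (Sum.inr j))) ^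
          (j.mult * j.1.ht (sh.x₁, sh.y₀) : ℤ)) * (x ^ sh.col a * y ^ sh.row a)) := by
    intro a
    have h1 : σ (MvPolynomial.aeval ![RatFunc.X, 1] (sh.hform θ a)) =
        MvPolynomial.aeval ![σ RatFunc.X, 1] (sh.hform θ a) := by
      rw [← AlgHom.coe_coe, ← AlgHom.comp_apply]
      congr 1
      apply MvPolynomial.algHom_ext
      intro j; fin_cases j <;> simp
    have h2 := congrArg σ (sh.algebraMap_dform hreg a)
    rw [← sh.dehom_hform, algebraMap_dehom, h1, map_mul, map_mul, map_pow, map_pow, hσx, hσy] at h2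
    rw [← h2, ← aeval_mul_of_isHomogeneous (sh.isHomogeneous_hform θ a), aeval_linSubst]
    congr 2
    ext j
    fin_cases j
    · simp [hσX, mul_div_cancel₀ _ hu0, RatFunc.algebraMap_eq_C]
    · simp [hu, RatFunc.algebraMap_eq_C]
  have hh : (f.form a * linSubst ![![α, β], ![γ, δ]] (sh.hform θ b) -
      f.form b * linSubst ![![α, β], ![γ, δ]] (sh.hform θ a)).IsHomogeneous
        (f.degree + sh.paramDegree d) :=
    ((f.isHomogeneous a).mul (isHomogeneous_linSubst _ (sh.isHomogeneous_hform θ b))).sub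
      ((f.isHomogeneous b).mul (isHomogeneous_linSubst _ (sh.isHomogeneous_hform θ a)))
  rw [← sub_eq_zero, ← dehom_eq_zero_iff hh,
    ← map_eq_zero_iff _ (IsFractionRing.injective K[X] (RatFunc K)), algebraMap_dehom, map_sub,
    map_mul, map_mul, hsub, hsub]
  change Z a * _ - Z b * _ = 0
  rw [hxy, hxy]
  ring

end LineMap

end LatticePolygon

namespace LatticePolygon

open Polynomial

variable {Δ : LatticePolygon} {d : Δ.TangencyProfile} {K : Type*} [Field K]

/-! ### Injectivity on the toric boundary -/

namespace Shape

variable (sh : Δ.Shape) {θ : Par d → K}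

/-- On a divisor the quotient of two coordinates is a Laurent monomial without a zero or pole at
`j`. It has total degree zero, so the scale `p 1` cancels. -/
theorem eval_hform_face (hθ : IsRegular θ) {p : Fin 2 → K} (hp1 : p 1 ≠ 0) {j : Idx d}
    (hj : p 0 = θ (Sum.inr j) * p 1) {a b : Δ.Pts} (ha : a ∈ Δ.face j.1.1) (hb : b ∈ Δ.face j.1.1) :
    MvPolynomial.eval p (sh.hform θ a) =
      mval θ j (a.1 - b.1) * MvPolynomial.eval p (sh.hform θ b) := by
  classical
  have hwj : ∀ c ∈ Δ.face j.1.1, j.weight c = 0 := fun c hc => (j.weight_eq_zero_iff c).2 hc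
  have hexpj : j.exp (a.1 - b.1) = 0 := by
    have h1 := j.weight_eq a
    have h2 := j.weight_eq b
    rw [hwj a ha] at h1
    rw [hwj b hb] at h2
    simp only [Idx.exp, latticePairing_sub] at h1 h2 ⊢
    rw [mul_sub]
    omega
  have hL : ∀ k : Idx d, p 0 - θ (Sum.inr k) * p 1 = (θ (Sum.inr j) - θ (Sum.inr k)) * p 1 := fun k => by
    rw [hj]; ring
  have hprod : ∀ c ∈ Δ.face j.1.1, ∏ k : Idx d, (p 0 - θ (Sum.inr k) * p 1) ^ k.weight c =
      ∏ k ∈ Finset.univ.erase j, (p 0 - θ (Sum.inr k) * p 1) ^ k.weight c := fun c hc => by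
    rw [← Finset.mul_prod_erase _ _ (Finset.mem_univ j), hwj c hc, pow_zero, one_mul]
  have hsum : ∑ k ∈ Finset.univ.erase j, k.exp (a.1 - b.1) = 0 := by
    have := sh.sum_exp (d := d) (a.1 - b.1)
    rw [← Finset.add_sum_erase _ _ (Finset.mem_univ j), hexpj, zero_add] at this
    exact this
  have hw : ∀ k ∈ Finset.univ.erase j, (p 0 - θ (Sum.inr k) * p 1) ^ k.weight a =
      (θ (Sum.inr j) - θ (Sum.inr k)) ^ k.exp (a.1 - b.1) * p 1 ^ k.exp (a.1 - b.1) *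
        (p 0 - θ (Sum.inr k) * p 1) ^ k.weight b := by
    intro k hk
    have hne : p 0 - θ (Sum.inr k) * p 1 ≠ 0 := by
      rw [hL]; exact mul_ne_zero (hθ.sub_ne_zero hk) hp1
    rw [← mul_zpow, ← hL, ← zpow_natCast, ← zpow_natCast, ← zpow_add₀ hne]
    congr 1
    rw [k.weight_eq, k.weight_eq, Idx.exp, Idx.exp, Idx.exp, latticePairing_sub]
    ring
  have hp1sum : ∏ k ∈ Finset.univ.erase j, p 1 ^ k.exp (a.1 - b.1) = 1 := by
    have : ∀ s : Finset (Idx d), ∏ k ∈ s, p 1 ^ k.exp (a.1 - b.1) =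
        p 1 ^ ∑ k ∈ s, k.exp (a.1 - b.1) := by
      intro s
      induction s using Finset.induction_on with
      | empty => simp
      | insert k s hk ih => rw [Finset.prod_insert hk, Finset.sum_insert hk, zpow_add₀ hp1, ih]
    rw [this, hsum, zpow_zero]
  rw [eval_hform, eval_hform, hprod a ha, hprod b hb, Finset.prod_congr rfl hw, Finset.prod_mul_distrib,
    Finset.prod_mul_distrib, hp1sum, mval, Prod.fst_sub, Prod.snd_sub, sh.fst_eq a, sh.fst_eq b,
    sh.snd_eq a, sh.snd_eq b, add_sub_add_left_eq_sub, add_sub_add_left_eq_sub,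
    zpow_sub₀ (hθ.ne_zero 0), zpow_sub₀ (hθ.ne_zero 1)]
  have h1 := hθ.ne_zero 0
  have h2 := hθ.ne_zero 1
  simp only [zpow_natCast]
  field_simp
  simp only [mul_comm (p 1)]

theorem mem_face_iff_of_eval (hθ : IsRegular θ) {p : Fin 2 → K} (hp : p ≠ 0) {j : Idx d}
    (hj : p 0 = θ (Sum.inr j) * p 1) (a : Δ.Pts) :
    MvPolynomial.eval p (sh.hform θ a) ≠ 0 ↔ a ∈ Δ.face j.1.1 := by
  rw [sh.eval_hform_ne_zero_iff hθ]
  exact ⟨fun h => h j hj, fun h k hk => idx_unique hθ hp hj hk ▸ h⟩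

omit sh in
theorem snd_ne_zero {p : Fin 2 → K} (hp : p ≠ 0) {t : K} (ht : p 0 = t * p 1) : p 1 ≠ 0 := by
  intro h
  apply hp
  ext l
  fin_cases l
  · simp [ht, h]
  · exact h

/-- For general parameters the morphism is injective on the preimage of the toric boundary. -/
theorem eq_smul_of_lift_eq (hθ : IsGeneric θ) {p q : Fin 2 → K} (hp : p ≠ 0) (hq : q ≠ 0) {c : K}
    (hc : c ≠ 0) (hpq : ∀ a, MvPolynomial.eval p (sh.hform θ a) = c * MvPolynomial.eval q (sh.hform θ a))
    {a₀ : Δ.Pts} (ha₀ : MvPolynomial.eval p (sh.hform θ a₀) = 0) : ∃ l : K, p = l • q := by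
  have hreg := hθ.toIsRegular
  have hex : ∀ r : Fin 2 → K, MvPolynomial.eval r (sh.hform θ a₀) = 0 →
      ∃ j : Idx d, r 0 = θ (Sum.inr j) * r 1 := by
    intro r hr
    by_contra! h
    exact (sh.eval_hform_ne_zero_iff hreg r a₀).2 (fun j hj => absurd hj (h j)) hr
  obtain ⟨j, hj⟩ := hex p ha₀
  obtain ⟨k, hk⟩ := hex q (by
    have := hpq a₀
    rw [ha₀] at this
    exact (mul_eq_zero.1 this.symm).resolve_left hc)
  have hside : j.1 = k.1 := by
    by_contra hne
    obtain ⟨a, ha, ha'⟩ := sh.exists_mem_face_notMem hne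
    rw [← sh.mem_face_iff_of_eval hreg hp hj, hpq] at ha
    rw [← sh.mem_face_iff_of_eval hreg hq hk] at ha'
    exact ha' (right_ne_zero_of_mul ha)
  have ho : j.1.origin ∈ Δ.face j.1.1 := (Side.mem_face_iff _).2 j.1.ht_origin
  have h1 : j.1.edgePt 1 j.1.length_pos ∈ Δ.face j.1.1 := (Side.mem_face_iff _).2 (j.1.ht_edgePt 1 _)
  have ht : (j.1.edgePt 1 j.1.length_pos).1 - j.1.origin.1 = j.1.tangent := by simp [Side.edgePt]
  have e1 := sh.eval_hform_face hreg (snd_ne_zero hp hj) hj h1 ho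
  have e2 := sh.eval_hform_face hreg (snd_ne_zero hq hk) hk
    (a := j.1.edgePt 1 j.1.length_pos) (b := j.1.origin) (by rw [← hside]; exact h1)
    (by rw [← hside]; exact ho)
  have hne := (sh.mem_face_iff_of_eval hreg hp hj _).2 ho
  rw [ht] at e1 e2
  -- Equal image points have equal coordinates along the divisor, and generality separates these.
  have hs : sval θ j = sval θ k := by
    rw [sval, sval, ← hside]
    apply mul_right_cancel₀ hne
    rw [← e1, hpq, e2, hpq]
    ring
  have hjk : j = k := by
    by_contra h
    exact hθ.sval_ne j k h hside hs
  subst hjk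
  refine ⟨p 1 / q 1, ?_⟩
  have hq1 := snd_ne_zero hq hk
  ext l
  fin_cases l
  · simp [hj, hk]; field_simp
  · simp [hq1]

end Shape

namespace LineMap

variable {f : LineMap K Δ} {C₀ : LinearSystem K Δ} (sh : Δ.Shape) {θ : Par d → K}

theorem linSubst_ne_zero {m : Fin 2 → Fin 2 → K} (hm : m 0 0 * m 1 1 - m 0 1 * m 1 0 ≠ 0)
    {p : Fin 2 → K} (hp : p ≠ 0) : (fun j => m j 0 * p 0 + m j 1 * p 1) ≠ 0 := by
  intro h
  have h0 : m 0 0 * p 0 + m 0 1 * p 1 = 0 := congrFun h 0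
  have h1 : m 1 0 * p 0 + m 1 1 * p 1 = 0 := congrFun h 1
  apply hp
  ext l
  fin_cases l
  · exact (mul_eq_zero.1 (show (m 0 0 * m 1 1 - m 0 1 * m 1 0) * p 0 = 0 by
      linear_combination m 1 1 * h0 - m 0 1 * h1)).resolve_left hm
  · exact (mul_eq_zero.1 (show (m 0 0 * m 1 1 - m 0 1 * m 1 0) * p 1 = 0 by
      linear_combination m 0 0 * h1 - m 1 0 * h0)).resolve_left hm

/-- A morphism and its tangent vectors after a linear change of coordinates. -/
theorem exists_eq_smul_of_linSubst (hθ : IsRegular θ) {m : Fin 2 → Fin 2 → K}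
    (hm : m 0 0 * m 1 1 - m 0 1 * m 1 0 ≠ 0)
    (h : ∀ a b, f.form a * linSubst m (sh.hform θ b) = f.form b * linSubst m (sh.hform θ a))
    {p : Fin 2 → K} (hp : p ≠ 0) (q : Fin 2 → K) : ∃ l l' : K, l ≠ 0 ∧
      f.lift p = l • (sh.lineMap hθ).lift (fun j => m j 0 * p 0 + m j 1 * p 1) ∧
      (fun a => ∑ j, q j * MvPolynomial.eval p (MvPolynomial.pderiv j (f.form a))) =
        l • (fun a => ∑ j, (m j 0 * q 0 + m j 1 * q 1) * MvPolynomial.eval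
          (fun j => m j 0 * p 0 + m j 1 * p 1) (MvPolynomial.pderiv j ((sh.lineMap hθ).form a))) +
        l' • (sh.lineMap hθ).lift (fun j => m j 0 * p 0 + m j 1 * p 1) := by
  set P : Fin 2 → K := fun j => m j 0 * p 0 + m j 1 * p 1 with hP
  set Q : Fin 2 → K := fun j => m j 0 * q 0 + m j 1 * q 1 with hQ
  have hsub : ∀ b, MvPolynomial.aeval (fun j => (TrivSqZeroExt.inl (p j) + TrivSqZeroExt.inr (q j) :
      DualNumber K)) (linSubst m (sh.hform θ b)) = TrivSqZeroExt.inl (MvPolynomial.eval P (sh.hform θ b)) +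
        TrivSqZeroExt.inr (∑ j, Q j * MvPolynomial.eval P (MvPolynomial.pderiv j (sh.hform θ b))) := by
    intro b
    rw [aeval_linSubst, ← aeval_dualNumber]
    congr 2
    ext j <;> simp [hP, hQ, TrivSqZeroExt.algebraMap_eq_inl]
  set u := f.lift p with hu
  set w : Δ.Pts → K := fun a => ∑ j, q j * MvPolynomial.eval p (MvPolynomial.pderiv j (f.form a)) with hw
  set u' := (sh.lineMap hθ).lift P with hu'
  set w' : Δ.Pts → K := fun a => ∑ j, Q j * MvPolynomial.eval P
    (MvPolynomial.pderiv j ((sh.lineMap hθ).form a)) with hw'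
  -- Evaluating the proportionality of the two parametrizations at a dual number yields at once the
  -- relations between values and between first derivatives.
  have key : ∀ a b, u a * u' b = u b * u' a ∧ u a * w' b + w a * u' b = u b * w' a + w b * u' a := by
    intro a b
    have h1 := congrArg (MvPolynomial.aeval (fun j => (TrivSqZeroExt.inl (p j) +
      TrivSqZeroExt.inr (q j) : DualNumber K))) (h a b)
    rw [map_mul, map_mul, hsub, hsub, aeval_dualNumber, aeval_dualNumber] at h1
    have e1 := congrArg TrivSqZeroExt.fst h1
    have e2 := congrArg TrivSqZeroExt.snd h1
    simp only [TrivSqZeroExt.fst_mul, TrivSqZeroExt.snd_mul, TrivSqZeroExt.fst_add,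
      TrivSqZeroExt.snd_add, TrivSqZeroExt.fst_inl, TrivSqZeroExt.snd_inl, TrivSqZeroExt.fst_inr,
      TrivSqZeroExt.snd_inr, add_zero, zero_add, smul_eq_mul, MulOpposite.smul_eq_mul_unop,
      MulOpposite.unop_op] at e1 e2
    exact ⟨e1, e2⟩
  obtain ⟨b, hb⟩ := (sh.lineMap hθ).no_common_zero P (linSubst_ne_zero hm hp)
  change u' b ≠ 0 at hb
  have hu0 : u = (u b / u' b) • u' := by
    ext a
    rw [Pi.smul_apply, smul_eq_mul, div_mul_eq_mul_div, eq_div_iff hb]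
    exact (key a b).1
  refine ⟨u b / u' b, (w b - u b / u' b * w' b) / u' b, ?_, hu0, ?_⟩
  · intro h0
    rw [h0, zero_smul] at hu0
    exact f.lift_ne_zero hp hu0
  · ext a
    have e1 := (key a b).1
    have e2 := (key a b).2
    simp only [Pi.add_apply, Pi.smul_apply, smul_eq_mul]
    field_simp
    linear_combination u' b * e2 - w' b * e1

include sh in
theorem IsNormalizationOf.isImmersion (hθ : IsGeneric θ)
    (hd : ∀ i : Δ.Side, ¬ i.IsHorizontal → d.IsTrivialOn i)
    (hrel : ∑ a, C (C₀.coeff a) * sh.dform θ a = 0) (hf : f.IsNormalizationOf C₀)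
    (himm : (sh.lineMap hθ.toIsRegular).IsImmersion) : f.IsImmersion := by
  obtain ⟨m, hm, h⟩ := hf.exists_linSubst sh hθ hd hrel
  intro p q hpq
  obtain ⟨l, l', hl, h1, h2⟩ := exists_eq_smul_of_linSubst sh hθ.toIsRegular hm h (hpq.ne_zero 0) q
  refine linearIndependent_pair_of_eq hl h1 h2 (himm _ _ ?_)
  rw [LinearIndependent.pair_iff] at hpq ⊢
  intro s t hst
  by_contra hne
  have h0 : s • p + t • q ≠ 0 := fun h0 => hne (hpq s t h0)
  apply linSubst_ne_zero hm h0
  rw [← hst]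
  ext j
  simp
  ring

include sh in
theorem IsNormalizationOf.injOn (hθ : IsGeneric θ)
    (hd : ∀ i : Δ.Side, ¬ i.IsHorizontal → d.IsTrivialOn i)
    (hrel : ∑ a, C (C₀.coeff a) * sh.dform θ a = 0) (hf : f.IsNormalizationOf C₀) :
    Set.InjOn f.toFun (f.toFun ⁻¹' Δ.toricBoundary K) := by
  obtain ⟨m, hm, h⟩ := hf.exists_linSubst sh hθ hd hrel
  intro p hp q _ hpq
  obtain ⟨l₁, -, hl₁, h₁, -⟩ := exists_eq_smul_of_linSubst sh hθ.toIsRegular hm h p.rep_nonzero 0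
  obtain ⟨l₂, -, hl₂, h₂, -⟩ := exists_eq_smul_of_linSubst sh hθ.toIsRegular hm h q.rep_nonzero 0
  obtain ⟨c, hc⟩ := (Projectivization.mk_eq_mk_iff' K _ _ _ _).1 hpq
  have hc0 : c ≠ 0 := by
    rintro rfl
    exact f.lift_ne_zero p.rep_nonzero (by rw [← hc, zero_smul])
  obtain ⟨a₀, ha₀⟩ : ∃ a, f.lift p.rep a = 0 := by
    obtain ⟨i, -, hi⟩ := Set.mem_iUnion.1 hp
    obtain ⟨a, ha⟩ := sh.exists_ht_one i
    refine ⟨a, ?_⟩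
    have := hi a (fun h => by rw [Side.mem_face_iff] at h; omega)
    obtain ⟨e, he⟩ := Projectivization.exists_smul_eq_mk_rep K _ (f.lift_ne_zero p.rep_nonzero)
    rw [toFun, ← he, Units.smul_def, Pi.smul_apply, smul_eq_mul, mul_eq_zero] at this
    exact this.resolve_left e.ne_zero
  obtain ⟨e, he⟩ := sh.eq_smul_of_lift_eq hθ (linSubst_ne_zero hm p.rep_nonzero)
    (linSubst_ne_zero hm q.rep_nonzero) (c := l₁⁻¹ * (c * l₂))
    (mul_ne_zero (inv_ne_zero hl₁) (mul_ne_zero hc0 hl₂)) (fun a => by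
      have e1 := congrFun h₁ a
      have e2 := congrFun h₂ a
      have e3 := congrFun hc a
      rw [Pi.smul_apply, smul_eq_mul] at e1 e2 e3
      rw [e1, e2] at e3
      change (sh.lineMap hθ.toIsRegular).lift _ a = _ * (sh.lineMap hθ.toIsRegular).lift _ a
      rw [mul_assoc, mul_assoc, e3, inv_mul_cancel_left₀ hl₁]) (a₀ := a₀) (by
      have e1 := congrFun h₁ a₀
      rw [ha₀, Pi.smul_apply, smul_eq_mul] at e1
      exact (mul_eq_zero.1 e1.symm).resolve_left hl₁)
  have hpq' : p.rep = e • q.rep := by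
    by_contra hne
    apply linSubst_ne_zero hm (sub_ne_zero.2 hne)
    ext j
    have := congrFun he j
    simp only [Pi.smul_apply, smul_eq_mul] at this
    simp only [Pi.sub_apply, Pi.smul_apply, smul_eq_mul, Pi.zero_apply]
    linear_combination this
  rw [← p.mk_rep, ← q.mk_rep, Projectivization.mk_eq_mk_iff']
  exact ⟨e, hpq'.symm⟩

end LineMap

end LatticePolygon

/-! ### Zeros of pairs of logarithmic derivatives -/

section LogDerivatives

open Polynomial

variable {ι : Type*} [DecidableEq ι] {S S' : Type*} [CommRing S] [CommRing S']

/-- The numerator of the logarithmic derivative `∑ A j / (X - θ j)`. -/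
def logNum (s : Finset ι) (A θ : ι → S) : S[X] := ∑ j ∈ s, C (A j) * ∏ k ∈ s.erase j, (X - C (θ k))

theorem logNum_map (φ : S →+* S') (s : Finset ι) (A θ : ι → S) :
    (logNum s A θ).map φ = logNum s (fun j => φ (A j)) (fun j => φ (θ j)) := by
  simp [logNum, Polynomial.map_sum, Polynomial.map_prod]

theorem logNum_congr {s : Finset ι} {A A' θ θ' : ι → S} (hA : ∀ j ∈ s, A j = A' j)
    (h : ∀ j ∈ s, θ j = θ' j) : logNum s A θ = logNum s A' θ' :=
  Finset.sum_congr rfl fun j hj => by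
    rw [hA j hj, Finset.prod_congr rfl fun k hk => by rw [h k (Finset.mem_of_mem_erase hk)]]

theorem logNum_insert {s : Finset ι} {b : ι} (hb : b ∉ s) (A θ : ι → S) : logNum (insert b s) A θ =
    C (A b) * ∏ k ∈ s, (X - C (θ k)) + (X - C (θ b)) * logNum s A θ := by
  rw [logNum, Finset.sum_insert hb, Finset.erase_insert hb, logNum, Finset.mul_sum]
  congr 1
  refine Finset.sum_congr rfl fun j hj => ?_
  have hjb : j ≠ b := fun h => hb (h ▸ hj)
  rw [Finset.erase_insert_of_ne hjb.symm, Finset.prod_insert (by simp [hb])]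
  ring

theorem eval_logNum_self {s : Finset ι} {k : ι} (hk : k ∈ s) (A θ : ι → S) :
    (logNum s A θ).eval (θ k) = A k * ∏ l ∈ s.erase k, (θ k - θ l) := by
  conv_lhs => rw [← Finset.insert_erase hk]
  rw [logNum_insert (by simp)]
  simp [eval_prod]

theorem eval_logNum {K : Type*} [Field K] (s : Finset ι) (A θ : ι → K) {t : K}
    (ht : ∀ j ∈ s, t ≠ θ j) :
    (logNum s A θ).eval t = (∏ k ∈ s, (t - θ k)) * ∑ j ∈ s, A j / (t - θ j) := by
  rw [logNum, eval_finsetSum, Finset.mul_sum]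
  refine Finset.sum_congr rfl fun j hj => ?_
  rw [← Finset.mul_prod_erase _ _ hj]
  have := sub_ne_zero.2 (ht j hj)
  simp only [eval_mul, eval_C, eval_prod, eval_sub, eval_X]
  field_simp

/-- The first numerator omits the point `b`, so it and its finitely many roots do not depend on the
position `s` of `b`. At each root `t` the second numerator is affine in `s` and not identically
zero: if `t` is one of the points other than `a` and `b`, then `A` vanishes there, so `B` does not
and the slope is nonzero; otherwise the value at `s = t` is nonzero. -/
theorem exists_logNum_no_common_root {K : Type*} [Field K] [IsAlgClosed K] [Fintype ι] {A B : ι → K}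
    {a b : ι} (hAa : A a ≠ 0) (hBa : B a = 0) (hBb : B b ≠ 0) (hAB : ∀ k, A k ≠ 0 ∨ B k ≠ 0)
    {θ : ι → K} (hθ : Function.Injective θ) : ∃ s : K, ∀ t,
      (logNum (Finset.univ.erase b) A θ).IsRoot t →
        ¬ (logNum (Finset.univ.erase a) B (Function.update θ b s)).IsRoot t := by
  classical
  have hab : b ≠ a := by
    rintro rfl
    exact hBb hBa
  set f := logNum (Finset.univ.erase b) A θ with hf
  have haf : a ∈ Finset.univ.erase b := by simp [hab.symm]
  have hprod : ∀ (s : Finset ι) (k : ι), ∏ l ∈ s.erase k, (θ k - θ l) ≠ 0 := fun s k =>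
    Finset.prod_ne_zero_iff.2 fun l hl => sub_ne_zero.2 fun h => Finset.ne_of_mem_erase hl (hθ h).symm
  have hf0 : f ≠ 0 := by
    intro h
    have h1 := eval_logNum_self haf A θ
    rw [← hf, h, eval_zero] at h1
    exact mul_ne_zero hAa (hprod _ _) h1.symm
  set r : Finset ι := (Finset.univ.erase a).erase b with hr
  let G : K → K[X] := fun t =>
    -- This is a polynomial in the position of `b`, for a fixed root `t`.
    C (B b * ∏ k ∈ r, (t - θ k)) + (C t - X) * C ((logNum r B θ).eval t)
  have hG : ∀ s t, (G t).eval s =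
      (logNum (Finset.univ.erase a) B (Function.update θ b s)).eval t := by
    intro s t
    have hb : b ∈ Finset.univ.erase a := by simp [hab]
    conv_rhs => rw [← Finset.insert_erase hb]
    rw [logNum_insert (by simp), logNum_congr (θ' := θ) (A' := B) (fun _ _ => rfl) (fun j hj => by
      rw [Function.update_of_ne (Finset.ne_of_mem_erase hj)])]
    have hp : ∏ k ∈ r, (X - C (Function.update θ b s k)) = ∏ k ∈ r, (X - C (θ k)) :=
      Finset.prod_congr rfl fun k hk => by rw [Function.update_of_ne (Finset.ne_of_mem_erase hk)]
    rw [← hr, hp, Function.update_self]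
    simp [G, eval_prod]
  have hG0 : ∀ t, f.IsRoot t → G t ≠ 0 := by
    intro t ht h0
    by_cases h : ∃ k ∈ r, t = θ k
    · obtain ⟨k, hk, rfl⟩ := h
      have hkb : k ∈ Finset.univ.erase b := by simp [Finset.ne_of_mem_erase hk]
      rw [IsRoot.def, hf, eval_logNum_self hkb, mul_eq_zero, or_iff_left (hprod _ _)] at ht
      have hBk := (hAB k).resolve_left (not_not.2 ht)
      have h1 := congrArg (fun q => q.coeff 1) h0
      simp only [G, coeff_add, coeff_C_succ, coeff_mul_C, coeff_sub, coeff_X_one, zero_sub, coeff_zero,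
        zero_add, eval_logNum_self hk] at h1
      exact mul_ne_zero hBk (hprod _ _) (by simpa using h1)
    · push Not at h
      have h1 := congrArg (eval t) h0
      simp only [G, eval_add, eval_C, eval_mul, eval_sub, eval_X, sub_self, zero_mul, add_zero,
        eval_zero] at h1
      exact mul_ne_zero hBb (Finset.prod_ne_zero_iff.2 fun k hk => sub_ne_zero.2 (h k hk)) h1
  have : Infinite K := IsAlgClosed.instInfinite
  have hP : ∏ t ∈ f.roots.toFinset, G t ≠ 0 := Finset.prod_ne_zero_iff.2 fun t ht =>
    hG0 t (isRoot_of_mem_roots (Multiset.mem_toFinset.1 ht))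
  obtain ⟨s, hs⟩ : ∃ s, (∏ t ∈ f.roots.toFinset, G t).eval s ≠ 0 := by
    by_contra! h
    exact hP (Polynomial.funext fun s => by rw [h s, eval_zero])
  rw [eval_prod] at hs
  refine ⟨s, fun t ht h => Finset.prod_ne_zero_iff.1 hs t
    (Multiset.mem_toFinset.2 ((mem_roots hf0).2 ht)) ?_⟩
  rw [hG]
  exact h

namespace LatticePolygon.HoldsGenerically

variable {K : Type*} [Field K] [IsAlgClosed K] [Fintype ι]

/-- A common root makes the resultant vanish, so the nonvanishing of the resultant is a suitable
polynomial condition, nonzero by the example obtained from moving the point `b`. The leading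
coefficient is included because the degree might drop at special parameters. -/
theorem logNum_no_common_root {A B : ι → K} {a b : ι} (hAa : A a ≠ 0) (hBa : B a = 0)
    (hBb : B b ≠ 0) (hAB : ∀ k, A k ≠ 0 ∨ B k ≠ 0) :
    HoldsGenerically fun θ : ι → K => ∀ t, (logNum (Finset.univ.erase b) A θ).IsRoot t →
      ¬ (logNum (Finset.univ.erase a) B θ).IsRoot t := by
  have : Infinite K := IsAlgClosed.instInfinite
  let f : (MvPolynomial ι K)[X] :=
    logNum (Finset.univ.erase b) (fun j => MvPolynomial.C (A j)) MvPolynomial.X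
  let g : (MvPolynomial ι K)[X] :=
    logNum (Finset.univ.erase a) (fun j => MvPolynomial.C (B j)) MvPolynomial.X
  have hf : ∀ θ : ι → K, f.map (MvPolynomial.eval θ) = logNum (Finset.univ.erase b) A θ := fun θ => by
    simp only [f, logNum_map, MvPolynomial.eval_C, MvPolynomial.eval_X]
  have hg : ∀ θ : ι → K, g.map (MvPolynomial.eval θ) = logNum (Finset.univ.erase a) B θ := fun θ => by
    simp only [g, logNum_map, MvPolynomial.eval_C, MvPolynomial.eval_X]
  have hdisc : (∏ t ∈ (Finset.univ : Finset ι).offDiag,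
      (MvPolynomial.X t.1 - MvPolynomial.X t.2 : MvPolynomial ι K)) ≠ 0 :=
    Finset.prod_ne_zero_iff.2 fun t ht => sub_ne_zero.2 fun h =>
      (Finset.mem_offDiag.1 ht).2.2 (MvPolynomial.X_injective h)
  have hf0 : f ≠ 0 := by
    obtain ⟨θ, hθ⟩ := exists_injective_values ι K
    intro h
    have h1 := hf θ
    rw [h, Polynomial.map_zero] at h1
    have hab : a ∈ Finset.univ.erase b := by
      rw [Finset.mem_erase]
      refine ⟨?_, Finset.mem_univ _⟩
      rintro rfl
      exact hBb hBa
    have h2 := eval_logNum_self hab A θ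
    rw [← h1, eval_zero] at h2
    exact mul_ne_zero hAa (Finset.prod_ne_zero_iff.2 fun l hl => sub_ne_zero.2 fun h =>
      Finset.ne_of_mem_erase hl (hθ h).symm) h2.symm
  obtain ⟨θ₁, hθ₁⟩ := exists_eval_ne_zero (mul_ne_zero (leadingCoeff_ne_zero.2 hf0) hdisc)
  rw [map_mul, map_prod] at hθ₁
  have hinj : Function.Injective θ₁ := by
    intro j k hjk
    by_contra hne
    have := Finset.prod_ne_zero_iff.1 (right_ne_zero_of_mul hθ₁) (j, k)
      (Finset.mem_offDiag.2 ⟨Finset.mem_univ _, Finset.mem_univ _, hne⟩)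
    simp [hjk] at this
  obtain ⟨s, hs⟩ := exists_logNum_no_common_root hAa hBa hBb hAB hinj
  set θ₀ := Function.update θ₁ b s with hθ₀
  have hfeq : f.map (MvPolynomial.eval θ₀) = f.map (MvPolynomial.eval θ₁) := by
    rw [hf, hf]
    exact logNum_congr (fun _ _ => rfl) fun j hj => Function.update_of_ne (Finset.ne_of_mem_erase hj) _ _
  have hlc : MvPolynomial.eval θ₀ f.leadingCoeff ≠ 0 := by
    rw [leadingCoeff, ← coeff_map, hfeq, coeff_map]
    exact left_ne_zero_of_mul hθ₁
  refine ⟨f.leadingCoeff * f.resultant g, ne_zero_of_eval_ne_zero (θ := θ₀) ?_, fun θ hθ t hft hgt => ?_⟩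
  · rw [map_mul]
    refine mul_ne_zero hlc ?_
    rw [← resultant_map_map]
    have hnd : (f.map (MvPolynomial.eval θ₀)).natDegree = f.natDegree :=
      natDegree_map_of_leadingCoeff_ne_zero _ hlc
    rw [← hnd, resultant_eq_prod_eval _ _ _ natDegree_map_le (IsAlgClosed.splits _)]
    refine mul_ne_zero (pow_ne_zero _ (leadingCoeff_ne_zero.2 ?_)) (Multiset.prod_ne_zero ?_)
    · intro h
      have h1 := congrArg (fun q => q.coeff f.natDegree) h
      rw [coeff_map, coeff_zero] at h1
      exact hlc h1
    · intro h
      obtain ⟨t, ht, h0⟩ := Multiset.mem_map.1 h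
      have ht' := isRoot_of_mem_roots ht
      rw [hfeq, hf] at ht'
      rw [hg] at h0
      exact hs t ht' h0
  · rw [map_mul] at hθ
    rw [← hf, IsRoot.def] at hft
    rw [← hg, IsRoot.def] at hgt
    -- In degree zero the numerator equals its leading coefficient, which does not vanish.
    by_cases hdeg : f.natDegree = 0
    · apply left_ne_zero_of_mul hθ
      rw [eq_C_of_natDegree_eq_zero hdeg, Polynomial.map_C, eval_C] at hft
      rw [leadingCoeff, hdeg, hft]
    · obtain ⟨p, q, -, -, hpq⟩ := exists_mul_add_mul_eq_C_resultant f g le_rfl le_rfl (Or.inl hdeg)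
      apply right_ne_zero_of_mul hθ
      have h1 := congrArg (fun h => (h.map (MvPolynomial.eval θ)).eval t) hpq
      simp only [Polynomial.map_add, Polynomial.map_mul, eval_add, eval_mul, hft, hgt, zero_mul,
        add_zero, Polynomial.map_C, eval_C] at h1
      exact h1.symm

/-- Two independent logarithmic derivatives have in general no common zero. -/
theorem log_derivatives {A B : ι → K} {a b : ι} (hab : A a * B b - A b * B a ≠ 0)
    (hAB : ∀ k, A k ≠ 0 ∨ B k ≠ 0) : HoldsGenerically fun θ : ι → K => ∀ t, (∀ j, t ≠ θ j) →
      ¬ (∑ j, A j / (t - θ j) = 0 ∧ ∑ j, B j / (t - θ j) = 0) := by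
  -- Linear combinations of the two conditions remove the term of `b` from one and the term of `a`
  -- from the other.
  refine (logNum_no_common_root (A := fun j => B b * A j - A b * B j)
    (B := fun j => A a * B j - B a * A j) (a := a) (b := b) ?_ ?_ ?_ fun k => ?_).mono
    fun θ hθ t ht h => ?_
  · intro h; exact hab (by linear_combination h)
  · ring
  · intro h; exact hab (by linear_combination h)
  · by_contra! h
    have e1 : (A a * B b - A b * B a) * A k = 0 := by linear_combination A a * h.1 + A b * h.2
    have e2 : (A a * B b - A b * B a) * B k = 0 := by linear_combination B a * h.1 + B b * h.2
    exact (hAB k).elim (fun h' => h' ((mul_eq_zero.1 e1).resolve_left hab))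
      (fun h' => h' ((mul_eq_zero.1 e2).resolve_left hab))
  · have key : ∀ (c c' : K), ∑ j, (c * A j - c' * B j) / (t - θ j) = 0 := by
      intro c c'
      have h1 : ∀ j, (c * A j - c' * B j) / (t - θ j) = c * (A j / (t - θ j)) - c' * (B j / (t - θ j)) :=
        fun j => by ring
      simp only [h1, Finset.sum_sub_distrib, ← Finset.mul_sum, h.1, h.2, mul_zero, sub_zero]
    refine hθ t ?_ ?_
    · rw [IsRoot.def, eval_logNum _ _ _ fun j _ => ht j]
      have h2 := key (B b) (A b)
      rw [← Finset.add_sum_erase _ _ (Finset.mem_univ b)] at h2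
      have h3 : (B b * A b - A b * B b) / (t - θ b) = 0 := by rw [mul_comm, sub_self, zero_div]
      rw [h3, zero_add] at h2
      rw [h2, mul_zero]
    · rw [IsRoot.def, eval_logNum _ _ _ fun j _ => ht j]
      have h2 := key (-B a) (-A a)
      rw [← Finset.add_sum_erase _ _ (Finset.mem_univ a)] at h2
      have h3 : (-B a * A a - -A a * B a) / (t - θ a) = 0 := by
        rw [show -B a * A a - -A a * B a = 0 by ring, zero_div]
      rw [h3, zero_add] at h2
      have h4 : ∑ j ∈ Finset.univ.erase a, (A a * B j - B a * A j) / (t - θ j) = 0 := by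
        rw [← h2]
        exact Finset.sum_congr rfl fun j _ => by ring
      rw [h4, mul_zero]

end LatticePolygon.HoldsGenerically

end LogDerivatives

namespace LatticePolygon

open Polynomial

variable {Δ : LatticePolygon} {d : Δ.TangencyProfile} {K : Type*} [Field K]

/-! ### Immersions -/

theorem HoldsGenerically.comp_injective {ι κ : Type*} {P : (ι → K) → Prop} (hP : HoldsGenerically P)
    {e : ι → κ} (he : Function.Injective e) : HoldsGenerically fun θ : κ → K => P (θ ∘ e) := by
  obtain ⟨q, hq, h⟩ := hP
  exact ⟨MvPolynomial.rename e q, (map_ne_zero_iff _ (MvPolynomial.rename_injective e he)).2 hq,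
    fun θ hθ => h _ (by rwa [MvPolynomial.eval_rename] at hθ)⟩

/-- The parameters are general enough for the parametrization to be an immersion. The conditions
concern the points in the torus with finite coordinate, the point at infinity, and the points on
the toric divisors of the horizontal sides. -/
structure IsUnramified (θ : Par d → K) : Prop where
  torus : ∀ t, (∀ j : Idx d, t ≠ θ (Sum.inr j)) →
    ¬ (∑ j : Idx d, (j.exp (1, 0) : K) / (t - θ (Sum.inr j)) = 0 ∧
      ∑ j : Idx d, (j.exp (0, 1) : K) / (t - θ (Sum.inr j)) = 0)
  infinity : ∑ j : Idx d, (j.exp (1, 0) : K) * θ (Sum.inr j) ≠ 0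
  horizontal : ∀ j : Idx d, j.1.IsHorizontal →
    ∑ k ∈ Finset.univ.erase j, (k.exp (1, 0) : K) / (θ (Sum.inr j) - θ (Sum.inr k)) ≠ 0

theorem intCast_ne_zero_of_le_width (hchar : ringChar K = 0 ∨ Δ.width < (ringChar K : ℝ)) {m : ℤ}
    (hm : 0 < m) (h : (m : ℝ) ≤ Δ.width) : (m : K) ≠ 0 := by
  rw [Ne, CharP.intCast_eq_zero_iff K (ringChar K)]
  rintro ⟨c, hc⟩
  rcases hchar with h0 | h0
  · rw [h0] at hc
    simp at hc
    omega
  · have h1 : m < ringChar K := by exact_mod_cast h.trans_lt h0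
    have h2 : 0 < c := by
      by_contra hcon
      nlinarith [Int.natCast_nonneg (ringChar K)]
    nlinarith [Int.natCast_nonneg (ringChar K)]

namespace Shape

variable (sh : Δ.Shape)

theorem mult_le_length (j : Idx d) : j.mult ≤ j.1.length := by
  rw [← d.sum_eq j.1]
  exact Multiset.le_sum_of_mem Multiset.coe_mem

theorem mult_eq_one (hd : ∀ i : Δ.Side, ¬ i.IsHorizontal → d.IsTrivialOn i) {j : Idx d}
    (hj : ¬ j.1.IsHorizontal) : j.mult = 1 := hd j.1 hj _ Multiset.coe_mem

include sh in
theorem snd_cast_ne_zero {i : Δ.Side} (hi : i.IsHorizontal) : (i.1.2 : K) ≠ 0 := by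
  rcases sh.side_cases i with ⟨k, hk, h⟩ | ⟨k, hk, h⟩ | h | h <;> simp_all [Side.IsHorizontal]

theorem exp_tangent {i : Δ.Side} (hi : i.IsHorizontal) (k : Idx d) :
    k.exp i.tangent = -i.1.2 * k.exp (1, 0) := by
  rw [Side.IsHorizontal] at hi
  simp only [Idx.exp, latticePairing, Side.tangent, hi]
  ring

include sh in
theorem mult_cast_ne_zero (hchar : ringChar K = 0 ∨ Δ.width < (ringChar K : ℝ)) {j : Idx d}
    (hj : j.1.IsHorizontal) : (j.mult : K) ≠ 0 := by
  have h1 := mult_le_length j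
  have h2 := j.mult_pos
  have key : ∀ w : ℤ, (j.1.length : ℤ) = w → (w : ℝ) ≤ Δ.width → (j.mult : K) ≠ 0 := by
    intro w hw h
    have h3 : ((j.mult : ℤ) : ℝ) ≤ (w : ℝ) := by
      rw [← hw]; exact_mod_cast h1
    have := intCast_ne_zero_of_le_width (K := K) hchar (m := j.mult) (by omega) (h3.trans h)
    exact_mod_cast this
  rcases sh.side_cases j.1 with ⟨k, hk, hi⟩ | ⟨k, hk, hi⟩ | hi | hi
  · simp [Side.IsHorizontal, hi] at hj
  · simp [Side.IsHorizontal, hi] at hj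
  · exact key _ (sh.bottom_length hi) (sh.le_width 0 (Nat.zero_le _))
  · exact key _ (sh.top_length hi) (sh.le_width _ le_rfl)

/-- A point on the toric divisor of a left side. -/
theorem exists_idx_left (hd : ∀ i : Δ.Side, ¬ i.IsHorizontal → d.IsTrivialOn i) : ∃ j : Idx d,
    j.mult = 1 ∧ j.1.1 = (1, -(sh.L 1 - sh.L 0)) := by
  obtain ⟨i, hi⟩ := sh.exists_left sh.h_pos
  obtain ⟨x⟩ := mult_nonempty (d := d) i
  exact ⟨⟨i, x⟩, mult_eq_one hd (by simp [Side.IsHorizontal, hi]), hi⟩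

include sh in
theorem exp_fst_ne_zero_or (hd : ∀ i : Δ.Side, ¬ i.IsHorizontal → d.IsTrivialOn i)
    (hchar : ringChar K = 0 ∨ Δ.width < (ringChar K : ℝ)) (k : Idx d) :
    (k.exp (1, 0) : K) ≠ 0 ∨ (k.exp (0, 1) : K) ≠ 0 := by
  by_cases hk : k.1.IsHorizontal
  · have h := sh.mult_cast_ne_zero hchar hk
    right
    rcases sh.side_cases k.1 with ⟨l, hl, hi⟩ | ⟨l, hl, hi⟩ | hi | hi <;>
      simp_all [Side.IsHorizontal, Idx.exp, latticePairing]
  · have h := mult_eq_one hd hk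
    left
    rcases sh.side_cases k.1 with ⟨l, hl, hi⟩ | ⟨l, hl, hi⟩ | hi | hi <;>
      simp_all [Side.IsHorizontal, Idx.exp, latticePairing]

include sh in
-- A point over a left side is paired with one over the bottom side or, if there is none, over a
-- right side. The determinant is the tangency of the former, or the width of the row above the
-- bottom vertex; both are positive and at most `Δ.width`.
theorem exists_independent_exp (hd : ∀ i : Δ.Side, ¬ i.IsHorizontal → d.IsTrivialOn i)
    (hchar : ringChar K = 0 ∨ Δ.width < (ringChar K : ℝ)) : ∃ a b : Idx d,
      (a.exp (1, 0) : K) * b.exp (0, 1) - b.exp (1, 0) * a.exp (0, 1) ≠ 0 := by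
  obtain ⟨a, ha, ha'⟩ := sh.exists_idx_left hd
  by_cases h : sh.L 0 < sh.R 0
  · obtain ⟨i, hi⟩ := sh.exists_bottom h
    obtain ⟨x⟩ := mult_nonempty (d := d) i
    refine ⟨a, ⟨i, x⟩, ?_⟩
    have := sh.mult_cast_ne_zero hchar (j := (⟨i, x⟩ : Idx d)) (by simp [Side.IsHorizontal, hi])
    simpa [Idx.exp, latticePairing, ha, ha', hi] using this
  · obtain ⟨i, hi⟩ := sh.exists_right sh.h_pos
    obtain ⟨x⟩ := mult_nonempty (d := d) i
    refine ⟨a, ⟨i, x⟩, ?_⟩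
    have h1 := mult_eq_one hd (j := (⟨i, x⟩ : Idx d)) (by simp [Side.IsHorizontal, hi])
    have h2 := sh.L_le_R 0 (Nat.zero_le _)
    have h3 := (sh.nondeg 0 sh.h_pos).resolve_left h
    have h4 := intCast_ne_zero_of_le_width (K := K) hchar (m := sh.R 1 - sh.L 1)
      (by simpa using h3) (sh.le_width 1 sh.h_pos)
    have h5 : sh.R 0 = sh.L 0 := by omega
    simp only [Idx.exp, latticePairing, ha, ha', hi, h1]
    convert h4 using 1
    push_cast
    rw [h5]
    simp

include sh in
-- Each condition is nonempty: the torus condition by independence of the logarithmic derivatives,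
-- the others because of a point over a left side, whose exponent is `1`.
theorem holdsGenerically_isUnramified [IsAlgClosed K]
    (hd : ∀ i : Δ.Side, ¬ i.IsHorizontal → d.IsTrivialOn i)
    (hchar : ringChar K = 0 ∨ Δ.width < (ringChar K : ℝ)) :
    HoldsGenerically fun θ : Par d → K => IsUnramified θ := by
  have : Infinite K := IsAlgClosed.instInfinite
  obtain ⟨a, b, hab⟩ := sh.exists_independent_exp (K := K) hd hchar
  obtain ⟨c, hc, hc'⟩ := sh.exists_idx_left hd
  have hcA : c.exp (1, 0) = 1 := by simp [Idx.exp, latticePairing, hc, hc']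
  have h1 := (HoldsGenerically.log_derivatives (A := fun j : Idx d => (j.exp (1, 0) : K))
    (B := fun j : Idx d => (j.exp (0, 1) : K)) hab (sh.exp_fst_ne_zero_or hd hchar)).comp_injective
      (Sum.inr_injective (α := Fin 2))
  have h2 : HoldsGenerically fun θ : Par d → K =>
      ∑ j : Idx d, (j.exp (1, 0) : K) * θ (Sum.inr j) ≠ 0 := by
    refine (HoldsGenerically.of_eval_ne_zero (∑ j : Idx d, MvPolynomial.C (j.exp (1, 0) : K) *
      MvPolynomial.X (Sum.inr j)) ⟨Pi.single (Sum.inr c) 1, ?_⟩).mono fun θ hθ => by simpa using hθ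
    simp [Pi.single_apply, hcA]
  have h3 : HoldsGenerically fun θ : Par d → K => ∀ j : Idx d, j.1.IsHorizontal →
      (logNum (Finset.univ.erase j) (fun k => (k.exp (1, 0) : K)) (θ ∘ Sum.inr)).eval
        (θ (Sum.inr j)) ≠ 0 := by
    refine HoldsGenerically.forall_finite fun j => HoldsGenerically.imp_const fun hj => ?_
    have hev : ∀ θ : Par d → K, MvPolynomial.eval θ ((logNum (Finset.univ.erase j)
        (fun k => MvPolynomial.C (k.exp (1, 0) : K)) (fun k => MvPolynomial.X (Sum.inr k))).eval
          (MvPolynomial.X (Sum.inr j))) = (logNum (Finset.univ.erase j) (fun k => (k.exp (1, 0) : K))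
            (θ ∘ Sum.inr)).eval (θ (Sum.inr j)) := by
      intro θ
      rw [← eval_map_apply, logNum_map]
      simp [Function.comp_def]
    refine (HoldsGenerically.of_eval_ne_zero _ ?_).mono fun θ hθ => by rwa [hev] at hθ
    obtain ⟨φ, hφ⟩ := exists_injective_values (Par d) K
    have hcj : c ∈ Finset.univ.erase j := by
      rw [Finset.mem_erase]
      refine ⟨?_, Finset.mem_univ _⟩
      rintro rfl
      simp [Side.IsHorizontal, hc'] at hj
    -- When the point `j` collides with `c`, only the term of `c` survives in the numerator.
    refine ⟨Function.update φ (Sum.inr j) (φ (Sum.inr c)), ?_⟩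
    have hupd : ∀ k ∈ Finset.univ.erase j,
        (Function.update φ (Sum.inr j) (φ (Sum.inr c)) ∘ Sum.inr) k = (φ ∘ Sum.inr) k := fun k hk =>
      Function.update_of_ne (fun h => Finset.ne_of_mem_erase hk (Sum.inr_injective h)) _ _
    rw [hev, Function.update_self, logNum_congr (fun _ _ => rfl) hupd]
    have := eval_logNum_self hcj (fun k => (k.exp (1, 0) : K)) (φ ∘ Sum.inr)
    rw [Function.comp_apply] at this
    rw [this, hcA, Int.cast_one, one_mul]
    exact Finset.prod_ne_zero_iff.2 fun l hl => sub_ne_zero.2 fun h =>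
      Finset.ne_of_mem_erase hl (Sum.inr_injective (hφ h)).symm
  refine (((h1.and h2).and h3).and holdsGenerically_isRegular).mono fun θ hθ =>
    ⟨fun t ht => hθ.1.1.1 t ht, hθ.1.1.2, fun j hj h => hθ.1.2 j hj ?_⟩
  rw [eval_logNum _ _ (θ ∘ Sum.inr) fun k hk h' => Finset.ne_of_mem_erase hk
    (hθ.2.inj (a₁ := j) (a₂ := k) h').symm]
  exact mul_eq_zero_of_right _ h

end Shape

/-- The alternative `n = 0` covers coordinates that do not involve the factor vanishing at the
point; there the quotient by zero is harmless. -/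
theorem pow_dualNumber {x : K} (y : K) {n : ℕ} (h : x ≠ 0 ∨ n = 0) :
    (TrivSqZeroExt.inl x + TrivSqZeroExt.inr y : DualNumber K) ^ n =
      TrivSqZeroExt.inl (x ^ n) + TrivSqZeroExt.inr (x ^ n * ((n : K) * (y / x))) := by
  rcases h with h0 | h0
  · induction n with
    | zero => simp
    | succ n ih =>
      rw [pow_succ, ih]
      ext
      · simp [pow_succ]
      · simp
        field_simp
        ring
  · simp [h0]

theorem prod_dualNumber {ι : Type*} (s : Finset ι) {x : ι → K} (y : ι → K) {w : ι → ℕ}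
    (h : ∀ j ∈ s, x j ≠ 0 ∨ w j = 0) :
    ∏ j ∈ s, (TrivSqZeroExt.inl (x j) + TrivSqZeroExt.inr (y j) : DualNumber K) ^ w j =
      TrivSqZeroExt.inl (∏ j ∈ s, x j ^ w j) +
        TrivSqZeroExt.inr ((∏ j ∈ s, x j ^ w j) * ∑ j ∈ s, (w j : K) * (y j / x j)) := by
  classical
  induction s using Finset.induction_on with
  | empty => simp
  | insert j s hj ih =>
    rw [Finset.prod_insert hj, Finset.prod_insert hj, Finset.sum_insert hj,
      ih fun k hk => h k (Finset.mem_insert_of_mem hk),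
      pow_dualNumber _ (h j (Finset.mem_insert_self _ _))]
    ext
    · simp
    · simp
      ring

namespace Shape

variable (sh : Δ.Shape) {θ : Par d → K}

theorem aeval_hform_dualNumber (p q : Fin 2 → K) (a : Δ.Pts) :
    TrivSqZeroExt.inl (MvPolynomial.eval p (sh.hform θ a)) +
      TrivSqZeroExt.inr (∑ l, q l * MvPolynomial.eval p (MvPolynomial.pderiv l (sh.hform θ a))) =
      (TrivSqZeroExt.inl (θ (Sum.inl 0) ^ sh.col a * θ (Sum.inl 1) ^ sh.row a) : DualNumber K) *
        ∏ j : Idx d, (TrivSqZeroExt.inl (p 0 - θ (Sum.inr j) * p 1) +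
          TrivSqZeroExt.inr (q 0 - θ (Sum.inr j) * q 1)) ^ j.weight a := by
  rw [← aeval_dualNumber, hform]
  simp only [map_mul, map_prod, map_pow, map_sub, MvPolynomial.aeval_C, MvPolynomial.aeval_X,
    TrivSqZeroExt.algebraMap_eq_inl, TrivSqZeroExt.inl_mul, TrivSqZeroExt.inl_pow]
  congr 1
  refine Finset.prod_congr rfl fun j _ => ?_
  congr 1
  ext <;> simp

/-- The derivative of a coordinate that does not vanish at the point `p`. -/
theorem sum_pderiv_hform (hθ : IsRegular θ) (p q : Fin 2 → K) (a : Δ.Pts)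
    (h : MvPolynomial.eval p (sh.hform θ a) ≠ 0) :
    ∑ l, q l * MvPolynomial.eval p (MvPolynomial.pderiv l (sh.hform θ a)) =
      MvPolynomial.eval p (sh.hform θ a) * ∑ j : Idx d, (j.weight a : K) *
        ((q 0 - θ (Sum.inr j) * q 1) / (p 0 - θ (Sum.inr j) * p 1)) := by
  have h1 := sh.aeval_hform_dualNumber (θ := θ) p q a
  rw [prod_dualNumber _ _ fun j _ => ?_] at h1
  · have h2 := congrArg TrivSqZeroExt.snd h1
    simp only [TrivSqZeroExt.snd_mul, TrivSqZeroExt.fst_add, TrivSqZeroExt.snd_add,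
      TrivSqZeroExt.fst_inl, TrivSqZeroExt.snd_inl, TrivSqZeroExt.fst_inr, TrivSqZeroExt.snd_inr,
      add_zero, zero_add, smul_eq_mul, MulOpposite.smul_eq_mul_unop, MulOpposite.unop_op, zero_mul,
      mul_zero] at h2
    rw [h2, eval_hform]
    ring
  · by_cases hj : p 0 - θ (Sum.inr j) * p 1 = 0
    · exact Or.inr ((j.weight_eq_zero_iff a).2
        ((sh.eval_hform_ne_zero_iff hθ p a).1 h j (sub_eq_zero.1 hj)))
    · exact Or.inl hj

theorem weight_sub (j : Idx d) (a b : Δ.Pts) : (j.weight a : K) - j.weight b = (j.exp (a.1 - b.1) : K) := by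
  have h1 := j.weight_eq a
  have h2 := j.weight_eq b
  rw [← Int.cast_natCast, ← Int.cast_natCast (j.weight b), ← Int.cast_sub, h1, h2, Idx.exp, Idx.exp,
    Idx.exp, latticePairing_sub]
  congr 1
  ring

/-- A dependence between value and derivative makes the logarithmic derivatives of all coordinates
nonzero at the point equal. Over the torus both torus coordinates would then have vanishing
logarithmic derivatives; over a horizontal side this would hold for the coordinate along the
divisor; over any other side a coordinate vanishes to order exactly one. -/
theorem lineMap_isImmersion (hθ : IsRegular θ) (hu : IsUnramified θ)
    (hd : ∀ i : Δ.Side, ¬ i.IsHorizontal → d.IsTrivialOn i) : (sh.lineMap hθ).IsImmersion := by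
  classical
  intro p q hpq
  have hp : p ≠ 0 := hpq.ne_zero 0
  have hdet : q 0 * p 1 - p 0 * q 1 ≠ 0 := by
    intro h
    rw [LinearIndependent.pair_iff] at hpq
    obtain ⟨h1, h2⟩ := hpq (q 1) (-p 1) (by
      ext l
      fin_cases l
      · simp; linear_combination -h
      · simp; ring)
    obtain ⟨h3, h4⟩ := hpq (q 0) (-p 0) (by
      ext l
      fin_cases l
      · simp; ring
      · simp; linear_combination h)
    apply hp
    ext l
    fin_cases l
    · simpa using h4
    · simpa using h2
  -- This splits each quotient `r j` into a part independent of `j`, which disappears since the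
  -- exponents sum to zero, and the term of the logarithmic derivative times the determinant of `p`
  -- and `q`.
  have hL : ∀ t : K, (q 0 - t * q 1) * p 1 = (p 0 - t * p 1) * q 1 + (q 0 * p 1 - p 0 * q 1) :=
    fun t => by ring
  set r : Idx d → K := fun j => (q 0 - θ (Sum.inr j) * q 1) / (p 0 - θ (Sum.inr j) * p 1) with hr
  rw [LinearIndependent.pair_iff]
  intro s t hst
  have hst' : ∀ a, s * MvPolynomial.eval p (sh.hform θ a) + t * (∑ l, q l *
      MvPolynomial.eval p (MvPolynomial.pderiv l (sh.hform θ a))) = 0 := fun a => congrFun hst a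
  by_cases ht : t = 0
  · refine ⟨?_, ht⟩
    rw [ht, zero_smul, add_zero] at hst
    exact (smul_eq_zero.1 hst).resolve_right ((sh.lineMap hθ).lift_ne_zero hp)
  exfalso
  have hdiff : ∀ a b, MvPolynomial.eval p (sh.hform θ a) ≠ 0 → MvPolynomial.eval p (sh.hform θ b) ≠ 0 →
      ∑ j : Idx d, (j.exp (a.1 - b.1) : K) * r j = 0 := by
    have key : ∀ a, MvPolynomial.eval p (sh.hform θ a) ≠ 0 →
        s + t * ∑ j : Idx d, (j.weight a : K) * r j = 0 := fun a ha => by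
      have h1 := hst' a
      rw [sh.sum_pderiv_hform hθ p q a ha] at h1
      exact (mul_eq_zero.1 (show MvPolynomial.eval p (sh.hform θ a) *
        (s + t * ∑ j : Idx d, (j.weight a : K) * r j) = 0 by linear_combination h1)).resolve_left ha
    intro a b ha hb
    simp only [← weight_sub, sub_mul, Finset.sum_sub_distrib]
    exact (mul_eq_zero.1 (show t * (∑ j : Idx d, (j.weight a : K) * r j -
      ∑ j : Idx d, (j.weight b : K) * r j) = 0 by linear_combination key a ha - key b hb)).resolve_left ht
  have hsum : ∀ v, ∑ j : Idx d, (j.exp v : K) = 0 := fun v => by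
    rw [← Int.cast_sum, sh.sum_exp, Int.cast_zero]
  by_cases hj : ∃ j : Idx d, p 0 = θ (Sum.inr j) * p 1
  · obtain ⟨j, hj⟩ := hj
    have hp1 := snd_ne_zero hp hj
    by_cases hh : j.1.IsHorizontal
    · have h1 : (j.1.edgePt 1 j.1.length_pos).1 - j.1.origin.1 = j.1.tangent := by simp [Side.edgePt]
      have h2 := hdiff (j.1.edgePt 1 j.1.length_pos) j.1.origin
        ((sh.mem_face_iff_of_eval hθ hp hj _).2 ((Side.mem_face_iff _).2 (j.1.ht_edgePt 1 _)))
        ((sh.mem_face_iff_of_eval hθ hp hj _).2 ((Side.mem_face_iff _).2 j.1.ht_origin))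
      have hn2 : (j.1.1.2 : K) ≠ 0 := sh.snd_cast_ne_zero hh
      have hAj : j.exp (1, 0) = 0 := by
        rw [Side.IsHorizontal] at hh
        simp [Idx.exp, latticePairing, hh]
      have h3 : ∑ k : Idx d, (k.exp (1, 0) : K) * r k = 0 := by
        rw [h1] at h2
        simp only [exp_tangent hh, Int.cast_mul, mul_assoc, ← Finset.mul_sum] at h2
        exact (mul_eq_zero.1 h2).resolve_left (by simpa using hn2)
      have h4 := hsum (1, 0)
      rw [← Finset.add_sum_erase _ _ (Finset.mem_univ j), hAj, Int.cast_zero] at h3 h4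
      rw [zero_mul, zero_add] at h3
      rw [zero_add] at h4
      apply hu.horizontal j hh
      have h5 : (q 0 * p 1 - p 0 * q 1) * ∑ k ∈ Finset.univ.erase j, (k.exp (1, 0) : K) /
          (θ (Sum.inr j) - θ (Sum.inr k)) = 0 := by
        have e : ∀ k ∈ Finset.univ.erase j, (q 0 * p 1 - p 0 * q 1) * ((k.exp (1, 0) : K) /
            (θ (Sum.inr j) - θ (Sum.inr k))) = p 1 ^ 2 * ((k.exp (1, 0) : K) * r k) -
              p 1 * q 1 * (k.exp (1, 0) : K) := fun k hk => by
          have hne := hθ.sub_ne_zero hk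
          have : p 0 - θ (Sum.inr k) * p 1 = (θ (Sum.inr j) - θ (Sum.inr k)) * p 1 := by rw [hj]; ring
          simp only [hr, this]
          field_simp
          rw [hj]
          ring
        rw [Finset.mul_sum, Finset.sum_congr rfl e, Finset.sum_sub_distrib, ← Finset.mul_sum,
          ← Finset.mul_sum, h3, h4]
        ring
      exact (mul_eq_zero.1 h5).resolve_left hdet
    · obtain ⟨a, ha⟩ := sh.exists_ht_one j.1
      have hwj : j.weight a = 1 := by rw [Idx.weight, ha, mult_eq_one hd hh]; rfl
      have hLj : p 0 - θ (Sum.inr j) * p 1 = 0 := sub_eq_zero.2 hj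
      have h1 := hst' a
      have h0 : MvPolynomial.eval p (sh.hform θ a) = 0 := by
        by_contra h
        have := (sh.mem_face_iff_of_eval hθ hp hj a).1 h
        rw [Side.mem_face_iff] at this
        omega
      rw [h0, mul_zero, zero_add] at h1
      have h2 := (mul_eq_zero.1 h1).resolve_left ht
      have h3 := congrArg TrivSqZeroExt.snd (sh.aeval_hform_dualNumber (θ := θ) p q a)
      rw [h2, h0, ← Finset.mul_prod_erase _ _ (Finset.mem_univ j), hwj, pow_one, hLj,
        prod_dualNumber _ _ fun k hk => Or.inl ?_] at h3
      · simp only [TrivSqZeroExt.snd_mul, TrivSqZeroExt.fst_add, TrivSqZeroExt.snd_add,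
          TrivSqZeroExt.fst_inl, TrivSqZeroExt.snd_inl, TrivSqZeroExt.fst_inr, TrivSqZeroExt.snd_inr,
          TrivSqZeroExt.fst_mul, add_zero, zero_add, smul_eq_mul, MulOpposite.smul_eq_mul_unop,
          MulOpposite.unop_op, zero_mul, mul_zero] at h3
        have hθ0 := hθ.ne_zero 0
        have hθ1 := hθ.ne_zero 1
        refine mul_ne_zero (by positivity) (mul_ne_zero ?_ ?_) h3.symm
        · intro h
          have := hL (θ (Sum.inr j))
          rw [h, hLj, zero_mul, zero_mul, zero_add] at this
          exact hdet this.symm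
        · refine Finset.prod_ne_zero_iff.2 fun k hk => pow_ne_zero _ fun h => ?_
          exact Finset.ne_of_mem_erase hk (idx_unique hθ hp (sub_eq_zero.1 h) hj)
      · intro h
        exact Finset.ne_of_mem_erase hk (idx_unique hθ hp (sub_eq_zero.1 h) hj)
  · push Not at hj
    have hne : ∀ a, MvPolynomial.eval p (sh.hform θ a) ≠ 0 := fun a =>
      (sh.eval_hform_ne_zero_iff hθ p a).2 fun j h => absurd h (hj j)
    have hL0 : ∀ j : Idx d, p 0 - θ (Sum.inr j) * p 1 ≠ 0 := fun j => sub_ne_zero.2 (hj j)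
    -- Differences of lattice points of `Δ` generate the lattice, so the identity extends to all
    -- exponents.
    have hall : ∀ v, ∑ j : Idx d, (j.exp v : K) * r j = 0 := by
      obtain ⟨i, -⟩ := sh.exists_left sh.h_pos
      obtain ⟨o₂, u, -, hu⟩ := sh.exists_frame i
      have h1 : (i.edgePt 1 i.length_pos).1 - i.origin.1 = i.tangent := by simp [Side.edgePt]
      intro v
      have e1 := hdiff (i.edgePt 1 i.length_pos) i.origin (hne _) (hne _)
      have e2 := hdiff o₂ i.origin (hne _) (hne _)
      rw [h1] at e1
      have e : ∀ j : Idx d, (j.exp v : K) * r j = (latticePairing u v : K) * ((j.exp i.tangent : K) * r j) +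
          (latticePairing i.1 v : K) * ((j.exp (o₂.1 - i.origin.1) : K) * r j) := fun j => by
        conv_lhs => rw [hu v, Idx.exp, latticePairing_add, latticePairing_zsmul, latticePairing_zsmul]
        rw [Idx.exp, Idx.exp]
        push_cast
        ring
      simp only [e, Finset.sum_add_distrib, ← Finset.mul_sum, e1, e2, mul_zero, add_zero]
    -- At infinity the logarithmic derivative is replaced by its first order coefficient, the sum of
    -- exponents times points.
    by_cases hp1 : p 1 = 0
    · have hp0 : p 0 ≠ 0 := fun h => hp (by ext l; fin_cases l; exacts [h, hp1])
      have hq1 : q 1 ≠ 0 := fun h => hdet (by rw [h, hp1]; ring)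
      apply hu.infinity
      have h1 := hall (1, 0)
      have e : ∀ j : Idx d, (j.exp (1, 0) : K) * r j =
          q 0 / p 0 * (j.exp (1, 0) : K) - q 1 / p 0 * ((j.exp (1, 0) : K) * θ (Sum.inr j)) := fun j => by
        simp only [hr, hp1, mul_zero, sub_zero]
        ring
      simp only [e, Finset.sum_sub_distrib, ← Finset.mul_sum, hsum, mul_zero, zero_sub, neg_eq_zero] at h1
      exact (mul_eq_zero.1 h1).resolve_left (div_ne_zero hq1 hp0)
    · have key : ∀ v, ∑ j : Idx d, (j.exp v : K) / (p 0 / p 1 - θ (Sum.inr j)) = 0 := by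
        intro v
        have e : ∀ j : Idx d, (q 0 * p 1 - p 0 * q 1) * ((j.exp v : K) / (p 0 / p 1 - θ (Sum.inr j))) =
            p 1 ^ 2 * ((j.exp v : K) * r j) - p 1 * q 1 * (j.exp v : K) := fun j => by
          have h1 := hL0 j
          have h2 : p 0 / p 1 - θ (Sum.inr j) = (p 0 - θ (Sum.inr j) * p 1) / p 1 := by field_simp
          have e0 : r j * p 1 = q 1 + (q 0 * p 1 - p 0 * q 1) / (p 0 - θ (Sum.inr j) * p 1) := by
            simp only [hr]
            rw [div_mul_eq_mul_div, hL, add_div, mul_div_cancel_left₀ _ h1]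
          rw [h2, div_div_eq_mul_div]
          linear_combination (-p 1 * (j.exp v : K)) * e0
        have h5 : (q 0 * p 1 - p 0 * q 1) * ∑ j : Idx d, (j.exp v : K) / (p 0 / p 1 - θ (Sum.inr j)) = 0 := by
          rw [Finset.mul_sum, Finset.sum_congr rfl fun j _ => e j, Finset.sum_sub_distrib,
            ← Finset.mul_sum, ← Finset.mul_sum, hall, hsum]
          ring
        exact (mul_eq_zero.1 h5).resolve_left hdet
      refine hu.torus (p 0 / p 1) (fun j h => hj j ?_) ⟨key _, key _⟩
      rw [← h]
      field_simp

end Shape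

end LatticePolygon

namespace LatticePolygon

open Polynomial

variable {Δ : LatticePolygon} {d : Δ.TangencyProfile} {K : Type*} [Field K]

/-! ### Tangent spaces at points of the toric boundary -/

theorem isToric_of_add {R : Type*} [CommMonoid R] {χ : ℤ × ℤ → R} (h0 : χ 0 = 1)
    (hadd : ∀ v w, χ (v + w) = χ v * χ w) : IsToric fun a : Δ.Pts => χ a.1 := by
  have hn : ∀ (n : ℕ) v, χ (n • v) = χ v ^ n := fun n v => by
    induction n with
    | zero => simp [h0]
    | succ n ih => rw [succ_nsmul, hadd, ih, pow_succ]
  have hs : ∀ u : Δ.Pts → ℕ, ∏ a, χ a.1 ^ u a = χ (∑ a, u a • a.1) := by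
    intro u
    induction (Finset.univ : Finset Δ.Pts) using Finset.induction_on with
    | empty => simp [h0]
    | insert a s ha ih => rw [Finset.prod_insert ha, Finset.sum_insert ha, hadd, hn, ih]
  intro u v _ h
  rw [hs, hs, h]

/-- Tangent vectors are points over the dual numbers, so the differentials of the toric binomials
are handled by the multiplicative toric relations. -/
theorem LinearSystem.mem_affineTangentSpace_iff (C₀ : LinearSystem K Δ) {z : AmbientSpace K Δ}
    (hz : z ∈ Δ.toricSurface K) (w : Δ.Pts → K) : w ∈ C₀.affineTangentSpace z ↔
      IsToric (fun a => (TrivSqZeroExt.inl (z.rep a) + TrivSqZeroExt.inr (w a) : DualNumber K)) ∧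
        ∑ a, C₀.coeff a * w a = 0 := by
  rw [← forall_toricBinomials_iff (K := K)]
  have hlin : ∀ a, MvPolynomial.eval z.rep (MvPolynomial.pderiv a C₀.linearForm) = C₀.coeff a := by
    intro a
    rw [linearForm, map_sum, map_sum]
    simp [Derivation.leibniz, MvPolynomial.pderiv_X, Pi.single_apply]
    simp only [apply_ite (MvPolynomial.eval z.rep), map_zero, map_one, mul_ite, mul_one, mul_zero,
      Finset.sum_ite_eq', Finset.mem_univ, if_true, MvPolynomial.eval_C]
  have hbin : ∀ G ∈ Δ.toricBinomials K, (MvPolynomial.aeval (fun a => (TrivSqZeroExt.inl (z.rep a) +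
      TrivSqZeroExt.inr (w a) : DualNumber K)) G = 0 ↔
        ∑ a, MvPolynomial.eval z.rep (MvPolynomial.pderiv a G) * w a = 0) := by
    intro G hG
    rw [aeval_dualNumber, hz G hG, TrivSqZeroExt.inl_zero, zero_add]
    simp only [mul_comm (w _)]
    exact ⟨fun h => by simpa using congrArg TrivSqZeroExt.snd h, fun h => by rw [h, TrivSqZeroExt.inr_zero]⟩
  constructor
  · intro h
    refine ⟨fun G hG => (hbin G hG).2 (h G (Or.inl hG)), ?_⟩
    simpa only [hlin] using h _ (Or.inr rfl)
  · rintro ⟨h1, h2⟩ G (hG | rfl)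
    · exact (hbin G hG).1 (h1 G hG)
    · simpa only [hlin] using h2

namespace Side

variable {i : Δ.Side} {o₂ : Δ.Pts} {u : ℤ × ℤ} (ho₂ : i.ht o₂.1 = 1)
  (hu : ∀ v : ℤ × ℤ, v = latticePairing u v • i.tangent + latticePairing i.1 v • (o₂.1 - i.origin.1))

include hu in
theorem frame_edgePt (k : ℕ) (hk : k ≤ i.length) :
    latticePairing u ((i.edgePt k hk).1 - i.origin.1) = k := by
  have h1 : latticePairing u i.tangent = 1 := by
    have := hu i.tangent
    rw [pairing_tangent, zero_smul, add_zero] at this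
    exact (smul_tangent_inj (by rw [one_smul]; exact this)).symm
  simp only [edgePt, add_sub_cancel_left, latticePairing_zsmul, h1, mul_one]

include ho₂ hu in
theorem frame_snd : latticePairing u (o₂.1 - i.origin.1) = 0 := by
  have h1 : latticePairing i.1 (o₂.1 - i.origin.1) = 1 := by
    rw [latticePairing_sub, ← ho₂, i.ht_eq]
  have := hu (o₂.1 - i.origin.1)
  rw [h1, one_smul] at this
  exact smul_tangent_inj (i := i) (by rw [zero_smul]; exact right_eq_add.1 this)

include hu in
theorem frame_eq (a : Δ.Pts) : a.1 - i.origin.1 = latticePairing u (a.1 - i.origin.1) •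
    ((i.edgePt 1 i.length_pos).1 - i.origin.1) + i.ht a.1 • (o₂.1 - i.origin.1) := by
  conv_lhs => rw [hu (a.1 - i.origin.1)]
  rw [i.ht_eq, ← latticePairing_sub]
  simp [edgePt]

/-- The tangent vectors of the toric surface at a point `z` of the toric divisor of `i`. -/
def tangentMap (i : Δ.Side) (u : ℤ × ℤ) (z : Δ.Pts → K) (s : K) : (Fin 3 → K) →ₗ[K] (Δ.Pts → K) where
  toFun c a := if i.ht a.1 = 0 then z a * (c 0 + latticePairing u (a.1 - i.origin.1) * c 1)
    else if i.ht a.1 = 1 then s ^ latticePairing u (a.1 - i.origin.1) * c 2 else 0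
  map_add' c c' := by
    ext a
    simp only [Pi.add_apply]
    split_ifs <;> ring
  map_smul' l c := by
    ext a
    simp only [Pi.smul_apply, smul_eq_mul, RingHom.id_apply]
    split_ifs <;> ring

variable {z : Δ.Pts → K} {s : K} (hz : IsToric z) (h0 : ∀ a, z a ≠ 0 ↔ i.ht a.1 = 0)
  (hs : z (i.edgePt 1 i.length_pos) = s * z i.origin)

include hz h0 hs in
theorem eq_pow_of_toric (k : ℕ) (hk : k ≤ i.length) : z (i.edgePt k hk) = z i.origin * s ^ k := by
  have ho := (h0 _).2 i.ht_origin
  have := hz.edge i hk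
  rw [hs, mul_pow] at this
  exact mul_right_cancel₀ (pow_ne_zero k ho) (by rw [this]; ring)

include h0 hs in
theorem param_ne_zero : s ≠ 0 := by
  rintro rfl
  rw [zero_mul] at hs
  exact (h0 _).2 (i.ht_edgePt 1 i.length_pos) hs

include ho₂ hu hz h0 hs in
theorem isToric_tangentMap (c : Fin 3 → K) : IsToric (fun a =>
    (TrivSqZeroExt.inl (z a) + TrivSqZeroExt.inr (i.tangentMap u z s c a) : DualNumber K)) := by
  have ho := (h0 _).2 i.ht_origin
  have hs0 := param_ne_zero h0 hs
  let χ : ℤ × ℤ → DualNumber K := fun v => TrivSqZeroExt.inl (s ^ latticePairing u v) +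
    TrivSqZeroExt.inr (s ^ latticePairing u v * (latticePairing u v * c 1))
  have hadd : ∀ v w, χ (v + w) = χ v * χ w := by
    intro v w
    simp only [χ, latticePairing_add, zpow_add₀ hs0]
    ext
    · simp
    · simp
      ring
  have h1 := (isToric_of_add (Δ := Δ) (χ := χ) (by simp [χ, latticePairing]) hadd).mul
    (isToric_const (χ (-i.origin.1)))
  -- A nilpotent raised to the distance from the side: it is `1` on the side, moves off the divisor
  -- to first order at distance one, and is zero from distance two on. The other factors move along
  -- the divisor and rescale.
  have h2 := isToric_pow (Δ := Δ) (TrivSqZeroExt.inr (c 2 / z i.origin) : DualNumber K)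
    (w := fun a => (i.ht a.1).toNat) i.1 (-i.level) fun a => by
      rw [Int.toNat_of_nonneg (ht_nonneg a), ht]; ring
  convert (h1.mul h2).mul (isToric_const (TrivSqZeroExt.inl (z i.origin) +
    TrivSqZeroExt.inr (z i.origin * c 0))) using 2 with a
  rw [← hadd, ← sub_eq_add_neg]
  simp only [χ, tangentMap, LinearMap.coe_mk, AddHom.coe_mk]
  have hnn := ht_nonneg (i := i) a
  by_cases ha : i.ht a.1 = 0
  · obtain ⟨k, hk, rfl⟩ := i.exists_edgePt ha
    rw [if_pos ha, ha, Int.toNat_zero, pow_zero, mul_one, frame_edgePt hu k hk,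
      eq_pow_of_toric hz h0 hs k hk]
    ext
    · simp
      ring
    · simp
      ring
  · have hza : z a = 0 := by_contra fun h => ha ((h0 a).1 h)
    rw [if_neg ha, hza]
    by_cases ha1 : i.ht a.1 = 1
    · rw [if_pos ha1, ha1, Int.toNat_one, pow_one]
      ext
      · simp
      · simp
        field_simp
    · obtain ⟨n, hn⟩ : ∃ n : ℕ, (i.ht a.1).toNat = n + 2 := ⟨(i.ht a.1).toNat - 2, by omega⟩
      rw [if_neg ha1, hn, pow_add, pow_two, TrivSqZeroExt.inr_mul_inr]
      simp

include ho₂ hu hz h0 hs in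
theorem exists_eq_tangentMap {w : Δ.Pts → K} (hw : IsToric (fun a =>
    (TrivSqZeroExt.inl (z a) + TrivSqZeroExt.inr (w a) : DualNumber K))) :
    ∃ c, i.tangentMap u z s c = w := by
  have ho := (h0 _).2 i.ht_origin
  have hs0 := param_ne_zero h0 hs
  set o₁ := i.edgePt 1 i.length_pos with ho₁'
  have ho₁ : z o₁ ≠ 0 := (h0 _).2 (i.ht_edgePt 1 _)
  refine ⟨![w i.origin / z i.origin, w o₁ / z o₁ - w i.origin / z i.origin, w o₂], ?_⟩
  ext a
  simp only [tangentMap, LinearMap.coe_mk, AddHom.coe_mk, Matrix.cons_val]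
  have hnn := ht_nonneg (i := i) a
  by_cases ha : i.ht a.1 = 0
  · have hza := (h0 a).2 ha
    obtain ⟨k, hk, rfl⟩ := i.exists_edgePt ha
    have h1 := hw.edge i hk
    rw [if_pos ha, frame_edgePt hu k hk]
    simp only [← ho₁'] at h1
    rw [pow_dualNumber _ (Or.inl ho), pow_dualNumber _ (Or.inl ho₁)] at h1
    have e1 := congrArg TrivSqZeroExt.fst h1
    have e2 := congrArg TrivSqZeroExt.snd h1
    simp at e1 e2
    have hk0 := pow_ne_zero k ho
    apply mul_right_cancel₀ hk0
    have e3 : w (i.edgePt k hk) * z i.origin ^ k = z i.origin * (z o₁ ^ k * (k * (w o₁ / z o₁))) +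
        z o₁ ^ k * w i.origin - z (i.edgePt k hk) * (z i.origin ^ k * (k * (w i.origin / z i.origin))) := by
      linear_combination e2
    rw [e3]
    have e4 : z o₁ ^ k * w i.origin = z i.origin * z o₁ ^ k * (w i.origin / z i.origin) := by
      field_simp
    rw [e4]
    push_cast
    linear_combination (w i.origin / z i.origin + k * (w o₁ / z o₁)) * e1
  · have hza : z a = 0 := by_contra fun h => ha ((h0 a).1 h)
    have hz₂ : z o₂ = 0 := by_contra fun h => by have := (h0 o₂).1 h; omega
    rw [if_neg ha]
    set n := latticePairing u (a.1 - i.origin.1) with hn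
    have h1 := hw.frame (a := a) (o := i.origin) (o₁ := o₁) (o₂ := o₂) (k := n.toNat)
      (k' := (-n).toNat) (l := (i.ht a.1).toNat) (l' := 0) (by
        rw [frame_eq hu a, ← hn, Int.toNat_of_nonneg hnn, Nat.cast_zero, sub_zero]
        congr 2
        omega)
    simp only [hza, hz₂, TrivSqZeroExt.inl_zero, zero_add, pow_zero, one_mul, mul_one] at h1
    rw [pow_dualNumber _ (Or.inl ho), pow_dualNumber _ (Or.inl ho₁), pow_dualNumber _ (Or.inl ho),
      pow_dualNumber _ (Or.inl ho₁), pow_dualNumber _ (Or.inl ho)] at h1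
    by_cases ha1 : i.ht a.1 = 1
    · rw [if_pos ha1]
      rw [ha1, Int.toNat_one, pow_one] at h1
      have e2 := congrArg TrivSqZeroExt.snd h1
      simp at e2
      have hsn : s ^ n * (z o₁ ^ (-n).toNat * z i.origin ^ n.toNat) =
          z o₁ ^ n.toNat * z i.origin ^ (-n).toNat := by
        rw [hs, mul_pow, mul_pow]
        have : s ^ n * s ^ (-n).toNat = s ^ n.toNat := by
          rw [← zpow_natCast, ← zpow_natCast, ← zpow_add₀ hs0]
          congr 1
          omega
        linear_combination z i.origin ^ (-n).toNat * z i.origin ^ n.toNat * this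
      have hne : z o₁ ^ (-n).toNat * z i.origin ^ n.toNat * z i.origin ≠ 0 := by positivity
      apply mul_right_cancel₀ hne
      linear_combination (w o₂ * z i.origin) * hsn - e2
    · obtain ⟨m, hm⟩ : ∃ m : ℕ, (i.ht a.1).toNat = m + 2 := ⟨(i.ht a.1).toNat - 2, by omega⟩
      rw [if_neg ha1]
      rw [hm, pow_add (TrivSqZeroExt.inr (w o₂)) m 2, pow_two (TrivSqZeroExt.inr (w o₂)),
        TrivSqZeroExt.inr_mul_inr] at h1
      have e2 := congrArg TrivSqZeroExt.snd h1
      simp [ho, ho₁] at e2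
      exact e2.symm

include ho₂ hu hz h0 hs in
theorem tangentMap_injective : Function.Injective (i.tangentMap u z s) := by
  have ho := (h0 _).2 i.ht_origin
  have ho₁ := (h0 _).2 (i.ht_edgePt 1 i.length_pos)
  rw [injective_iff_map_eq_zero]
  intro c hc
  have e0 := congrFun hc (i.edgePt 0 (Nat.zero_le _))
  have e1 := congrFun hc (i.edgePt 1 i.length_pos)
  have e2 := congrFun hc o₂
  simp only [tangentMap, LinearMap.coe_mk, AddHom.coe_mk, i.ht_edgePt, if_true, frame_edgePt hu,
    Pi.zero_apply] at e0 e1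
  simp only [tangentMap, LinearMap.coe_mk, AddHom.coe_mk, ho₂, frame_snd ho₂ hu, one_ne_zero, if_false,
    if_true, zpow_zero, one_mul, Pi.zero_apply] at e2
  rw [edgePt_zero] at e0
  simp [ho] at e0
  simp [ho₁, e0] at e1
  ext l
  fin_cases l
  exacts [e0, e1, e2]

include ho₂ hu in
/-- A curve is smooth at a point of the toric divisor of `i` if the restriction of its equation to the
divisor has a simple zero there, or if the derivative normal to the divisor does not vanish there. -/
theorem finrank_affineTangentSpace (C₀ : LinearSystem K Δ) {z : AmbientSpace K Δ}
    (hz : z ∈ Δ.toricSurface K) (h0 : ∀ a, z.rep a ≠ 0 ↔ i.ht a.1 = 0)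
    (hs : z.rep (i.edgePt 1 i.length_pos) = s * z.rep i.origin)
    (hne : (derivative (i.edgePoly C₀.coeff)).eval s ≠ 0 ∨
      ∑ a, (if i.ht a.1 = 1 then C₀.coeff a * s ^ latticePairing u (a.1 - i.origin.1) else 0) ≠ 0) :
    Module.finrank K (C₀.affineTangentSpace z) = 2 := by
  have htor := (mem_toricSurface_iff z).1 hz
  have ho := (h0 _).2 i.ht_origin
  have hs0 := param_ne_zero h0 hs
  -- The cone over the tangent space of the surface is three-dimensional here, and the linear form
  -- of the curve cuts it down to dimension two unless it vanishes on it. The last two basis vectors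
  -- test the derivative along the divisor and the one normal to it.
  let φ : Module.Dual K (Fin 3 → K) :=
    (∑ a, C₀.coeff a • LinearMap.proj a) ∘ₗ i.tangentMap u z.rep s
  have hφ : ∀ c, φ c = ∑ a, C₀.coeff a * i.tangentMap u z.rep s c a := fun c => by simp [φ]
  have hφ0 : φ ≠ 0 := by
    intro h
    rcases hne with h1 | h1
    · have h2 := hφ ![0, 1, 0]
      rw [h, LinearMap.zero_apply, i.sum_face] at h2
      · apply mul_ne_zero (mul_ne_zero ho hs0) h1
        rw [h2, edgePoly, derivative_sum, eval_finsetSum, Finset.mul_sum]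
        refine Finset.sum_congr rfl fun k _ => ?_
        have hk := Nat.lt_succ_iff.1 k.2
        simp only [tangentMap, LinearMap.coe_mk, AddHom.coe_mk, i.ht_edgePt, if_true,
          frame_edgePt hu k.1 hk, eq_pow_of_toric htor h0 hs k.1 hk, derivative_monomial,
          eval_monomial, Matrix.cons_val]
        rcases Nat.eq_zero_or_pos k.1 with h3 | h3
        · simp [h3]
        · have h4 : s ^ k.1 = s * s ^ (k.1 - 1) := by rw [← pow_succ', Nat.sub_add_cancel h3]
          rw [h4]
          push_cast
          ring
      · intro a ha
        simp [tangentMap, ha]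
    · apply h1
      have h2 := hφ ![0, 0, 1]
      rw [h, LinearMap.zero_apply] at h2
      refine Eq.trans ?_ h2.symm
      refine Finset.sum_congr rfl fun a _ => ?_
      simp only [tangentMap, LinearMap.coe_mk, AddHom.coe_mk, Matrix.cons_val]
      split_ifs with h3 h4 <;> first | omega | simp
  have hT : C₀.affineTangentSpace z = (LinearMap.ker φ).map (i.tangentMap u z.rep s) := by
    ext w
    rw [C₀.mem_affineTangentSpace_iff hz, Submodule.mem_map]
    constructor
    · rintro ⟨h1, h2⟩
      obtain ⟨c, rfl⟩ := exists_eq_tangentMap ho₂ hu htor h0 hs h1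
      exact ⟨c, by rw [LinearMap.mem_ker, hφ, h2], rfl⟩
    · rintro ⟨c, hc, rfl⟩
      exact ⟨isToric_tangentMap ho₂ hu htor h0 hs c, by rw [← hφ]; exact hc⟩
  rw [hT, ← (Submodule.equivMapOfInjective _ (tangentMap_injective ho₂ hu htor h0 hs) _).finrank_eq]
  have := Module.Dual.finrank_ker_add_one_of_ne_zero hφ0
  rw [Module.finrank_fin_fun] at this
  omega

end Side

end LatticePolygon

/-! ### Power series and multiplicities of roots -/

section

variable {K : Type*} [Field K]

theorem constantCoeff_aeval (ρ : PowerSeries K) (P : Polynomial K) :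
    PowerSeries.constantCoeff (Polynomial.aeval ρ P) = P.eval (PowerSeries.constantCoeff ρ) := by
  induction P using Polynomial.induction_on' with
  | add p q hp hq => simp [hp, hq]
  | monomial n c => simp [Polynomial.aeval_monomial, ← PowerSeries.C_eq_algebraMap]

theorem constantCoeff_prod_C_add_X {ι : Type*} (s : Finset ι) (x : ι → K) (w : ι → ℕ) :
    PowerSeries.constantCoeff (∏ k ∈ s, (PowerSeries.C (x k) + PowerSeries.X) ^ w k) =
      ∏ k ∈ s, x k ^ w k := by
  simp [map_prod]

theorem coeff_one_prod_C_add_X {ι : Type*} (s : Finset ι) {x : ι → K} (hx : ∀ k ∈ s, x k ≠ 0)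
    (w : ι → ℕ) : PowerSeries.coeff 1 (∏ k ∈ s, (PowerSeries.C (x k) + PowerSeries.X) ^ w k) =
      (∏ k ∈ s, x k ^ w k) * ∑ k ∈ s, (w k : K) / x k := by
  classical
  induction s using Finset.induction_on with
  | empty => simp [PowerSeries.coeff_one]
  | insert k s hk ih =>
    have h0 := hx k (Finset.mem_insert_self _ _)
    have h1 : x k ^ (w k - 1) * w k = x k ^ w k * (w k / x k) := by
      rcases Nat.eq_zero_or_pos (w k) with h | h
      · simp [h]
      · conv_rhs => rw [← Nat.sub_add_cancel h, pow_succ, Nat.sub_add_cancel h]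
        field_simp
    rw [Finset.prod_insert hk, Finset.prod_insert hk, Finset.sum_insert hk, PowerSeries.coeff_one_mul,
      ih fun l hl => hx l (Finset.mem_insert_of_mem hl), constantCoeff_prod_C_add_X,
      PowerSeries.coeff_one_pow]
    simp [PowerSeries.coeff_C]
    linear_combination (∏ l ∈ s, x l ^ w l) * h1

/-- As `ρ` minus its constant term has order one, `P(ρ)` has order exactly the multiplicity of the
root, and `G` is a unit. Comparing orders with the right side gives both claims. -/
theorem le_rootMultiplicity_of_series {ρ G H : PowerSeries K} {P : Polynomial K} {m : ℕ} (hP : P ≠ 0)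
    (h : G * Polynomial.aeval ρ P = PowerSeries.X ^ m * H) (hG : PowerSeries.constantCoeff G ≠ 0)
    (h1 : PowerSeries.coeff 1 ρ ≠ 0) :
    m ≤ P.rootMultiplicity (PowerSeries.constantCoeff ρ) ∧
      (P.rootMultiplicity (PowerSeries.constantCoeff ρ) = m → PowerSeries.constantCoeff H ≠ 0) := by
  set s := PowerSeries.constantCoeff ρ with hs
  obtain ⟨Q, hQ, hQs⟩ := P.exists_eq_pow_rootMultiplicity_mul_and_not_dvd hP s
  rw [Polynomial.dvd_iff_isRoot, Polynomial.IsRoot.def] at hQs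
  set μ := P.rootMultiplicity s with hμ
  obtain ⟨η, hη⟩ : PowerSeries.X ∣ ρ - PowerSeries.C s :=
    PowerSeries.X_dvd_iff.2 (by simp [hs])
  have hη0 : PowerSeries.constantCoeff η ≠ 0 := by
    have := congrArg (PowerSeries.coeff 1) hη
    simp [PowerSeries.coeff_C, PowerSeries.coeff_one_mul] at this
    rwa [← this]
  have e : G * Polynomial.aeval ρ P =
      PowerSeries.X ^ μ * (G * η ^ μ * Polynomial.aeval ρ Q) := by
    rw [hQ, map_mul, map_pow, map_sub, Polynomial.aeval_X, Polynomial.aeval_C,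
      ← PowerSeries.C_eq_algebraMap, hη]
    ring
  have hU : PowerSeries.constantCoeff (G * η ^ μ * Polynomial.aeval ρ Q) ≠ 0 := by
    rw [map_mul, map_mul, map_pow, constantCoeff_aeval]
    exact mul_ne_zero (mul_ne_zero hG (pow_ne_zero _ hη0)) hQs
  rw [e] at h
  constructor
  · by_contra hlt
    push Not at hlt
    obtain ⟨n, hn⟩ := Nat.exists_eq_add_of_lt hlt
    rw [hn, pow_succ, pow_add, mul_assoc (PowerSeries.X ^ μ * _), mul_assoc (PowerSeries.X ^ μ)] at h
    have h2 := mul_left_cancel₀ (pow_ne_zero μ PowerSeries.X_ne_zero) h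
    rw [h2] at hU
    simp at hU
  · rintro hm
    rw [hm] at h hU
    have h2 := mul_left_cancel₀ (pow_ne_zero m PowerSeries.X_ne_zero) h
    rwa [← h2]

theorem Polynomial.sum_rootMultiplicity_le {P : Polynomial K} (S : Finset K) :
    ∑ r ∈ S, P.rootMultiplicity r ≤ P.natDegree := by
  classical
  simp only [← count_roots]
  calc ∑ r ∈ S, P.roots.count r ≤ ∑ r ∈ S ∪ P.roots.toFinset, P.roots.count r :=
        Finset.sum_le_sum_of_subset Finset.subset_union_left
    _ = Multiset.card P.roots := Multiset.sum_count_eq_card fun a ha =>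
        Finset.mem_union_right _ (Multiset.mem_toFinset.2 ha)
    _ ≤ _ := P.card_roots'

/-- Roots of a polynomial with given lower bounds for the multiplicities that add up to the degree. -/
theorem Polynomial.rootMultiplicity_eq_of_le {ι : Type*} [Fintype ι] {P : Polynomial K} (hP : P ≠ 0)
    {r : ι → K} (hr : Function.Injective r) {m : ι → ℕ} (h : ∀ x, m x ≤ P.rootMultiplicity (r x))
    (hdeg : P.natDegree ≤ ∑ x, m x) {s : K} (hs : P.IsRoot s) :
    ∃ x, s = r x ∧ P.rootMultiplicity s = m x := by
  classical
  have hsum := sum_rootMultiplicity_le (P := P) (Finset.univ.image r)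
  have hsum' := sum_rootMultiplicity_le (P := P) (insert s (Finset.univ.image r))
  rw [Finset.sum_image fun x _ y _ h => hr h] at hsum
  have hle := Finset.sum_le_sum fun x (_ : x ∈ Finset.univ) => h x
  by_cases hx : s ∈ Finset.univ.image r
  · obtain ⟨x, -, rfl⟩ := Finset.mem_image.1 hx
    refine ⟨x, rfl, ?_⟩
    have := (Finset.sum_eq_sum_iff_of_le fun x (_ : x ∈ Finset.univ) => h x).1 (by omega)
    exact (this x (Finset.mem_univ _)).symm
  · rw [Finset.sum_insert hx, Finset.sum_image fun x _ y _ h => hr h] at hsum'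
    have := (rootMultiplicity_pos hP).2 hs
    omega

end

namespace LatticePolygon

open Polynomial

variable {Δ : LatticePolygon} {d : Δ.TangencyProfile} {K : Type*} [Field K]

namespace Shape

variable (sh : Δ.Shape) {θ : Par d → K}

/-! ### Expansion of the equation at a point of the toric boundary -/

/-- The expansion at the point `j` of the coordinate `a`, divided by its leading power. -/
def series (θ : Par d → K) (j : Idx d) (a : Δ.Pts) : PowerSeries K :=
  PowerSeries.C (θ (Sum.inl 0) ^ sh.col a * θ (Sum.inl 1) ^ sh.row a) *
    ∏ k ∈ Finset.univ.erase j, (PowerSeries.C (θ (Sum.inr j) - θ (Sum.inr k)) + PowerSeries.X) ^ k.weight a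

theorem isToric_series (j : Idx d) : IsToric (sh.series θ j) := by
  refine IsToric.mul ?_ (IsToric.prod _ fun k _ => k.isToric_pow_weight _)
  exact ((sh.isToric_pow_col _).mul (sh.isToric_pow_row _)).map PowerSeries.C

theorem aeval_dform_series (j : Idx d) (a : Δ.Pts) :
    aeval (PowerSeries.C (θ (Sum.inr j)) + PowerSeries.X) (sh.dform θ a) =
      PowerSeries.X ^ j.weight a * sh.series θ j a := by
  rw [dform, series, map_mul, aeval_C, map_prod, ← Finset.mul_prod_erase _ _ (Finset.mem_univ j),
    ← PowerSeries.C_eq_algebraMap]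
  simp only [map_pow, map_sub, aeval_X, aeval_C, ← PowerSeries.C_eq_algebraMap, add_sub_cancel_left]
  simp only [add_sub_right_comm]
  ring

theorem constantCoeff_series (j : Idx d) (a : Δ.Pts) : PowerSeries.constantCoeff (sh.series θ j a) =
    θ (Sum.inl 0) ^ sh.col a * θ (Sum.inl 1) ^ sh.row a *
      ∏ k ∈ Finset.univ.erase j, (θ (Sum.inr j) - θ (Sum.inr k)) ^ k.weight a := by
  rw [series, map_mul, constantCoeff_prod_C_add_X, PowerSeries.constantCoeff_C]

variable (hθ : IsRegular θ)
include hθ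

theorem constantCoeff_series_ne_zero (j : Idx d) (a : Δ.Pts) :
    PowerSeries.constantCoeff (sh.series θ j a) ≠ 0 := by
  have h1 := hθ.ne_zero 0
  have h2 := hθ.ne_zero 1
  rw [constantCoeff_series]
  exact mul_ne_zero (by positivity)
    (Finset.prod_ne_zero_iff.2 fun k hk => pow_ne_zero _ (hθ.sub_ne_zero hk))

theorem coeff_one_series (j : Idx d) (a : Δ.Pts) : PowerSeries.coeff 1 (sh.series θ j a) =
    PowerSeries.constantCoeff (sh.series θ j a) * ∑ k ∈ Finset.univ.erase j,
      (k.weight a : K) / (θ (Sum.inr j) - θ (Sum.inr k)) := by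
  rw [constantCoeff_series, series, PowerSeries.coeff_C_mul,
    coeff_one_prod_C_add_X _ fun k hk => hθ.sub_ne_zero hk]
  ring

theorem constantCoeff_series_edge (j : Idx d) :
    PowerSeries.constantCoeff (sh.series θ j (j.1.edgePt 1 j.1.length_pos)) =
      sval θ j * PowerSeries.constantCoeff (sh.series θ j j.1.origin) := by
  have hev : ∀ a ∈ Δ.face j.1.1, PowerSeries.constantCoeff (sh.series θ j a) =
      MvPolynomial.eval ![θ (Sum.inr j), 1] (sh.hform θ a) := fun a ha => by
    rw [constantCoeff_series, eval_hform, ← Finset.mul_prod_erase _ _ (Finset.mem_univ j),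
      (j.weight_eq_zero_iff a).2 ha]
    simp
  have h1 : (j.1.edgePt 1 j.1.length_pos) ∈ Δ.face j.1.1 := (Side.mem_face_iff _).2 (j.1.ht_edgePt 1 _)
  have ho : j.1.origin ∈ Δ.face j.1.1 := (Side.mem_face_iff _).2 j.1.ht_origin
  have ht : (j.1.edgePt 1 j.1.length_pos).1 - j.1.origin.1 = j.1.tangent := by simp [Side.edgePt]
  rw [hev _ h1, hev _ ho, sh.eval_hform_face hθ (by simp) (by simp) h1 ho, ht, sval]

/-- The restriction of the equation to a side in terms of the expansion at a point. -/
theorem exists_expansion {F : Δ.Pts → K} (hrel : ∑ a, C (F a) * sh.dform θ a = 0) (j : Idx d) :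
    ∃ ρ H : PowerSeries K, sh.series θ j j.1.origin * aeval ρ (j.1.edgePoly F) =
        PowerSeries.X ^ j.mult * H ∧ PowerSeries.constantCoeff ρ = sval θ j ∧
      PowerSeries.constantCoeff H = - ∑ a, (if j.1.ht a.1 = 1 then
        F a * PowerSeries.constantCoeff (sh.series θ j a) else 0) ∧
      (j.1.IsHorizontal → IsUnramified θ → PowerSeries.coeff 1 ρ ≠ 0) := by
  have hc := sh.constantCoeff_series_ne_zero hθ j
  set S := sh.series θ j with hS
  set o₁ := j.1.edgePt 1 j.1.length_pos with ho₁
  have hSo : S j.1.origin ≠ 0 := fun h => hc j.1.origin (by rw [h, map_zero])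
  set ρ := (S j.1.origin)⁻¹ * S o₁ with hρ
  have hSρ : S j.1.origin * ρ = S o₁ := by
    rw [hρ, ← mul_assoc, PowerSeries.mul_inv_cancel _ (hc _), one_mul]
  have hedge : ∀ k (hk : k ≤ j.1.length), S (j.1.edgePt k hk) = S j.1.origin * ρ ^ k := fun k hk => by
    have := (sh.isToric_series (θ := θ) j).edge j.1 hk
    rw [← hS, ← ho₁, ← hSρ] at this
    exact mul_right_cancel₀ (pow_ne_zero k hSo) (by rw [this]; ring)
  have hρ0 : PowerSeries.constantCoeff ρ = sval θ j := by
    have := congrArg PowerSeries.constantCoeff hSρ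
    rw [map_mul, hS, ho₁, sh.constantCoeff_series_edge hθ j, mul_comm] at this
    exact mul_right_cancel₀ (hc _) this
  -- The terms off the side are divisible by the power `mult`. After division only those at distance
  -- one contribute to the constant term, so this is the normal derivative of the equation.
  let H : PowerSeries K := -∑ a, if j.1.ht a.1 = 0 then 0 else
    PowerSeries.C (F a) * (PowerSeries.X ^ (j.mult * ((j.1.ht a.1).toNat - 1)) * S a)
  refine ⟨ρ, H, ?_, hρ0, ?_, fun hh hu => ?_⟩
  · have h1 := congrArg (aeval (PowerSeries.C (θ (Sum.inr j)) + PowerSeries.X)) hrel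
    rw [map_sum, map_zero] at h1
    have h2 : ∀ a, aeval (PowerSeries.C (θ (Sum.inr j)) + PowerSeries.X) (C (F a) * sh.dform θ a) =
        (if j.1.ht a.1 = 0 then PowerSeries.C (F a) * S a else 0) + PowerSeries.X ^ j.mult *
          (if j.1.ht a.1 = 0 then 0 else
    PowerSeries.C (F a) * (PowerSeries.X ^ (j.mult * ((j.1.ht a.1).toNat - 1)) * S a)) := by
      intro a
      rw [map_mul, aeval_C, aeval_dform_series, ← PowerSeries.C_eq_algebraMap, Idx.weight]
      have hnn := Side.ht_nonneg (i := j.1) a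
      split_ifs with h
      · simp [h, hS]
      · obtain ⟨n, hn⟩ : ∃ n, (j.1.ht a.1).toNat = n + 1 := ⟨(j.1.ht a.1).toNat - 1, by omega⟩
        rw [hn, Nat.add_sub_cancel, mul_add, mul_one, pow_add]
        ring
    rw [Finset.sum_congr rfl fun a _ => h2 a, Finset.sum_add_distrib, ← Finset.mul_sum,
      j.1.sum_face (fun a ha => if_neg ha)] at h1
    rw [j.1.aeval_edgePoly, Finset.mul_sum]
    simp only [H, mul_neg]
    rw [← eq_neg_iff_add_eq_zero] at h1
    rw [← h1]
    refine Finset.sum_congr rfl fun k _ => ?_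
    rw [if_pos (j.1.ht_edgePt _ _), hedge, ← PowerSeries.C_eq_algebraMap]
    ring
  · simp only [H, map_neg, map_sum]
    congr 1
    refine Finset.sum_congr rfl fun a _ => ?_
    have hnn := Side.ht_nonneg (i := j.1) a
    by_cases h0 : j.1.ht a.1 = 0
    · simp [h0]
    · rw [if_neg h0]
      by_cases h1 : j.1.ht a.1 = 1
      · simp [h1]
      · have h2 : j.mult * ((j.1.ht a.1).toNat - 1) ≠ 0 := by
          have := j.mult_pos
          exact mul_ne_zero (by omega) (by omega)
        simp [h1, h2]
  · intro h0
    have h1 := congrArg (PowerSeries.coeff 1) hSρ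
    rw [PowerSeries.coeff_one_mul, h0, hρ0, hS, ho₁, coeff_one_series sh hθ, coeff_one_series sh hθ,
      constantCoeff_series_edge sh hθ] at h1
    have hs0 : sval θ j ≠ 0 := mval_ne_zero hθ _ _
    have ht : (j.1.edgePt 1 j.1.length_pos).1 - j.1.origin.1 = j.1.tangent := by simp [Side.edgePt]
    -- The linear coefficient of `ρ` is its value times its logarithmic derivative, excluded from
    -- vanishing by the horizontal condition.
    have h2 : ∑ k ∈ Finset.univ.erase j, (k.exp j.1.tangent : K) /
        (θ (Sum.inr j) - θ (Sum.inr k)) = 0 := by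
      rw [← ht]
      simp only [← weight_sub, sub_div, Finset.sum_sub_distrib]
      have h3 := mul_ne_zero hs0 (hc j.1.origin)
      apply mul_left_cancel₀ h3
      rw [hS]
      linear_combination -h1
    apply hu.horizontal j hh
    have hn2 : (j.1.1.2 : K) ≠ 0 := sh.snd_cast_ne_zero hh
    simp only [exp_tangent hh, Int.cast_mul, mul_div_assoc, ← Finset.mul_sum] at h2
    exact (mul_eq_zero.1 h2).resolve_left (by simpa using hn2)

end Shape

theorem Side.natDegree_edgePoly_le (i : Δ.Side) (F : Δ.Pts → K) : (i.edgePoly F).natDegree ≤ i.length :=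
  natDegree_sum_le_of_forall_le _ _ fun k _ =>
    (natDegree_monomial_le _).trans (Nat.lt_succ_iff.1 k.2)

/-- For general parameters the curve is smooth along the toric boundary. -/
theorem IsGeneric.singularLocus_subset (sh : Δ.Shape) {θ : Par d → K} (hθ : IsGeneric θ)
    (hu : IsUnramified θ) (hd : ∀ i : Δ.Side, ¬ i.IsHorizontal → d.IsTrivialOn i)
    {C₀ : LinearSystem K Δ} (hrel : ∑ a, C (C₀.coeff a) * sh.dform θ a = 0)
    (htr : C₀.IsToricallyTransverse) : C₀.singularLocus ⊆ Δ.torus K := by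
  have hreg := hθ.toIsRegular
  obtain ⟨-, -, hv⟩ := hθ.equation sh hd C₀.coeff_ne_zero hrel
  rintro z ⟨hzC, hrank⟩
  obtain ⟨hz, hFz⟩ := hzC
  have htor := (mem_toricSurface_iff z).1 hz
  rcases htor.support sh (Function.ne_iff.1 z.rep_nonzero) with h | ⟨i, h0⟩ | ⟨a, -, -, -, h⟩
  · exact ⟨hz, h⟩
  swap
  · exact absurd ⟨hz, a, h⟩ (htr z ⟨hz, hFz⟩)
  exfalso
  apply hrank
  obtain ⟨o₂, u, ho₂, hu'⟩ := sh.exists_frame i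
  have ho := (h0 _).2 i.ht_origin
  set s := z.rep (i.edgePt 1 i.length_pos) / z.rep i.origin with hs'
  have hs : z.rep (i.edgePt 1 i.length_pos) = s * z.rep i.origin := by rw [hs']; field_simp
  refine Side.finrank_affineTangentSpace ho₂ hu' C₀ hz h0 hs ?_
  set P := i.edgePoly C₀.coeff with hP'
  have hP : P ≠ 0 := by
    intro h
    have h1 := i.coeff_edgePoly C₀.coeff 0 (Nat.zero_le _)
    rw [← hP', h, coeff_zero] at h1
    exact hv _ (i.isVertex_edgePt (Nat.zero_le _) (Or.inl rfl)) h1.symm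
  have hPs : P.IsRoot s := by
    have h1 : ∑ a, C₀.coeff a * z.rep a = 0 := by
      simpa [LinearSystem.linearForm] using hFz
    rw [i.sum_face fun a ha => by rw [by_contra fun h => ha ((h0 a).1 h), mul_zero]] at h1
    have h2 := i.aeval_edgePoly C₀.coeff s
    rw [coe_aeval_eq_eval] at h2
    apply mul_left_cancel₀ ho
    rw [hP', h2, mul_zero, Finset.mul_sum, ← h1]
    refine Finset.sum_congr rfl fun k _ => ?_
    rw [Side.eq_pow_of_toric htor h0 hs, Algebra.algebraMap_self_apply]
    ring
  -- Each boundary point gives a root of the restricted equation of at least the prescribed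
  -- multiplicity. These add up to the length of the side, which bounds the degree, so there are no
  -- other roots and no larger multiplicities.
  have hmult : ∀ x : (d.mult i).ToType,
      Idx.mult (⟨i, x⟩ : Idx d) ≤ P.rootMultiplicity (sval θ (⟨i, x⟩ : Idx d)) := by
    intro x
    obtain ⟨ρ, H, h1, h2, -, h4⟩ := sh.exists_expansion hreg hrel (⟨i, x⟩ : Idx d)
    by_cases hh : i.IsHorizontal
    · rw [← h2]
      exact (le_rootMultiplicity_of_series hP h1 (sh.constantCoeff_series_ne_zero hreg _ _) (h4 hh hu)).1
    · rw [Shape.mult_eq_one hd hh, Nat.succ_le_iff, rootMultiplicity_pos hP, IsRoot.def, ← h2,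
        ← constantCoeff_aeval]
      have h5 := congrArg PowerSeries.constantCoeff h1
      rw [map_mul, map_mul, Shape.mult_eq_one hd hh, pow_one, PowerSeries.constantCoeff_X, zero_mul] at h5
      exact (mul_eq_zero.1 h5).resolve_left (sh.constantCoeff_series_ne_zero hreg _ _)
  obtain ⟨x, hx, hm⟩ := rootMultiplicity_eq_of_le hP (r := fun x => sval θ (⟨i, x⟩ : Idx d))
    (fun x y hxy => by
      by_contra hne
      exact hθ.sval_ne ⟨i, x⟩ ⟨i, y⟩ (fun h => hne (by simpa using h)) rfl hxy) hmult (by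
      refine (i.natDegree_edgePoly_le _).trans (le_of_eq ?_)
      rw [← d.sum_eq i, Multiset.sum_eq_sum_coe]
      rfl) hPs
  -- At a tangency the multiplicity is exact, so the constant term of the expansion, the normal
  -- derivative up to a nonzero factor, does not vanish. On the other sides the root is simple.
  by_cases hh : i.IsHorizontal
  · right
    obtain ⟨ρ, H, h1, h2, h3, h4⟩ := sh.exists_expansion hreg hrel (⟨i, x⟩ : Idx d)
    have hH := (le_rootMultiplicity_of_series hP h1 (sh.constantCoeff_series_ne_zero hreg _ _)
      (h4 hh hu)).2 (by rw [h2, ← hm, hx])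
    rw [h3, neg_ne_zero] at hH
    set y : Δ.Pts → K := fun a => PowerSeries.constantCoeff (sh.series θ (⟨i, x⟩ : Idx d) a) with hy
    have hytor : IsToric y := (sh.isToric_series (θ := θ) (⟨i, x⟩ : Idx d)).map PowerSeries.constantCoeff
    have hy0 : ∀ a, y a ≠ 0 := sh.constantCoeff_series_ne_zero hreg _
    have hys : y (i.edgePt 1 i.length_pos) / y i.origin = s := by
      rw [div_eq_iff (hy0 _), hx]
      exact sh.constantCoeff_series_edge hreg (⟨i, x⟩ : Idx d)
    intro hQ
    apply hH
    have : ∀ a, (if i.ht a.1 = 1 then C₀.coeff a * y a else 0) = y o₂ *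
        (if i.ht a.1 = 1 then C₀.coeff a * s ^ latticePairing u (a.1 - i.origin.1) else 0) := by
      intro a
      split_ifs with ha
      · have h5 := hytor.eq_zpow hy0 (Side.frame_eq hu' a)
        rw [ha, zpow_one, hys] at h5
        rw [h5]
        have := hy0 i.origin
        field_simp
      · rw [mul_zero]
    refine (Finset.sum_congr rfl fun a _ => this a).trans ?_
    rw [← Finset.mul_sum, hQ, mul_zero]
  · left
    rw [Shape.mult_eq_one hd hh] at hm
    intro h
    have := (one_lt_rootMultiplicity_iff_isRoot hP).2 ⟨hPs, h⟩
    omega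

end LatticePolygon

end

theorem lemma5p8 (K : Type*) [Field K] [IsAlgClosed K] (Δ : LatticePolygon)
    (hΔ : Δ.IsHTransverse) (d : Δ.TangencyProfile)
    (hd : ∀ i : Δ.Side, ¬ i.IsHorizontal → d.IsTrivialOn i) :
    ((LatticePolygon.severi K d).Nonempty ∧
      IsIrreducible (LatticePolygon.severi K d) ∧
      LatticePolygon.ForGeneral (LatticePolygon.severi K d) (fun C =>
        ∀ f : LatticePolygon.LineMap K Δ, f.IsNormalizationOf C →
          Set.InjOn f.toFun (f.toFun ⁻¹' Δ.toricBoundary K))) ∧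
    (ringChar K = 0 ∨ Δ.width < (ringChar K : ℝ) →
      LatticePolygon.ForGeneral (LatticePolygon.severi K d) (fun C =>
        (∀ f : LatticePolygon.LineMap K Δ, f.IsNormalizationOf C → f.IsImmersion) ∧
          C.singularLocus ⊆ Δ.torus K)) := by
  classical
  have : Infinite K := IsAlgClosed.instInfinite
  obtain ⟨sh⟩ := LatticePolygon.exists_shape hΔ
  obtain ⟨q₀, hq₀, hgen⟩ := LatticePolygon.holdsGenerically_isGeneric (K := K) (d := d) sh
  -- Every curve of the Severi variety, general or not, is the kernel at some parameter; its
  -- parametrization is birational by assumption, so generality is not needed for uniqueness.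
  have hV : ∀ C ∈ LatticePolygon.severi K d, ∃ θ,
      ((sh.relMatrix K d).map (MvPolynomial.eval θ)).mulVec C.coeff = 0 ∧
        ∀ G, ((sh.relMatrix K d).map (MvPolynomial.eval θ)).mulVec G = 0 → ∃ c : K, G = c • C.coeff := by
    rintro C ⟨-, htr, f, hn, hprof⟩
    obtain ⟨θ, hθ, htop, hrel⟩ := LatticePolygon.LineMap.exists_parameters sh htr hn hprof
    refine ⟨θ, (sh.relMatrix_mulVec_eq_zero_iff θ _).2 hrel, fun G hG => ?_⟩
    exact sh.eq_smul_of_relations hθ htop C.coeff_ne_zero hrel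
      ((sh.relMatrix_mulVec_eq_zero_iff θ _).1 hG)
  have hex : ∀ θ, MvPolynomial.eval θ q₀ ≠ 0 → ∃ C ∈ LatticePolygon.severi K d,
      ((sh.relMatrix K d).map (MvPolynomial.eval θ)).mulVec C.coeff = 0 :=
    fun θ hθ => (hgen θ hθ).exists_mem_severi sh hd
  have hirr := LatticePolygon.isIrreducible_of_kernels hV hq₀ hex
  refine ⟨⟨hirr.nonempty, hirr, ?_⟩, fun hchar => ?_⟩
  · refine LatticePolygon.forGeneral_of_kernels hV hq₀ hex hq₀ fun θ hθ C _ hrel f hf => ?_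
    exact hf.injOn sh (hgen θ hθ) hd ((sh.relMatrix_mulVec_eq_zero_iff θ _).1 hrel)
  · obtain ⟨q, hq, hqgen⟩ := (LatticePolygon.holdsGenerically_isGeneric (K := K) (d := d) sh).and
      (sh.holdsGenerically_isUnramified hd hchar)
    refine LatticePolygon.forGeneral_of_kernels hV hq₀ hex hq fun θ hθ C hC hrel => ?_
    obtain ⟨hg, hu⟩ := hqgen θ hθ
    have hrel' := (sh.relMatrix_mulVec_eq_zero_iff θ _).1 hrel
    exact ⟨fun f hf => hf.isImmersion sh hg hd hrel' (sh.lineMap_isImmersion hg.toIsRegular hu hd),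
      hg.singularLocus_subset sh hu hd hrel' hC.2.1⟩
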